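/- Let $d_1,d_2\ge 1$, let $1<p_i<q_i<\infty$ and $\beta_i/d_i = 1/p_i-1/q_i$ for $i=1,2$. For $b\in L^1_{\mathrm{loc}}(\mathbb R^{d_1}\times\mathbb R^{d_2})$ and a rectangle $R=I_1\times I_2$ ($I_i\subset\mathbb R^{d_i}$ a cube with sides parallel to the axes and side length $\ell(I_i)>0$) put $$\mathcal O^{\beta_1,\beta_2}(b,R)=\ell(I_1)^{-\beta_1}\ell(I_2)^{-\beta_2}\,\frac1{|R|}\int_R\big|b(x_1,x_2)-\langle b(\cdot,x_2)\rangle_{I_1}-\langle b(x_1,\cdot)\rangle_{I_2}+\langle b\rangle_R\big|\,dx_1\,dx_2 ,$$ where $\langle\cdot\rangle_A$ is the average over $A$. We say $b\in \mathrm{VMO}^{\beta_1,\beta_2}$ if $\sup_R\mathcal O^{\beta_1,\beta_2}(b,R)<\infty$ and for every $\varepsilon>0$ there is $t>0$ such that $\mathcal O^{\beta_1,\beta_2}(b,R)<\varepsilon$ whenever $\ell(I_i)<t$ or $\ell(I_i)>t^{-1}$ for $i=1$ or $i=2$, or $\operatorname{dist}(R,\{0\})>t^{-1}$. A Calderón–Zygmund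 operator (CZO) on $\mathbb R^{n}$ is a linear operator $T$ that is bounded $L^p(\mathbb R^n)\to L^p(\mathbb R^n)$ for all $p\in(1,\infty)$ and for which there are a kernel $K$, defined off the diagonal, and constants $C$ and $\alpha\in(0,1]$ with $|K(x,y)|\le C|x-y|^{-n}$ for $x\neq y$ and $$|K(x,y)-K(x',y)|+|K(y,x)-K(y,x')|\le C\frac{|x-x'|^{\alpha}}{|x-y|^{n+\alpha}}\qquad\text{if } x\ne y,\ |x-x'|\le|x-y|/2,$$ such that $\int (Tf)\,g=\iint K(x,y)f(y)g(x)\,dy\,dx$ for all bounded, compactly supported $f,g$ with disjoint supports. Let $T_i$ be a CZO on $\mathbb R^{d_i}$, $i=1,2$, acting on functions on $\mathbb R^{d_1}\times\mathbb R^{d_2}$ in the $i$-th variable, and let $b\in L^2_{\mathrm{loc}}(\mathbb R^{d_1}\times\mathbb R^{d_2})$ be complex valued. If $b\in\mathrm{VMO}^{\beta_1,\beta_2}$, then the bi-commutator $[T_1,[b,T_2]]$, where $[b,T_2]f=bT_2f-T_2(bf)$ and $[T_1,[b,T_2]]f=T_1([b,T_2]f)-[b,T_2](T_1f)$, is well defined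 on bounded, compactly supported functions $f$ on $\mathbb R^{d_1}\times\mathbb R^{d_2}$, and it extends to a compact operator from $L^{p_1}(\mathbb R^{d_1};L^{p_2}(\mathbb R^{d_2}))$ to $L^{q_1}(\mathbb R^{d_1};L^{q_2}(\mathbb R^{d_2}))$. -/

import Mathlib

open MeasureTheory
open scoped ENNReal NNReal

noncomputable section

namespace BiCommutator

/-- The Euclidean space `ℝⁿ`. -/
abbrev Rn (n : ℕ) : Type := EuclideanSpace ℝ (Fin n)

/-! ### Calderón–Zygmund operators -/

/-- Standard Calderón–Zygmund kernels on `ℝⁿ`; the values on the diagonal play no role. -/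
def IsStandardKernel {n : ℕ} (K : Rn n → Rn n → ℂ) : Prop :=
  ∃ C α : ℝ, 0 < α ∧ α ≤ 1 ∧
    (∀ x y, x ≠ y → ‖K x y‖ ≤ C / ‖x - y‖ ^ n) ∧
    (∀ x x' y, x ≠ y → ‖x - x'‖ ≤ ‖x - y‖ / 2 →
      ‖K x y - K x' y‖ + ‖K y x - K y x'‖ ≤ C * ‖x - x'‖ ^ α / ‖x - y‖ ^ ((n : ℝ) + α))

/-- Bounded functions with compact support (as functions modulo null sets: `L^∞` with compact
support). -/
def BoundedCompact {X : Type*} [TopologicalSpace X] [MeasureSpace X] (f : X → ℂ) : Prop :=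
  MemLp f ∞ volume ∧ HasCompactSupport f

/-- Calderón–Zygmund operators on `ℝⁿ`: linear operators on the spaces `L^p`, `1 < p < ∞`
(equality of functions is equality almost everywhere, and one map `T` serves all exponents),
bounded on each `L^p`, and represented off the diagonal by a standard kernel. The values of `T` on
functions that lie in no `L^p`, `1 < p < ∞`, play no role. -/
structure IsCZO {n : ℕ} (T : (Rn n → ℂ) → (Rn n → ℂ)) : Prop where
  map_add : ∀ p : ℝ≥0∞, 1 < p → p < ∞ → ∀ f g, MemLp f p volume → MemLp g p volume →
    T (f + g) =ᵐ[volume] T f + T g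
  map_smul : ∀ p : ℝ≥0∞, 1 < p → p < ∞ → ∀ (c : ℂ) f, MemLp f p volume →
    T (c • f) =ᵐ[volume] c • T f
  bounded : ∀ p : ℝ≥0∞, 1 < p → p < ∞ → ∃ C : ℝ≥0, ∀ f, MemLp f p volume →
    MemLp (T f) p volume ∧ eLpNorm (T f) p volume ≤ C * eLpNorm f p volume
  kernel : ∃ K : Rn n → Rn n → ℂ, IsStandardKernel K ∧
    ∀ f g, BoundedCompact f → BoundedCompact g → Disjoint (tsupport f) (tsupport g) →
      ∫ x, T f x * g x = ∫ z : Rn n × Rn n, K z.1 z.2 * f z.2 * g z.1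

/-! ### Action on the product space and the bi-commutator -/

/-- `F` is the function `T f` on `ℝᵐ × ℝⁿ`, where `T` acts in the first variable:
`F(·, y) = T (f(·, y))` for almost every `y`, with `f(·, y)` in the domain of `T`. Up to null sets,
`F` is determined by `f`. -/
def ActsFirst {m n : ℕ} (T : (Rn m → ℂ) → (Rn m → ℂ)) (f F : Rn m × Rn n → ℂ) : Prop :=
  AEStronglyMeasurable F volume ∧
  ∀ᵐ y : Rn n, (∃ r : ℝ≥0∞, 1 < r ∧ r < ∞ ∧ MemLp (fun x => f (x, y)) r volume) ∧
    (fun x => F (x, y)) =ᵐ[volume] T (fun x => f (x, y))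

/-- `F` is the function `T f` on `ℝᵐ × ℝⁿ`, where `T` acts in the second variable. -/
def ActsSecond {m n : ℕ} (T : (Rn n → ℂ) → (Rn n → ℂ)) (f F : Rn m × Rn n → ℂ) : Prop :=
  AEStronglyMeasurable F volume ∧
  ∀ᵐ x : Rn m, (∃ r : ℝ≥0∞, 1 < r ∧ r < ∞ ∧ MemLp (fun y => f (x, y)) r volume) ∧
    (fun y => F (x, y)) =ᵐ[volume] T (fun y => f (x, y))

/-- `h = [b, T₂] f = b T₂ f - T₂ (b f)`, all terms being well defined. -/
def IsCommutatorSecond {m n : ℕ} (b : Rn m × Rn n → ℂ) (T₂ : (Rn n → ℂ) → (Rn n → ℂ))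
    (f h : Rn m × Rn n → ℂ) : Prop :=
  ∃ F G : Rn m × Rn n → ℂ, ActsSecond T₂ f F ∧ ActsSecond T₂ (b * f) G ∧
    h =ᵐ[volume] b * F - G

/-- `h = [T₁, [b, T₂]] f = T₁ ([b, T₂] f) - [b, T₂] (T₁ f)`, all terms being well defined. -/
def IsBicommutator {m n : ℕ} (b : Rn m × Rn n → ℂ) (T₁ : (Rn m → ℂ) → (Rn m → ℂ))
    (T₂ : (Rn n → ℂ) → (Rn n → ℂ)) (f h : Rn m × Rn n → ℂ) : Prop :=
  ∃ u Tu v w : Rn m × Rn n → ℂ,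
    IsCommutatorSecond b T₂ f u ∧ ActsFirst T₁ u Tu ∧
    ActsFirst T₁ f v ∧ IsCommutatorSecond b T₂ v w ∧
    h =ᵐ[volume] Tu - w

/-! ### Mixed-norm Lebesgue spaces -/

/-- The mixed-norm space `L^{p₁}(ℝᵐ; L^{p₂}(ℝⁿ))`. -/
abbrev MixedLp (m n : ℕ) (p₁ p₂ : ℝ≥0∞) [Fact (1 ≤ p₂)] : Type :=
  Lp (Lp ℂ p₂ (volume : Measure (Rn n))) p₁ (volume : Measure (Rn m))

/-- The function `f(x₁, x₂)` is the element `F` of the mixed-norm space, under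
`F(x₁) = f(x₁, ·)`. -/
def Represents {m n : ℕ} {p₁ p₂ : ℝ≥0∞} [Fact (1 ≤ p₂)]
    (f : Rn m × Rn n → ℂ) (F : MixedLp m n p₁ p₂) : Prop :=
  AEStronglyMeasurable f volume ∧
  ∀ᵐ x : Rn m, (F x : Rn n → ℂ) =ᵐ[volume] fun y => f (x, y)

/-! ### Rectangular oscillations and `VMO^{β₁,β₂}` -/

/-- The closed axis-parallel cube with centre `c` and side length `ℓ`. -/
def cube {n : ℕ} (c : Rn n) (ℓ : ℝ) : Set (Rn n) :=
  {x | ∀ j, |x j - c j| ≤ ℓ / 2}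

/-- The mean rectangular oscillation
`osc(b, R) = ⨍_R |b - ⟨b⟩_{I₁} - ⟨b⟩_{I₂} + ⟨b⟩_R|` over `R = I₁ × I₂`. -/
def osc {m n : ℕ} (b : Rn m × Rn n → ℂ) (I₁ : Set (Rn m)) (I₂ : Set (Rn n)) : ℝ :=
  ⨍ z in I₁ ×ˢ I₂, ‖b z - (⨍ x in I₁, b (x, z.2)) - (⨍ y in I₂, b (z.1, y))
    + ⨍ w in I₁ ×ˢ I₂, b w‖

/-- The fractional oscillation `ℓ(I₁)^{-β₁} ℓ(I₂)^{-β₂} osc(b, I₁ × I₂)` over the rectangle with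
sides the cubes `I_i = cube c_i ℓ_i`. -/
def fracOsc {m n : ℕ} (β₁ β₂ : ℝ) (b : Rn m × Rn n → ℂ)
    (c₁ : Rn m) (ℓ₁ : ℝ) (c₂ : Rn n) (ℓ₂ : ℝ) : ℝ :=
  ℓ₁ ^ (-β₁) * ℓ₂ ^ (-β₂) * osc b (cube c₁ ℓ₁) (cube c₂ ℓ₂)

/-- The rectangular space `BMO^{β₁,β₂}`. -/
def MemBMO {m n : ℕ} (β₁ β₂ : ℝ) (b : Rn m × Rn n → ℂ) : Prop :=
  LocallyIntegrable b volume ∧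
  ∃ M : ℝ, ∀ c₁ ℓ₁ c₂ ℓ₂, 0 < ℓ₁ → 0 < ℓ₂ → fracOsc β₁ β₂ b c₁ ℓ₁ c₂ ℓ₂ ≤ M

/-- The rectangular space `VMO^{β₁,β₂}`. The last alternative says `dist(R, {0}) > 1/t` for the
Euclidean distance of `ℝᵐ⁺ⁿ` (the rectangle `R` is compact). -/
def MemVMO {m n : ℕ} (β₁ β₂ : ℝ) (b : Rn m × Rn n → ℂ) : Prop :=
  MemBMO β₁ β₂ b ∧
  ∀ ε > 0, ∃ t > 0, ∀ (c₁ : Rn m) (ℓ₁ : ℝ) (c₂ : Rn n) (ℓ₂ : ℝ), 0 < ℓ₁ → 0 < ℓ₂ →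
    (ℓ₁ < t ∨ t⁻¹ < ℓ₁ ∨ ℓ₂ < t ∨ t⁻¹ < ℓ₂ ∨
      ∀ z ∈ cube c₁ ℓ₁ ×ˢ cube c₂ ℓ₂, t⁻¹ < √(‖z.1‖ ^ 2 + ‖z.2‖ ^ 2)) →
    fracOsc β₁ β₂ b c₁ ℓ₁ c₂ ℓ₂ < ε

/-- `b ∈ L²_loc`. -/
def MemL2loc {m n : ℕ} (b : Rn m × Rn n → ℂ) : Prop :=
  ∀ A : Set (Rn m × Rn n), IsCompact A → MemLp b 2 (volume.restrict A)

end BiCommutator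

end

namespace BiCommutator

open Filter Topology

/-! ### Functions on a product and measurable maps into `L^p` -/

section Slices

variable {α β : Type*} [MeasurableSpace α] [MeasurableSpace β]

/-! Pointwise estimate. Since `β₁` and `β₂` are positive, a mean oscillation condition of this kind
is a Hölder condition, as in Campanato's theorem. Telescoping the averages of `b` over doubling
cubes in each variable shows that, off a null set, the second difference Δb(x,y) = b(x₁,x₂) −
b(y₁,x₂) − b(x₁,y₂) + b(y₁,y₂) is at most M|x₁−y₁|^β₁|x₂−y₂|^β₂. The vanishing condition replaces M
by any ε > 0 once some |xᵢ−yᵢ| is very small or very large, or x is far from the origin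
(`MemVMO.exists_rectHolder`).

Boundedness and compactness. Formally the bi-commutator has the kernel −K₁(x₁,y₁)K₂(x₂,y₂)Δb(x,y).
The Hölder estimate dominates it by the product of the Riesz kernels |xᵢ−yᵢ|^(βᵢ−dᵢ). The
Hardy–Littlewood–Sobolev inequality in each variable, proved by Hedberg's argument and combined
through Minkowski's inequality, bounds such operators between the mixed-norm spaces, linearly in the
constant of the domination (`exists_mixed_hls`). Truncated to R⁻¹ ≤ |xᵢ−yᵢ| ≤ R and |x| ≤ R, the
kernel is bounded with bounded support, hence a limit in some L^s of combinations of indicators of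
rectangles, which give operators of rank one. The discarded part is at most ε times the product of
the Riesz kernels, so its operator is small in norm; compact operators are norm closed
(`exists_isCompactOperator_of_riesz`).

Identification. It remains to see that the integral operator is the bi-commutator, although `T₁` and
`T₂` are given by their kernels only off the diagonal. In one variable and for a Hölder continuous
B, the diagonal carries nothing: over a ball of radius δ the part of f far from the ball is handled
exactly by the kernel, while the near part contributes O(δ^β) times the volume, so Lebesgue
differentiation gives T(Bf) − B·Tf = ∫K(x,y)(B(y)−B(x))f(y)dy almost everywhere
(`commutator_eq_commutatorIntegral`). On a tensor f₁⊗f₂ this is used twice: for `T₂` with B =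
b(y₁,·) − b(x₁,·), then for `T₁` with B = c(·,x₂), where c = [b,T₂](1⊗f₂)
(`IsBicommutator.eq_kernelOp_tensor`). Both sides are continuous from L⁴ of a box to L¹ of any other
box, because b ∈ L²_loc times an L⁴ function lies locally in L^(4/3), an exponent at which the
operators are still bounded. Density of the span of tensors then covers all f
(`IsBicommutator.eq_kernelOp`). -/

/-- In a separable space every open set is a countable union of balls with centres in a dense
sequence and rational radii, so distances to fixed points decide measurability. -/
theorem measurable_of_enorm_sub {E : Type*} [NormedAddCommGroup E] [MeasurableSpace E]
    [BorelSpace E] [SecondCountableTopology E] {g : α → E}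
    (h : ∀ e, Measurable fun x => ‖g x - e‖ₑ) : Measurable g := by
  refine measurable_of_isOpen fun U hU => ?_
  obtain ⟨s, hs, hsd⟩ := TopologicalSpace.exists_countable_dense E
  have key : g ⁻¹' U = ⋃ e ∈ s, ⋃ q : ℚ, ⋃ (_ : Metric.eball e (ENNReal.ofReal q) ⊆ U),
      {x | ‖g x - e‖ₑ < ENNReal.ofReal q} := by
    ext x
    simp only [Set.mem_preimage, Set.mem_iUnion, Set.mem_ofPred_eq, exists_prop]
    constructor
    · intro hx
      obtain ⟨ε, hε, hball⟩ := Metric.isOpen_iff.1 hU _ hx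
      obtain ⟨q, hq0, hq⟩ := exists_rat_btwn (half_pos hε)
      have hq0' : (0 : ℝ) < q := by exact_mod_cast hq0
      obtain ⟨e, he, hed⟩ := hsd.exists_dist_lt (g x) hq0'
      refine ⟨e, he, q, fun z hz => hball ?_, ?_⟩
      · rw [Metric.eball_ofReal, Metric.mem_ball] at hz
        rw [Metric.mem_ball]
        calc dist z (g x) ≤ dist z e + dist e (g x) := dist_triangle _ _ _
          _ < ε := by rw [dist_comm e]; linarith
      · rw [← ofReal_norm, ← dist_eq_norm]
        exact (ENNReal.ofReal_lt_ofReal_iff hq0').2 hed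
    · rintro ⟨e, -, q, hsub, hlt⟩
      apply hsub
      rw [Metric.mem_eball, edist_eq_enorm_sub]
      exact hlt
  rw [key]
  refine MeasurableSet.biUnion hs fun e _ => .iUnion fun q => .iUnion fun _ =>
    measurableSet_lt (h e) measurable_const

theorem measurable_eLpNorm_slice {ν : Measure β} [SFinite ν] {p : ℝ≥0∞} (hp0 : p ≠ 0) (hp : p ≠ ∞)
    {ε : Type*} [MeasurableSpace ε] [TopologicalSpace ε] [ContinuousENorm ε]
    [OpensMeasurableSpace ε] {f : α × β → ε} (hf : Measurable f) :
    Measurable fun x => eLpNorm (fun y => f (x, y)) p ν := by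
  simp_rw [eLpNorm_eq_lintegral_rpow_enorm_toReal hp0 hp]
  exact ((hf.enorm.pow_const _).lintegral_prod_right').pow_const _

theorem enorm_toLp_sub {ν : Measure β} {p : ℝ≥0∞} {f : β → ℂ} (hf : MemLp f p ν)
    (e : Lp ℂ p ν) : ‖hf.toLp f - e‖ₑ = eLpNorm (fun y => f y - e y) p ν := by
  rw [Lp.enorm_def]
  refine eLpNorm_congr_ae ?_
  filter_upwards [Lp.coeFn_sub (hf.toLp f) e, hf.coeFn_toLp] with y h1 h2
  rw [h1, Pi.sub_apply, h2]

/-- By separability of `L^p`, measurability of the slice map reduces to that of the distances of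
f(x,·) to fixed elements, which is Tonelli's theorem. Slices outside `L^p` are replaced by 0. -/
theorem exists_slice {μ : Measure α} {ν : Measure β} [SFinite ν]
    [MeasurableSpace.CountablyGenerated β] {p : ℝ≥0∞} [Fact (1 ≤ p)] (hp : p ≠ ∞)
    {f : α × β → ℂ} (hf : AEStronglyMeasurable f (μ.prod ν)) :
    ∃ g : α → Lp ℂ p ν, AEStronglyMeasurable g μ ∧
      ∀ᵐ x ∂μ, MemLp (fun y => f (x, y)) p ν → g x =ᵐ[ν] fun y => f (x, y) := by
  classical
  have : Fact (p ≠ ∞) := ⟨hp⟩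
  have hp0 : p ≠ 0 := (zero_lt_one.trans_le (Fact.out : 1 ≤ p)).ne'
  obtain ⟨f', hm', hff'⟩ := hf
  have hm : Measurable f' := hm'.measurable
  let S : Set α := {x | eLpNorm (fun y => f' (x, y)) p ν < ∞}
  have hS : MeasurableSet S :=
    measurableSet_lt (measurable_eLpNorm_slice hp0 hp hm) measurable_const
  have hmem : ∀ x ∈ S, MemLp (fun y => f' (x, y)) p ν := fun x hx =>
    ⟨(hm.comp measurable_prodMk_left).aestronglyMeasurable, hx⟩
  let g : α → Lp ℂ p ν := fun x => if h : x ∈ S then (hmem x h).toLp else 0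
  borelize ↥(Lp ℂ p ν)
  have hg : Measurable g := by
    refine measurable_of_enorm_sub fun e => ?_
    have : (fun x => ‖g x - e‖ₑ) = fun x => if x ∈ S then
        eLpNorm (fun y => f' (x, y) - (e : β → ℂ) y) p ν else ‖e‖ₑ := by
      ext x
      by_cases hx : x ∈ S
      · simp only [g, hx, dite_true, if_true]
        exact enorm_toLp_sub _ _
      · simp [g, hx]
    rw [this]
    refine Measurable.ite hS ?_ measurable_const
    exact measurable_eLpNorm_slice (f := fun z : α × β => f' z - (e : β → ℂ) z.2) hp0 hp
      (hm.sub ((Lp.stronglyMeasurable e).measurable.comp measurable_snd))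
  refine ⟨g, hg.aestronglyMeasurable, ?_⟩
  filter_upwards [Measure.ae_ae_of_ae_prod hff'] with x hx hxm
  have h2 : x ∈ S := by
    change eLpNorm _ _ _ < ∞
    rw [← eLpNorm_congr_ae hx]
    exact hxm.2
  simp only [g, h2, dite_true]
  exact (hmem x h2).coeFn_toLp.trans (hx.mono fun y hy => hy.symm)

/-- Elements of `L^p` are classes, and arbitrary representatives of the g(x) need not be jointly
measurable. Countably valued approximations are jointly measurable, and when they converge fast
enough they converge almost everywhere on each slice. -/
theorem exists_joint_representative {μ : Measure α} {ν : Measure β} [SFinite ν]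
    [MeasurableSpace.CountablyGenerated β] {p : ℝ≥0∞} [Fact (1 ≤ p)] (hp : p ≠ ∞)
    {g : α → Lp ℂ p ν} (hg : AEStronglyMeasurable g μ) :
    ∃ F : α × β → ℂ, StronglyMeasurable F ∧ ∀ᵐ x ∂μ, g x =ᵐ[ν] fun y => F (x, y) := by
  classical
  have : Fact (p ≠ ∞) := ⟨hp⟩
  have hp1 : 1 ≤ p := Fact.out
  borelize ↥(Lp ℂ p ν)
  obtain ⟨g', hg', hgg'⟩ := hg
  let d : ℕ → Lp ℂ p ν := TopologicalSpace.denseSeq _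
  have hd : ∀ (n : ℕ) x, ∃ k, ‖g' x - d k‖ < (1 / 4 : ℝ) ^ n := fun n x => by
    obtain ⟨k, hk⟩ := (TopologicalSpace.denseRange_denseSeq (Lp ℂ p ν)).exists_dist_lt
      (g' x) (show (0 : ℝ) < (1 / 4 : ℝ) ^ n by positivity)
    exact ⟨k, by rwa [dist_eq_norm] at hk⟩
  -- Taking the first admissible index makes the choice measurable in x.
  let k : ℕ → α → ℕ := fun n x => Nat.find (hd n x)
  have hk : ∀ n x, ‖g' x - d (k n x)‖ < (1 / 4 : ℝ) ^ n := fun n x => Nat.find_spec (hd n x)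
  have hkm : ∀ n, Measurable (k n) := fun n => measurable_find (hd n) fun j =>
    measurableSet_lt (hg'.measurable.sub_const _).norm measurable_const
  let F : ℕ → α × β → ℂ := fun n z => d (k n z.1) z.2
  have hF : ∀ n, Measurable (F n) := fun n => by
    have : Measurable fun w : ℕ × β => (d w.1 : β → ℂ) w.2 :=
      measurable_from_prod_countable_right fun j => (Lp.stronglyMeasurable (d j)).measurable
    exact this.comp (((hkm n).comp measurable_fst).prodMk measurable_snd)
  refine ⟨fun z => limUnder atTop fun n => F n z,
    StronglyMeasurable.limUnder fun n => (hF n).stronglyMeasurable, ?_⟩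
  filter_upwards [hgg'] with x hx
  rw [hx]
  have hlim : ∀ᵐ y ∂ν, ∃ l, Tendsto (fun n => (d (k n x) : β → ℂ) y) atTop (𝓝 l) := by
    refine Lp.ae_tendsto_of_cauchy_eLpNorm (p := p)
      (B := fun n => ENNReal.ofReal (2 * (1 / 4 : ℝ) ^ n))
      (fun n => Lp.aestronglyMeasurable _) hp1 ?_ ?_
    · rw [← ENNReal.ofReal_tsum_of_nonneg (fun n => by positivity)
        ((summable_geometric_of_lt_one (by norm_num) (by norm_num)).mul_left _)]
      exact ENNReal.ofReal_ne_top
    · intro N n m hn hm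
      rw [← eLpNorm_congr_ae (Lp.coeFn_sub _ _), ← Lp.enorm_def, ← ofReal_norm]
      refine (ENNReal.ofReal_lt_ofReal_iff (by positivity)).2 ?_
      have h1 : (1 / 4 : ℝ) ^ n ≤ (1 / 4 : ℝ) ^ N :=
        pow_le_pow_of_le_one (by norm_num) (by norm_num) hn
      have h2 : (1 / 4 : ℝ) ^ m ≤ (1 / 4 : ℝ) ^ N :=
        pow_le_pow_of_le_one (by norm_num) (by norm_num) hm
      calc ‖d (k n x) - d (k m x)‖ = ‖(g' x - d (k m x)) - (g' x - d (k n x))‖ := by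
            congr 1; abel
        _ ≤ ‖g' x - d (k m x)‖ + ‖g' x - d (k n x)‖ := norm_sub_le _ _
        _ < 2 * (1 / 4 : ℝ) ^ N := by linarith [hk n x, hk m x]
  have hconv : Tendsto (fun n => d (k n x)) atTop (𝓝 (g' x)) := by
    rw [tendsto_iff_norm_sub_tendsto_zero]
    refine squeeze_zero (fun _ => norm_nonneg _) (fun n => ?_)
      (tendsto_pow_atTop_nhds_zero_of_lt_one (r := (1 / 4 : ℝ)) (by norm_num) (by norm_num))
    rw [norm_sub_rev]
    exact (hk n x).le
  -- Convergence in `L^p` gives a subsequence converging almost everywhere to `g' x`, which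
  -- identifies the pointwise limit.
  obtain ⟨ns, hns, hsub⟩ := (tendstoInMeasure_of_tendsto_Lp hconv).exists_seq_tendsto_ae
  filter_upwards [hlim, hsub] with y ⟨l, hl⟩ h2
  have : l = (g' x : β → ℂ) y := tendsto_nhds_unique (hl.comp hns.tendsto_atTop) h2
  rw [← this]
  exact hl.limUnder_eq.symm

/-- Product-measurable functions agree almost everywhere if almost all their slices do. -/
theorem ae_eq_prod_of_slices {μ : Measure α} {ν : Measure β} [SFinite μ] [SFinite ν]
    {f g : α × β → ℂ} (hf : AEStronglyMeasurable f (μ.prod ν))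
    (hg : AEStronglyMeasurable g (μ.prod ν))
    (h : ∀ᵐ x ∂μ, (fun y => f (x, y)) =ᵐ[ν] fun y => g (x, y)) : f =ᵐ[μ.prod ν] g := by
  have hm : MeasurableSet {z | hf.mk f z = hg.mk g z} :=
    measurableSet_eq_fun hf.stronglyMeasurable_mk.measurable hg.stronglyMeasurable_mk.measurable
  have : hf.mk f =ᵐ[μ.prod ν] hg.mk g := by
    refine (Measure.ae_prod_iff_ae_ae hm).2 ?_
    filter_upwards [h, Measure.ae_ae_of_ae_prod hf.ae_eq_mk,
      Measure.ae_ae_of_ae_prod hg.ae_eq_mk] with x h1 h2 h3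
    filter_upwards [h1, h2, h3] with y h1 h2 h3
    rw [← h2, ← h3, h1]
  exact hf.ae_eq_mk.trans (this.trans hg.ae_eq_mk.symm)

end Slices

end BiCommutator

namespace BiCommutator

open Filter Topology

/-! ### Norms of slices, and operators acting in one variable -/

section SliceNorms

variable {α β : Type*} [MeasurableSpace α] [MeasurableSpace β]

theorem ae_slice_aestronglyMeasurable {μ : Measure α} {ν : Measure β} [SFinite ν]
    {f : α × β → ℂ} (hf : AEStronglyMeasurable f (μ.prod ν)) :
    ∀ᵐ x ∂μ, AEStronglyMeasurable (fun y => f (x, y)) ν := by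
  filter_upwards [Measure.ae_ae_of_ae_prod hf.ae_eq_mk] with x hx
  exact ⟨_, hf.stronglyMeasurable_mk.comp_measurable measurable_prodMk_left, hx⟩

theorem eLpNorm_prod {μ : Measure α} {ν : Measure β} [SFinite ν] {p : ℝ≥0∞} (hp0 : p ≠ 0)
    (hp : p ≠ ∞) {f : α × β → ℂ} (hf : AEStronglyMeasurable f (μ.prod ν)) :
    eLpNorm f p (μ.prod ν) ^ p.toReal = ∫⁻ x, eLpNorm (fun y => f (x, y)) p ν ^ p.toReal ∂μ := by
  have h0 : p.toReal ≠ 0 := (ENNReal.toReal_pos hp0 hp).ne'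
  simp_rw [eLpNorm_eq_lintegral_rpow_enorm_toReal hp0 hp, ← ENNReal.rpow_mul,
    one_div_mul_cancel h0, ENNReal.rpow_one]
  exact lintegral_prod _ (hf.enorm.pow_const _)

theorem ae_memLp_slice {μ : Measure α} {ν : Measure β} [SFinite ν] {p : ℝ≥0∞} (hp0 : p ≠ 0)
    (hp : p ≠ ∞) {f : α × β → ℂ} (hf : MemLp f p (μ.prod ν)) :
    ∀ᵐ x ∂μ, MemLp (fun y => f (x, y)) p ν := by
  have h0 : 0 < p.toReal := ENNReal.toReal_pos hp0 hp
  obtain ⟨g, hg, hfg⟩ := hf.1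
  have h1 := eLpNorm_prod (μ := μ) (ν := ν) hp0 hp hf.1
  have h2 : ∫⁻ x, eLpNorm (fun y => g (x, y)) p ν ^ p.toReal ∂μ ≠ ∞ := by
    rw [← eLpNorm_prod hp0 hp hg.aestronglyMeasurable, ← eLpNorm_congr_ae hfg]
    exact ENNReal.rpow_ne_top_of_nonneg h0.le hf.2.ne
  have h3 := ae_lt_top ((measurable_eLpNorm_slice hp0 hp hg.measurable).pow_const p.toReal) h2
  filter_upwards [h3, Measure.ae_ae_of_ae_prod hfg, ae_slice_aestronglyMeasurable hf.1]
    with x hx h4 h5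
  refine ⟨h5, ?_⟩
  rw [eLpNorm_congr_ae h4]
  exact (ENNReal.rpow_lt_top_iff_of_pos h0).1 hx

theorem ae_prod_swap {μ : Measure α} {ν : Measure β} [SFinite μ] [SFinite ν] {f g : α × β → ℂ}
    (h : f =ᵐ[μ.prod ν] g) : (fun z : β × α => f z.swap) =ᵐ[ν.prod μ] fun z => g z.swap :=
  (Measure.measurePreserving_swap (μ := ν) (ν := μ)).quasiMeasurePreserving.ae_eq_comp h

end SliceNorms

namespace IsCZO

variable {n : ℕ} {T : (Rn n → ℂ) → (Rn n → ℂ)}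

/-- `T` acts on functions rather than on classes; that it respects null sets comes from applying its
bound to the difference of the two functions. -/
theorem congr (hT : IsCZO T) {p : ℝ≥0∞} (h1 : 1 < p) (h2 : p < ∞) {f g : Rn n → ℂ}
    (hf : MemLp f p volume) (h : f =ᵐ[volume] g) : T f =ᵐ[volume] T g := by
  have hg : MemLp g p volume := hf.ae_eq h
  obtain ⟨C, hC⟩ := hT.bounded p h1 h2
  have hz : eLpNorm (T (f - g)) p volume = 0 := by
    refine le_antisymm ((hC _ (hf.sub hg)).2.trans ?_) zero_le
    have : f - g =ᵐ[volume] (0 : Rn n → ℂ) := h.mono fun x hx => by simp [hx]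
    simp [eLpNorm_congr_ae this]
  have hz' := (eLpNorm_eq_zero_iff (hC _ (hf.sub hg)).1.1 (zero_lt_one.trans h1).ne').1 hz
  have := hT.map_add p h1 h2 (f - g) g (hf.sub hg) hg
  rw [sub_add_cancel] at this
  filter_upwards [this, hz'] with x h3 h4
  rw [h3, Pi.add_apply, h4, Pi.zero_apply, zero_add]

theorem memLp (hT : IsCZO T) {p : ℝ≥0∞} (h1 : 1 < p) (h2 : p < ∞) {f : Rn n → ℂ}
    (hf : MemLp f p volume) : MemLp (T f) p volume :=
  ((hT.bounded p h1 h2).choose_spec f hf).1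

theorem map_sub (hT : IsCZO T) {p : ℝ≥0∞} (h1 : 1 < p) (h2 : p < ∞) {f g : Rn n → ℂ}
    (hf : MemLp f p volume) (hg : MemLp g p volume) : T (f - g) =ᵐ[volume] T f - T g := by
  have := hT.map_add p h1 h2 (f - g) g (hf.sub hg) hg
  rw [sub_add_cancel] at this
  filter_upwards [this] with x hx
  simp [hx]

theorem exists_clm (hT : IsCZO T) {p : ℝ≥0∞} [Fact (1 ≤ p)] (h1 : 1 < p) (h2 : p < ∞) :
    ∃ L : Lp ℂ p (volume : Measure (Rn n)) →L[ℂ] Lp ℂ p (volume : Measure (Rn n)),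
      ∀ f : Lp ℂ p (volume : Measure (Rn n)), L f =ᵐ[volume] T f := by
  obtain ⟨C, hC⟩ := hT.bounded p h1 h2
  have hm : ∀ f : Lp ℂ p (volume : Measure (Rn n)), MemLp (T f) p volume :=
    fun f => (hC f (Lp.memLp f)).1
  let L₀ : Lp ℂ p (volume : Measure (Rn n)) →ₗ[ℂ] Lp ℂ p (volume : Measure (Rn n)) :=
    { toFun := fun f => (hm f).toLp
      map_add' := fun f g => by
        rw [← MemLp.toLp_add]
        exact MemLp.toLp_congr _ _ ((hT.congr h1 h2 (Lp.memLp _) (Lp.coeFn_add f g)).trans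
          (hT.map_add p h1 h2 f g (Lp.memLp f) (Lp.memLp g)))
      map_smul' := fun c f => by
        rw [RingHom.id_apply, ← MemLp.toLp_const_smul]
        exact MemLp.toLp_congr _ _ ((hT.congr h1 h2 (Lp.memLp _) (Lp.coeFn_smul c f)).trans
          (hT.map_smul p h1 h2 c f (Lp.memLp f))) }
  refine ⟨L₀.mkContinuous C fun f => ?_, fun f => (hm f).coeFn_toLp⟩
  change ‖(hm f).toLp‖ ≤ _
  rw [Lp.norm_toLp, Lp.norm_def, ← ENNReal.coe_toReal, ← ENNReal.toReal_mul]
  exact ENNReal.toReal_mono (ENNReal.mul_ne_top ENNReal.coe_ne_top (Lp.memLp f).2.ne)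
    (hC f (Lp.memLp f)).2

end IsCZO

section Action

variable {m n : ℕ}

/-- Transfers every statement about the second variable to the first one. -/
theorem actsFirst_iff_swap {T : (Rn m → ℂ) → (Rn m → ℂ)} {f F : Rn m × Rn n → ℂ} :
    ActsFirst T f F ↔ ActsSecond T (fun z => f z.swap) (fun z => F z.swap) := by
  unfold ActsFirst ActsSecond
  refine and_congr ⟨fun h => ?_, fun h => ?_⟩ Iff.rfl
  · exact h.comp_quasiMeasurePreserving
      (Measure.measurePreserving_swap (μ := volume) (ν := volume)).quasiMeasurePreserving
  · exact h.comp_quasiMeasurePreserving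
      (Measure.measurePreserving_swap (μ := (volume : Measure (Rn m)))
        (ν := (volume : Measure (Rn n)))).quasiMeasurePreserving

variable {T : (Rn n → ℂ) → (Rn n → ℂ)}

/-- The slices form a measurable `L^p`-valued map, a bounded operator keeps it measurable, and a
joint representative turns the image back into a function on the product. -/
theorem exists_actsSecond (hT : IsCZO T) {p : ℝ≥0∞} (h1 : 1 < p) (h2 : p < ∞)
    {f : Rn m × Rn n → ℂ} (hf : AEStronglyMeasurable f volume)
    (hs : ∀ᵐ x : Rn m, MemLp (fun y => f (x, y)) p volume) : ∃ F, ActsSecond T f F := by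
  have : Fact (1 ≤ p) := ⟨h1.le⟩
  obtain ⟨g, hg, hgf⟩ := exists_slice (p := p) (μ := (volume : Measure (Rn m)))
    (ν := (volume : Measure (Rn n))) h2.ne hf
  obtain ⟨L, hL⟩ := hT.exists_clm h1 h2
  obtain ⟨F, hF, hFg⟩ := exists_joint_representative (ν := (volume : Measure (Rn n))) h2.ne
    (L.continuous.comp_aestronglyMeasurable hg)
  refine ⟨F, hF.aestronglyMeasurable, ?_⟩
  filter_upwards [hgf, hFg, hs] with x h3 h4 h5
  exact ⟨⟨p, h1, h2, h5⟩, h4.symm.trans ((hL _).trans (hT.congr h1 h2 (Lp.memLp _) (h3 h5)))⟩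

theorem ActsSecond.unique {f F F' : Rn m × Rn n → ℂ} (h : ActsSecond T f F)
    (h' : ActsSecond T f F') : F =ᵐ[volume] F' := by
  refine ae_eq_prod_of_slices h.1 h'.1 ?_
  filter_upwards [h.2, h'.2] with x h1 h2
  exact h1.2.trans h2.2.symm

theorem ActsSecond.congr (hT : IsCZO T) {f f' F F' : Rn m × Rn n → ℂ} (h : ActsSecond T f F)
    (hf : f =ᵐ[volume] f') (hF : F =ᵐ[volume] F') : ActsSecond T f' F' := by
  refine ⟨h.1.congr hF, ?_⟩
  filter_upwards [h.2, Measure.ae_ae_of_ae_prod hf, Measure.ae_ae_of_ae_prod hF]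
    with x ⟨⟨r, hr1, hr2, h1⟩, h2⟩ h3 h4
  exact ⟨⟨r, hr1, hr2, h1.ae_eq h3⟩,
    (EventuallyEq.symm h4).trans (h2.trans (hT.congr hr1 hr2 h1 h3))⟩

theorem ActsSecond.add (hT : IsCZO T) {p : ℝ≥0∞} (h1 : 1 < p) (h2 : p < ∞)
    {f F g G : Rn m × Rn n → ℂ} (hf : ActsSecond T f F) (hg : ActsSecond T g G)
    (hfp : ∀ᵐ x : Rn m, MemLp (fun y => f (x, y)) p volume)
    (hgp : ∀ᵐ x : Rn m, MemLp (fun y => g (x, y)) p volume) : ActsSecond T (f + g) (F + G) := by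
  refine ⟨hf.1.add hg.1, ?_⟩
  filter_upwards [hf.2, hg.2, hfp, hgp] with x h3 h4 h5 h6
  refine ⟨⟨p, h1, h2, h5.add h6⟩, ?_⟩
  exact (h3.2.add h4.2).trans (hT.map_add p h1 h2 _ _ h5 h6).symm

theorem ActsSecond.smul (hT : IsCZO T) (c : ℂ) {f F : Rn m × Rn n → ℂ}
    (hf : ActsSecond T f F) : ActsSecond T (c • f) (c • F) := by
  refine ⟨hf.1.const_smul c, ?_⟩
  filter_upwards [hf.2] with x ⟨⟨r, hr1, hr2, h3⟩, h4⟩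
  refine ⟨⟨r, hr1, hr2, h3.const_smul c⟩, ?_⟩
  exact (h4.const_smul c).trans (hT.map_smul r hr1 hr2 c _ h3).symm

/-- The bound of `T` is integrated over the slices. Since `T` works slice by slice, the first
variable may be confined to any set A; this is what makes products with a merely locally integrable
symbol tractable. -/
theorem exists_actsSecond_bound (hT : IsCZO T) (m : ℕ) {p : ℝ≥0∞} (h1 : 1 < p) (h2 : p < ∞) :
    ∃ C : ℝ≥0, ∀ (f F : Rn m × Rn n → ℂ), ActsSecond T f F →
      ∀ (A : Set (Rn m)), MemLp f p ((volume.restrict A).prod volume) →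
        MemLp F p ((volume.restrict A).prod volume) ∧
        eLpNorm F p ((volume.restrict A).prod volume) ≤
          C * eLpNorm f p ((volume.restrict A).prod volume) := by
  obtain ⟨C, hC⟩ := hT.bounded p h1 h2
  have hp0 : p ≠ 0 := (zero_lt_one.trans h1).ne'
  have h0 : 0 < p.toReal := ENNReal.toReal_pos hp0 h2.ne
  refine ⟨C, fun f F hF A hf => ?_⟩
  have hFm : AEStronglyMeasurable F ((volume.restrict A).prod volume) :=
    hF.1.mono_ac (Measure.AbsolutelyContinuous.prod Measure.restrict_le_self.absolutelyContinuous
      Measure.AbsolutelyContinuous.rfl)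
  have key : eLpNorm F p ((volume.restrict A).prod volume) ≤
          C * eLpNorm f p ((volume.restrict A).prod volume) := by
    rw [← ENNReal.rpow_le_rpow_iff h0, ENNReal.mul_rpow_of_nonneg _ _ h0.le,
      eLpNorm_prod hp0 h2.ne hFm, eLpNorm_prod hp0 h2.ne hf.1,
      ← lintegral_const_mul' _ _ (ENNReal.rpow_ne_top_of_nonneg h0.le ENNReal.coe_ne_top)]
    refine lintegral_mono_ae ?_
    filter_upwards [ae_memLp_slice hp0 h2.ne hf, ae_restrict_of_ae hF.2] with x h3 h4
    rw [← ENNReal.mul_rpow_of_nonneg _ _ h0.le, eLpNorm_congr_ae h4.2]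
    exact ENNReal.rpow_le_rpow (hC _ h3).2 h0.le
  exact ⟨⟨hFm, key.trans_lt (ENNReal.mul_lt_top ENNReal.coe_lt_top hf.2)⟩, key⟩

end Action

end BiCommutator

namespace BiCommutator

open Filter Topology

/-! ### Second differences of averages are controlled by the rectangular oscillation -/

section RectangularDifferences

variable {α β : Type*} [MeasurableSpace α] [MeasurableSpace β] {μ : Measure α} {ν : Measure β}
  [SFinite μ] [SFinite ν]

/-- The function b − ⟨b⟩_I − ⟨b⟩_J + ⟨b⟩_(I×J) inside the oscillation has, as its average over A ×
B, exactly the second difference of averages on the left. Its modulus may then be integrated over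
the larger I × J, at the cost of the ratio of the volumes. -/
theorem norm_average_sub_average_le {b : α × β → ℂ} {A I : Set α} {B J : Set β}
    (hAI : A ⊆ I) (hBJ : B ⊆ J) (hA0 : μ A ≠ 0) (hB0 : ν B ≠ 0) (hI : μ I ≠ ∞) (hJ : ν J ≠ ∞)
    (hb : IntegrableOn b (I ×ˢ J) (μ.prod ν)) :
    ‖(⨍ z in A ×ˢ B, b z ∂(μ.prod ν)) - (⨍ z in I ×ˢ B, b z ∂(μ.prod ν))
      - (⨍ z in A ×ˢ J, b z ∂(μ.prod ν)) + (⨍ z in I ×ˢ J, b z ∂(μ.prod ν))‖ ≤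
    (μ.real I * ν.real J) / (μ.real A * ν.real B) *
      ⨍ z in I ×ˢ J, ‖b z - (⨍ x in I, b (x, z.2) ∂μ) - (⨍ y in J, b (z.1, y) ∂ν)
        + ⨍ w in I ×ˢ J, b w ∂(μ.prod ν)‖ ∂(μ.prod ν) := by
  have hAf : μ A ≠ ∞ := ne_top_of_le_ne_top hI (measure_mono hAI)
  have hBf : ν B ≠ ∞ := ne_top_of_le_ne_top hJ (measure_mono hBJ)
  have hI0 : μ I ≠ 0 := fun h => hA0 (measure_mono_null hAI h)
  have hJ0 : ν J ≠ 0 := fun h => hB0 (measure_mono_null hBJ h)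
  have a0 : μ.real A ≠ 0 := (ENNReal.toReal_pos hA0 hAf).ne'
  have b0 : ν.real B ≠ 0 := (ENNReal.toReal_pos hB0 hBf).ne'
  have i0 : μ.real I ≠ 0 := (ENNReal.toReal_pos hI0 hI).ne'
  have j0 : ν.real J ≠ 0 := (ENNReal.toReal_pos hJ0 hJ).ne'
  have : IsFiniteMeasure (μ.restrict I) := ⟨by simpa using hI.lt_top⟩
  have : IsFiniteMeasure (ν.restrict J) := ⟨by simpa using hJ.lt_top⟩
  have : IsFiniteMeasure (μ.restrict A) := ⟨by simpa using hAf.lt_top⟩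
  have : IsFiniteMeasure (ν.restrict B) := ⟨by simpa using hBf.lt_top⟩
  have hb' : Integrable b ((μ.restrict I).prod (ν.restrict J)) := by
    rw [Measure.prod_restrict]; exact hb
  have hbIB : Integrable b ((μ.restrict I).prod (ν.restrict B)) := by
    rw [Measure.prod_restrict]; exact hb.mono_set (Set.prod_mono subset_rfl hBJ)
  have hbAJ : Integrable b ((μ.restrict A).prod (ν.restrict J)) := by
    rw [Measure.prod_restrict]; exact hb.mono_set (Set.prod_mono hAI subset_rfl)
  have hbAB : Integrable b ((μ.restrict A).prod (ν.restrict B)) := by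
    rw [Measure.prod_restrict]; exact hb.mono_set (Set.prod_mono hAI hBJ)
  set w : ℂ := ⨍ w in I ×ˢ J, b w ∂(μ.prod ν) with hw
  set g : β → ℂ := fun y => ⨍ x in I, b (x, y) ∂μ with hg
  set h : α → ℂ := fun x => ⨍ y in J, b (x, y) ∂ν with hh
  have hgi : Integrable g (ν.restrict J) := by
    simp only [hg, setAverage_eq]; exact hb'.integral_prod_right.smul _
  have hhi : Integrable h (μ.restrict I) := by
    simp only [hh, setAverage_eq]; exact hb'.integral_prod_left.smul _
  have hgB : Integrable g (ν.restrict B) := hgi.mono_measure (Measure.restrict_mono hBJ le_rfl)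
  have hhA : Integrable h (μ.restrict A) := hhi.mono_measure (Measure.restrict_mono hAI le_rfl)
  have hΦ : Integrable (fun z : α × β => b z - g z.2 - h z.1 + w)
      ((μ.restrict I).prod (ν.restrict J)) :=
    ((hb'.sub (hgi.comp_snd _)).sub (hhi.comp_fst _)).add (integrable_const w)
  have hint : ∫ z in A ×ˢ B, (b z - g z.2 - h z.1 + w) ∂(μ.prod ν)
      = (∫ z in A ×ˢ B, b z ∂(μ.prod ν)) - μ.real A • ∫ y in B, g y ∂ν
        - ν.real B • (∫ x in A, h x ∂μ) + (μ.real A * ν.real B) • w := by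
    rw [← Measure.prod_restrict]
    have e1 := integral_add ((hbAB.sub (hgB.comp_snd (μ.restrict A))).sub
      (hhA.comp_fst (ν.restrict B)))
      (integrable_const (μ := (μ.restrict A).prod (ν.restrict B)) w)
    have e2 := integral_sub (hbAB.sub (hgB.comp_snd (μ.restrict A))) (hhA.comp_fst (ν.restrict B))
    have e3 := integral_sub hbAB (hgB.comp_snd (μ.restrict A))
    simp only [Pi.sub_apply] at e1 e2 e3
    rw [e1, e2, e3, integral_fun_snd, integral_fun_fst, integral_const]
    simp [measureReal_def, ← Set.univ_prod_univ, Measure.prod_prod]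
  have hg' : ∫ y in B, g y ∂ν = (μ.real I)⁻¹ • ∫ z in I ×ˢ B, b z ∂(μ.prod ν) := by
    simp only [hg, setAverage_eq]
    rw [integral_smul, ← Measure.prod_restrict, integral_prod_symm _ hbIB]
  have hh' : ∫ x in A, h x ∂μ = (ν.real J)⁻¹ • ∫ z in A ×ˢ J, b z ∂(μ.prod ν) := by
    simp only [hh, setAverage_eq]
    rw [integral_smul, ← Measure.prod_restrict, integral_prod _ hbAJ]
  have hD : (⨍ z in A ×ˢ B, b z ∂(μ.prod ν)) - (⨍ z in I ×ˢ B, b z ∂(μ.prod ν))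
      - (⨍ z in A ×ˢ J, b z ∂(μ.prod ν)) + w
      = (μ.real A * ν.real B)⁻¹ • ∫ z in A ×ˢ B, (b z - g z.2 - h z.1 + w) ∂(μ.prod ν) := by
    rw [hint, hg', hh']
    simp only [setAverage_eq, measureReal_prod_prod, Complex.real_smul, Complex.ofReal_mul,
      Complex.ofReal_inv]
    have a0' : (μ.real A : ℂ) ≠ 0 := by exact_mod_cast a0
    have b0' : (ν.real B : ℂ) ≠ 0 := by exact_mod_cast b0
    have i0' : (μ.real I : ℂ) ≠ 0 := by exact_mod_cast i0
    have j0' : (ν.real J : ℂ) ≠ 0 := by exact_mod_cast j0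
    field_simp
  rw [hD, norm_smul, setAverage_eq, measureReal_prod_prod, norm_inv, Real.norm_eq_abs,
    abs_of_nonneg (mul_nonneg measureReal_nonneg measureReal_nonneg), smul_eq_mul, ← mul_assoc]
  have e : μ.real I * ν.real J / (μ.real A * ν.real B) * (μ.real I * ν.real J)⁻¹
      = (μ.real A * ν.real B)⁻¹ := by field_simp
  rw [e]
  refine mul_le_mul_of_nonneg_left ?_ (inv_nonneg.2 (mul_nonneg measureReal_nonneg measureReal_nonneg))
  refine (norm_integral_le_integral_norm _).trans ?_
  refine setIntegral_mono_set ?_ (Eventually.of_forall fun _ => norm_nonneg _)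
    (LE.le.eventuallyLE (Set.prod_mono hAI hBJ))
  rw [Measure.prod_restrict] at hΦ
  exact hΦ.norm

end RectangularDifferences

/-! ### Cubes and differentiation along them -/

section Cubes

variable {n : ℕ}

theorem cube_eq_preimage (c : Rn n) (s : ℝ) :
    cube c s = (WithLp.ofLp : Rn n → Fin n → ℝ) ⁻¹'
      Set.univ.pi fun j => Set.Icc (c j - s / 2) (c j + s / 2) := by
  ext x
  simp only [cube, Set.mem_ofPred_eq, Set.mem_preimage, Set.mem_univ_pi, Set.mem_Icc, abs_le]
  exact forall_congr' fun j => ⟨fun h => ⟨by linarith, by linarith⟩,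
    fun h => ⟨by linarith, by linarith⟩⟩

theorem volume_cube (c : Rn n) (s : ℝ) : volume (cube c s) = ENNReal.ofReal s ^ n := by
  rw [cube_eq_preimage, (PiLp.volume_preserving_ofLp _).measure_preimage
    (MeasurableSet.univ_pi fun j => measurableSet_Icc).nullMeasurableSet, volume_pi_pi]
  simp [Real.volume_Icc]

theorem volumeReal_cube (c : Rn n) {s : ℝ} (hs : 0 ≤ s) : volume.real (cube c s) = s ^ n := by
  rw [measureReal_def, volume_cube, ENNReal.toReal_pow, ENNReal.toReal_ofReal hs]

theorem cube_eq_preimage_closedBall (c : Rn n) {r : ℝ} (hr : 0 ≤ r) :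
    cube c (2 * r) = (WithLp.ofLp : Rn n → Fin n → ℝ) ⁻¹' Metric.closedBall (WithLp.ofLp c) r := by
  ext x
  simp only [cube, Set.mem_ofPred_eq, Set.mem_preimage, Metric.mem_closedBall,
    dist_pi_le_iff hr, Real.dist_eq]
  exact forall_congr' fun j => by rw [mul_div_cancel_left₀ _ two_ne_zero]

theorem isCompact_cube (c : Rn n) (s : ℝ) : IsCompact (cube c s) := by
  rw [cube_eq_preimage]
  exact (PiLp.homeomorph 2 (fun _ : Fin n => ℝ)).isCompact_preimage.2
    (isCompact_univ_pi fun j => isCompact_Icc)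

theorem cube_subset_cube {c c' : Rn n} {s s' : ℝ} (h : ∀ j, |c j - c' j| ≤ (s' - s) / 2) :
    cube c s ⊆ cube c' s' := fun x hx j => by
  have := abs_sub_le (x j) (c j) (c' j)
  linarith [hx j, h j]

end Cubes

/-- Cubes of side 2r are balls of radius r for the maximum norm, so Lebesgue differentiation over
balls applies after passing to coordinates. -/
theorem ae_tendsto_average_cube {m n : ℕ} {f : Rn m × Rn n → ℂ} (hf : LocallyIntegrable f volume) :
    ∀ᵐ z : Rn m × Rn n, Tendsto (fun r : ℝ => ⨍ w in cube z.1 (2 * r) ×ˢ cube z.2 (2 * r), f w)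
      (𝓝[>] 0) (𝓝 (f z)) := by
  let e : (Rn m × Rn n) ≃ₜ ((Fin m → ℝ) × (Fin n → ℝ)) :=
    (PiLp.homeomorph 2 (fun _ : Fin m => ℝ)).prodCongr (PiLp.homeomorph 2 (fun _ : Fin n => ℝ))
  have he : MeasurePreserving e volume volume :=
    (PiLp.volume_preserving_ofLp _).prod (PiLp.volume_preserving_ofLp _)
  have hme : MeasurableEmbedding e := e.measurableEmbedding
  have hg : LocallyIntegrable (fun w => f (e.symm w)) volume := by
    rw [locallyIntegrable_iff]
    intro K hK
    rw [← he.integrableOn_comp_preimage hme]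
    have : (fun w => f (e.symm w)) ∘ e = f := by ext z; simp
    rw [this]
    exact hf.integrableOn_isCompact (e.isCompact_preimage.2 hK)
  have : (volume : Measure ((Fin m → ℝ) × (Fin n → ℝ))).IsAddHaarMeasure :=
    Measure.prod.instIsAddHaarMeasure _ _
  have h1 := IsUnifLocDoublingMeasure.ae_tendsto_average volume hg 1
  have h2 := he.quasiMeasurePreserving.ae h1
  filter_upwards [h2] with z hz
  have h3 := hz (l := 𝓝[>] (0 : ℝ)) (fun _ => e z) (fun r => r) tendsto_id
    (by filter_upwards [self_mem_nhdsWithin] with r hr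
        exact Metric.mem_closedBall_self (by rw [one_mul]; exact (Set.mem_Ioi.1 hr).le))
  rw [e.symm_apply_apply] at h3
  refine h3.congr' ?_
  filter_upwards [self_mem_nhdsWithin] with r hr
  have hr0 : 0 ≤ r := (Set.mem_Ioi.1 hr).le
  have hset : cube z.1 (2 * r) ×ˢ cube z.2 (2 * r) = e ⁻¹' Metric.closedBall (e z) r := by
    rw [cube_eq_preimage_closedBall _ hr0, cube_eq_preimage_closedBall _ hr0, ← Set.preimage_prod_map_prod,
      closedBall_prod_same]
    rfl
  rw [hset, setAverage_eq, setAverage_eq, ← he.setIntegral_preimage_emb hme]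
  simp only [e.symm_apply_apply, measureReal_def,
    he.measure_preimage Metric.isClosed_closedBall.measurableSet.nullMeasurableSet]

end BiCommutator

namespace BiCommutator

open Filter Topology

/-! ### From oscillations to pointwise second differences -/

section Campanato

variable {m n : ℕ}

/-- Telescoping along concentric doubled cubes. -/
theorem norm_sub_le_of_doubling {θ : ℝ} (hθ1 : θ < 1) {φ : ℝ → ℝ}
    (hφ0 : ∀ s, 0 < s → 0 ≤ φ s) (hφ : ∀ s, 0 < s → φ s ≤ θ * φ (2 * s))
    (hmono : ∀ s u, 0 < s → s ≤ u → φ s ≤ φ u) {L : ℝ} (hL : 0 < L) {x y : Rn n}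
    (hxy : ∀ j, |x j - y j| ≤ L) {M : ℝ} (hM : 0 ≤ M) (G : Rn n → ℝ → ℂ)
    (hG : ∀ c c' : Rn n, ∀ s, (c = x ∨ c = y) → (c' = x ∨ c' = y) → 0 < s → 2 * s ≤ 8 * L →
      cube c s ⊆ cube c' (2 * s) → ‖G c s - G c' (2 * s)‖ ≤ M * φ (2 * s))
    {r : ℝ} (hr : 0 < r) (hrL : r ≤ L) :
    ‖G x r - G y r‖ ≤ 2 / (1 - θ) * M * φ (8 * L) := by
  have hθ' : 0 < 1 - θ := by linarith
  -- The constant M/(1−θ) is stable under doubling: θ·M/(1−θ) + M = M/(1−θ).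
  have key : ∀ c, (c = x ∨ c = y) → ∀ k : ℕ, 2 ^ k * r ≤ 8 * L →
      ‖G c r - G c (2 ^ k * r)‖ ≤ M / (1 - θ) * φ (2 ^ k * r) := by
    intro c hc k
    induction k with
    | zero =>
      intro _
      simp only [pow_zero, one_mul, sub_self, norm_zero]
      exact mul_nonneg (div_nonneg hM hθ'.le) (hφ0 _ hr)
    | succ k ih =>
      intro hk
      have hp : (0 : ℝ) < 2 ^ k * r := by positivity
      have e : (2 : ℝ) ^ (k + 1) * r = 2 * (2 ^ k * r) := by ring
      rw [e] at hk ⊢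
      have h1 := ih (by linarith)
      have h2 := hG c c (2 ^ k * r) hc hc hp hk (cube_subset_cube fun j => by
        rw [sub_self, abs_zero]; linarith)
      have h3 : M / (1 - θ) * φ (2 ^ k * r) ≤ M / (1 - θ) * (θ * φ (2 * (2 ^ k * r))) :=
        mul_le_mul_of_nonneg_left (hφ _ hp) (div_nonneg hM hθ'.le)
      calc ‖G c r - G c (2 * (2 ^ k * r))‖
          ≤ ‖G c r - G c (2 ^ k * r)‖ + ‖G c (2 ^ k * r) - G c (2 * (2 ^ k * r))‖ :=
            norm_sub_le_norm_sub_add_norm_sub _ _ _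
        _ ≤ M / (1 - θ) * (θ * φ (2 * (2 ^ k * r))) + M * φ (2 * (2 ^ k * r)) :=
            add_le_add (h1.trans h3) h2
        _ = M / (1 - θ) * φ (2 * (2 ^ k * r)) := by field_simp; ring
  obtain ⟨k, hk⟩ : ∃ k : ℕ, 2 * L ≤ 2 ^ k * r := by
    obtain ⟨k, hk⟩ := pow_unbounded_of_one_lt (2 * L / r) (one_lt_two (α := ℝ))
    exact ⟨k, by rw [div_lt_iff₀ hr] at hk; exact hk.le⟩
  classical
  -- The least such K puts the scale 2^K r between 2L and 4L. There the cube at y lies in the cube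
  -- at x of twice the side, and that side is at most 8L.
  let K := Nat.find (p := fun k => 2 * L ≤ 2 ^ k * r) ⟨k, hk⟩
  have hK : 2 * L ≤ 2 ^ K * r := Nat.find_spec (p := fun k => 2 * L ≤ 2 ^ k * r) ⟨k, hk⟩
  have hK' : 2 ^ K * r ≤ 4 * L := by
    rcases Nat.eq_zero_or_pos K with h0 | h0
    · rw [h0]; linarith
    · have := Nat.find_min (p := fun k => 2 * L ≤ 2 ^ k * r) ⟨k, hk⟩ (Nat.sub_lt h0 one_pos)
      have e : (2 : ℝ) ^ K = 2 * 2 ^ (K - 1) := by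
        rw [← pow_succ', Nat.sub_add_cancel h0]
      rw [e]
      change ¬ (2 * L ≤ 2 ^ (K - 1) * r) at this
      linarith
  have hp : (0 : ℝ) < 2 ^ K * r := by positivity
  have e : (2 : ℝ) ^ (K + 1) * r = 2 * (2 ^ K * r) := by ring
  -- The chain at x goes one doubling further than the chain at y, so that the two can be linked by
  -- a single inclusion of cubes.
  have hx := key x (Or.inl rfl) (K + 1) (by rw [e]; linarith)
  rw [e] at hx
  have hy := key y (Or.inr rfl) K (by linarith)
  have hc := hG y x (2 ^ K * r) (Or.inr rfl) (Or.inl rfl) hp (by linarith)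
    (cube_subset_cube fun j => by rw [abs_sub_comm]; linarith [hxy j])
  have hy' : M / (1 - θ) * φ (2 ^ K * r) ≤ M / (1 - θ) * (θ * φ (2 * (2 ^ K * r))) :=
    mul_le_mul_of_nonneg_left (hφ _ hp) (div_nonneg hM hθ'.le)
  calc ‖G x r - G y r‖
      = ‖(G x r - G x (2 * (2 ^ K * r))) - (G y r - G y (2 ^ K * r))
          - (G y (2 ^ K * r) - G x (2 * (2 ^ K * r)))‖ := by congr 1; ring
    _ ≤ ‖G x r - G x (2 * (2 ^ K * r))‖ + ‖G y r - G y (2 ^ K * r)‖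
          + ‖G y (2 ^ K * r) - G x (2 * (2 ^ K * r))‖ :=
        (norm_sub_le _ _).trans (add_le_add (norm_sub_le _ _) le_rfl)
    _ ≤ M / (1 - θ) * φ (2 * (2 ^ K * r)) + M / (1 - θ) * (θ * φ (2 * (2 ^ K * r)))
          + M * φ (2 * (2 ^ K * r)) := add_le_add (add_le_add hx (hy.trans hy')) hc
    _ = 2 / (1 - θ) * M * φ (2 * (2 ^ K * r)) := by field_simp; ring
    _ ≤ 2 / (1 - θ) * M * φ (8 * L) :=
        mul_le_mul_of_nonneg_left (hmono _ _ (by linarith) (by linarith))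
          (mul_nonneg (div_nonneg zero_le_two hθ'.le) hM)

theorem norm_average_cube_sub_le {b : Rn m × Rn n → ℂ} (hb : LocallyIntegrable b volume)
    {c c' : Rn m} {d d' : Rn n} {s u : ℝ} (hs : 0 < s) (hu : 0 < u)
    (hc : cube c s ⊆ cube c' (2 * s)) (hd : cube d u ⊆ cube d' (2 * u)) :
    ‖(⨍ z in cube c s ×ˢ cube d u, b z) - (⨍ z in cube c' (2 * s) ×ˢ cube d u, b z)
      - (⨍ z in cube c s ×ˢ cube d' (2 * u), b z)
      + (⨍ z in cube c' (2 * s) ×ˢ cube d' (2 * u), b z)‖ ≤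
    2 ^ (m + n) * osc b (cube c' (2 * s)) (cube d' (2 * u)) := by
  have hne : ∀ {k : ℕ} (a : Rn k) {s : ℝ}, 0 < s → volume (cube a s) ≠ 0 := fun a s hs => by
    rw [volume_cube]
    exact pow_ne_zero _ (ENNReal.ofReal_pos.2 hs).ne'
  have h := norm_average_sub_average_le (μ := volume) (ν := volume) (b := b) hc hd (hne c hs)
    (hne d hu) (isCompact_cube _ _).measure_lt_top.ne (isCompact_cube _ _).measure_lt_top.ne
    (hb.integrableOn_isCompact ((isCompact_cube _ _).prod (isCompact_cube _ _)))
  rw [volumeReal_cube _ hs.le, volumeReal_cube _ hu.le, volumeReal_cube _ (by linarith),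
    volumeReal_cube _ (by linarith)] at h
  have e : (2 * s) ^ m * (2 * u) ^ n / (s ^ m * u ^ n) = (2 : ℝ) ^ (m + n) := by
    rw [mul_pow, mul_pow, pow_add]; field_simp
  rw [e] at h
  exact h

/-- The set of points at which the averages over small cubes converge. -/
def regularPoints (b : Rn m × Rn n → ℂ) : Set (Rn m × Rn n) :=
  {z | Tendsto (fun r : ℝ => ⨍ w in cube z.1 (2 * r) ×ˢ cube z.2 (2 * r), b w)
      (𝓝[>] 0) (𝓝 (b z))}

/-- The second difference of `b` with corners `x` and `y`. -/
def secondDiff (b : Rn m × Rn n → ℂ) (x y : Rn m × Rn n) : ℂ :=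
  b x - b (y.1, x.2) - b (x.1, y.2) + b y

/-- All the corners of the rectangle spanned by `x` and `y` lie in `S`. -/
def CornersIn (S : Set (Rn m × Rn n)) (x y : Rn m × Rn n) : Prop :=
  x ∈ S ∧ (y.1, x.2) ∈ S ∧ (x.1, y.2) ∈ S ∧ y ∈ S

/-- The telescoping is used twice. In the first variable it is applied to differences of averages in
the second variable at a fixed scale r; its hypothesis on one doubling is itself obtained by
telescoping in the second variable, which produces the factor ψ(8L₂). Letting r tend to 0 at the
four corners replaces averages by values of b. -/
theorem norm_secondDiff_le {b : Rn m × Rn n → ℂ} (hb : LocallyIntegrable b volume) {θ : ℝ}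
    (hθ1 : θ < 1) {φ ψ : ℝ → ℝ}
    (hφ0 : ∀ s, 0 < s → 0 ≤ φ s) (hφ : ∀ s, 0 < s → φ s ≤ θ * φ (2 * s))
    (hφm : ∀ s u, 0 < s → s ≤ u → φ s ≤ φ u)
    (hψ0 : ∀ s, 0 < s → 0 ≤ ψ s) (hψ : ∀ s, 0 < s → ψ s ≤ θ * ψ (2 * s))
    (hψm : ∀ s u, 0 < s → s ≤ u → ψ s ≤ ψ u) {L₁ L₂ : ℝ} (hL₁ : 0 < L₁) (hL₂ : 0 < L₂)
    {x y : Rn m × Rn n} (h₁ : ∀ j, |x.1 j - y.1 j| ≤ L₁) (h₂ : ∀ j, |x.2 j - y.2 j| ≤ L₂)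
    (hosc : ∀ c d s u, (c = x.1 ∨ c = y.1) → (d = x.2 ∨ d = y.2) → 0 < s → 0 < u → s ≤ 8 * L₁ →
      u ≤ 8 * L₂ → osc b (cube c s) (cube d u) ≤ φ s * ψ u)
    (hreg : CornersIn (regularPoints b) x y) :
    ‖secondDiff b x y‖ ≤ (2 / (1 - θ)) ^ 2 * 2 ^ (m + n) * φ (8 * L₁) * ψ (8 * L₂) := by
  set A : Rn m → ℝ → Rn n → ℝ → ℂ := fun c s d u => ⨍ z in cube c s ×ˢ cube d u, b z with hA
  have hθ' : 0 < 1 - θ := by linarith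
  have step : ∀ r, 0 < r → r ≤ L₁ → r ≤ L₂ →
      ‖(A x.1 r x.2 r - A x.1 r y.2 r) - (A y.1 r x.2 r - A y.1 r y.2 r)‖ ≤
      (2 / (1 - θ)) ^ 2 * 2 ^ (m + n) * φ (8 * L₁) * ψ (8 * L₂) := by
    intro r hr hr1 hr2
    have := norm_sub_le_of_doubling hθ1 hφ0 hφ hφm hL₁ h₁
      (M := 2 / (1 - θ) * 2 ^ (m + n) * ψ (8 * L₂))
      (mul_nonneg (by positivity) (hψ0 _ (by linarith)))
      (fun c s => A c s x.2 r - A c s y.2 r) ?_ hr hr1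
    · refine this.trans (le_of_eq ?_)
      ring
    intro c c' s hc hc' hs hs8 hsub
    have h := norm_sub_le_of_doubling hθ1 hψ0 hψ hψm hL₂ h₂
      (M := 2 ^ (m + n) * φ (2 * s)) (mul_nonneg (by positivity) (hφ0 _ (by linarith)))
      (fun d u => A c s d u - A c' (2 * s) d u) ?_ hr hr2
    · calc ‖A c s x.2 r - A c s y.2 r - (A c' (2 * s) x.2 r - A c' (2 * s) y.2 r)‖
          = ‖A c s x.2 r - A c' (2 * s) x.2 r - (A c s y.2 r - A c' (2 * s) y.2 r)‖ := by
            congr 1; ring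
        _ ≤ _ := h
        _ = _ := by ring
    intro d d' u _ hd' hu hu8 hsub'
    calc ‖A c s d u - A c' (2 * s) d u - (A c s d' (2 * u) - A c' (2 * s) d' (2 * u))‖
        = ‖A c s d u - A c' (2 * s) d u - A c s d' (2 * u) + A c' (2 * s) d' (2 * u)‖ := by
          congr 1; ring
      _ ≤ 2 ^ (m + n) * osc b (cube c' (2 * s)) (cube d' (2 * u)) :=
          norm_average_cube_sub_le hb hs hu hsub hsub'
      _ ≤ 2 ^ (m + n) * (φ (2 * s) * ψ (2 * u)) :=
          mul_le_mul_of_nonneg_left (hosc _ _ _ _ hc' hd' (by linarith) (by linarith) hs8 hu8)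
            (by positivity)
      _ = _ := by ring
  have hlim := (((hreg.1.sub hreg.2.2.1).sub (hreg.2.1.sub hreg.2.2.2))).norm
  refine le_of_tendsto (f := fun r : ℝ => _) (hlim.trans_eq (by simp [secondDiff]; ring_nf)) ?_
  have hev : ∀ᶠ r : ℝ in 𝓝[>] 0, 2 * r ≤ min L₁ L₂ := by
    have : Tendsto (fun r : ℝ => 2 * r) (𝓝[>] 0) (𝓝 0) := by
      have h : Tendsto (fun r : ℝ => 2 * r) (𝓝 0) (𝓝 (2 * 0)) := tendsto_id.const_mul 2
      rw [mul_zero] at h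
      exact h.mono_left nhdsWithin_le_nhds
    exact (this.eventually_lt_const (lt_min hL₁ hL₂)).mono fun r hr => hr.le
  filter_upwards [hev, self_mem_nhdsWithin] with r hr hr0
  exact step (2 * r) (by linarith [Set.mem_Ioi.1 hr0]) (hr.trans (min_le_left _ _))
    (hr.trans (min_le_right _ _))

end Campanato

end BiCommutator

namespace BiCommutator

open Filter Topology

/-! ### Product Hölder estimates for the symbol, small for extreme rectangles -/

section VMO

variable {m n : ℕ}

/-- The additional power β/2 accommodates oscillations that are known to be small only at large
scales: at bounded scales s^β is at most a constant times s^(β/2), and at a large scale s^(β/2) is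
negligible against s^β. -/
theorem exists_norm_secondDiff_le_rpow (m n : ℕ) {β₁ β₂ : ℝ} (hβ₁ : 0 < β₁) (hβ₂ : 0 < β₂) :
    ∃ C : ℝ, 0 < C ∧ ∀ (b : Rn m × Rn n → ℂ), LocallyIntegrable b volume →
      ∀ a c a' c' : ℝ, 0 ≤ a → 0 ≤ c → 0 ≤ a' → 0 ≤ c' →
      ∀ x y : Rn m × Rn n, x.1 ≠ y.1 → x.2 ≠ y.2 → CornersIn (regularPoints b) x y →
      (∀ e d s u, (e = x.1 ∨ e = y.1) → (d = x.2 ∨ d = y.2) → 0 < s → 0 < u →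
        s ≤ 8 * ‖x.1 - y.1‖ → u ≤ 8 * ‖x.2 - y.2‖ → osc b (cube e s) (cube d u) ≤
          (a * s ^ β₁ + c * s ^ (β₁ / 2)) * (a' * u ^ β₂ + c' * u ^ (β₂ / 2))) →
      ‖secondDiff b x y‖ ≤ C * (a * ‖x.1 - y.1‖ ^ β₁ + c * ‖x.1 - y.1‖ ^ (β₁ / 2)) *
        (a' * ‖x.2 - y.2‖ ^ β₂ + c' * ‖x.2 - y.2‖ ^ (β₂ / 2)) := by
  -- This γ is below all four exponents βᵢ and βᵢ/2, so the single contraction factor 2^(−γ) serves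
  -- both variables.
  set γ := min β₁ β₂ / 2 with hγ
  have hγ0 : 0 < γ := half_pos (lt_min hβ₁ hβ₂)
  set θ : ℝ := 2 ^ (-γ) with hθ
  have hθ0 : 0 < θ := by positivity
  have hθ1 : θ < 1 := Real.rpow_lt_one_of_one_lt_of_neg one_lt_two (by linarith)
  have hmono : ∀ β a c : ℝ, 0 < β → 0 ≤ a → 0 ≤ c → ∀ s u : ℝ, 0 < s → s ≤ u →
      a * s ^ β + c * s ^ (β / 2) ≤ a * u ^ β + c * u ^ (β / 2) := by
    intro β a c hβ ha hc s u hs hsu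
    have h1 := Real.rpow_le_rpow hs.le hsu hβ.le
    have h2 := Real.rpow_le_rpow hs.le hsu (half_pos hβ).le
    gcongr
  have hpow : ∀ β : ℝ, γ ≤ β → ∀ s : ℝ, 0 < s → s ^ β ≤ θ * (2 * s) ^ β := by
    intro β hβ s hs
    rw [Real.mul_rpow zero_le_two hs.le, ← mul_assoc, hθ, ← Real.rpow_add two_pos]
    exact le_mul_of_one_le_left (by positivity) (Real.one_le_rpow one_le_two (by linarith))
  have hdouble : ∀ β a c : ℝ, γ ≤ β / 2 → 0 ≤ a → 0 ≤ c → ∀ s : ℝ, 0 < s →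
      a * s ^ β + c * s ^ (β / 2) ≤ θ * (a * (2 * s) ^ β + c * (2 * s) ^ (β / 2)) := by
    intro β a c hβ ha hc s hs
    have h1 := mul_le_mul_of_nonneg_left (hpow β (by linarith) s hs) ha
    have h2 := mul_le_mul_of_nonneg_left (hpow (β / 2) hβ s hs) hc
    linarith
  have height : ∀ β a c : ℝ, 0 < β → 0 ≤ a → 0 ≤ c → ∀ s : ℝ, 0 < s →
      a * (8 * s) ^ β + c * (8 * s) ^ (β / 2) ≤ 8 ^ β * (a * s ^ β + c * s ^ (β / 2)) := by
    intro β a c hβ ha hc s hs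
    rw [Real.mul_rpow (by norm_num) hs.le, Real.mul_rpow (by norm_num) hs.le]
    have h1 : (8 : ℝ) ^ (β / 2) ≤ 8 ^ β := Real.rpow_le_rpow_of_exponent_le (by norm_num) (by linarith)
    have h2 := mul_le_mul_of_nonneg_right h1 (mul_nonneg hc (Real.rpow_nonneg hs.le (β / 2)))
    linarith
  have hθ' : 0 < 1 - θ := by linarith
  refine ⟨(2 / (1 - θ)) ^ 2 * 2 ^ (m + n) * 8 ^ β₁ * 8 ^ β₂, by positivity, ?_⟩
  intro b hb a c a' c' ha hc ha' hc' x y h1 h2 hreg hosc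
  have hL₁ : 0 < ‖x.1 - y.1‖ := norm_pos_iff.2 (sub_ne_zero.2 h1)
  have hL₂ : 0 < ‖x.2 - y.2‖ := norm_pos_iff.2 (sub_ne_zero.2 h2)
  have hg1 : γ ≤ β₁ / 2 := by rw [hγ]; linarith [min_le_left β₁ β₂]
  have hg2 : γ ≤ β₂ / 2 := by rw [hγ]; linarith [min_le_right β₁ β₂]
  have := norm_secondDiff_le hb hθ1 (φ := fun s => a * s ^ β₁ + c * s ^ (β₁ / 2))
    (ψ := fun u => a' * u ^ β₂ + c' * u ^ (β₂ / 2)) (fun s hs => by positivity)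
    (hdouble _ _ _ hg1 ha hc) (hmono _ _ _ hβ₁ ha hc) (fun s hs => by positivity)
    (hdouble _ _ _ hg2 ha' hc') (hmono _ _ _ hβ₂ ha' hc') hL₁ hL₂
    (fun j => by
      rw [← Real.norm_eq_abs]; exact PiLp.norm_apply_le (x.1 - y.1) j)
    (fun j => by
      rw [← Real.norm_eq_abs]; exact PiLp.norm_apply_le (x.2 - y.2) j) hosc hreg
  refine this.trans ?_
  have k1 := height β₁ a c hβ₁ ha hc _ hL₁
  have k2 := height β₂ a' c' hβ₂ ha' hc' _ hL₂
  have hK : 0 ≤ (2 / (1 - θ)) ^ 2 * (2 : ℝ) ^ (m + n) := by positivity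
  calc (2 / (1 - θ)) ^ 2 * 2 ^ (m + n) *
        (a * (8 * ‖x.1 - y.1‖) ^ β₁ + c * (8 * ‖x.1 - y.1‖) ^ (β₁ / 2)) *
        (a' * (8 * ‖x.2 - y.2‖) ^ β₂ + c' * (8 * ‖x.2 - y.2‖) ^ (β₂ / 2))
      ≤ (2 / (1 - θ)) ^ 2 * 2 ^ (m + n) *
        (8 ^ β₁ * (a * ‖x.1 - y.1‖ ^ β₁ + c * ‖x.1 - y.1‖ ^ (β₁ / 2))) *
        (8 ^ β₂ * (a' * ‖x.2 - y.2‖ ^ β₂ + c' * ‖x.2 - y.2‖ ^ (β₂ / 2))) := by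
        gcongr
    _ = _ := by ring

theorem osc_le_of_fracOsc_le {β₁ β₂ K : ℝ} {b : Rn m × Rn n → ℂ} {c : Rn m} {d : Rn n} {s u : ℝ}
    (hs : 0 < s) (hu : 0 < u) (h : fracOsc β₁ β₂ b c s d u ≤ K) :
    osc b (cube c s) (cube d u) ≤ K * s ^ β₁ * u ^ β₂ := by
  rw [fracOsc, Real.rpow_neg hs.le, Real.rpow_neg hu.le, ← mul_inv, inv_mul_le_iff₀ (by positivity)]
    at h
  linarith

theorem MemBMO.exists_norm_secondDiff_le {β₁ β₂ : ℝ} (hβ₁ : 0 < β₁) (hβ₂ : 0 < β₂)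
    {b : Rn m × Rn n → ℂ} (hb : MemBMO β₁ β₂ b) :
    ∃ M : ℝ, 0 ≤ M ∧ ∀ x y : Rn m × Rn n, x.1 ≠ y.1 → x.2 ≠ y.2 → CornersIn (regularPoints b) x y →
      ‖secondDiff b x y‖ ≤ M * (‖x.1 - y.1‖ ^ β₁ * ‖x.2 - y.2‖ ^ β₂) := by
  obtain ⟨hl, M, hM⟩ := hb
  obtain ⟨C, hC, h⟩ := exists_norm_secondDiff_le_rpow m n hβ₁ hβ₂
  refine ⟨C * max M 0, by positivity, fun x y h1 h2 hxy => ?_⟩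
  have := h b hl (max M 0) 0 1 0 (le_max_right _ _) le_rfl zero_le_one le_rfl x y h1 h2 hxy
    (fun e d s u _ _ hs hu _ _ => by
      refine (osc_le_of_fracOsc_le hs hu ((hM e s d u hs hu).trans (le_max_left M 0))).trans
        (le_of_eq ?_)
      ring)
  refine this.trans (le_of_eq ?_)
  ring

theorem norm_sub_le_of_mem_cube {c x : Rn n} {s : ℝ} (hx : x ∈ cube c s) :
    ‖x - c‖ ≤ n * (s / 2) := by
  rcases Nat.eq_zero_or_pos n with h0 | h0
  · subst h0
    simp [Subsingleton.elim x c]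
  have hs : 0 ≤ s / 2 := (abs_nonneg _).trans (hx ⟨0, h0⟩)
  rw [EuclideanSpace.norm_eq, Real.sqrt_le_left (by positivity)]
  calc ∑ j, ‖(x - c) j‖ ^ 2 ≤ ∑ _j : Fin n, (s / 2) ^ 2 :=
        Finset.sum_le_sum fun j _ => pow_le_pow_left₀ (norm_nonneg _) (hx j) 2
    _ = n * (s / 2) ^ 2 := by simp
    _ ≤ (n : ℝ) ^ 2 * (s / 2) ^ 2 := by
        gcongr
        have : (1 : ℝ) ≤ n := by exact_mod_cast h0
        nlinarith
    _ = _ := by ring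

theorem exists_rpow_half_dominated {β : ℝ} (hβ : 0 < β) {ε : ℝ} (hε : 0 < ε) (c : ℝ) :
    ∃ A : ℝ, 0 < A ∧ ∀ L, A < L → c * L ^ (β / 2) ≤ ε * L ^ β := by
  have h1 := (tendsto_rpow_atTop (half_pos hβ)).eventually_ge_atTop (c / ε)
  obtain ⟨A, hA⟩ := eventually_atTop.1 h1
  refine ⟨max A 1, by positivity, fun L hL => ?_⟩
  have hL0 : 0 < L := zero_lt_one.trans ((le_max_right A 1).trans_lt hL)
  have h2 := hA L ((le_max_left A 1).trans hL.le)
  rw [div_le_iff₀ hε] at h2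
  have e : L ^ β = L ^ (β / 2) * L ^ (β / 2) := by rw [← Real.rpow_add hL0, add_halves]
  rw [e]
  have := mul_le_mul_of_nonneg_right h2 (Real.rpow_nonneg hL0.le (β / 2))
  linarith

/-- Telescoping involves cubes of every side up to 8|xᵢ−yᵢ| around the corners. If some |xᵢ−yᵢ| is
small, or both are moderate and x is far away, all these rectangles have small fractional
oscillation. If some |xᵢ−yᵢ| is large, the cubes of moderate side in that variable are not small,
but they enter with the power βᵢ/2 only, which is dominated. -/
theorem MemVMO.exists_norm_secondDiff_le {β₁ β₂ : ℝ} (hβ₁ : 0 < β₁) (hβ₂ : 0 < β₂)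
    {b : Rn m × Rn n → ℂ} (hb : MemVMO β₁ β₂ b) {ε : ℝ} (hε : 0 < ε) :
    ∃ R : ℝ, 1 ≤ R ∧ ∀ x y : Rn m × Rn n, x.1 ≠ y.1 → x.2 ≠ y.2 →
      CornersIn (regularPoints b) x y →
      (‖x.1 - y.1‖ < R⁻¹ ∨ R < ‖x.1 - y.1‖ ∨ ‖x.2 - y.2‖ < R⁻¹ ∨ R < ‖x.2 - y.2‖ ∨ R < ‖x‖) →
      ‖secondDiff b x y‖ ≤ ε * (‖x.1 - y.1‖ ^ β₁ * ‖x.2 - y.2‖ ^ β₂) := by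
  obtain ⟨⟨hl, M, hM⟩, hv⟩ := hb
  obtain ⟨C, hC, h⟩ := exists_norm_secondDiff_le_rpow m n hβ₁ hβ₂
  -- The factor 2 pays for the two terms, of powers β and β/2, in the case of a large side.
  set δ := ε / (2 * C) with hδ
  have hδ0 : 0 < δ := by positivity
  obtain ⟨t, ht, hvt⟩ := hv δ hδ0
  set K := max M 0 with hK
  have hK0 : 0 ≤ K := le_max_right _ _
  have hMK : ∀ c s d u, 0 < s → 0 < u → osc b (cube c s) (cube d u) ≤ K * s ^ β₁ * u ^ β₂ :=
    fun c s d u hs hu =>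
      osc_le_of_fracOsc_le hs hu ((hM c s d u hs hu).trans (le_max_left M 0))
  set c₁ := K * t⁻¹ ^ (β₁ / 2) with hc₁
  set c₂ := K * t⁻¹ ^ (β₂ / 2) with hc₂
  have hc₁0 : 0 ≤ c₁ := by positivity
  have hc₂0 : 0 ≤ c₂ := by positivity
  obtain ⟨A₁, hA₁, hd₁⟩ := exists_rpow_half_dominated hβ₁ hδ0 c₁
  obtain ⟨A₂, hA₂, hd₂⟩ := exists_rpow_half_dominated hβ₂ hδ0 c₂
  set A := A₁ + A₂ with hA
  -- Three requirements fix R: 8/R ≤ t, so that a short side keeps all its cubes shorter than t; R ≥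
  -- A; and a margin for moving from x to any point of a cube around a corner, namely A for the
  -- change of corner and at most 4mA or 4nA for the cube.
  set R := 1 + 8 * t⁻¹ + (4 * (m + n) + 1) * A with hR
  have hAR : A ≤ R := by
    have : 0 ≤ (4 * ((m : ℝ) + n)) * A := by positivity
    have : 0 < t⁻¹ := by positivity
    rw [hR]; linarith
  have hR1 : 1 ≤ R := by
    have : 0 ≤ 8 * t⁻¹ + (4 * ((m : ℝ) + n) + 1) * A := by positivity
    rw [hR]; linarith
  have hRt : 8 * R⁻¹ ≤ t := by
    rw [← div_eq_mul_inv, div_le_iff₀ (by linarith)]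
    have h1 : t * (8 * t⁻¹) = 8 := by field_simp
    have h2 : 0 ≤ t * (1 + (4 * ((m : ℝ) + n) + 1) * A) := by positivity
    calc (8 : ℝ) ≤ 8 + t * (1 + (4 * ((m : ℝ) + n) + 1) * A) := by linarith
      _ = t * R := by rw [hR]; linear_combination -h1
  have half : ∀ β s : ℝ, 0 < β → 0 < s → s ≤ t⁻¹ → K * s ^ β ≤ K * t⁻¹ ^ (β / 2) * s ^ (β / 2) := by
    intro β s hβ hs hst
    have e : s ^ β = s ^ (β / 2) * s ^ (β / 2) := by rw [← Real.rpow_add hs, add_halves]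
    rw [e, ← mul_assoc]
    have := Real.rpow_le_rpow hs.le hst (half_pos hβ).le
    gcongr
  have small : ∀ x y : Rn m × Rn n, x.1 ≠ y.1 → x.2 ≠ y.2 → CornersIn (regularPoints b) x y →
      (∀ e d s u, (e = x.1 ∨ e = y.1) → (d = x.2 ∨ d = y.2) → 0 < s → 0 < u →
        s ≤ 8 * ‖x.1 - y.1‖ → u ≤ 8 * ‖x.2 - y.2‖ → fracOsc β₁ β₂ b e s d u ≤ δ) →
      ‖secondDiff b x y‖ ≤ ε * (‖x.1 - y.1‖ ^ β₁ * ‖x.2 - y.2‖ ^ β₂) := by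
    intro x y h1 h2 hxy hsm
    have := h b hl δ 0 1 0 hδ0.le le_rfl zero_le_one le_rfl x y h1 h2 hxy
      (fun e d s u he hd hs hu hs8 hu8 =>
        (osc_le_of_fracOsc_le hs hu (hsm e d s u he hd hs hu hs8 hu8)).trans
          (le_of_eq (by ring)))
    have hn : 0 ≤ ‖x.1 - y.1‖ ^ β₁ * ‖x.2 - y.2‖ ^ β₂ := by positivity
    calc ‖secondDiff b x y‖ ≤ _ := this
      _ = C * δ * (‖x.1 - y.1‖ ^ β₁ * ‖x.2 - y.2‖ ^ β₂) := by ring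
      _ ≤ _ := mul_le_mul_of_nonneg_right (by rw [hδ]; field_simp; linarith) hn
  refine ⟨R, hR1, fun x y h1 h2 hxy hcase => ?_⟩
  by_cases hbig₁ : A < ‖x.1 - y.1‖
  · have := h b hl δ c₁ 1 0 hδ0.le hc₁0 zero_le_one le_rfl x y h1 h2 hxy
      (fun e d s u he hd hs hu hs8 hu8 => by
        rw [one_mul, zero_mul, add_zero]
        rcases lt_or_ge t⁻¹ s with hts | hts
        · refine (osc_le_of_fracOsc_le hs hu
            (hvt e s d u hs hu (Or.inr (Or.inl hts))).le).trans ?_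
          have : 0 ≤ c₁ * s ^ (β₁ / 2) := by positivity
          gcongr
          linarith
        · refine (hMK e s d u hs hu).trans ?_
          have h3 := half β₁ s hβ₁ hs hts
          have : 0 ≤ δ * s ^ β₁ := by positivity
          gcongr
          linarith)
    have h3 := hd₁ _ (lt_of_le_of_lt (by linarith) hbig₁)
    have hn : 0 ≤ ‖x.2 - y.2‖ ^ β₂ := by positivity
    calc ‖secondDiff b x y‖ ≤ _ := this
      _ = C * (δ * ‖x.1 - y.1‖ ^ β₁ + c₁ * ‖x.1 - y.1‖ ^ (β₁ / 2)) * ‖x.2 - y.2‖ ^ β₂ := by ring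
      _ ≤ C * (δ * ‖x.1 - y.1‖ ^ β₁ + δ * ‖x.1 - y.1‖ ^ β₁) * ‖x.2 - y.2‖ ^ β₂ := by gcongr
      _ = _ := by rw [hδ]; field_simp; ring
  by_cases hbig₂ : A < ‖x.2 - y.2‖
  · have := h b hl 1 0 δ c₂ zero_le_one le_rfl hδ0.le hc₂0 x y h1 h2 hxy
      (fun e d s u he hd hs hu hs8 hu8 => by
        rw [one_mul, zero_mul, add_zero]
        rcases lt_or_ge t⁻¹ u with hts | hts
        · refine (osc_le_of_fracOsc_le hs hu
            (hvt e s d u hs hu (Or.inr (Or.inr (Or.inr (Or.inl hts))))).le).trans ?_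
          have : 0 ≤ c₂ * u ^ (β₂ / 2) := by positivity
          rw [mul_comm δ, mul_assoc]
          gcongr
          linarith
        · refine (hMK e s d u hs hu).trans ?_
          have h3 := half β₂ u hβ₂ hu hts
          have : 0 ≤ δ * u ^ β₂ := by positivity
          rw [mul_comm K, mul_assoc]
          gcongr
          linarith)
    have h3 := hd₂ _ (lt_of_le_of_lt (by linarith) hbig₂)
    have hn : 0 ≤ ‖x.1 - y.1‖ ^ β₁ := by positivity
    calc ‖secondDiff b x y‖ ≤ _ := this
      _ = C * ‖x.1 - y.1‖ ^ β₁ * (δ * ‖x.2 - y.2‖ ^ β₂ + c₂ * ‖x.2 - y.2‖ ^ (β₂ / 2)) := by ring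
      _ ≤ C * ‖x.1 - y.1‖ ^ β₁ * (δ * ‖x.2 - y.2‖ ^ β₂ + δ * ‖x.2 - y.2‖ ^ β₂) := by gcongr
      _ = _ := by rw [hδ]; field_simp; ring
  push Not at hbig₁ hbig₂
  -- Both sides are now at most A, and every rectangle met in the telescoping satisfies one of the
  -- alternatives of the vanishing condition.
  refine small x y h1 h2 hxy fun e d s u he hd hs hu hs8 hu8 =>
    (hvt e s d u hs hu ?_).le
  rcases hcase with hc | hc | hc | hc | hc
  · exact Or.inl (by linarith)
  · exact absurd (hAR.trans_lt hc) (not_lt.2 hbig₁)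
  · exact Or.inr (Or.inr (Or.inl (by linarith)))
  · exact absurd (hAR.trans_lt hc) (not_lt.2 hbig₂)
  · refine Or.inr (Or.inr (Or.inr (Or.inr fun z hz => ?_)))
    have far : ∀ {k : ℕ} {v w c z : Rn k} {s : ℝ}, (c = v ∨ c = w) → ‖v - w‖ ≤ A →
        s ≤ 8 * ‖v - w‖ → z ∈ cube c s → ‖v‖ ≤ ‖z‖ + (4 * k + 1) * A := by
      intro k v w c z s hc hvw hs hz
      have h3 := norm_sub_le_of_mem_cube hz
      have h4 : ‖v - c‖ ≤ A := by
        rcases hc with rfl | rfl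
        · rw [sub_self, norm_zero]; positivity
        · exact hvw
      have h5 : (k : ℝ) * (s / 2) ≤ k * (4 * A) := by gcongr; linarith
      have h6 : ‖v‖ ≤ ‖v - c‖ + ‖z - c‖ + ‖z‖ := by
        calc ‖v‖ = ‖(v - c) - (z - c) + z‖ := by congr 1; abel
          _ ≤ _ := (norm_add_le _ _).trans (add_le_add (norm_sub_le _ _) le_rfl)
      linarith
    have f1 := far he hbig₁ hs8 hz.1
    have f2 := far hd hbig₂ hu8 hz.2
    have hm : (0 : ℝ) ≤ 4 * m * A := by positivity
    have hn : (0 : ℝ) ≤ 4 * n * A := by positivity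
    have htp : 0 < t⁻¹ := by positivity
    rcases lt_max_iff.1 (Prod.norm_def (x := x) ▸ hc) with h3 | h3
    · have : t⁻¹ < ‖z.1‖ := by
        have : R = 1 + 8 * t⁻¹ + (4 * m * A + 4 * n * A + A) := by rw [hR]; ring
        linarith
      exact this.trans_le (Real.le_sqrt_of_sq_le (by nlinarith [sq_nonneg ‖z.2‖]))
    · have : t⁻¹ < ‖z.2‖ := by
        have : R = 1 + 8 * t⁻¹ + (4 * m * A + 4 * n * A + A) := by rw [hR]; ring
        linarith
      exact this.trans_le (Real.le_sqrt_of_sq_le (by nlinarith [sq_nonneg ‖z.1‖]))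

end VMO

end BiCommutator

namespace BiCommutator

open Filter Topology Metric

/-! ### Power integrals and the layer-cake formula -/

section PowerIntegrals

theorem lintegral_Ioo_rpow {s R : ℝ} (hs : 0 < s) (hR : 0 ≤ R) :
    ∫⁻ t in Set.Ioo 0 R, ENNReal.ofReal (t ^ (s - 1)) = ENNReal.ofReal (R ^ s / s) := by
  rw [setLIntegral_congr Ioo_ae_eq_Ioc, ← ofReal_integral_eq_lintegral_ofReal]
  · rw [← intervalIntegral.integral_of_le hR, integral_rpow (Or.inl (by linarith)), sub_add_cancel,
      Real.zero_rpow hs.ne', sub_zero]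
  · rw [← IntegrableOn, ← intervalIntegrable_iff_integrableOn_Ioc_of_le hR]
    exact intervalIntegral.intervalIntegrable_rpow' (by linarith)
  · filter_upwards [ae_restrict_mem measurableSet_Ioc] with t ht
    exact Real.rpow_nonneg ht.1.le _

theorem lintegral_Ioi_rpow {s R : ℝ} (hs : 0 < s) (hR : 0 < R) :
    ∫⁻ t in Set.Ioi R, ENNReal.ofReal (t ^ (-s - 1)) = ENNReal.ofReal (R ^ (-s) / s) := by
  rw [← ofReal_integral_eq_lintegral_ofReal]
  · rw [integral_Ioi_rpow_of_lt (by linarith) hR, sub_add_cancel, neg_div_neg_eq]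
  · exact integrableOn_Ioi_rpow_of_lt (by linarith) hR
  · filter_upwards [ae_restrict_mem measurableSet_Ioi] with t ht
    exact Real.rpow_nonneg (hR.trans ht).le _

/-- The layer-cake formula for powers. -/
theorem lintegral_indicator_rpow {s : ℝ} (hs : 0 < s) (a : ℝ≥0∞) :
    ∫⁻ t in Set.Ioi (0 : ℝ), {t : ℝ | ENNReal.ofReal t < a}.indicator
      (fun t => ENNReal.ofReal (t ^ (s - 1))) t = ENNReal.ofReal s⁻¹ * a ^ s := by
  have hm : MeasurableSet {t : ℝ | ENNReal.ofReal t < a} :=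
    measurableSet_lt ENNReal.measurable_ofReal measurable_const
  rw [setLIntegral_indicator hm]
  rcases eq_or_ne a ∞ with rfl | ha
  · have : {t : ℝ | ENNReal.ofReal t < ∞} ∩ Set.Ioi 0 = Set.Ioi 0 := by
      ext t; simp
    rw [this, ENNReal.top_rpow_of_pos hs, ENNReal.mul_top (by simpa using hs)]
    refine ENNReal.eq_top_of_forall_nnreal_le fun r => ?_
    have hr : (0 : ℝ) ≤ (r * s) ^ s⁻¹ := by positivity
    calc (r : ℝ≥0∞) = ENNReal.ofReal (((r * s) ^ s⁻¹) ^ s / s) := by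
          rw [← Real.rpow_mul (by positivity), inv_mul_cancel₀ hs.ne', Real.rpow_one,
            mul_div_cancel_right₀ _ hs.ne', ENNReal.ofReal_coe_nnreal]
      _ = _ := (lintegral_Ioo_rpow hs hr).symm
      _ ≤ _ := lintegral_mono_set fun t ht => ht.1
  · have : {t : ℝ | ENNReal.ofReal t < a} ∩ Set.Ioi 0 = Set.Ioo 0 a.toReal := by
      ext t
      simp only [Set.mem_inter_iff, Set.mem_ofPred_eq, Set.mem_Ioi, Set.mem_Ioo]
      exact ⟨fun h => ⟨h.2, (ENNReal.ofReal_lt_iff_lt_toReal h.2.le ha).1 h.1⟩,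
        fun h => ⟨(ENNReal.ofReal_lt_iff_lt_toReal h.1.le ha).2 h.2, h.1⟩⟩
    rw [this, lintegral_Ioo_rpow hs ENNReal.toReal_nonneg, div_eq_inv_mul,
      ENNReal.ofReal_mul (inv_nonneg.2 hs.le),
      ← ENNReal.ofReal_rpow_of_nonneg ENNReal.toReal_nonneg hs.le, ENNReal.ofReal_toReal ha]

end PowerIntegrals

/-! ### The Hardy–Littlewood maximal theorem -/

section MaximalFunction

variable {n : ℕ}

/-- The Hardy–Littlewood maximal function over balls of dyadic radii. -/
noncomputable def dyadicMax (f : Rn n → ℝ≥0∞) (x : Rn n) : ℝ≥0∞ :=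
  ⨆ k : ℤ, (∫⁻ y in ball x ((2 : ℝ) ^ k), f y) / ENNReal.ofReal (((2 : ℝ) ^ k) ^ n)

theorem measurable_lintegral_ball {f : Rn n → ℝ≥0∞} (hf : Measurable f) :
    Measurable fun z : Rn n × ℝ => ∫⁻ y in ball z.1 z.2, f y := by
  have : (fun z : Rn n × ℝ => ∫⁻ y in ball z.1 z.2, f y) = fun z => ∫⁻ y,
      {w : (Rn n × ℝ) × Rn n | dist w.2 w.1.1 < w.1.2}.indicator (fun w => f w.2) (z, y) := by
    ext z
    rw [← lintegral_indicator measurableSet_ball]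
    rfl
  rw [this]
  refine Measurable.lintegral_prod_right' (Measurable.indicator (hf.comp measurable_snd) ?_)
  exact measurableSet_lt (by fun_prop) (by fun_prop)

theorem measurable_dyadicMax {f : Rn n → ℝ≥0∞} (hf : Measurable f) : Measurable (dyadicMax f) :=
  .iSup fun _ => ((measurable_lintegral_ball hf).comp
    (measurable_id.prodMk measurable_const)).div_const _

theorem volume_ball_eq (x : Rn n) {r : ℝ} (hr : 0 < r) :
    volume (ball x r) = ENNReal.ofReal (r ^ n) * volume (ball (0 : Rn n) 1) := by
  simpa using Measure.addHaar_ball_of_pos volume x hr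

/-- Vitali covering: the balls on which the average of f exceeds t have a disjoint subfamily whose
fourfold enlargements cover the level set, and disjointness sums their integrals to at most ∫f. -/
theorem exists_weak_type_dyadicMax (hn : 0 < n) :
    ∃ C : ℝ≥0, ∀ f : Rn n → ℝ≥0∞, ∀ t : ℝ≥0∞, t ≠ 0 →
      volume {x | t < dyadicMax f x} ≤ C * (∫⁻ x, f x) / t := by
  set V := volume (ball (0 : Rn n) 1) with hV
  have hVf : V ≠ ∞ := measure_ball_lt_top.ne
  refine ⟨4 ^ n * V.toNNReal, fun f t ht => ?_⟩
  rw [ENNReal.coe_mul, ENNReal.coe_toNNReal hVf]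
  rcases eq_or_ne (∫⁻ x, f x) ∞ with hf | hf
  · rcases eq_or_ne t ∞ with rfl | ht'
    · simp
    have hV0 : V ≠ 0 := (measure_ball_pos _ _ one_pos).ne'
    rw [hf, ENNReal.mul_top (mul_ne_zero (by simp) hV0), ENNReal.top_div_of_ne_top ht']
    exact le_top
  rcases eq_or_ne t ∞ with rfl | ht'
  · simp
  have hk : ∀ x : {x | t < dyadicMax f x}, ∃ k : ℤ,
      t * ENNReal.ofReal (((2 : ℝ) ^ k) ^ n) < ∫⁻ y in ball (x : Rn n) ((2 : ℝ) ^ k), f y := by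
    rintro ⟨x, hx⟩
    obtain ⟨k, hk⟩ := lt_iSup_iff.1 (show t < iSup _ from hx)
    exact ⟨k, (ENNReal.lt_div_iff_mul_lt
      (Or.inl (ENNReal.ofReal_pos.2 (by positivity)).ne') (Or.inl ENNReal.ofReal_ne_top)).1 hk⟩
  choose k hk using hk
  -- Vitali's lemma needs bounded radii. A selected radius r satisfies t·rⁿ < ∫f, and r ≤ rⁿ when r
  -- ≥ 1.
  have hR : ∀ x, (2 : ℝ) ^ k x ≤ max 1 ((∫⁻ x, f x) / t).toReal := by
    intro x
    rcases le_total ((2 : ℝ) ^ k x) 1 with h1 | h1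
    · exact h1.trans (le_max_left _ _)
    · refine le_trans ?_ (le_max_right _ _)
      refine (le_self_pow₀ h1 hn.ne').trans ?_
      rw [← ENNReal.ofReal_le_iff_le_toReal (ENNReal.div_ne_top hf ht),
        ENNReal.le_div_iff_mul_le (Or.inl ht) (Or.inl ht'), mul_comm]
      exact (hk x).le.trans (setLIntegral_le_lintegral _ _)
  obtain ⟨u, -, hdisj, hcov⟩ := Vitali.exists_disjoint_subfamily_covering_enlargement_ball
    (Set.univ : Set {x | t < dyadicMax f x}) (fun x => (x : Rn n)) (fun x => (2 : ℝ) ^ k x)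
    _ (fun x _ => hR x) 4 (by norm_num)
  have hpos : ∀ x, (0 : ℝ) < (2 : ℝ) ^ k x := fun x => by positivity
  have hu : u.Countable := hdisj.countable_of_isOpen (fun _ _ => isOpen_ball)
    (fun x _ => nonempty_ball.2 (hpos x))
  have hsub : {x | t < dyadicMax f x} ⊆ ⋃ x ∈ u, ball (x : Rn n) (4 * (2 : ℝ) ^ k x) := by
    intro x hx
    obtain ⟨y, hy, hxy⟩ := hcov ⟨x, hx⟩ (Set.mem_univ _)
    exact Set.mem_biUnion hy (hxy (mem_ball_self (hpos _)))
  rw [ENNReal.le_div_iff_mul_le (Or.inl ht) (Or.inl ht')]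
  calc volume {x | t < dyadicMax f x} * t
      ≤ (∑' x : u, volume (ball (x : Rn n) (4 * (2 : ℝ) ^ k x))) * t := by
        gcongr
        exact (measure_mono hsub).trans (measure_biUnion_le _ hu _)
    _ = ∑' x : u, 4 ^ n * V * (t * ENNReal.ofReal (((2 : ℝ) ^ k x.1) ^ n)) := by
        rw [← ENNReal.tsum_mul_right]
        refine tsum_congr fun x => ?_
        rw [volume_ball_eq _ (by positivity), mul_pow, ENNReal.ofReal_mul (by positivity),
          ENNReal.ofReal_pow (by norm_num)]
        simp only [ENNReal.ofReal_ofNat]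
        ring
    _ ≤ ∑' x : u, 4 ^ n * V * ∫⁻ y in ball (x.1 : Rn n) ((2 : ℝ) ^ k x.1), f y := by
        refine ENNReal.tsum_le_tsum fun x => ?_
        gcongr
        exact (hk x).le
    _ = 4 ^ n * V * ∫⁻ y in ⋃ x ∈ u, ball (x : Rn n) ((2 : ℝ) ^ k x), f y := by
        rw [ENNReal.tsum_mul_left, lintegral_biUnion hu (fun _ _ => measurableSet_ball) hdisj]
    _ ≤ _ := by
        push_cast
        gcongr
        exact Measure.restrict_le_self

theorem dyadicMax_le_add {f g : Rn n → ℝ≥0∞} {c : ℝ≥0∞} (h : ∀ x, f x ≤ g x + c)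
    (x : Rn n) :
    dyadicMax f x ≤ dyadicMax g x + volume (ball (0 : Rn n) 1) * c := by
  refine iSup_le fun k => ?_
  have h1 : (0 : ℝ) < (2 : ℝ) ^ k := by positivity
  have h0 : ENNReal.ofReal (((2 : ℝ) ^ k) ^ n) ≠ 0 := (ENNReal.ofReal_pos.2 (by positivity)).ne'
  calc (∫⁻ y in ball x ((2 : ℝ) ^ k), f y) / ENNReal.ofReal (((2 : ℝ) ^ k) ^ n)
      ≤ (∫⁻ y in ball x ((2 : ℝ) ^ k), (g y + c)) / ENNReal.ofReal (((2 : ℝ) ^ k) ^ n) := by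
        gcongr with y
        exact h y
    _ = (∫⁻ y in ball x ((2 : ℝ) ^ k), g y) / ENNReal.ofReal (((2 : ℝ) ^ k) ^ n)
        + volume (ball (0 : Rn n) 1) * c := by
        rw [lintegral_add_right _ measurable_const, setLIntegral_const, volume_ball_eq _ h1,
          ENNReal.add_div]
        congr 1
        rw [mul_comm c, mul_assoc, mul_comm, mul_div_assoc, ENNReal.div_self h0
          ENNReal.ofReal_ne_top, mul_one]
    _ ≤ _ := by
        gcongr
        exact le_iSup (fun k : ℤ =>
          (∫⁻ y in ball x ((2 : ℝ) ^ k), g y) / ENNReal.ofReal (((2 : ℝ) ^ k) ^ n)) k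

/-- Marcinkiewicz interpolation between weak type (1,1) and L^∞: at height t only the part of f
above t/(2V) matters. The volume V of the unit ball appears because the averages are normalised by
rⁿ rather than by the volume of the ball. -/
theorem exists_strong_type_dyadicMax (hn : 0 < n) {p : ℝ} (hp : 1 < p) :
    ∃ C : ℝ≥0, ∀ f : Rn n → ℝ≥0∞, Measurable f →
      ∫⁻ x, dyadicMax f x ^ p ≤ C * ∫⁻ x, f x ^ p := by
  obtain ⟨C, hC⟩ := exists_weak_type_dyadicMax hn
  set V := volume (ball (0 : Rn n) 1) with hV
  have hVf : V ≠ ∞ := measure_ball_lt_top.ne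
  have hV0 : V ≠ 0 := (measure_ball_pos _ _ one_pos).ne'
  have hp0 : 0 < p := zero_lt_one.trans hp
  have hp1 : 0 < p - 1 := by linarith
  have h2V0 : 2 * V ≠ 0 := mul_ne_zero two_ne_zero hV0
  have h2Vf : 2 * V ≠ ∞ := ENNReal.mul_ne_top (by simp) hVf
  set K : ℝ≥0∞ := ENNReal.ofReal p * (2 * C) * (ENNReal.ofReal (p - 1)⁻¹ * (2 * V) ^ (p - 1))
    with hK
  have hKf : K ≠ ∞ := by
    refine ENNReal.mul_ne_top (ENNReal.mul_ne_top ENNReal.ofReal_ne_top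
      (ENNReal.mul_ne_top (by simp) ENNReal.coe_ne_top)) (ENNReal.mul_ne_top ENNReal.ofReal_ne_top
      (ENNReal.rpow_ne_top_of_nonneg hp1.le h2Vf))
  refine ⟨K.toNNReal, fun f hf => ?_⟩
  rw [ENNReal.coe_toNNReal hKf]
  -- The discarded part of f is at most t/(2V), so its maximal function is at most t/2, and the
  -- truncated part must exceed t/2.
  have hlevel : ∀ t : ℝ, 0 < t → volume {x | ENNReal.ofReal t < dyadicMax f x} ≤
      2 * C * (∫⁻ x, {x | ENNReal.ofReal t < 2 * V * f x}.indicator f x) / ENNReal.ofReal t := by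
    intro t ht
    set g := {x | ENNReal.ofReal t < 2 * V * f x}.indicator f with hg
    have ht0 : ENNReal.ofReal t ≠ 0 := (ENNReal.ofReal_pos.2 ht).ne'
    have hfg : ∀ x, f x ≤ g x + ENNReal.ofReal t / (2 * V) := by
      intro x
      by_cases hx : ENNReal.ofReal t < 2 * V * f x
      · simp [hg, hx]
      · refine le_add_left ?_
        rw [ENNReal.le_div_iff_mul_le (Or.inl h2V0) (Or.inl h2Vf), mul_comm]
        exact not_lt.1 hx
    have hhalf : V * (ENNReal.ofReal t / (2 * V)) = ENNReal.ofReal t / 2 := by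
      rw [mul_comm 2 V, ENNReal.div_eq_inv_mul, ENNReal.mul_inv (Or.inl hV0) (Or.inl hVf),
        mul_assoc, ← mul_assoc V, ENNReal.mul_inv_cancel hV0 hVf, one_mul, ENNReal.div_eq_inv_mul]
    have hsub : {x | ENNReal.ofReal t < dyadicMax f x} ⊆
        {x | ENNReal.ofReal t / 2 < dyadicMax g x} := by
      intro x hx
      by_contra hcon
      have h1 := dyadicMax_le_add hfg x
      rw [← hV, hhalf] at h1
      have h2 : dyadicMax g x ≤ ENNReal.ofReal t / 2 := not_lt.1 hcon
      have h3 := h1.trans (add_le_add_left h2 _)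
      rw [ENNReal.add_halves] at h3
      exact absurd (lt_of_lt_of_le hx h3) (lt_irrefl _)
    refine (measure_mono hsub).trans ((hC g _ (ENNReal.half_pos ht0).ne').trans (le_of_eq ?_))
    rw [ENNReal.div_eq_inv_mul, ENNReal.div_eq_inv_mul, ENNReal.div_eq_inv_mul,
      ENNReal.mul_inv (by simp) (by simp), inv_inv]
    ring
  have hprod : ∀ h : Rn n → ℝ≥0∞, Measurable h → ∀ s : ℝ,
      Measurable fun z : Rn n × ℝ => {t : ℝ | ENNReal.ofReal t < h z.1}.indicator
      (fun t => ENNReal.ofReal (t ^ s)) z.2 := by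
    intro h hh s
    have : (fun z : Rn n × ℝ => {t : ℝ | ENNReal.ofReal t < h z.1}.indicator
      (fun t => ENNReal.ofReal (t ^ s)) z.2) = {z : Rn n × ℝ | ENNReal.ofReal z.2 < h z.1}.indicator
        (fun z => ENNReal.ofReal (z.2 ^ s)) := rfl
    rw [this]
    exact Measurable.indicator (by fun_prop) (measurableSet_lt (by fun_prop) (by fun_prop))
  have hM := measurable_dyadicMax hf
  calc ∫⁻ x, dyadicMax f x ^ p
      = ENNReal.ofReal p * ∫⁻ x, ∫⁻ t in Set.Ioi (0 : ℝ),
          {t : ℝ | ENNReal.ofReal t < dyadicMax f x}.indicator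
            (fun t => ENNReal.ofReal (t ^ (p - 1))) t := by
        simp_rw [lintegral_indicator_rpow hp0]
        rw [lintegral_const_mul _ (hM.pow_const _), ← mul_assoc, ← ENNReal.ofReal_mul hp0.le,
          mul_inv_cancel₀ hp0.ne', ENNReal.ofReal_one, one_mul]
    _ = ENNReal.ofReal p * ∫⁻ t in Set.Ioi (0 : ℝ), ENNReal.ofReal (t ^ (p - 1)) *
          volume {x | ENNReal.ofReal t < dyadicMax f x} := by
        rw [lintegral_lintegral_swap (hprod _ hM _).aemeasurable]
        congr 1
        refine lintegral_congr fun t => ?_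
        rw [← lintegral_indicator_const (measurableSet_lt measurable_const hM)]
        rfl
    _ ≤ ENNReal.ofReal p * ∫⁻ t in Set.Ioi (0 : ℝ), 2 * C *
          ∫⁻ x, {t : ℝ | ENNReal.ofReal t < 2 * V * f x}.indicator
            (fun t => ENNReal.ofReal (t ^ (p - 1 - 1))) t * f x := by
        gcongr ENNReal.ofReal p * ?_
        refine setLIntegral_mono' measurableSet_Ioi fun t ht => ?_
        have ht : 0 < t := ht
        have ht0 : ENNReal.ofReal t ≠ 0 := (ENNReal.ofReal_pos.2 ht).ne'
        calc ENNReal.ofReal (t ^ (p - 1)) * volume {x | ENNReal.ofReal t < dyadicMax f x}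
            ≤ ENNReal.ofReal (t ^ (p - 1)) * (2 * C * (∫⁻ x,
              {x | ENNReal.ofReal t < 2 * V * f x}.indicator f x) / ENNReal.ofReal t) := by
              gcongr; exact hlevel t ht
          _ = 2 * C * (ENNReal.ofReal (t ^ (p - 1 - 1)) * ∫⁻ x,
              {x | ENNReal.ofReal t < 2 * V * f x}.indicator f x) := by
              rw [Real.rpow_sub_one ht.ne' (p - 1), ENNReal.ofReal_div_of_pos ht,
                ENNReal.div_eq_inv_mul, ENNReal.div_eq_inv_mul]
              ring
          _ = _ := by
              rw [← lintegral_const_mul' _ _ ENNReal.ofReal_ne_top]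
              congr 1
              refine lintegral_congr fun x => ?_
              by_cases hx : ENNReal.ofReal t < 2 * V * f x <;> simp [hx, Set.indicator]
    _ = ENNReal.ofReal p * (2 * C) * ∫⁻ x, f x * ∫⁻ t in Set.Ioi (0 : ℝ),
          {t : ℝ | ENNReal.ofReal t < 2 * V * f x}.indicator
            (fun t => ENNReal.ofReal (t ^ (p - 1 - 1))) t := by
        rw [lintegral_const_mul' _ _ (ENNReal.mul_ne_top (by simp) ENNReal.coe_ne_top), ← mul_assoc,
          lintegral_lintegral_swap]
        · congr 1
          refine lintegral_congr fun x => ?_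
          rw [lintegral_mul_const'']
          · rw [mul_comm]
          · exact ((hprod _ (hf.const_mul (2 * V)) _).comp measurable_prodMk_left).aemeasurable
        · exact (((hprod _ (hf.const_mul (2 * V)) _).comp measurable_swap).mul
            (hf.comp measurable_snd)).aemeasurable
    _ = K * ∫⁻ x, f x ^ p := by
        simp_rw [lintegral_indicator_rpow hp1, ENNReal.mul_rpow_of_nonneg _ _ hp1.le]
        rw [hK, mul_assoc (ENNReal.ofReal p * (2 * C)), ← lintegral_const_mul _ (hf.pow_const _)]
        congr 1
        refine lintegral_congr fun x => ?_
        have : f x ^ p = f x * f x ^ (p - 1) := by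
          nth_rw 2 [← ENNReal.rpow_one (f x)]
          rw [← ENNReal.rpow_add_of_nonneg _ _ zero_le_one hp1.le]; congr 1; ring
        rw [this, ENNReal.mul_rpow_of_nonneg _ _ hp1.le]
        ring

end MaximalFunction

end BiCommutator

namespace BiCommutator

open Filter Topology Metric

/-! ### Fractional integrals: Hedberg and Hardy–Littlewood–Sobolev -/

section FractionalIntegral

variable {n : ℕ}

/-- The kernel `|x - y|^{β-n}` of the fractional integral of order `β` on `ℝⁿ`. -/
noncomputable def riesz (β : ℝ) (x y : Rn n) : ℝ≥0∞ := ENNReal.ofReal (‖x - y‖ ^ (β - n))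

theorem measurable_riesz (β : ℝ) : Measurable fun z : Rn n × Rn n => riesz β z.1 z.2 := by
  unfold riesz
  fun_prop

theorem riesz_comm (β : ℝ) (x y : Rn n) : riesz β x y = riesz β y x := by
  rw [riesz, riesz, norm_sub_rev]

/-- The integral of (n−β)t^(β−n−1) over t > |x−y| equals |x−y|^(β−n). At x = y the right side is
infinite while the convention for 0 to a negative power makes the left side 0, hence an inequality
only. -/
theorem riesz_le_layers {β : ℝ} (hβ : β < n) (x y : Rn n) :
    riesz β x y ≤ ENNReal.ofReal (n - β) * ∫⁻ t in Set.Ioi (0 : ℝ),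
      {t : ℝ | dist y x < t}.indicator (fun t => ENNReal.ofReal (t ^ (β - n - 1))) t := by
  have hs : 0 < (n : ℝ) - β := by linarith
  rw [riesz, dist_comm, dist_eq_norm]
  rcases (norm_nonneg (x - y)).eq_or_lt with h | h
  · rw [← h, Real.zero_rpow (by linarith), ENNReal.ofReal_zero]
    exact zero_le
  · rw [setLIntegral_indicator (show MeasurableSet {t : ℝ | ‖x - y‖ < t} from measurableSet_Ioi)]
    have : {t : ℝ | ‖x - y‖ < t} ∩ Set.Ioi 0 = Set.Ioi ‖x - y‖ := by
      ext t
      exact ⟨fun ht => ht.1, fun ht => ⟨ht, h.trans ht⟩⟩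
    have e := lintegral_Ioi_rpow hs h
    rw [neg_sub] at e
    rw [this, e, ← ENNReal.ofReal_mul hs.le, mul_div_cancel₀ _ hs.ne']

theorem riesz_mul_le_layers {β : ℝ} (hβ : β < n) (x y : Rn n) (c : ℝ≥0∞) :
    riesz β x y * c ≤ ENNReal.ofReal (n - β) * ∫⁻ t in Set.Ioi (0 : ℝ),
      {t : ℝ | dist y x < t}.indicator (fun t => ENNReal.ofReal (t ^ (β - n - 1))) t * c := by
  have hm : Measurable fun t : ℝ => {t : ℝ | dist y x < t}.indicator
      (fun t => ENNReal.ofReal (t ^ (β - n - 1))) t :=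
    Measurable.indicator (by fun_prop) measurableSet_Ioi
  rw [lintegral_mul_const _ hm, ← mul_assoc]
  exact mul_le_mul' (riesz_le_layers hβ x y) le_rfl

/-- After the layer decomposition the integral runs over the masses of f in the balls B(x,t). Below
R the growth tⁿ is integrable against t^(β−n−1) because β > 0; above R the growth t^(n−σ) is,
because σ > β. -/
theorem lintegral_riesz_mul_le {β σ : ℝ} (hβ0 : 0 < β) (hβ : β < n) (hσ : β < σ)
    {f : Rn n → ℝ≥0∞} (hf : Measurable f) (x : Rn n) {R : ℝ} (hR : 0 < R) {a G : ℝ≥0∞}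
    (hsmall : ∀ t, 0 < t → t ≤ R → ∫⁻ y in ball x t, f y ≤ a * ENNReal.ofReal (t ^ (n : ℝ)))
    (hlarge : ∀ t, R < t → ∫⁻ y in ball x t, f y ≤ G * ENNReal.ofReal (t ^ (n - σ))) :
    ∫⁻ y, riesz β x y * f y ≤ ENNReal.ofReal (n - β) *
      (a * ENNReal.ofReal (R ^ β / β) + G * ENNReal.ofReal (R ^ (-(σ - β)) / (σ - β))) := by
  have hm : Measurable fun z : Rn n × ℝ => {t : ℝ | dist z.1 x < t}.indicator
      (fun t => ENNReal.ofReal (t ^ (β - n - 1))) z.2 := by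
    have : (fun z : Rn n × ℝ => {t : ℝ | dist z.1 x < t}.indicator
      (fun t => ENNReal.ofReal (t ^ (β - n - 1))) z.2) = {z : Rn n × ℝ | dist z.1 x < z.2}.indicator
        (fun z => ENNReal.ofReal (z.2 ^ (β - n - 1))) := rfl
    rw [this]
    exact Measurable.indicator (by fun_prop) (measurableSet_lt (by fun_prop) (by fun_prop))
  have hmf : Measurable fun z : Rn n × ℝ => {t : ℝ | dist z.1 x < t}.indicator
      (fun t => ENNReal.ofReal (t ^ (β - n - 1))) z.2 * f z.1 := hm.mul (hf.comp measurable_fst)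
  calc ∫⁻ y, riesz β x y * f y
      ≤ ∫⁻ y, ENNReal.ofReal (n - β) * ∫⁻ t in Set.Ioi (0 : ℝ),
        {t : ℝ | dist y x < t}.indicator (fun t => ENNReal.ofReal (t ^ (β - n - 1))) t * f y := by
        exact lintegral_mono fun y => riesz_mul_le_layers hβ x y (f y)
    _ = ENNReal.ofReal (n - β) * ∫⁻ t in Set.Ioi (0 : ℝ), ENNReal.ofReal (t ^ (β - n - 1)) *
          ∫⁻ y in ball x t, f y := by
        have hswap := lintegral_lintegral_swap (μ := volume) (ν := volume.restrict (Set.Ioi (0 : ℝ)))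
          (f := fun (y : Rn n) (t : ℝ) => {t : ℝ | dist y x < t}.indicator
            (fun t => ENNReal.ofReal (t ^ (β - n - 1))) t * f y) hmf.aemeasurable
        rw [lintegral_const_mul' _ _ ENNReal.ofReal_ne_top, hswap]
        congr 1
        refine lintegral_congr fun t => ?_
        rw [← lintegral_const_mul' _ _ ENNReal.ofReal_ne_top, ← lintegral_indicator measurableSet_ball]
        refine lintegral_congr fun y => ?_
        by_cases hy : dist y x < t <;> simp [hy, Set.indicator]
    _ ≤ _ := by
        gcongr ENNReal.ofReal (n - β) * ?_
        rw [← Set.Ioc_union_Ioi_eq_Ioi hR.le, lintegral_union measurableSet_Ioi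
          (Set.Ioc_disjoint_Ioi le_rfl)]
        refine add_le_add ?_ ?_
        · rw [setLIntegral_congr Ioo_ae_eq_Ioc.symm, ← lintegral_Ioo_rpow hβ0 hR.le,
            ← lintegral_const_mul _ (by fun_prop)]
          refine setLIntegral_mono' measurableSet_Ioo fun t ht => ?_
          calc ENNReal.ofReal (t ^ (β - n - 1)) * ∫⁻ y in ball x t, f y
              ≤ ENNReal.ofReal (t ^ (β - n - 1)) * (a * ENNReal.ofReal (t ^ (n : ℝ))) := by
                gcongr; exact hsmall t ht.1 ht.2.le
            _ = a * (ENNReal.ofReal (t ^ (β - n - 1)) * ENNReal.ofReal (t ^ (n : ℝ))) := by ring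
            _ = _ := by
                rw [← ENNReal.ofReal_mul (Real.rpow_nonneg ht.1.le _), ← Real.rpow_add ht.1]
                congr 3; ring
        · rw [← lintegral_Ioi_rpow (by linarith : 0 < σ - β) hR,
            ← lintegral_const_mul _ (by fun_prop)]
          refine setLIntegral_mono' measurableSet_Ioi fun t ht => ?_
          have ht0 : 0 < t := hR.trans ht
          calc ENNReal.ofReal (t ^ (β - n - 1)) * ∫⁻ y in ball x t, f y
              ≤ ENNReal.ofReal (t ^ (β - n - 1)) * (G * ENNReal.ofReal (t ^ (n - σ))) := by
                gcongr; exact hlarge t ht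
            _ = G * (ENNReal.ofReal (t ^ (β - n - 1)) * ENNReal.ofReal (t ^ (n - σ))) := by ring
            _ = _ := by
                rw [← ENNReal.ofReal_mul (Real.rpow_nonneg ht0.le _), ← Real.rpow_add ht0]
                congr 3; ring

/-- The preceding estimate for the indicator of the ball itself, with σ = n since its mass stops
growing beyond radius R. -/
theorem exists_lintegral_ball_riesz_le {β : ℝ} (hβ0 : 0 < β) (hβ : β < n) :
    ∃ C : ℝ, 0 ≤ C ∧ ∀ (x : Rn n) (R : ℝ), 0 < R →
      ∫⁻ y in ball x R, riesz β x y ≤ ENNReal.ofReal (C * R ^ β) := by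
  set V := volume (ball (0 : Rn n) 1) with hV
  have hVf : V ≠ ∞ := measure_ball_lt_top.ne
  have hnβ : 0 < (n : ℝ) - β := by linarith
  refine ⟨(n - β) * (V.toReal * (1 / β) + V.toReal * (1 / (n - β))), by positivity,
    fun x R hR => ?_⟩
  have hball : ∀ t, 0 < t → ∫⁻ y in ball x t, (ball x R).indicator (fun _ => (1 : ℝ≥0∞)) y =
      volume (ball x R ∩ ball x t) := fun t _ => by
    rw [lintegral_indicator_const measurableSet_ball, one_mul,
      Measure.restrict_apply measurableSet_ball]
  have h := lintegral_riesz_mul_le hβ0 hβ hβ (σ := n)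
    (f := (ball x R).indicator fun _ => (1 : ℝ≥0∞))
    (measurable_const.indicator measurableSet_ball) x hR (a := V)
    (G := V * ENNReal.ofReal (R ^ (n : ℝ)))
    (fun t ht _ => by
      rw [hball t ht, Real.rpow_natCast, mul_comm, ← volume_ball_eq x ht]
      exact measure_mono Set.inter_subset_right)
    (fun t ht => by
      rw [hball t (hR.trans ht), sub_self, Real.rpow_zero, ENNReal.ofReal_one, mul_one,
        Real.rpow_natCast, mul_comm, ← volume_ball_eq x hR]
      exact measure_mono Set.inter_subset_left)
  calc ∫⁻ y in ball x R, riesz β x y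
      = ∫⁻ y, riesz β x y * (ball x R).indicator (fun _ => (1 : ℝ≥0∞)) y := by
        rw [← lintegral_indicator measurableSet_ball]
        refine lintegral_congr fun y => ?_
        by_cases hy : y ∈ ball x R <;> simp [hy]
    _ ≤ _ := h
    _ = _ := by
        rw [← ENNReal.ofReal_toReal hVf, ← ENNReal.ofReal_mul (by positivity),
          ← ENNReal.ofReal_mul (by positivity), ← ENNReal.ofReal_mul (by positivity),
          ← ENNReal.ofReal_add (by positivity) (by positivity),
          ← ENNReal.ofReal_mul hnβ.le, ENNReal.ofReal_toReal hVf]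
        congr 1
        have e : R ^ (n : ℝ) * R ^ (-((n : ℝ) - β)) = R ^ β := by
          rw [← Real.rpow_add hR]; congr 1; ring
        rw [← e]
        field_simp

theorem lintegral_ball_le_dyadicMax {f : Rn n → ℝ≥0∞} (x : Rn n) {t : ℝ} (ht : 0 < t) :
    ∫⁻ y in ball x t, f y ≤ 2 ^ n * dyadicMax f x * ENNReal.ofReal (t ^ (n : ℝ)) := by
  obtain ⟨k, hk1, hk2⟩ := exists_mem_Ioc_zpow ht (one_lt_two (α := ℝ))
  have hp : (0 : ℝ) < 2 ^ (k + 1) := by positivity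
  have h0 : ENNReal.ofReal (((2 : ℝ) ^ (k + 1)) ^ n) ≠ 0 :=
    (ENNReal.ofReal_pos.2 (by positivity)).ne'
  calc ∫⁻ y in ball x t, f y ≤ ∫⁻ y in ball x ((2 : ℝ) ^ (k + 1)), f y :=
        lintegral_mono_set (ball_subset_ball hk2)
    _ ≤ dyadicMax f x * ENNReal.ofReal (((2 : ℝ) ^ (k + 1)) ^ n) := by
        rw [← ENNReal.div_le_iff_le_mul (Or.inl h0) (Or.inl ENNReal.ofReal_ne_top)]
        exact le_iSup (fun k : ℤ =>
          (∫⁻ y in ball x ((2 : ℝ) ^ k), f y) / ENNReal.ofReal (((2 : ℝ) ^ k) ^ n)) (k + 1)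
    _ ≤ dyadicMax f x * ENNReal.ofReal ((2 * t) ^ n) := by
        have : (2 : ℝ) ^ (k + 1) ≤ 2 * t := by
          rw [zpow_add_one₀ two_ne_zero]; linarith
        gcongr
    _ = _ := by
        rw [mul_pow, ENNReal.ofReal_mul (by positivity), ENNReal.ofReal_pow (by norm_num),
          Real.rpow_natCast, ENNReal.ofReal_ofNat]
        ring

theorem lintegral_ball_le_rpow {f : Rn n → ℝ≥0∞} (hf : Measurable f) {p : ℝ} (hp : 1 < p)
    (x : Rn n) {t : ℝ} (ht : 0 < t) :
    ∫⁻ y in ball x t, f y ≤ (∫⁻ y, f y ^ p) ^ (1 / p) * volume (ball (0 : Rn n) 1) ^ (1 - 1 / p)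
      * ENNReal.ofReal (t ^ ((n : ℝ) - n / p)) := by
  have hp0 : 0 < p := zero_lt_one.trans hp
  have hc := Real.HolderConjugate.conjExponent hp
  have h := ENNReal.lintegral_mul_le_Lp_mul_Lq (volume.restrict (ball x t)) hc
    hf.aemeasurable (measurable_const (a := (1 : ℝ≥0∞))).aemeasurable
  have e : 1 / p.conjExponent = 1 - 1 / p := by
    rw [one_div, one_div]
    linarith [hc.inv_add_inv_eq_one]
  have h1p : 0 ≤ 1 - 1 / p := by
    rw [sub_nonneg, div_le_one hp0]; exact hp.le
  simp only [Pi.mul_apply, mul_one, ENNReal.one_rpow, lintegral_const, one_mul,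
    Measure.restrict_apply MeasurableSet.univ, Set.univ_inter] at h
  rw [e, volume_ball_eq x ht, ENNReal.mul_rpow_of_nonneg _ _ h1p,
    ENNReal.ofReal_rpow_of_nonneg (by positivity) h1p, ← Real.rpow_natCast,
    ← Real.rpow_mul ht.le] at h
  refine h.trans ?_
  rw [mul_comm (ENNReal.ofReal _), ← mul_assoc]
  have e2 : (n : ℝ) * (1 - 1 / p) = n - n / p := by field_simp
  rw [e2]
  gcongr
  exact Measure.restrict_le_self

/-- Hedberg's inequality. -/
theorem exists_riesz_le_dyadicMax (hn : 0 < n) {β p q : ℝ} (hp : 1 < p) (hpq : p < q)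
    (hβ : β / n = 1 / p - 1 / q) :
    ∃ C : ℝ≥0, ∀ f : Rn n → ℝ≥0∞, Measurable f → ∀ x, ∫⁻ y, f y ^ p ≠ 0 → ∫⁻ y, f y ^ p ≠ ∞ →
      ∫⁻ y, riesz β x y * f y ≤
        C * ((∫⁻ y, f y ^ p) ^ (1 / p - 1 / q) * dyadicMax f x ^ (p / q)) := by
  have hp0 : 0 < p := zero_lt_one.trans hp
  have hq0 : 0 < q := hp0.trans hpq
  have hn0 : (0 : ℝ) < n := by exact_mod_cast hn
  have hpq' : 0 < 1 / p - 1 / q := sub_pos.2 (one_div_lt_one_div_of_lt hp0 hpq)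
  have hβe : β = n * (1 / p - 1 / q) := by rw [← hβ]; field_simp
  have hβ0 : 0 < β := by rw [hβe]; positivity
  have hβn : β < n := by
    rw [hβe]
    have h1 : 1 / p < 1 := by rw [div_lt_one hp0]; exact hp
    have h2 : 0 < 1 / q := by positivity
    nlinarith
  have hσe : (n : ℝ) / p - β = n / q := by rw [hβe]; ring
  have hσ : β < n / p := by
    have : 0 < (n : ℝ) / q := by positivity
    linarith
  set V := volume (ball (0 : Rn n) 1) with hV
  have hVf : V ≠ ∞ := measure_ball_lt_top.ne
  have h1p : 0 ≤ 1 - 1 / p := by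
    rw [sub_nonneg, div_le_one hp0]; exact hp.le
  have hV' : V ^ (1 - 1 / p) ≠ ∞ := ENNReal.rpow_ne_top_of_nonneg h1p hVf
  set v := (V ^ (1 - 1 / p)).toReal with hv
  have hnβ : 0 < (n : ℝ) - β := by linarith
  set C : ℝ := (n - β) * (2 ^ n / β + v / (n / p - β)) with hC
  have hσ' : 0 < (n : ℝ) / p - β := by linarith
  have hC0 : 0 < C := by positivity
  refine ⟨C.toNNReal, fun f hf x hΦ0 hΦf => ?_⟩
  rw [show ((C.toNNReal : ℝ≥0) : ℝ≥0∞) = ENNReal.ofReal C from rfl]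
  set Φ := ∫⁻ y, f y ^ p with hΦ
  -- A zero of the maximal function at one point forces f = 0 almost everywhere, since the balls
  -- around that point exhaust the space.
  have hM0 : dyadicMax f x ≠ 0 := by
    intro h0
    have h1 : ∀ k : ℕ, ∫⁻ y in ball x ((k : ℝ) + 1), f y = 0 := fun k => by
      have := lintegral_ball_le_dyadicMax (f := f) x (show (0 : ℝ) < (k : ℝ) + 1 by positivity)
      rw [h0, mul_zero, zero_mul] at this
      exact le_antisymm this zero_le
    have h2 : ∀ᵐ y, f y = 0 := by
      have h3 : ∀ᵐ y, ∀ k : ℕ, y ∈ ball x ((k : ℝ) + 1) → f y = 0 := by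
        refine ae_all_iff.2 fun k => ?_
        rw [← ae_restrict_iff' measurableSet_ball]
        exact (lintegral_eq_zero_iff hf).1 (h1 k)
      filter_upwards [h3] with y hy
      obtain ⟨k, hk⟩ := exists_nat_gt (dist y x)
      exact hy k (mem_ball.2 (by linarith))
    apply hΦ0
    rw [hΦ, lintegral_congr_ae (h2.mono fun y hy => show f y ^ p = 0 by
      rw [hy, ENNReal.zero_rpow_of_pos hp0]),
      lintegral_zero]
  rcases eq_or_ne (dyadicMax f x) ∞ with hMf | hMf
  · have hΦ' : Φ ^ (1 / p - 1 / q) ≠ 0 := by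
      rw [Ne, ENNReal.rpow_eq_zero_iff]
      push Not
      exact ⟨fun h => absurd h hΦ0, fun h => absurd h hΦf⟩
    rw [hMf, ENNReal.top_rpow_of_pos (by positivity), ENNReal.mul_top hΦ', ENNReal.mul_top
      (ENNReal.ofReal_pos.2 hC0).ne']
    exact le_top
  set m := (dyadicMax f x).toReal with hm
  set φ := Φ.toReal with hφ
  have hm0 : 0 < m := ENNReal.toReal_pos hM0 hMf
  have hφ0 : 0 < φ := ENNReal.toReal_pos hΦ0 hΦf
  -- The radius (‖f‖_p / Mf(x))^(p/n) balances the maximal bound on small balls against the Hölder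
  -- bound on large ones.
  set R : ℝ := (φ ^ (1 / p) / m) ^ (p / n) with hR
  have hR0 : 0 < R := by positivity
  have h := lintegral_riesz_mul_le hβ0 hβn hσ hf x hR0 (a := 2 ^ n * dyadicMax f x)
    (G := Φ ^ (1 / p) * V ^ (1 - 1 / p)) (fun t ht _ => lintegral_ball_le_dyadicMax x ht)
    (fun t ht => lintegral_ball_le_rpow hf hp x (hR0.trans ht))
  refine h.trans (le_of_eq ?_)
  have e1 : R ^ β = (φ ^ (1 / p) / m) ^ (1 - p / q) := by
    rw [hR, ← Real.rpow_mul (by positivity)]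
    congr 1
    rw [hβe]; field_simp
  have e2 : R ^ (-(n / p - β)) = (φ ^ (1 / p) / m) ^ (-(p / q)) := by
    rw [hR, ← Real.rpow_mul (by positivity)]
    congr 1
    rw [hσe]; field_simp
  have f1 : φ ^ (1 / p - 1 / q) = (φ ^ (1 / p)) ^ (1 - p / q) := by
    rw [← Real.rpow_mul hφ0.le]; congr 1; field_simp
  have hψ0 : 0 < φ ^ (1 / p) := by positivity
  have g1 : m * (φ ^ (1 / p) / m) ^ (1 - p / q) = (φ ^ (1 / p)) ^ (1 - p / q) * m ^ (p / q) := by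
    rw [Real.div_rpow hψ0.le hm0.le, Real.rpow_sub hm0, Real.rpow_one]
    field_simp
  have g2 : φ ^ (1 / p) * (φ ^ (1 / p) / m) ^ (-(p / q))
      = (φ ^ (1 / p)) ^ (1 - p / q) * m ^ (p / q) := by
    rw [Real.rpow_neg (by positivity), Real.div_rpow hψ0.le hm0.le, Real.rpow_sub hψ0,
      Real.rpow_one]
    field_simp
  rw [e1, e2, ← ENNReal.ofReal_toReal hMf, ← ENNReal.ofReal_toReal hΦf,
    ← ENNReal.ofReal_toReal hV', ← hm, ← hφ, ← hv, ENNReal.ofReal_rpow_of_pos hφ0,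
    ENNReal.ofReal_rpow_of_pos hφ0, ENNReal.ofReal_rpow_of_pos hm0,
    show (2 : ℝ≥0∞) ^ n = ENNReal.ofReal (2 ^ n) by
      rw [ENNReal.ofReal_pow (by norm_num), ENNReal.ofReal_ofNat],
    ← ENNReal.ofReal_mul (by positivity), ← ENNReal.ofReal_mul (by positivity),
    ← ENNReal.ofReal_mul (by positivity), ← ENNReal.ofReal_mul (by positivity),
    ← ENNReal.ofReal_add (by positivity) (by positivity), ← ENNReal.ofReal_mul hnβ.le,
    ← ENNReal.ofReal_mul (by positivity), ← ENNReal.ofReal_mul (by positivity)]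
  congr 1
  rw [f1, hC]
  linear_combination (n - β) * (2 ^ n / β) * g1 + (n - β) * (v / (n / p - β)) * g2

/-- The Hardy–Littlewood–Sobolev inequality. -/
theorem exists_hls (hn : 0 < n) {β : ℝ} {p q : ℝ≥0∞} (hp : 1 < p) (hpq : p < q) (hq : q < ∞)
    (hβ : β / n = 1 / p.toReal - 1 / q.toReal) :
    ∃ C : ℝ≥0, ∀ f : Rn n → ℝ≥0∞, Measurable f →
      eLpNorm (fun x => ∫⁻ y, riesz β x y * f y) q volume ≤ C * eLpNorm f p volume := by
  have hpf : p ≠ ∞ := (hpq.trans hq).ne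
  have hp0 : p ≠ 0 := (zero_lt_one.trans hp).ne'
  have hq0 : q ≠ 0 := (zero_lt_one.trans (hp.trans hpq)).ne'
  have hp1' : 1 < p.toReal := by
    simpa using (ENNReal.toReal_lt_toReal ENNReal.one_ne_top hpf).2 hp
  have hpq' : p.toReal < q.toReal := (ENNReal.toReal_lt_toReal hpf hq.ne).2 hpq
  obtain ⟨C₁, hC₁⟩ := exists_riesz_le_dyadicMax hn hp1' hpq' hβ
  obtain ⟨C₂, hC₂⟩ := exists_strong_type_dyadicMax hn hp1'
  set r := p.toReal with hr
  set s := q.toReal with hs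
  have hr0 : 0 < r := by linarith
  have hs0 : 0 < s := by linarith
  -- The summand 1 keeps the constant positive, so that the right side is infinite when the norm of
  -- f is.
  refine ⟨C₁ * C₂ ^ (1 / s) + 1, fun f hf => ?_⟩
  rw [eLpNorm_eq_lintegral_rpow_enorm_toReal hp0 hpf,
    eLpNorm_eq_lintegral_rpow_enorm_toReal hq0 hq.ne, ← hr, ← hs]
  simp_rw [enorm_eq_self]
  rcases eq_or_ne (∫⁻ y, f y ^ r) 0 with h0 | h0
  · have hf0 : ∀ᵐ y, f y = 0 := by
      have := (lintegral_eq_zero_iff (hf.pow_const r)).1 h0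
      filter_upwards [this] with y hy
      exact (ENNReal.rpow_eq_zero_iff_of_pos hr0).1 hy
    have : ∀ x, ∫⁻ y, riesz β x y * f y = 0 := fun x => by
      rw [lintegral_congr_ae (hf0.mono fun y hy => by rw [hy, mul_zero]), lintegral_zero]
    simp only [this, ENNReal.zero_rpow_of_pos hs0, lintegral_zero]
    rw [ENNReal.zero_rpow_of_pos (by positivity)]
    exact zero_le
  rcases eq_or_ne (∫⁻ y, f y ^ r) ∞ with h1 | h1
  · rw [h1, ENNReal.top_rpow_of_pos (by positivity), ENNReal.mul_top (by simp)]
    exact le_top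
  have e : ∫⁻ x, (∫⁻ y, riesz β x y * f y) ^ s ≤
      (C₁ * C₂ ^ (1 / s) * (∫⁻ y, f y ^ r) ^ (1 / r)) ^ s := by
    set Φ := ∫⁻ y, f y ^ r with hΦ
    calc ∫⁻ x, (∫⁻ y, riesz β x y * f y) ^ s
        ≤ ∫⁻ x, (C₁ * Φ ^ (1 / r - 1 / s)) ^ s * dyadicMax f x ^ r := by
          refine lintegral_mono fun x => ?_
          refine (ENNReal.rpow_le_rpow (hC₁ f hf x h0 h1) hs0.le).trans (le_of_eq ?_)
          rw [← mul_assoc, ENNReal.mul_rpow_of_nonneg _ _ hs0.le, ← ENNReal.rpow_mul,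
            div_mul_cancel₀ _ hs0.ne']
      _ = (C₁ * Φ ^ (1 / r - 1 / s)) ^ s * ∫⁻ x, dyadicMax f x ^ r :=
          lintegral_const_mul _ ((measurable_dyadicMax hf).pow_const r)
      _ ≤ (C₁ * Φ ^ (1 / r - 1 / s)) ^ s * (C₂ * Φ) := by gcongr; exact hC₂ f hf
      _ = (C₁ * Φ ^ (1 / r - 1 / s)) ^ s * (C₂ ^ (1 / s) * Φ ^ (1 / s)) ^ s := by
          rw [ENNReal.mul_rpow_of_nonneg (_ ^ (1 / s)) _ hs0.le, ← ENNReal.rpow_mul,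
            ← ENNReal.rpow_mul, one_div_mul_cancel hs0.ne', ENNReal.rpow_one, ENNReal.rpow_one]
      _ = _ := by
          rw [← ENNReal.mul_rpow_of_nonneg _ _ hs0.le]
          congr 1
          have : Φ ^ (1 / r) = Φ ^ (1 / r - 1 / s) * Φ ^ (1 / s) := by
            rw [← ENNReal.rpow_add _ _ h0 h1, sub_add_cancel]
          rw [this]
          ring
  calc (∫⁻ x, (∫⁻ y, riesz β x y * f y) ^ s) ^ (1 / s)
      ≤ ((C₁ * C₂ ^ (1 / s) * (∫⁻ y, f y ^ r) ^ (1 / r)) ^ s) ^ (1 / s) :=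
        ENNReal.rpow_le_rpow e (by positivity)
    _ = C₁ * C₂ ^ (1 / s) * (∫⁻ y, f y ^ r) ^ (1 / r) := by
        rw [← ENNReal.rpow_mul, mul_one_div_cancel hs0.ne', ENNReal.rpow_one]
    _ ≤ _ := by
        gcongr
        rw [ENNReal.coe_add, ENNReal.coe_mul, ENNReal.coe_rpow_of_nonneg _ (by positivity)]
        exact le_self_add

end FractionalIntegral

/-! ### Minkowski's inequality and the mixed-norm estimate -/

section Mixed

variable {α β : Type*} [MeasurableSpace α] [MeasurableSpace β]

/-- **Minkowski's integral inequality**. -/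
theorem eLpNorm_lintegral_le {μ : Measure α} {ν : Measure β} [SFinite μ] [SigmaFinite ν]
    {q : ℝ≥0∞} (hq1 : 1 < q) (hq : q < ∞) {F : α × β → ℝ≥0∞} (hF : Measurable F) :
    eLpNorm (fun y => ∫⁻ x, F (x, y) ∂μ) q ν ≤ ∫⁻ x, eLpNorm (fun y => F (x, y)) q ν ∂μ := by
  have hq0 : q ≠ 0 := (zero_lt_one.trans hq1).ne'
  have hs1 : 1 < q.toReal := by
    simpa using (ENNReal.toReal_lt_toReal ENNReal.one_ne_top hq.ne).2 hq1
  simp_rw [eLpNorm_eq_lintegral_rpow_enorm_toReal hq0 hq.ne, enorm_eq_self]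
  set s := q.toReal
  have hs0 : 0 < s := by linarith
  have hc := Real.HolderConjugate.conjExponent hs1
  set s' := s.conjExponent
  have hs'0 : 0 < s' := hc.symm.pos
  set I : ℝ≥0∞ := ∫⁻ x, (∫⁻ y, F (x, y) ^ s ∂ν) ^ (1 / s) ∂μ with hI
  set H : β → ℝ≥0∞ := fun y => ∫⁻ x, F (x, y) ∂μ with hH
  have hHm : Measurable H := hF.lintegral_prod_left'
  let S := spanningSets ν
  -- The duality argument divides by a power of ∫H^s, which may be infinite. Truncating in height
  -- and to sets of finite measure makes the division legitimate, and monotone convergence removes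
  -- the truncation.
  let G : ℕ → β → ℝ≥0∞ := fun k => (S k).indicator fun y => min (H y) k
  have hGm : ∀ k, Measurable (G k) := fun k =>
    (hHm.min measurable_const).indicator (measurableSet_spanningSets ν k)
  have hGH : ∀ k y, G k y ≤ H y := fun k y => by
    by_cases hy : y ∈ S k
    · simp [G, hy]
    · simp [G, hy]
  have hGf : ∀ k, ∫⁻ y, G k y ^ s ∂ν ≠ ∞ := fun k => by
    refine ne_top_of_le_ne_top (b := (k : ℝ≥0∞) ^ s * ν (S k)) (ENNReal.mul_ne_top
      (ENNReal.rpow_ne_top_of_nonneg hs0.le (by simp)) (measure_spanningSets_lt_top ν k).ne) ?_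
    rw [← lintegral_indicator_const (measurableSet_spanningSets ν k)]
    refine lintegral_mono fun y => ?_
    by_cases hy : y ∈ S k
    · simp only [G]
      rw [Set.indicator_of_mem hy, Set.indicator_of_mem hy]
      exact ENNReal.rpow_le_rpow (min_le_right _ _) hs0.le
    · simp [G, hy, hs0]
  have hbound : ∀ k, (∫⁻ y, G k y ^ s ∂ν) ^ (1 / s) ≤ I := by
    intro k
    have hpow : ∀ y, G k y ^ s ≤ H y * G k y ^ (s - 1) := fun y => by
      have : G k y ^ s = G k y * G k y ^ (s - 1) := by
        nth_rw 2 [← ENNReal.rpow_one (G k y)]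
        rw [← ENNReal.rpow_add_of_nonneg _ _ zero_le_one (by linarith)]; congr 1; ring
      rw [this]
      gcongr
      exact hGH k y
    have h1 : ∫⁻ y, G k y ^ s ∂ν ≤ I * (∫⁻ y, G k y ^ s ∂ν) ^ (1 / s') := by
      calc ∫⁻ y, G k y ^ s ∂ν ≤ ∫⁻ y, (∫⁻ x, F (x, y) ∂μ) * G k y ^ (s - 1) ∂ν :=
            lintegral_mono hpow
        _ = ∫⁻ y, ∫⁻ x, F (x, y) * G k y ^ (s - 1) ∂μ ∂ν := by
            refine lintegral_congr fun y => ?_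
            have hFy : Measurable fun x => F (x, y) := hF.comp measurable_prodMk_right
            rw [lintegral_mul_const _ hFy]
        _ = ∫⁻ x, ∫⁻ y, F (x, y) * G k y ^ (s - 1) ∂ν ∂μ := by
            rw [lintegral_lintegral_swap]
            exact ((hF.comp measurable_swap).mul
              (((hGm k).comp measurable_fst).pow_const _)).aemeasurable
        _ ≤ ∫⁻ x, (∫⁻ y, F (x, y) ^ s ∂ν) ^ (1 / s) * (∫⁻ y, G k y ^ s ∂ν) ^ (1 / s') ∂μ := by
            refine lintegral_mono fun x => ?_
            have h := ENNReal.lintegral_mul_le_Lp_mul_Lq ν hc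
              (hF.comp (measurable_prodMk_left (x := x))).aemeasurable
              ((hGm k).pow_const (s - 1)).aemeasurable
            simp_rw [← ENNReal.rpow_mul, hc.sub_one_mul_conj] at h
            exact h
        _ = I * (∫⁻ y, G k y ^ s ∂ν) ^ (1 / s') := by
            rw [lintegral_mul_const]
            exact ((hF.pow_const s).lintegral_prod_right').pow_const _
    rcases eq_or_ne (∫⁻ y, G k y ^ s ∂ν) 0 with h0 | h0
    · rw [h0, ENNReal.zero_rpow_of_pos (by positivity)]
      exact zero_le
    · have h2 : ∫⁻ y, G k y ^ s ∂ν =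
          (∫⁻ y, G k y ^ s ∂ν) ^ (1 / s) * (∫⁻ y, G k y ^ s ∂ν) ^ (1 / s') := by
        rw [← ENNReal.rpow_add _ _ h0 (hGf k), one_div, one_div, hc.inv_add_inv_eq_one,
          ENNReal.rpow_one]
      nth_rw 1 [h2] at h1
      refine (ENNReal.mul_le_mul_iff_left ?_ ?_).1 h1
      · rw [Ne, ENNReal.rpow_eq_zero_iff]
        push Not
        exact ⟨fun h => absurd h h0, fun h => absurd h (hGf k)⟩
      · exact ENNReal.rpow_ne_top_of_nonneg (by positivity) (hGf k)
  have hmono : ∀ y, Monotone fun k => G k y ^ s := fun y k l hkl => by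
    refine ENNReal.rpow_le_rpow ?_ hs0.le
    by_cases hy : y ∈ S k
    · have hy' : y ∈ S l := monotone_spanningSets ν hkl hy
      simp only [G, hy, hy', Set.indicator_of_mem]
      exact min_le_min le_rfl (by exact_mod_cast hkl)
    · simp [G, hy]
  have hsup : ∀ y, H y ^ s = ⨆ k, G k y ^ s := fun y => by
    refine le_antisymm ?_ (iSup_le fun k => ENNReal.rpow_le_rpow (hGH k y) hs0.le)
    have hyS : ∃ k, y ∈ S k := by
      have : y ∈ ⋃ k, S k := by rw [iUnion_spanningSets]; trivial
      exact Set.mem_iUnion.1 this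
    obtain ⟨k₀, hk₀⟩ := hyS
    have hT : Tendsto (fun k : ℕ => (min (H y) k) ^ s) atTop (𝓝 (H y ^ s)) := by
      refine (ENNReal.continuous_rpow_const.tendsto _).comp ?_
      have := (tendsto_const_nhds (x := H y) (f := (atTop : Filter ℕ))).min
        ENNReal.tendsto_nat_nhds_top
      rwa [min_eq_left le_top] at this
    refine le_of_tendsto hT ?_
    filter_upwards [eventually_ge_atTop k₀] with k hk
    refine le_iSup_of_le k (le_of_eq ?_)
    have hy' : y ∈ S k := monotone_spanningSets ν hk hk₀
    simp [G, hy']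
  have hfin : ∫⁻ y, H y ^ s ∂ν ≤ I ^ s := by
    simp_rw [hsup]
    rw [lintegral_iSup (fun k => (hGm k).pow_const s) (fun k l hkl y => hmono y hkl)]
    refine iSup_le fun k => ?_
    have := ENNReal.rpow_le_rpow (hbound k) hs0.le
    rwa [← ENNReal.rpow_mul, one_div_mul_cancel hs0.ne', ENNReal.rpow_one] at this
  calc (∫⁻ y, H y ^ s ∂ν) ^ (1 / s) ≤ (I ^ s) ^ (1 / s) :=
        ENNReal.rpow_le_rpow hfin (by positivity)
    _ = I := by rw [← ENNReal.rpow_mul, mul_one_div_cancel hs0.ne', ENNReal.rpow_one]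

variable {m n : ℕ}

/-- The mixed norm of `L^{p₁}(ℝᵐ; L^{p₂}(ℝⁿ))` of a function with values in `[0, ∞]`. -/
noncomputable def mixedNorm (p₁ p₂ : ℝ≥0∞) (F : Rn m × Rn n → ℝ≥0∞) : ℝ≥0∞ :=
  eLpNorm (fun x => eLpNorm (fun y => F (x, y)) p₂ volume) p₁ volume

/-- The mixed-norm Hardy–Littlewood–Sobolev inequality. -/
theorem exists_mixed_hls (hm : 0 < m) (hn : 0 < n) {β₁ β₂ : ℝ} {p₁ p₂ q₁ q₂ : ℝ≥0∞}
    (hp₁ : 1 < p₁) (hpq₁ : p₁ < q₁) (hq₁ : q₁ < ∞) (hβ₁ : β₁ / m = 1 / p₁.toReal - 1 / q₁.toReal)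
    (hp₂ : 1 < p₂) (hpq₂ : p₂ < q₂) (hq₂ : q₂ < ∞) (hβ₂ : β₂ / n = 1 / p₂.toReal - 1 / q₂.toReal) :
    ∃ C : ℝ≥0, ∀ F : Rn m × Rn n → ℝ≥0∞, Measurable F →
      mixedNorm q₁ q₂ (fun x => ∫⁻ y, riesz β₁ x.1 y.1 * riesz β₂ x.2 y.2 * F y) ≤
        C * mixedNorm p₁ p₂ F := by
  obtain ⟨C₁, hC₁⟩ := exists_hls hm hp₁ hpq₁ hq₁ hβ₁
  obtain ⟨C₂, hC₂⟩ := exists_hls hn hp₂ hpq₂ hq₂ hβ₂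
  have hp₂0 : p₂ ≠ 0 := (zero_lt_one.trans hp₂).ne'
  refine ⟨C₁ * C₂, fun F hF => ?_⟩
  have hI₂ : Measurable fun z : Rn m × Rn n => ∫⁻ y₂, riesz β₂ z.2 y₂ * F (z.1, y₂) := by
    refine Measurable.lintegral_prod_right' (f := fun w : (Rn m × Rn n) × Rn n =>
      riesz β₂ w.1.2 w.2 * F (w.1.1, w.2)) ?_
    exact ((measurable_riesz β₂).comp (by fun_prop : Measurable fun w : (Rn m × Rn n) × Rn n =>
      (w.1.2, w.2))).mul (hF.comp (by fun_prop))
  have hg : Measurable fun x₁ => eLpNorm (fun y₂ => F (x₁, y₂)) p₂ volume :=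
    measurable_eLpNorm_slice hp₂0 (hpq₂.trans hq₂).ne hF
  have hsplit : ∀ x : Rn m × Rn n, ∫⁻ y, riesz β₁ x.1 y.1 * riesz β₂ x.2 y.2 * F y =
      ∫⁻ y₁, riesz β₁ x.1 y₁ * ∫⁻ y₂, riesz β₂ x.2 y₂ * F (y₁, y₂) := fun x => by
    rw [Measure.volume_eq_prod, lintegral_prod]
    · refine lintegral_congr fun y₁ => ?_
      rw [← lintegral_const_mul]
      · simp_rw [mul_assoc]
      · exact ((measurable_riesz β₂).comp measurable_prodMk_left).mul
          (hF.comp measurable_prodMk_left)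
    · refine Measurable.aemeasurable ?_
      exact (((measurable_riesz β₁).comp (by fun_prop : Measurable fun w : Rn m × Rn n =>
        (x.1, w.1))).mul ((measurable_riesz β₂).comp (by fun_prop : Measurable
        fun w : Rn m × Rn n => (x.2, w.2)))).mul hF
  -- Minkowski's inequality takes the norm in x₂ inside the integral in y₁; the one-variable
  -- inequality then applies in the second variable for each y₁, and what remains is a fractional
  -- integral in the first variable.
  have hinner : ∀ x₁ : Rn m, eLpNorm (fun x₂ : Rn n =>
      ∫⁻ y, riesz β₁ x₁ y.1 * riesz β₂ x₂ y.2 * F y) q₂ volume ≤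
      C₂ * ∫⁻ y₁, riesz β₁ x₁ y₁ * eLpNorm (fun y₂ => F (y₁, y₂)) p₂ volume := fun x₁ => by
    have e : (fun x₂ : Rn n => ∫⁻ y, riesz β₁ x₁ y.1 * riesz β₂ x₂ y.2 * F y) = fun x₂ =>
      ∫⁻ y₁, riesz β₁ x₁ y₁ * ∫⁻ y₂, riesz β₂ x₂ y₂ * F (y₁, y₂) := by
      ext x₂
      exact hsplit (x₁, x₂)
    rw [e]
    refine (eLpNorm_lintegral_le (hp₂.trans hpq₂) hq₂ (F := fun z : Rn m × Rn n =>
      riesz β₁ x₁ z.1 * ∫⁻ y₂, riesz β₂ z.2 y₂ * F (z.1, y₂)) ?_).trans ?_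
    · exact ((measurable_riesz β₁).comp (by fun_prop : Measurable fun w : Rn m × Rn n =>
        (x₁, w.1))).mul hI₂
    rw [← lintegral_const_mul]
    · refine lintegral_mono fun y₁ => ?_
      have hcm : eLpNorm (fun y => riesz β₁ x₁ y₁ * ∫⁻ y₂, riesz β₂ y y₂ * F (y₁, y₂)) q₂ volume ≤
          riesz β₁ x₁ y₁ * eLpNorm (fun y => ∫⁻ y₂, riesz β₂ y y₂ * F (y₁, y₂)) q₂ volume := by
        have hq₂0 : q₂ ≠ 0 := (zero_lt_one.trans (hp₂.trans hpq₂)).ne'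
        have hq₂t : 0 < q₂.toReal := ENNReal.toReal_pos hq₂0 hq₂.ne
        simp_rw [eLpNorm_eq_lintegral_rpow_enorm_toReal hq₂0 hq₂.ne, enorm_eq_self,
          ENNReal.mul_rpow_of_nonneg _ _ hq₂t.le]
        rw [lintegral_const_mul', ENNReal.mul_rpow_of_nonneg _ _ (by positivity),
          ← ENNReal.rpow_mul, mul_one_div_cancel hq₂t.ne', ENNReal.rpow_one]
        exact ENNReal.rpow_ne_top_of_nonneg hq₂t.le ENNReal.ofReal_ne_top
      refine hcm.trans ?_
      calc riesz β₁ x₁ y₁ * eLpNorm (fun y => ∫⁻ y₂, riesz β₂ y y₂ * F (y₁, y₂)) q₂ volume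
          ≤ riesz β₁ x₁ y₁ * (C₂ * eLpNorm (fun y₂ => F (y₁, y₂)) p₂ volume) := by
            gcongr
            exact hC₂ _ (hF.comp measurable_prodMk_left)
        _ = _ := by ring
    · exact ((measurable_riesz β₁).comp measurable_prodMk_left).mul hg
  have hq₁0 : q₁ ≠ 0 := (zero_lt_one.trans (hp₁.trans hpq₁)).ne'
  have hq₁t : 0 < q₁.toReal := ENNReal.toReal_pos hq₁0 hq₁.ne
  have key := hC₁ _ hg
  unfold mixedNorm
  calc eLpNorm (fun x₁ => eLpNorm (fun x₂ : Rn n =>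
        ∫⁻ y, riesz β₁ x₁ y.1 * riesz β₂ x₂ y.2 * F y) q₂ volume) q₁ volume
      ≤ eLpNorm (fun x₁ => C₂ * ∫⁻ y₁, riesz β₁ x₁ y₁ *
          eLpNorm (fun y₂ => F (y₁, y₂)) p₂ volume) q₁ volume := by
        refine eLpNorm_mono_enorm fun x₁ => ?_
        simp only [enorm_eq_self]
        exact hinner x₁
    _ ≤ C₂ * eLpNorm (fun x₁ => ∫⁻ y₁, riesz β₁ x₁ y₁ *
          eLpNorm (fun y₂ => F (y₁, y₂)) p₂ volume) q₁ volume := by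
        simp_rw [eLpNorm_eq_lintegral_rpow_enorm_toReal hq₁0 hq₁.ne, enorm_eq_self,
          ENNReal.mul_rpow_of_nonneg _ _ hq₁t.le]
        rw [lintegral_const_mul', ENNReal.mul_rpow_of_nonneg _ _ (by positivity),
          ← ENNReal.rpow_mul, mul_one_div_cancel hq₁t.ne', ENNReal.rpow_one]
        exact ENNReal.rpow_ne_top_of_nonneg hq₁t.le ENNReal.coe_ne_top
    _ ≤ C₂ * (C₁ * eLpNorm (fun x₁ => eLpNorm (fun y₂ => F (x₁, y₂)) p₂ volume) p₁ volume) := by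
        gcongr
    _ = _ := by push_cast; ring

end Mixed

end BiCommutator

namespace BiCommutator

open Filter Topology Metric

/-! ### Standard kernels, and bounded functions of compact support -/

section Kernels

variable {n : ℕ} {T : (Rn n → ℂ) → (Rn n → ℂ)}

/-- `K` is a measurable kernel of `T` with the size bound of a standard kernel. -/
structure IsKernelOf (T : (Rn n → ℂ) → (Rn n → ℂ)) (K : Rn n × Rn n → ℂ) (C : ℝ≥0) : Prop where
  measurable : Measurable K
  norm_le : ∀ z, ‖K z‖ ≤ C * ‖z.1 - z.2‖ ^ (-(n : ℝ))
  integral_eq : ∀ f g, BoundedCompact f → BoundedCompact g → Disjoint (tsupport f) (tsupport g) →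
      ∫ x, T f x * g x = ∫ z : Rn n × Rn n, K z * f z.2 * g z.1

/-- Measurability is not part of the notion of a standard kernel; the regularity condition supplies
it, through continuity off the diagonal. -/
theorem IsStandardKernel.continuousOn {K : Rn n → Rn n → ℂ} (hK : IsStandardKernel K) :
    ContinuousOn (fun z : Rn n × Rn n => K z.1 z.2) {z | z.1 ≠ z.2} := by
  obtain ⟨C, α, hα, -, -, hreg⟩ := hK
  have hopen : IsOpen {z : Rn n × Rn n | z.1 ≠ z.2} :=
    isOpen_ne_fun continuous_fst continuous_snd
  rintro ⟨x, y⟩ hxy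
  have hxy' : x ≠ y := hxy
  refine ContinuousAt.continuousWithinAt ?_
  have hpos : 0 < ‖x - y‖ := norm_pos_iff.2 (sub_ne_zero.2 hxy')
  rw [ContinuousAt, tendsto_iff_norm_sub_tendsto_zero]
  have hlim : Tendsto (fun z : Rn n × Rn n =>
      C * ‖x - z.1‖ ^ α / ‖x - z.2‖ ^ ((n : ℝ) + α) + C * ‖y - z.2‖ ^ α / ‖y - x‖ ^ ((n : ℝ) + α))
      (𝓝 (x, y)) (𝓝 (C * ‖x - x‖ ^ α / ‖x - y‖ ^ ((n : ℝ) + α) +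
        C * ‖y - y‖ ^ α / ‖y - x‖ ^ ((n : ℝ) + α))) := by
    have h1 : Tendsto (fun z : Rn n × Rn n => ‖x - z.1‖ ^ α) (𝓝 (x, y)) (𝓝 (‖x - x‖ ^ α)) :=
      ((continuous_const.sub continuous_fst).norm.tendsto _).rpow_const (Or.inr hα.le)
    have h2 : Tendsto (fun z : Rn n × Rn n => ‖y - z.2‖ ^ α) (𝓝 (x, y)) (𝓝 (‖y - y‖ ^ α)) :=
      ((continuous_const.sub continuous_snd).norm.tendsto _).rpow_const (Or.inr hα.le)
    have h3 : Tendsto (fun z : Rn n × Rn n => ‖x - z.2‖ ^ ((n : ℝ) + α)) (𝓝 (x, y))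
        (𝓝 (‖x - y‖ ^ ((n : ℝ) + α))) :=
      ((continuous_const.sub continuous_snd).norm.tendsto _).rpow_const (Or.inl hpos.ne')
    exact ((h1.const_mul C).div h3 (by positivity)).add ((h2.const_mul C).div_const _)
  have h0 : (0 : ℝ) ^ α = 0 := Real.zero_rpow hα.ne'
  rw [sub_self, sub_self, norm_zero, h0, mul_zero, zero_div, zero_div, add_zero] at hlim
  refine squeeze_zero' (Eventually.of_forall fun _ => norm_nonneg _) ?_ hlim
  have e1 : ∀ᶠ z : Rn n × Rn n in 𝓝 (x, y), x ≠ z.2 :=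
    (isOpen_ne_fun continuous_const continuous_snd).mem_nhds hxy'
  have e2 : ∀ᶠ z : Rn n × Rn n in 𝓝 (x, y), ‖x - z.1‖ ≤ ‖x - z.2‖ / 2 := by
    have : ∀ᶠ z : Rn n × Rn n in 𝓝 (x, y), ‖x - z.1‖ < ‖x - z.2‖ / 2 := by
      refine (isOpen_lt (f := fun z : Rn n × Rn n => ‖x - z.1‖)
        (g := fun z : Rn n × Rn n => ‖x - z.2‖ / 2) (by fun_prop) (by fun_prop)).mem_nhds ?_
      simp only [Set.mem_ofPred_eq, sub_self, norm_zero]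
      positivity
    exact this.mono fun z hz => hz.le
  have e3 : ∀ᶠ z : Rn n × Rn n in 𝓝 (x, y), ‖y - z.2‖ ≤ ‖y - x‖ / 2 := by
    have : ∀ᶠ z : Rn n × Rn n in 𝓝 (x, y), ‖y - z.2‖ < ‖y - x‖ / 2 := by
      refine (isOpen_lt (f := fun z : Rn n × Rn n => ‖y - z.2‖)
        (g := fun _ : Rn n × Rn n => ‖y - x‖ / 2) (by fun_prop) (by fun_prop)).mem_nhds ?_
      simp only [Set.mem_ofPred_eq, sub_self, norm_zero]
      rw [norm_sub_rev]; positivity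
    exact this.mono fun z hz => hz.le
  filter_upwards [e1, e2, e3] with z h1 h2 h3
  have k1 := hreg x z.1 z.2 h1 h2
  have k2 := hreg y z.2 x hxy'.symm h3
  calc ‖K z.1 z.2 - K x y‖ = ‖-(K x z.2 - K z.1 z.2) - (K x y - K x z.2)‖ := by congr 1; ring
    _ ≤ ‖K x z.2 - K z.1 z.2‖ + ‖K x y - K x z.2‖ := (norm_sub_le _ _).trans (by rw [norm_neg])
    _ ≤ _ := add_le_add (by linarith [norm_nonneg (K z.2 x - K z.2 z.1)])
        (by linarith [norm_nonneg (K y x - K z.2 x)])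

theorem IsCZO.exists_kernel (hT : IsCZO T) : ∃ K C, IsKernelOf T K C := by
  obtain ⟨K, hK, hTK⟩ := hT.kernel
  have hcont := hK.continuousOn
  obtain ⟨C, α, -, -, hsize, -⟩ := hK
  have hopen : IsOpen {z : Rn n × Rn n | z.1 ≠ z.2} :=
    isOpen_ne_fun continuous_fst continuous_snd
  classical
  -- The kernel is reset to 0 on the diagonal, where the size bound reads 0 when n > 0. Pairings of
  -- functions with disjoint supports do not see this change.
  refine ⟨{z : Rn n × Rn n | z.1 ≠ z.2}.indicator fun z => K z.1 z.2, (max C 0).toNNReal, ?_, ?_, ?_⟩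
  · rw [← Set.piecewise_eq_indicator]
    exact hcont.measurable_piecewise continuousOn_const hopen.measurableSet
  · intro z
    rw [Real.coe_toNNReal _ (le_max_right _ _)]
    by_cases hz : z.1 = z.2
    · rw [Set.indicator_of_notMem (by simpa using hz), norm_zero]
      positivity
    · rw [Set.indicator_of_mem (show z ∈ {z : Rn n × Rn n | z.1 ≠ z.2} from hz)]
      refine (hsize _ _ hz).trans ?_
      rw [Real.rpow_neg (norm_nonneg _), Real.rpow_natCast, ← div_eq_mul_inv]
      gcongr
      exact le_max_left _ _
  · intro f g hf hg hfg
    rw [hTK f g hf hg hfg]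
    congr 1
    ext z
    by_cases hz : z.1 = z.2
    · have : f z.2 = 0 ∨ g z.1 = 0 := by
        by_contra! hcon
        refine Set.disjoint_left.1 hfg (subset_tsupport f hcon.1) (?_ : z.2 ∈ tsupport g)
        rw [← hz]
        exact subset_tsupport g hcon.2
      rcases this with h | h <;> simp [h]
    · rw [Set.indicator_of_mem (show z ∈ {z : Rn n × Rn n | z.1 ≠ z.2} from hz)]

/-- A Hölder increment of order β weakens the singularity of the kernel from −n to β − n. At x = y
both sides vanish. -/
theorem IsKernelOf.enorm_mul_le {K : Rn n × Rn n → ℂ} {C : ℝ≥0} (hK : IsKernelOf T K C) {β : ℝ}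
    (hβ : 0 < β) (hβn : β < n) {x y : Rn n} {d : ℂ} {A : ℝ≥0} (hd : ‖d‖ ≤ A * ‖x - y‖ ^ β) :
    ‖K (x, y) * d‖ₑ ≤ C * A * riesz β x y := by
  have h1 : ‖K (x, y)‖ ≤ C * ‖x - y‖ ^ (-(n : ℝ)) := hK.norm_le (x, y)
  have h2 : ‖K (x, y) * d‖ ≤ C * A * ‖x - y‖ ^ (β - n) := by
    rw [norm_mul]
    refine (mul_le_mul h1 hd (norm_nonneg _) (by positivity)).trans (le_of_eq ?_)
    rcases (norm_nonneg (x - y)).eq_or_lt with h | h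
    · rw [← h, Real.zero_rpow hβ.ne', Real.zero_rpow (sub_neg.2 hβn).ne]
      ring
    · rw [show β - n = -n + β by ring, Real.rpow_add h]; ring
  rw [← ofReal_norm, riesz]
  refine (ENNReal.ofReal_le_ofReal h2).trans (le_of_eq ?_)
  rw [ENNReal.ofReal_mul (by positivity), ENNReal.ofReal_mul (by positivity),
    ENNReal.ofReal_coe_nnreal, ENNReal.ofReal_coe_nnreal]

end Kernels

section BoundedCompactFunctions

variable {X : Type*} [TopologicalSpace X] [MeasureSpace X]

theorem BoundedCompact.memLp [IsFiniteMeasureOnCompacts (volume : Measure X)] {f : X → ℂ} (hf : BoundedCompact f) (p : ℝ≥0∞) :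
    MemLp f p volume :=
  hf.1.mono_exponent_of_measure_support_ne_top (s := tsupport f)
    (fun _ hx => image_eq_zero_of_notMem_tsupport hx) hf.2.isCompact.measure_lt_top.ne le_top

theorem BoundedCompact.ae_norm_le {f : X → ℂ} (hf : BoundedCompact f) :
    ∃ M : ℝ≥0, ∀ᵐ x, ‖f x‖ ≤ M := by
  refine ⟨(eLpNorm f ∞ volume).toNNReal, ?_⟩
  filter_upwards [ae_le_eLpNormEssSup (f := f) (μ := volume)] with x hx
  rw [← coe_nnnorm, NNReal.coe_le_coe, ← ENNReal.coe_le_coe, ← enorm_eq_nnnorm,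
    ENNReal.coe_toNNReal hf.1.2.ne, eLpNorm_exponent_top]
  exact hx

theorem BoundedCompact.indicator {f : X → ℂ} (hf : BoundedCompact f) {s : Set X}
    (hs : MeasurableSet s) : BoundedCompact (s.indicator f) :=
  ⟨hf.1.indicator hs, hf.2.mono' fun x hx => subset_tsupport f fun h0 =>
    hx (by simp [Set.indicator, h0])⟩

end BoundedCompactFunctions

theorem boundedCompact_indicator_one {X : Type*} [PseudoMetricSpace X] [ProperSpace X]
    [MeasureSpace X] {s : Set X} (hs : MeasurableSet s)
    (hb : Bornology.IsBounded s) : BoundedCompact (s.indicator (1 : X → ℂ)) := by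
  refine ⟨?_, ?_⟩
  · refine memLp_top_of_bound ((measurable_one.indicator hs).aestronglyMeasurable) 1
      (Eventually.of_forall fun x => ?_)
    by_cases hx : x ∈ s <;> simp [hx]
  · exact HasCompactSupport.of_support_subset_isCompact hb.isCompact_closure
      (Set.support_indicator_subset.trans subset_closure)

end BiCommutator

namespace BiCommutator

open Filter Topology Metric

/-! ### The commutator with a Hölder continuous function in one variable -/

section OneParameter

variable {n : ℕ} {T : (Rn n → ℂ) → (Rn n → ℂ)} {K : Rn n × Rn n → ℂ} {C A : ℝ≥0} {β : ℝ}
  {B : Rn n → ℂ} {G : Set (Rn n)}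

/-- `B` is Hölder continuous of order `β` off a null set. -/
structure HolderOffNull (B : Rn n → ℂ) (A : ℝ≥0) (β : ℝ) (G : Set (Rn n)) : Prop where
  ae_mem : ∀ᵐ x, x ∈ G
  aestronglyMeasurable : AEStronglyMeasurable B volume
  norm_sub_le : ∀ x ∈ G, ∀ y ∈ G, ‖B x - B y‖ ≤ A * ‖x - y‖ ^ β

theorem HolderOffNull.ae_norm_le (hB : HolderOffNull B A β G) (hβ : 0 < β) (R : ℝ) :
    ∃ M : ℝ≥0, ∀ᵐ x, ‖x‖ ≤ R → ‖B x‖ ≤ M := by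
  obtain ⟨x₀, hx₀⟩ := hB.ae_mem.exists
  refine ⟨(‖B x₀‖ + A * (|R| + ‖x₀‖) ^ β).toNNReal, ?_⟩
  filter_upwards [hB.ae_mem] with x hx hxR
  rw [Real.coe_toNNReal _ (by positivity)]
  have h1 := hB.norm_sub_le x hx x₀ hx₀
  have h2 : ‖x - x₀‖ ^ β ≤ (|R| + ‖x₀‖) ^ β :=
    Real.rpow_le_rpow (norm_nonneg _) ((_root_.norm_sub_le _ _).trans
      (add_le_add (hxR.trans (le_abs_self R)) le_rfl)) hβ.le
  calc ‖B x‖ = ‖B x₀ + (B x - B x₀)‖ := by congr 1; ring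
    _ ≤ ‖B x₀‖ + ‖B x - B x₀‖ := norm_add_le _ _
    _ ≤ _ := by gcongr; exact h1.trans (by gcongr)

theorem HolderOffNull.boundedCompact_mul (hB : HolderOffNull B A β G) (hβ : 0 < β) {f : Rn n → ℂ}
    (hf : BoundedCompact f) : BoundedCompact (B * f) := by
  obtain ⟨R, hR⟩ := hf.2.isCompact.isBounded.exists_norm_le
  obtain ⟨M, hM⟩ := hB.ae_norm_le hβ R
  obtain ⟨F, hF⟩ := hf.ae_norm_le
  refine ⟨memLp_top_of_bound (hB.aestronglyMeasurable.mul hf.1.1) (M * F) ?_, hf.2.mul_left⟩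
  filter_upwards [hM, hF] with x h1 h2
  rw [Pi.mul_apply, norm_mul]
  by_cases hx : x ∈ tsupport f
  · exact mul_le_mul (h1 (hR x hx)) h2 (norm_nonneg _) M.2
  · rw [image_eq_zero_of_notMem_tsupport hx, norm_zero, mul_zero]
    positivity

theorem IsKernelOf.integrable_mul (hK : IsKernelOf T K C) {η : ℝ} (hη : 0 < η)
    {u v : Rn n → ℂ} (hu : BoundedCompact u) (hv : BoundedCompact v)
    (hsep : ∀ x y, v x ≠ 0 → u y ≠ 0 → η ≤ ‖x - y‖) :
    Integrable (fun z : Rn n × Rn n => K z * u z.2 * v z.1) (volume.prod volume) := by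
  have hu1 := memLp_one_iff_integrable.1 (hu.memLp 1)
  have hv1 := memLp_one_iff_integrable.1 (hv.memLp 1)
  have hS : MeasurableSet {z : Rn n × Rn n | η ≤ ‖z.1 - z.2‖} :=
    measurableSet_le measurable_const (by fun_prop)
  have h := (hv1.mul_prod hu1).bdd_mul (c := C * η ^ (-(n : ℝ)))
    (hK.measurable.indicator hS).aestronglyMeasurable (Eventually.of_forall fun z => by
      by_cases hz : η ≤ ‖z.1 - z.2‖
      · rw [Set.indicator_of_mem (show z ∈ {z : Rn n × Rn n | η ≤ ‖z.1 - z.2‖} from hz)]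
        refine (hK.norm_le z).trans ?_
        exact mul_le_mul_of_nonneg_left
          (Real.rpow_le_rpow_of_nonpos hη hz (neg_nonpos.2 n.cast_nonneg)) C.2
      · rw [Set.indicator_of_notMem (show z ∉ {z : Rn n × Rn n | η ≤ ‖z.1 - z.2‖} from hz), norm_zero]
        positivity)
  refine h.congr (Eventually.of_forall fun z => ?_)
  by_cases hz : η ≤ ‖z.1 - z.2‖
  · simp only [Set.indicator_of_mem (show z ∈ {z : Rn n × Rn n | η ≤ ‖z.1 - z.2‖} from hz)]
    ring
  · simp only [Set.indicator_of_notMem (show z ∉ {z : Rn n × Rn n | η ≤ ‖z.1 - z.2‖} from hz)]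
    by_cases h1 : v z.1 = 0
    · simp [h1]
    · by_cases h2 : u z.2 = 0
      · simp [h2]
      · exact absurd (hsep _ _ h1 h2) hz

/-- The off-diagonal representation of the commutator. -/
noncomputable def commutatorIntegral (K : Rn n × Rn n → ℂ) (B f : Rn n → ℂ) (x : Rn n) : ℂ :=
  ∫ y, K (x, y) * (B y - B x) * f y

theorem aestronglyMeasurable_commutatorIntegral (hK : Measurable K)
    (hB : AEStronglyMeasurable B volume) {f : Rn n → ℂ} (hf : AEStronglyMeasurable f volume) :
    AEStronglyMeasurable (fun z : Rn n × Rn n => K z * (B z.2 - B z.1) * f z.2)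
      (volume.prod volume) :=
  (hK.aestronglyMeasurable.mul (hB.comp_snd.sub hB.comp_fst)).mul hf.comp_snd

/-- For separated supports the kernel represents both terms of the commutator, tested on the pairs
(Bu, v) and (u, Bv), and the two double integrals combine. -/
theorem integral_commutator_far (hK : IsKernelOf T K C) (hβ : 0 < β) (hB : HolderOffNull B A β G)
    {η : ℝ} (hη : 0 < η) {u v : Rn n → ℂ} (hu : BoundedCompact u) (hv : BoundedCompact v)
    (hsep : ∀ x y, v x ≠ 0 → u y ≠ 0 → η ≤ ‖x - y‖) (hdisj : Disjoint (tsupport u) (tsupport v)) :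
    (∫ x, T (B * u) x * v x) - ∫ x, T u x * (B * v) x = ∫ x, commutatorIntegral K B u x * v x := by
  have hBu := hB.boundedCompact_mul hβ hu
  have hBv := hB.boundedCompact_mul hβ hv
  have hne : ∀ {w : Rn n → ℂ} {x}, (B * w) x ≠ 0 → w x ≠ 0 := fun h h0 => h (by simp [h0])
  rw [hK.integral_eq _ _ hBu hv (hdisj.mono_left (closure_mono fun x hx => hne hx)),
    hK.integral_eq _ _ hu hBv (hdisj.mono_right (closure_mono fun x hx => hne hx))]
  have i1 := hK.integrable_mul hη hBu hv fun x y h1 h2 => hsep x y h1 (hne h2)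
  have i2 := hK.integrable_mul hη hu hBv fun x y h1 h2 => hsep x y (hne h1) h2
  rw [Measure.volume_eq_prod, ← integral_sub i1 i2]
  have e : (fun z : Rn n × Rn n => K z * (B * u) z.2 * v z.1 - K z * u z.2 * (B * v) z.1) =
      fun z => K z * (B z.2 - B z.1) * u z.2 * v z.1 := by
    ext z; simp only [Pi.mul_apply]; ring
  have i3 := i1.sub i2
  change Integrable (fun z : Rn n × Rn n =>
    K z * (B * u) z.2 * v z.1 - K z * u z.2 * (B * v) z.1) _ at i3
  rw [e] at i3 ⊢
  rw [integral_prod _ i3]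
  refine integral_congr_ae (Eventually.of_forall fun x => ?_)
  exact integral_mul_const (v x) _

/-- The constant is chosen before B. This uniformity matters later, when B = b(y₁,·) − b(x₁,·) runs
through a family whose Hölder constants carry the factor |x₁−y₁|^β₁. -/
theorem lintegral_commutator_le (hK : IsKernelOf T K C) (hβ : 0 < β) (hβn : β < n) :
    ∃ C' : ℝ≥0, ∀ (B : Rn n → ℂ) (A : ℝ≥0) (G : Set (Rn n)), HolderOffNull B A β G →
      ∀ (f : Rn n → ℂ) (F : ℝ≥0), (∀ᵐ x, ‖f x‖ ≤ F) →
      ∀ x ∈ G, ∀ r : ℝ, 0 < r → (∀ y, f y ≠ 0 → y ∈ ball x r) →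
      ∫⁻ y, ‖K (x, y) * (B y - B x) * f y‖ₑ ≤ ENNReal.ofReal (C' * A * F * r ^ β) := by
  obtain ⟨C₁, hC₁0, hC₁⟩ := exists_lintegral_ball_riesz_le hβ hβn
  refine ⟨C * C₁.toNNReal, fun B A G hB f F hF x hx r hr hsupp => ?_⟩
  calc ∫⁻ y, ‖K (x, y) * (B y - B x) * f y‖ₑ
      ≤ ∫⁻ y, (C * A * F) * (ball x r).indicator (fun y => riesz β x y) y := by
        refine lintegral_mono_ae ?_
        filter_upwards [hF, hB.ae_mem] with y h1 hy
        by_cases hyr : y ∈ ball x r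
        · rw [Set.indicator_of_mem hyr, enorm_mul]
          have h2 := hK.enorm_mul_le hβ hβn (d := B y - B x) (A := A) (x := x) (y := y)
            (by rw [norm_sub_rev x y]; exact hB.norm_sub_le y hy x hx)
          have h3 : ‖f y‖ₑ ≤ F := by
            rw [enorm_eq_nnnorm]; exact_mod_cast h1
          calc ‖K (x, y) * (B y - B x)‖ₑ * ‖f y‖ₑ ≤ C * A * riesz β x y * F := mul_le_mul' h2 h3
            _ = _ := by ring
        · have : f y = 0 := by
            by_contra h0
            exact hyr (hsupp y h0)
          simp [this]
    _ = (C * A * F) * ∫⁻ y in ball x r, riesz β x y := by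
        rw [lintegral_const_mul' _ _ (by finiteness), lintegral_indicator measurableSet_ball]
    _ ≤ (C * A * F) * ENNReal.ofReal (C₁ * r ^ β) := by gcongr; exact hC₁ x r hr
    _ = _ := by
        rw [ENNReal.ofReal_mul hC₁0, ENNReal.ofReal_mul (by positivity),
          ENNReal.ofReal_mul (by positivity), ENNReal.ofReal_mul (by positivity),
          ENNReal.ofReal_coe_nnreal, ENNReal.ofReal_coe_nnreal, ENNReal.ofReal_coe_nnreal]
        push_cast
        rw [show ((C₁.toNNReal : ℝ≥0) : ℝ≥0∞) = ENNReal.ofReal C₁ from rfl]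
        ring

theorem norm_commutatorIntegral_le {x : Rn n} {f : Rn n → ℂ} {M : ℝ} (hM : 0 ≤ M)
    (h : ∫⁻ y, ‖K (x, y) * (B y - B x) * f y‖ₑ ≤ ENNReal.ofReal M) :
    ‖commutatorIntegral K B f x‖ ≤ M := by
  rw [commutatorIntegral, ← ENNReal.ofReal_le_ofReal_iff hM, ofReal_norm]
  exact (enorm_integral_le_lintegral_enorm _).trans h

/-- Cauchy–Schwarz and the L² bound: ‖Tu‖₂ is at most a constant times M|S|^(1/2), and passing to L¹
on a subset of S costs another |S|^(1/2). -/
theorem exists_integral_norm_le (hT : IsCZO T) : ∃ C' : ℝ≥0, ∀ (u : Rn n → ℂ) (S S' : Set (Rn n))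
    (M : ℝ), 0 ≤ M → AEStronglyMeasurable u volume → (∀ x, u x ≠ 0 → x ∈ S) → S' ⊆ S →
    volume S ≠ ∞ → (∀ᵐ x, ‖u x‖ ≤ M) →
    MemLp (T u) 2 volume ∧ ∫ x in S', ‖T u x‖ ≤ C' * M * volume.real S := by
  obtain ⟨C', hC'⟩ := hT.bounded 2 ENNReal.one_lt_two (by simp)
  refine ⟨C', fun u S S' M hM hu hS hS' hSf hbd => ?_⟩
  have h1 : eLpNorm u 2 volume ≤ volume S ^ (2 : ℝ)⁻¹ * ENNReal.ofReal M := by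
    rw [← eLpNorm_restrict_eq_of_support_subset (s := S) (fun x hx => hS x hx)]
    simpa using eLpNorm_le_of_ae_bound (p := 2) (μ := volume.restrict S) (ae_restrict_of_ae hbd)
  have hmem : MemLp u 2 volume := ⟨hu, h1.trans_lt (ENNReal.mul_lt_top
    (ENNReal.rpow_lt_top_of_nonneg (by norm_num) hSf) ENNReal.ofReal_lt_top)⟩
  obtain ⟨hTm, hTb⟩ := hC' u hmem
  refine ⟨hTm, ?_⟩
  rw [integral_norm_eq_lintegral_enorm hTm.1.restrict]
  refine ENNReal.toReal_le_of_le_ofReal (by positivity) ?_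
  have h2 : ∫⁻ x in S', ‖T u x‖ₑ ≤ eLpNorm (T u) 2 volume * volume S ^ (2 : ℝ)⁻¹ := by
    rw [← eLpNorm_one_eq_lintegral_enorm]
    refine (eLpNorm_le_eLpNorm_mul_rpow_measure_univ (q := 2) (by norm_num) hTm.1.restrict).trans ?_
    rw [Measure.restrict_apply_univ]
    have e : (1 / (1 : ℝ≥0∞).toReal - 1 / (2 : ℝ≥0∞).toReal) = (2 : ℝ)⁻¹ := by norm_num
    rw [e]
    gcongr
    exact Measure.restrict_le_self
  have e2 : volume S ^ (2 : ℝ)⁻¹ * volume S ^ (2 : ℝ)⁻¹ = volume S := by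
    rw [← ENNReal.rpow_add_of_nonneg _ _ (by norm_num) (by norm_num)]
    norm_num
  calc ∫⁻ x in S', ‖T u x‖ₑ ≤ eLpNorm (T u) 2 volume * volume S ^ (2 : ℝ)⁻¹ := h2
    _ ≤ C' * (volume S ^ (2 : ℝ)⁻¹ * ENNReal.ofReal M) * volume S ^ (2 : ℝ)⁻¹ := by
        gcongr; exact hTb.trans (by gcongr)
    _ = C' * ENNReal.ofReal M * (volume S ^ (2 : ℝ)⁻¹ * volume S ^ (2 : ℝ)⁻¹) := by ring
    _ = _ := by
        rw [e2, ENNReal.ofReal_mul (by positivity), ENNReal.ofReal_mul (by positivity),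
          ENNReal.ofReal_coe_nnreal, measureReal_def, ENNReal.ofReal_toReal hSf]

/-- The contribution of the functions supported near a ball. -/
theorem exists_integral_commutator_near_le (hT : IsCZO T) (hβ : 0 < β)
    (hB : HolderOffNull B A β G) : ∃ C' : ℝ≥0, ∀ (u : Rn n → ℂ) (F : ℝ≥0), BoundedCompact u →
      (∀ᵐ x, ‖u x‖ ≤ F) → ∀ (c : Rn n) (δ : ℝ), 0 < δ → (∀ x, u x ≠ 0 → x ∈ ball c (2 * δ)) →
      ‖∫ x in closedBall c δ, (T (B * u) x - B x * T u x)‖ ≤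
        C' * F * (3 * δ) ^ β * volume.real (ball c (2 * δ)) := by
  obtain ⟨C₁, hC₁⟩ := exists_integral_norm_le hT
  refine ⟨2 * C₁ * A, fun u F hu hF c δ hδ hsupp => ?_⟩
  have hsub : closedBall c δ ⊆ ball c (2 * δ) := closedBall_subset_ball (by linarith)
  have hSf : volume (ball c (2 * δ)) ≠ ∞ := measure_ball_lt_top.ne
  obtain ⟨x₀, hx₀G, hx₀⟩ : ∃ x₀ ∈ G, x₀ ∈ closedBall c δ := by
    have h0 : volume (closedBall c δ) ≠ 0 := (measure_closedBall_pos _ _ hδ).ne'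
    by_contra! hcon
    refine h0 (measure_mono_null (fun x hx => ?_) (ae_iff.1 hB.ae_mem))
    exact fun hxG => hcon x hxG hx
  -- Constants commute with `T`, so B may be replaced by B − B(x₀). For almost every point of the
  -- ball of radius 2δ the Hölder bound applies; the distance to x₀ is below 3δ.
  set D : Rn n → ℂ := fun x => B x - B x₀ with hD
  have hDm : AEStronglyMeasurable D volume := hB.aestronglyMeasurable.sub aestronglyMeasurable_const
  have hDle : ∀ᵐ x, x ∈ ball c (2 * δ) → ‖D x‖ ≤ A * (3 * δ) ^ β := by
    filter_upwards [hB.ae_mem] with x hx hxb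
    refine (hB.norm_sub_le x hx x₀ hx₀G).trans ?_
    have : ‖x - x₀‖ ≤ 3 * δ := by
      rw [← dist_eq_norm]
      have := dist_triangle_right x x₀ c
      linarith [mem_ball.1 hxb, mem_closedBall.1 hx₀]
    gcongr
  have hDu : ∀ᵐ x, ‖(D * u) x‖ ≤ A * (3 * δ) ^ β * F := by
    filter_upwards [hDle, hF] with x h1 h2
    rw [Pi.mul_apply, norm_mul]
    by_cases hx : u x = 0
    · rw [hx, norm_zero, mul_zero]; positivity
    · exact mul_le_mul (h1 (hsupp x hx)) h2 (norm_nonneg _) (by positivity)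
  obtain ⟨m1, b1⟩ := hC₁ (D * u) (ball c (2 * δ)) (closedBall c δ) _ (by positivity)
    (hDm.mul hu.1.1) (fun x hx => hsupp x fun h0 => hx (by simp [h0])) hsub hSf hDu
  obtain ⟨m2, b2⟩ := hC₁ u (ball c (2 * δ)) (closedBall c δ) F F.2 hu.1.1 hsupp hsub hSf hF
  have hDu2 : MemLp (D * u) 2 volume := by
    have hB' : HolderOffNull D A β G := ⟨hB.ae_mem, hDm, fun x hx y hy => by
      simpa [hD] using hB.norm_sub_le x hx y hy⟩
    exact (hB'.boundedCompact_mul hβ hu).memLp 2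
  have hTB : T (B * u) =ᵐ[volume] fun x => T (D * u) x + B x₀ * T u x := by
    have e : B * u = D * u + B x₀ • u := by
      ext x; simp [hD]; ring
    rw [e]
    filter_upwards [hT.map_add 2 ENNReal.one_lt_two (by simp) (D * u) (B x₀ • u) hDu2
      ((hu.memLp 2).const_smul _), hT.map_smul 2 ENNReal.one_lt_two (by simp) (B x₀) u (hu.memLp 2)]
      with x h1 h2
    rw [h1, Pi.add_apply, h2, Pi.smul_apply, smul_eq_mul]
  have i1 : IntegrableOn (fun x => ‖T (D * u) x‖) (closedBall c δ) :=
    ((m1.locallyIntegrable one_le_two).integrableOn_isCompact (isCompact_closedBall c δ)).norm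
  have i2 : IntegrableOn (fun x => A * (3 * δ) ^ β * ‖T u x‖) (closedBall c δ) :=
    (((m2.locallyIntegrable one_le_two).integrableOn_isCompact
      (isCompact_closedBall c δ)).norm).const_mul _
  calc ‖∫ x in closedBall c δ, (T (B * u) x - B x * T u x)‖
      ≤ ∫ x in closedBall c δ, (‖T (D * u) x‖ + A * (3 * δ) ^ β * ‖T u x‖) := by
        refine norm_integral_le_of_norm_le (i1.add i2) ?_
        filter_upwards [ae_restrict_of_ae hTB, ae_restrict_of_ae hDle,
          ae_restrict_mem measurableSet_closedBall] with x h1 h2 h3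
        rw [h1]
        calc ‖T (D * u) x + B x₀ * T u x - B x * T u x‖ = ‖T (D * u) x - D x * T u x‖ := by
              simp only [hD]; congr 1; ring
          _ ≤ ‖T (D * u) x‖ + ‖D x‖ * ‖T u x‖ := (norm_sub_le _ _).trans_eq (by rw [norm_mul])
          _ ≤ _ := by gcongr; exact h2 (hsub h3)
    _ = (∫ x in closedBall c δ, ‖T (D * u) x‖)
          + A * (3 * δ) ^ β * ∫ x in closedBall c δ, ‖T u x‖ := by
        rw [integral_add i1 i2, integral_const_mul]
    _ ≤ C₁ * (A * (3 * δ) ^ β * F) * volume.real (ball c (2 * δ))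
          + A * (3 * δ) ^ β * (C₁ * F * volume.real (ball c (2 * δ))) := by gcongr
    _ = _ := by push_cast; ring

theorem locallyIntegrable_commutatorIntegral (hK : IsKernelOf T K C) (hβ : 0 < β) (hβn : β < n)
    (hB : HolderOffNull B A β G) {f : Rn n → ℂ} (hf : BoundedCompact f) :
    LocallyIntegrable (commutatorIntegral K B f) volume := by
  obtain ⟨C₀, hC₀⟩ := lintegral_commutator_le hK hβ hβn
  replace hC₀ := hC₀ B A G hB
  obtain ⟨F, hF⟩ := hf.ae_norm_le
  obtain ⟨R, hR⟩ := hf.2.isCompact.isBounded.exists_norm_le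
  have hm : AEStronglyMeasurable (commutatorIntegral K B f) volume :=
    (aestronglyMeasurable_commutatorIntegral hK.measurable hB.aestronglyMeasurable
      hf.1.1).integral_prod_right'
  rw [locallyIntegrable_iff]
  intro S hS
  obtain ⟨R', hR'⟩ := hS.isBounded.exists_norm_le
  have hfin : IsFiniteMeasure (volume.restrict S) := ⟨by simpa using hS.measure_lt_top⟩
  refine Integrable.of_bound hm.restrict (C₀ * A * F * (|R| + |R'| + 1) ^ β) ?_
  filter_upwards [ae_restrict_of_ae hB.ae_mem, ae_restrict_mem hS.measurableSet] with x hx hxS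
  refine norm_commutatorIntegral_le (by positivity)
    (hC₀ f F hF x hx (|R| + |R'| + 1) (by positivity) fun y hy => ?_)
  rw [mem_ball, dist_eq_norm]
  have h1 := hR y (subset_tsupport f hy)
  have h2 := hR' x hxS
  have := norm_sub_le y x
  linarith [le_abs_self R, le_abs_self R']

/-- The commutator of a Calderón–Zygmund operator with a Hölder continuous function is given by
absolutely convergent integrals. -/
theorem commutator_eq_commutatorIntegral (hT : IsCZO T) (hK : IsKernelOf T K C) (hβ : 0 < β)
    (hβn : β < n) (hB : HolderOffNull B A β G) {f : Rn n → ℂ} (hf : BoundedCompact f) :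
    (fun x => T (B * f) x - B x * T f x) =ᵐ[volume] commutatorIntegral K B f := by
  obtain ⟨C₁, hC₁⟩ := exists_integral_commutator_near_le hT hβ hB
  obtain ⟨C₀, hC₀⟩ := lintegral_commutator_le hK hβ hβn
  obtain ⟨C₂, hC₂⟩ : ∃ C₂ : ℝ≥0, ∀ (f : Rn n → ℂ) (F : ℝ≥0), (∀ᵐ x, ‖f x‖ ≤ F) →
      ∀ x ∈ G, ∀ r : ℝ, 0 < r → (∀ y, f y ≠ 0 → y ∈ ball x r) →
      ∫⁻ y, ‖K (x, y) * (B y - B x) * f y‖ₑ ≤ ENNReal.ofReal (C₂ * F * r ^ β) :=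
    ⟨C₀ * A, by simpa using hC₀ B A G hB⟩
  obtain ⟨F, hF⟩ := hf.ae_norm_le
  have hTloc : ∀ {u : Rn n → ℂ}, BoundedCompact u →
      LocallyIntegrable (fun x => T (B * u) x - B x * T u x) volume := by
    intro u hu
    have h1 : LocallyIntegrable (T (B * u)) volume :=
      (hT.memLp ENNReal.one_lt_two (by simp)
        ((hB.boundedCompact_mul hβ hu).memLp 2)).locallyIntegrable one_le_two
    have h2 : LocallyIntegrable (fun x => B x * T u x) volume := by
      have h3 : LocallyIntegrable (T u) volume :=
        (hT.memLp ENNReal.one_lt_two (by simp) (hu.memLp 2)).locallyIntegrable one_le_two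
      rw [locallyIntegrable_iff]
      intro S hS
      obtain ⟨R, hR⟩ := hS.isBounded.exists_norm_le
      obtain ⟨M, hM⟩ := hB.ae_norm_le hβ R
      refine (h3.integrableOn_isCompact hS).bdd_mul (c := M) hB.aestronglyMeasurable.restrict ?_
      filter_upwards [ae_restrict_of_ae hM, ae_restrict_mem hS.measurableSet] with x h4 h5
      exact h4 (hR x h5)
    exact h1.sub h2
  have hEloc : ∀ {u : Rn n → ℂ}, BoundedCompact u →
      LocallyIntegrable (commutatorIntegral K B u) volume := fun hu =>
    locallyIntegrable_commutatorIntegral hK hβ hβn hB hu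
  set Φ : Rn n → ℂ := fun x => T (B * f) x - B x * T f x - commutatorIntegral K B f x with hΦ
  have hΦloc : LocallyIntegrable Φ volume := (hTloc hf).sub (hEloc hf)
  set V := volume.real (ball (0 : Rn n) 1) with hV
  have hV0 : 0 < V := ENNReal.toReal_pos (measure_ball_pos _ _ one_pos).ne' measure_ball_lt_top.ne
  have hvol : ∀ (c : Rn n) (r : ℝ), 0 < r → volume.real (ball c r) = r ^ n * V := fun c r hr => by
    rw [measureReal_def, volume_ball_eq c hr, ENNReal.toReal_mul, ENNReal.toReal_ofReal (by positivity)]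
    rfl
  have hvolc : ∀ (c : Rn n) (r : ℝ), 0 < r → volume.real (closedBall c r) = r ^ n * V :=
    fun c r hr => by
      have hn : 0 < n := by
        have : (0 : ℝ) < n := hβ.trans hβn
        exact_mod_cast this
      have : Nonempty (Fin n) := ⟨⟨0, hn⟩⟩
      rw [measureReal_def, Measure.addHaar_closedBall_eq_addHaar_ball, ← measureReal_def, hvol c r hr]
  -- The function f is cut at the ball of radius 2δ. The outer part is at distance at least δ from
  -- the ball of integration and is treated exactly by the kernel; for the inner part the commutator
  -- and the integral are estimated separately, each by δ^β times the volume.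
  have key : ∀ (c : Rn n) (δ : ℝ), 0 < δ → ‖∫ x in closedBall c δ, Φ x‖ ≤
      (C₁ * F * 3 ^ β * 2 ^ n + C₂ * F * 4 ^ β) * δ ^ β * (δ ^ n * V) := by
    intro c δ hδ
    set f₁ := (ball c (2 * δ)).indicator f with hf₁
    set f₂ := (ball c (2 * δ))ᶜ.indicator f with hf₂
    set v := (closedBall c δ).indicator (1 : Rn n → ℂ) with hv
    have hb₁ : BoundedCompact f₁ := hf.indicator measurableSet_ball
    have hb₂ : BoundedCompact f₂ := hf.indicator measurableSet_ball.compl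
    have hbv : BoundedCompact v :=
      boundedCompact_indicator_one measurableSet_closedBall isBounded_closedBall
    have hsum : f = f₁ + f₂ := (Set.indicator_self_add_compl _ f).symm
    have hs₁ : ∀ x, f₁ x ≠ 0 → x ∈ ball c (2 * δ) := fun x hx => Set.mem_of_indicator_ne_zero hx
    have hs₂ : ∀ x, f₂ x ≠ 0 → x ∈ (ball c (2 * δ))ᶜ := fun x hx => Set.mem_of_indicator_ne_zero hx
    have hsv : ∀ x, v x ≠ 0 → x ∈ closedBall c δ := fun x hx => Set.mem_of_indicator_ne_zero hx
    have hF₁ : ∀ᵐ x, ‖f₁ x‖ ≤ F := hF.mono fun x hx => (norm_indicator_le_norm_self f x).trans hx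
    have hF₂ : ∀ᵐ x, ‖f₂ x‖ ≤ F := hF.mono fun x hx => (norm_indicator_le_norm_self f x).trans hx
    have hsplit : ∀ᵐ x, Φ x = (T (B * f₁) x - B x * T f₁ x) +
        ((T (B * f₂) x - B x * T f₂ x) - commutatorIntegral K B f₂ x)
        - commutatorIntegral K B f₁ x := by
      have hT1 := hT.map_add 2 ENNReal.one_lt_two (by simp) (B * f₁) (B * f₂)
        ((hB.boundedCompact_mul hβ hb₁).memLp 2) ((hB.boundedCompact_mul hβ hb₂).memLp 2)
      have hT2 := hT.map_add 2 ENNReal.one_lt_two (by simp) f₁ f₂ (hb₁.memLp 2) (hb₂.memLp 2)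
      rw [← mul_add, ← hsum] at hT1
      rw [← hsum] at hT2
      obtain ⟨R, hR⟩ := hf.2.isCompact.isBounded.exists_norm_le
      filter_upwards [hT1, hT2, hB.ae_mem] with x h1 h2 hx
      have hint : ∀ u : Rn n → ℂ, BoundedCompact u → (∀ᵐ x, ‖u x‖ ≤ F) →
          (∀ y, u y ≠ 0 → f y ≠ 0) →
          Integrable (fun y => K (x, y) * (B y - B x) * u y) volume := by
        intro u hu hFu hsu
        refine ⟨((hK.measurable.comp measurable_prodMk_left).aestronglyMeasurable.mul
          (hB.aestronglyMeasurable.sub aestronglyMeasurable_const)).mul hu.1.1, ?_⟩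
        refine (hC₂ u F hFu x hx (|R| + ‖x‖ + 1) (by positivity) fun y hy => ?_).trans_lt
          ENNReal.ofReal_lt_top
        rw [mem_ball, dist_eq_norm]
        have h3 := hR y (subset_tsupport f (hsu y hy))
        have := norm_sub_le y x
        linarith [le_abs_self R]
      have hE : commutatorIntegral K B f x =
          commutatorIntegral K B f₁ x + commutatorIntegral K B f₂ x := by
        unfold commutatorIntegral
        rw [← integral_add (hint f₁ hb₁ hF₁ fun y hy h0 => hy (by simp [hf₁, Set.indicator, h0]))
          (hint f₂ hb₂ hF₂ fun y hy h0 => hy (by simp [hf₂, Set.indicator, h0]))]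
        refine integral_congr_ae (Eventually.of_forall fun y => ?_)
        have := congrFun hsum y
        simp only [Pi.add_apply] at this
        change K (x, y) * (B y - B x) * f y =
          K (x, y) * (B y - B x) * f₁ y + K (x, y) * (B y - B x) * f₂ y
        rw [this]; ring
      simp only [hΦ]
      rw [h1, h2, hE]
      simp only [Pi.add_apply]
      ring
    have hcB : IsCompact (closedBall c δ) := isCompact_closedBall c δ
    have j1 := (hTloc hb₁).integrableOn_isCompact hcB
    have j2 := (hTloc hb₂).integrableOn_isCompact hcB
    have e1 := (hEloc hb₁).integrableOn_isCompact hcB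
    have e2 := (hEloc hb₂).integrableOn_isCompact hcB
    have hsep : ∀ x y, v x ≠ 0 → f₂ y ≠ 0 → δ ≤ ‖x - y‖ := by
      intro x y hx hy
      have h1 := mem_closedBall.1 (hsv x hx)
      have h2 : 2 * δ ≤ dist y c := not_lt.1 fun h => hs₂ y hy h
      rw [← dist_eq_norm]
      have := dist_triangle y x c
      rw [dist_comm y x] at this
      linarith
    have hdisj : Disjoint (tsupport f₂) (tsupport v) := by
      have t1 : tsupport f₂ ⊆ (ball c (2 * δ))ᶜ :=
        closure_minimal (fun x hx => hs₂ x hx) isOpen_ball.isClosed_compl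
      have t2 : tsupport v ⊆ closedBall c δ := closure_minimal (fun x hx => hsv x hx) isClosed_closedBall
      refine Set.disjoint_left.2 fun x h1 h2 => t1 h1 ?_
      exact closedBall_subset_ball (by linarith) (t2 h2)
    have hind : ∀ u : Rn n → ℂ, ∫ x, u x * v x = ∫ x in closedBall c δ, u x := fun u => by
      rw [← integral_indicator measurableSet_closedBall]
      refine integral_congr_ae (Eventually.of_forall fun x => ?_)
      by_cases hx : x ∈ closedBall c δ <;> simp only [hv, hx, Set.indicator_of_mem,
        Set.indicator_of_notMem, Pi.one_apply, mul_one, mul_zero, not_false_eq_true]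
    have hfar := integral_commutator_far hK hβ hB hδ hb₂ hbv hsep hdisj
    have hmul : ∫ x, T f₂ x * (B * v) x = ∫ x in closedBall c δ, B x * T f₂ x := by
      rw [← hind]
      refine integral_congr_ae (Eventually.of_forall fun x => ?_)
      simp only [Pi.mul_apply]; ring
    have k1 : IntegrableOn (T (B * f₂)) (closedBall c δ) :=
      ((hT.memLp ENNReal.one_lt_two (by simp)
        ((hB.boundedCompact_mul hβ hb₂).memLp 2)).locallyIntegrable one_le_two).integrableOn_isCompact hcB
    have k2 : IntegrableOn (fun x => B x * T f₂ x) (closedBall c δ) := by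
      refine (k1.sub j2).congr (Eventually.of_forall fun x => ?_)
      simp only [Pi.sub_apply]; ring
    rw [hind, hmul, hind, ← integral_sub k1 k2] at hfar
    -- The outer part contributes nothing to the discrepancy.
    have hzero : ∫ x in closedBall c δ,
        ((T (B * f₂) x - B x * T f₂ x) - commutatorIntegral K B f₂ x) = 0 := by
      rw [integral_sub j2 e2, hfar, sub_self]
    have hmain : ∫ x in closedBall c δ, Φ x = (∫ x in closedBall c δ, (T (B * f₁) x - B x * T f₁ x))
        - ∫ x in closedBall c δ, commutatorIntegral K B f₁ x := by
      have j3 : IntegrableOn (fun x => (T (B * f₂) x - B x * T f₂ x) - commutatorIntegral K B f₂ x)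
          (closedBall c δ) := j2.sub e2
      have j4 : IntegrableOn (fun x => (T (B * f₁) x - B x * T f₁ x) +
          ((T (B * f₂) x - B x * T f₂ x) - commutatorIntegral K B f₂ x)) (closedBall c δ) :=
        j1.add j3
      rw [integral_congr_ae (ae_restrict_of_ae hsplit), integral_sub j4 e1,
        integral_add j1 j3, hzero, add_zero]
    have b1 := hC₁ f₁ F hb₁ hF₁ c δ hδ hs₁
    rw [hvol c (2 * δ) (by positivity)] at b1
    have b2 : ‖∫ x in closedBall c δ, commutatorIntegral K B f₁ x‖ ≤
        C₂ * F * (4 * δ) ^ β * volume.real (closedBall c δ) := by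
      refine norm_setIntegral_le_of_norm_le_const_ae hcB.measure_lt_top ?_
      filter_upwards [ae_restrict_of_ae hB.ae_mem, ae_restrict_mem measurableSet_closedBall]
        with x hx hxb
      refine norm_commutatorIntegral_le (by positivity)
        (hC₂ f₁ F hF₁ x hx (4 * δ) (by positivity) fun y hy => ?_)
      have h1 := mem_ball.1 (hs₁ y hy)
      rw [mem_ball]
      have := dist_triangle_right y x c
      linarith [mem_closedBall.1 hxb]
    rw [hvolc c δ hδ] at b2
    rw [hmain]
    refine (norm_sub_le _ _).trans ((add_le_add b1 b2).trans (le_of_eq ?_))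
    rw [Real.mul_rpow (by norm_num) hδ.le, Real.mul_rpow (by norm_num) hδ.le, mul_pow]
    ring
  -- The averages of the discrepancy over balls of radius δ are O(δ^β), and almost everywhere they
  -- converge to its value.
  have hleb := IsUnifLocDoublingMeasure.ae_tendsto_average volume hΦloc 1
  filter_upwards [hleb] with x hx
  have h1 := hx (l := 𝓝[>] (0 : ℝ)) (fun _ => x) (fun r => r) tendsto_id
    (by filter_upwards [self_mem_nhdsWithin] with r hr
        exact mem_closedBall_self (by rw [one_mul]; exact (Set.mem_Ioi.1 hr).le))
  have h2 : Tendsto (fun δ : ℝ => (C₁ * F * 3 ^ β * 2 ^ n + C₂ * F * 4 ^ β) * δ ^ β)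
      (𝓝[>] 0) (𝓝 0) := by
    have : Tendsto (fun δ : ℝ => (C₁ * F * 3 ^ β * 2 ^ n + C₂ * F * 4 ^ β) * δ ^ β) (𝓝 0)
        (𝓝 ((C₁ * F * 3 ^ β * 2 ^ n + C₂ * F * 4 ^ β) * 0 ^ β)) :=
      (tendsto_id.rpow_const (Or.inr hβ.le)).const_mul _
    rw [Real.zero_rpow hβ.ne', mul_zero] at this
    exact this.mono_left nhdsWithin_le_nhds
  have h3 : Tendsto (fun δ : ℝ => ⨍ y in closedBall x δ, Φ y) (𝓝[>] 0) (𝓝 0) := by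
    refine squeeze_zero_norm' ?_ h2
    filter_upwards [self_mem_nhdsWithin] with δ hδ
    have hδ : 0 < δ := hδ
    rw [setAverage_eq, norm_smul, hvolc x δ hδ, norm_inv, Real.norm_of_nonneg (by positivity),
      inv_mul_le_iff₀ (by positivity), mul_comm]
    exact key x δ hδ
  have h4 : Φ x = 0 := tendsto_nhds_unique h1 h3
  exact sub_eq_zero.1 h4

end OneParameter

end BiCommutator

namespace BiCommutator

open Filter Topology Metric

/-! ### Functions on the product as elements of the mixed-norm space -/

section Represents

variable {m n : ℕ} {p₁ p₂ : ℝ≥0∞} {f g : Rn m × Rn n → ℂ}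

theorem mixedNorm_mono_ae {f g : Rn m × Rn n → ℝ≥0∞} (h : f ≤ᵐ[volume] g) :
    mixedNorm p₁ p₂ f ≤ mixedNorm p₁ p₂ g := by
  have h' : ∀ᵐ x : Rn m, ∀ᵐ y : Rn n, f (x, y) ≤ g (x, y) := Measure.ae_ae_of_ae_prod h
  refine eLpNorm_mono_enorm_ae (h'.mono fun x hx => ?_)
  simp only [enorm_eq_self]
  exact eLpNorm_mono_enorm_ae (hx.mono fun y hy => by simpa using hy)

theorem mixedNorm_congr_ae {f g : Rn m × Rn n → ℝ≥0∞} (h : f =ᵐ[volume] g) :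
    mixedNorm p₁ p₂ f = mixedNorm p₁ p₂ g :=
  le_antisymm (mixedNorm_mono_ae h.le) (mixedNorm_mono_ae h.symm.le)

variable [Fact (1 ≤ p₂)] {F G : MixedLp m n p₁ p₂}

theorem exists_represents (hp₂ : p₂ ≠ ∞) (F : MixedLp m n p₁ p₂) : ∃ f, Represents f F := by
  obtain ⟨f, hf, h⟩ := exists_joint_representative (ν := (volume : Measure (Rn n))) hp₂
    (Lp.aestronglyMeasurable F)
  exact ⟨f, hf.aestronglyMeasurable, h⟩

theorem Represents.enorm_eq (h : Represents f F) :
    ‖F‖ₑ = mixedNorm p₁ p₂ fun z => ‖f z‖ₑ := by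
  rw [Lp.enorm_def]
  refine eLpNorm_congr_enorm_ae (h.2.mono fun x hx => ?_)
  rw [enorm_eq_self, Lp.enorm_def, eLpNorm_enorm]
  exact eLpNorm_congr_ae hx

theorem Represents.ae_eq (hf : Represents f F) (hg : Represents g F) : f =ᵐ[volume] g :=
  ae_eq_prod_of_slices hf.1 hg.1 (by
    filter_upwards [hf.2, hg.2] with x h1 h2
    exact h1.symm.trans h2)

theorem Represents.congr (hf : Represents f F) (h : f =ᵐ[volume] g) : Represents g F := by
  refine ⟨hf.1.congr h, ?_⟩
  filter_upwards [hf.2, Measure.ae_ae_of_ae_prod h] with x h1 h2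
  exact h1.trans h2

theorem Represents.unique (hf : Represents f F) (hg : Represents f G) : F = G := by
  refine Lp.ext ?_
  filter_upwards [hf.2, hg.2] with x h1 h2
  exact Lp.ext (h1.trans h2.symm)

theorem Represents.add (hf : Represents f F) (hg : Represents g G) :
    Represents (f + g) (F + G) := by
  refine ⟨hf.1.add hg.1, ?_⟩
  filter_upwards [hf.2, hg.2, Lp.coeFn_add F G] with x h1 h2 h3
  rw [h3]
  filter_upwards [Lp.coeFn_add (F x) (G x), h1, h2] with y e1 e2 e3
  rw [Pi.add_apply, e1, Pi.add_apply, e2, e3, Pi.add_apply]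

theorem Represents.smul (c : ℂ) (hf : Represents f F) : Represents (c • f) (c • F) := by
  refine ⟨hf.1.const_smul c, ?_⟩
  filter_upwards [hf.2, Lp.coeFn_smul c F] with x h1 h3
  rw [h3]
  filter_upwards [Lp.coeFn_smul c (F x), h1] with y e1 e2
  rw [Pi.smul_apply, e1, Pi.smul_apply, e2, Pi.smul_apply]

/-- A finite mixed norm puts almost every slice in `L^{p₂}`, so the measurable slice map agrees with
the slices almost everywhere and inherits the norm. -/
theorem exists_represents_of_mixedNorm_lt_top [Fact (1 ≤ p₁)] (hp₁ : p₁ ≠ ∞) (hp₂ : p₂ ≠ ∞)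
    (hf : AEStronglyMeasurable f volume) (h : mixedNorm p₁ p₂ (fun z => ‖f z‖ₑ) < ∞) :
    ∃ F : MixedLp m n p₁ p₂, Represents f F := by
  have h1 : p₁ ≠ 0 := (zero_lt_one.trans_le (Fact.out (p := 1 ≤ p₁))).ne'
  have h2 : p₂ ≠ 0 := (zero_lt_one.trans_le (Fact.out (p := 1 ≤ p₂))).ne'
  obtain ⟨g, hg, hgf⟩ := exists_slice (μ := (volume : Measure (Rn m)))
    (ν := (volume : Measure (Rn n))) hp₂ hf
  have hmk : Measurable (hf.mk f) := hf.stronglyMeasurable_mk.measurable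
  have hsl : ∀ᵐ x : Rn m, (fun y => f (x, y)) =ᵐ[volume] fun y => hf.mk f (x, y) :=
    Measure.ae_ae_of_ae_prod hf.ae_eq_mk
  have hmeas := measurable_eLpNorm_slice (ν := (volume : Measure (Rn n))) h2 hp₂ (f := hf.mk f) hmk
  have hfin : ∀ᵐ x : Rn m, eLpNorm (fun y => f (x, y)) p₂ volume < ∞ := by
    have e : mixedNorm p₁ p₂ (fun z => ‖f z‖ₑ) = eLpNorm
        (fun x : Rn m => eLpNorm (fun y => hf.mk f (x, y)) p₂ (volume : Measure (Rn n))) p₁ volume := by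
      refine eLpNorm_congr_ae (hsl.mono fun x hx => ?_)
      simp only [eLpNorm_enorm]
      exact eLpNorm_congr_ae hx
    rw [e, eLpNorm_lt_top_iff_lintegral_rpow_enorm_lt_top h1 hp₁] at h
    filter_upwards [ae_lt_top (by fun_prop) h.ne, hsl] with x hx hs
    rw [eLpNorm_congr_ae hs]
    rw [enorm_eq_self] at hx
    exact (ENNReal.rpow_lt_top_iff_of_pos (ENNReal.toReal_pos h1 hp₁)).1 hx
  have hgf' : ∀ᵐ x : Rn m, g x =ᵐ[volume] fun y => f (x, y) := by
    filter_upwards [hgf, hfin, ae_slice_aestronglyMeasurable hf] with x hx1 hx2 hx3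
    exact hx1 ⟨hx3, hx2⟩
  have hgm : MemLp g p₁ volume := by
    refine ⟨hg, ?_⟩
    refine lt_of_eq_of_lt (eLpNorm_congr_enorm_ae (hgf'.mono fun x hx => ?_)) h
    rw [enorm_eq_self, Lp.enorm_def, eLpNorm_enorm]
    exact eLpNorm_congr_ae hx
  refine ⟨hgm.toLp g, hf, ?_⟩
  filter_upwards [hgm.coeFn_toLp, hgf'] with x hx1 hx2
  rw [hx1]
  exact hx2

end Represents

/-! ### Integral operators between mixed-norm spaces -/

section KernelOperator

variable {m n : ℕ} {p₁ p₂ q₁ q₂ : ℝ≥0∞} {k k' : (Rn m × Rn n) × (Rn m × Rn n) → ℂ} {A : ℝ≥0∞}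

/-- The integral operator with kernel `k`. -/
noncomputable def kernelOp (k : (Rn m × Rn n) × (Rn m × Rn n) → ℂ) (f : Rn m × Rn n → ℂ)
    (x : Rn m × Rn n) : ℂ :=
  ∫ y, k (x, y) * f y

/-- The integral operator with kernel `|k|` is bounded between mixed-norm spaces. -/
structure MixedBound (k : (Rn m × Rn n) × (Rn m × Rn n) → ℂ) (p₁ p₂ q₁ q₂ A : ℝ≥0∞) : Prop where
  measurable : Measurable k
  mixedNorm_le : ∀ F : Rn m × Rn n → ℝ≥0∞, Measurable F →
    mixedNorm q₁ q₂ (fun x => ∫⁻ y, ‖k (x, y)‖ₑ * F y) ≤ A * mixedNorm p₁ p₂ F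

variable [Fact (1 ≤ p₁)] [Fact (1 ≤ p₂)] [Fact (1 ≤ q₁)] [Fact (1 ≤ q₂)]

/-- `S` is the integral operator with kernel `k`, with absolutely convergent integrals. -/
def IsKernelOperator (k : (Rn m × Rn n) × (Rn m × Rn n) → ℂ)
    (S : MixedLp m n p₁ p₂ →L[ℂ] MixedLp m n q₁ q₂) : Prop :=
  ∀ f F, Represents f F → (∀ᵐ x, Integrable (fun y => k (x, y) * f y) volume) ∧
    Represents (kernelOp k f) (S F)

theorem MixedBound.enorm_le (hk : MixedBound k p₁ p₂ q₁ q₂ A) {f : Rn m × Rn n → ℂ}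
    {F : MixedLp m n p₁ p₂} (hf : Represents f F) :
    mixedNorm q₁ q₂ (fun x => ∫⁻ y, ‖k (x, y) * f y‖ₑ) ≤ A * ‖F‖ₑ := by
  have h := hk.mixedNorm_le (fun z => ‖hf.1.mk f z‖ₑ) hf.1.stronglyMeasurable_mk.measurable.enorm
  have e := hf.1.ae_eq_mk
  have e' : (fun z => ‖f z‖ₑ) =ᵐ[volume] fun z => ‖hf.1.mk f z‖ₑ :=
    e.mono fun z hz => by simp only; rw [hz]
  rw [hf.enorm_eq, mixedNorm_congr_ae e']
  refine le_of_eq_of_le ?_ h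
  congr 1
  ext x
  refine lintegral_congr_ae (e.mono fun z hz => ?_)
  simp only [enorm_mul]
  rw [hz]

theorem aestronglyMeasurable_kernel_mul (hk : Measurable k) {f : Rn m × Rn n → ℂ}
    (hf : AEStronglyMeasurable f volume) :
    AEStronglyMeasurable (fun z : (Rn m × Rn n) × (Rn m × Rn n) => k z * f z.2)
      (volume.prod volume) :=
  hk.aestronglyMeasurable.mul hf.comp_snd

theorem ae_lt_top_of_mixedNorm_lt_top (hq₁ : q₁ ≠ ∞) (hq₂ : q₂ ≠ ∞) {F : Rn m × Rn n → ℝ≥0∞}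
    (hF : AEMeasurable F volume) (h : mixedNorm q₁ q₂ F < ∞) : ∀ᵐ x, F x < ∞ := by
  have h1 : q₁ ≠ 0 := (zero_lt_one.trans_le (Fact.out (p := 1 ≤ q₁))).ne'
  have h2 : q₂ ≠ 0 := (zero_lt_one.trans_le (Fact.out (p := 1 ≤ q₂))).ne'
  have hmk : Measurable (hF.mk F) := hF.measurable_mk
  rw [mixedNorm_congr_ae hF.ae_eq_mk] at h
  suffices hs : ∀ᵐ x, hF.mk F x < ∞ by
    filter_upwards [hs, hF.ae_eq_mk] with x h1 h2
    rwa [h2]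
  have hmeas := measurable_eLpNorm_slice (ν := (volume : Measure (Rn n))) h2 hq₂ (f := hF.mk F) hmk
  rw [mixedNorm, eLpNorm_lt_top_iff_lintegral_rpow_enorm_lt_top h1 hq₁] at h
  have hm : MeasurableSet {z | hF.mk F z < ∞} := measurableSet_lt hmk measurable_const
  refine (Measure.ae_prod_iff_ae_ae hm).2 ?_
  filter_upwards [ae_lt_top (by fun_prop) h.ne] with x hx
  rw [enorm_eq_self, ENNReal.rpow_lt_top_iff_of_pos (ENNReal.toReal_pos h1 hq₁),
    eLpNorm_lt_top_iff_lintegral_rpow_enorm_lt_top h2 hq₂] at hx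
  filter_upwards [ae_lt_top (by fun_prop) hx.ne] with y hy
  rwa [enorm_eq_self, ENNReal.rpow_lt_top_iff_of_pos (ENNReal.toReal_pos h2 hq₂)] at hy

theorem MixedBound.ae_integrable (hk : MixedBound k p₁ p₂ q₁ q₂ A) (hA : A ≠ ∞) (hq₁ : q₁ ≠ ∞)
    (hq₂ : q₂ ≠ ∞) {f : Rn m × Rn n → ℂ} {F : MixedLp m n p₁ p₂} (hf : Represents f F) :
    ∀ᵐ x, Integrable (fun y => k (x, y) * f y) volume := by
  have hm := aestronglyMeasurable_kernel_mul hk.measurable hf.1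
  have h := (hk.enorm_le hf).trans_lt (ENNReal.mul_lt_top hA.lt_top enorm_lt_top)
  filter_upwards [ae_lt_top_of_mixedNorm_lt_top hq₁ hq₂ hm.enorm.lintegral_prod_right' h] with x hx
  exact ⟨(hk.measurable.comp measurable_prodMk_left).aestronglyMeasurable.mul hf.1, hx⟩

theorem MixedBound.mixedNorm_kernelOp_le (hk : MixedBound k p₁ p₂ q₁ q₂ A) {f : Rn m × Rn n → ℂ}
    {F : MixedLp m n p₁ p₂} (hf : Represents f F) :
    mixedNorm q₁ q₂ (fun x => ‖kernelOp k f x‖ₑ) ≤ A * ‖F‖ₑ :=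
  (mixedNorm_mono_ae (Eventually.of_forall fun _ => enorm_integral_le_lintegral_enorm _)).trans
    (hk.enorm_le hf)

theorem MixedBound.exists_represents (hk : MixedBound k p₁ p₂ q₁ q₂ A) (hA : A ≠ ∞) (hq₁ : q₁ ≠ ∞)
    (hq₂ : q₂ ≠ ∞) {f : Rn m × Rn n → ℂ} {F : MixedLp m n p₁ p₂} (hf : Represents f F) :
    ∃ G : MixedLp m n q₁ q₂, Represents (kernelOp k f) G :=
  exists_represents_of_mixedNorm_lt_top hq₁ hq₂
    (aestronglyMeasurable_kernel_mul hk.measurable hf.1).integral_prod_right'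
    ((hk.mixedNorm_kernelOp_le hf).trans_lt (ENNReal.mul_lt_top hA.lt_top enorm_lt_top))

theorem kernelOp_add {f g : Rn m × Rn n → ℂ} {x : Rn m × Rn n}
    (hf : Integrable (fun y => k (x, y) * f y) volume)
    (hg : Integrable (fun y => k (x, y) * g y) volume) :
    kernelOp k (f + g) x = kernelOp k f x + kernelOp k g x := by
  unfold kernelOp
  rw [← integral_add hf hg]
  simp only [Pi.add_apply, mul_add]

theorem kernelOp_smul (c : ℂ) (f : Rn m × Rn n → ℂ) (x : Rn m × Rn n) :
    kernelOp k (c • f) x = c * kernelOp k f x := by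
  unfold kernelOp
  rw [← integral_const_mul]
  refine integral_congr_ae (Eventually.of_forall fun y => ?_)
  simp only [Pi.smul_apply, smul_eq_mul]; ring

theorem kernelOp_congr {f g : Rn m × Rn n → ℂ} (h : f =ᵐ[volume] g) : kernelOp k f = kernelOp k g := by
  ext x
  exact integral_congr_ae (h.mono fun y hy => by simp only [hy])

theorem norm_le_of_mixedNorm_le {S : MixedLp m n p₁ p₂ →L[ℂ] MixedLp m n q₁ q₂} (hA : A ≠ ∞)
    (h : ∀ F, ‖S F‖ₑ ≤ A * ‖F‖ₑ) : ‖S‖ ≤ A.toReal := by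
  refine S.opNorm_le_bound ENNReal.toReal_nonneg fun F => ?_
  have := ENNReal.toReal_mono (ENNReal.mul_ne_top hA enorm_ne_top) (h F)
  rwa [ENNReal.toReal_mul, toReal_enorm, toReal_enorm] at this

theorem MixedBound.exists_clm (hk : MixedBound k p₁ p₂ q₁ q₂ A) (hA : A ≠ ∞) (hp₂ : p₂ ≠ ∞)
    (hq₁ : q₁ ≠ ∞) (hq₂ : q₂ ≠ ∞) :
    ∃ S : MixedLp m n p₁ p₂ →L[ℂ] MixedLp m n q₁ q₂, IsKernelOperator k S := by
  -- Representatives are chosen arbitrarily; the integral operator does not see the choice, which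
  -- yields linearity.
  choose r hr using fun F : MixedLp m n p₁ p₂ =>
    BiCommutator.exists_represents hp₂ F
  choose S₀ hS₀ using fun F : MixedLp m n p₁ p₂ => hk.exists_represents hA hq₁ hq₂ (hr F)
  have hrep : ∀ f F, Represents f F → Represents (kernelOp k f) (S₀ F) := fun f F hf => by
    rw [kernelOp_congr (hf.ae_eq (hr F))]; exact hS₀ F
  have hint : ∀ f (F : MixedLp m n p₁ p₂), Represents f F →
    ∀ᵐ x, Integrable (fun y => k (x, y) * f y) volume := fun f F hf => hk.ae_integrable hA hq₁ hq₂ hf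
  let L : MixedLp m n p₁ p₂ →ₗ[ℂ] MixedLp m n q₁ q₂ :=
    { toFun := S₀
      map_add' := fun F G => by
        refine (hrep _ _ ((hr F).add (hr G))).unique ?_
        refine ((hS₀ F).add (hS₀ G)).congr ?_
        filter_upwards [hint _ _ (hr F), hint _ _ (hr G)] with x h1 h2
        exact (kernelOp_add h1 h2).symm
      map_smul' := fun c F => by
        refine (hrep _ _ ((hr F).smul c)).unique ?_
        refine ((hS₀ F).smul c).congr (Eventually.of_forall fun x => ?_)
        exact (kernelOp_smul c _ x).symm }
  have hL : ∀ F, ‖L F‖ ≤ A.toReal * ‖F‖ := fun F => by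
    have h1 : ‖S₀ F‖ₑ ≤ A * ‖F‖ₑ := by
      rw [(hS₀ F).enorm_eq]; exact hk.mixedNorm_kernelOp_le (hr F)
    have := ENNReal.toReal_mono (ENNReal.mul_ne_top hA enorm_ne_top) h1
    rwa [ENNReal.toReal_mul, toReal_enorm, toReal_enorm] at this
  exact ⟨L.mkContinuous A.toReal hL, fun f F hf => ⟨hint f F hf, hrep f F hf⟩⟩

theorem IsKernelOperator.add {S S' : MixedLp m n p₁ p₂ →L[ℂ] MixedLp m n q₁ q₂}
    (h : IsKernelOperator k S) (h' : IsKernelOperator k' S') : IsKernelOperator (k + k') (S + S') := by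
  intro f F hf
  obtain ⟨i1, r1⟩ := h f F hf
  obtain ⟨i2, r2⟩ := h' f F hf
  refine ⟨?_, (r1.add r2).congr ?_⟩
  · filter_upwards [i1, i2] with x h1 h2
    refine (h1.add h2).congr (Eventually.of_forall fun y => ?_)
    simp only [Pi.add_apply, add_mul]
  · filter_upwards [i1, i2] with x h1 h2
    rw [Pi.add_apply, kernelOp, kernelOp, ← integral_add h1 h2, kernelOp]
    simp only [Pi.add_apply, add_mul]

theorem IsKernelOperator.smul (c : ℂ) {S : MixedLp m n p₁ p₂ →L[ℂ] MixedLp m n q₁ q₂}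
    (h : IsKernelOperator k S) : IsKernelOperator (c • k) (c • S) := by
  intro f F hf
  obtain ⟨i1, r1⟩ := h f F hf
  refine ⟨?_, (r1.smul c).congr ?_⟩
  · filter_upwards [i1] with x h1
    refine (h1.const_mul c).congr (Eventually.of_forall fun y => ?_)
    simp only [Pi.smul_apply, smul_eq_mul, mul_assoc]
  · refine Eventually.of_forall fun x => ?_
    rw [Pi.smul_apply, kernelOp, kernelOp, ← integral_smul]
    simp only [Pi.smul_apply, smul_eq_mul, mul_assoc]

theorem IsKernelOperator.sub {S S' : MixedLp m n p₁ p₂ →L[ℂ] MixedLp m n q₁ q₂}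
    (h : IsKernelOperator k S) (h' : IsKernelOperator k' S') : IsKernelOperator (k - k') (S - S') := by
  have := h.add (h'.smul (-1))
  rwa [neg_one_smul, neg_one_smul, ← sub_eq_add_neg, ← sub_eq_add_neg] at this

theorem IsKernelOperator.norm_le (hp₂ : p₂ ≠ ∞) {S : MixedLp m n p₁ p₂ →L[ℂ] MixedLp m n q₁ q₂}
    (h : IsKernelOperator k S) (hk : MixedBound k p₁ p₂ q₁ q₂ A) (hA : A ≠ ∞) :
    ‖S‖ ≤ A.toReal := by
  refine norm_le_of_mixedNorm_le hA fun F => ?_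
  obtain ⟨f, hf⟩ := exists_represents hp₂ F
  rw [(h f F hf).2.enorm_eq]
  exact hk.mixedNorm_kernelOp_le hf

/-- Compact operators are closed in operator norm, and the norm of a difference is controlled by the
bound for the difference of the kernels. -/
theorem IsKernelOperator.isCompactOperator_of_approx (hp₂ : p₂ ≠ ∞)
    {S : MixedLp m n p₁ p₂ →L[ℂ] MixedLp m n q₁ q₂} (h : IsKernelOperator k S)
    (happ : ∀ ε > 0, ∃ k' A, ∃ S' : MixedLp m n p₁ p₂ →L[ℂ] MixedLp m n q₁ q₂,
      IsKernelOperator k' S' ∧ IsCompactOperator S' ∧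
      MixedBound (k - k') p₁ p₂ q₁ q₂ A ∧ A ≤ ENNReal.ofReal ε) : IsCompactOperator S := by
  have hcl : IsClosed {S : MixedLp m n p₁ p₂ →L[ℂ] MixedLp m n q₁ q₂ | IsCompactOperator S} :=
    isClosed_setOfPred_isCompactOperator
  refine hcl.closure_subset (Metric.mem_closure_iff.2 fun ε hε => ?_)
  obtain ⟨k', A, S', h', hc, hb, hA⟩ := happ (ε / 2) (by positivity)
  refine ⟨S', hc, ?_⟩
  have hA' : A ≠ ∞ := (hA.trans_lt ENNReal.ofReal_lt_top).ne
  rw [dist_eq_norm]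
  have h1 := (h.sub h').norm_le hp₂ hb hA'
  have h2 := ENNReal.toReal_le_of_le_ofReal (by positivity) hA
  linarith

end KernelOperator

end BiCommutator

namespace BiCommutator

open Filter Topology Metric

/-! ### Density of the span of indicators of a π-system -/

section Induction

variable {α : Type*} {mα : MeasurableSpace α} {μ : Measure α} [IsFiniteMeasure μ] {s : ℝ≥0∞}

/-- A property of `L^s` functions that is linear and closed holds for all of them as soon as it
holds for the indicators of a generating `π`-system. -/
theorem memLp_induction_of_isPiSystem (hs0 : s ≠ 0) (hs : s ≠ ∞) {𝒮 : Set (Set α)}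
    (h𝒮 : mα = MeasurableSpace.generateFrom 𝒮) (hπ : IsPiSystem 𝒮) (huniv : Set.univ ∈ 𝒮)
    {P : (α → ℂ) → Prop} (indicator : ∀ t ∈ 𝒮, P (t.indicator 1))
    (add : ∀ f g, MemLp f s μ → MemLp g s μ → P f → P g → P (f + g))
    (smul : ∀ (c : ℂ) f, MemLp f s μ → P f → P (c • f))
    (closed : ∀ f, MemLp f s μ →
      (∀ ε : ℝ≥0∞, ε ≠ 0 → ∃ g, MemLp g s μ ∧ eLpNorm (f - g) s μ ≤ ε ∧ P g) → P f)
    {f : α → ℂ} (hf : MemLp f s μ) : P f := by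
  have hmem : ∀ {t : Set α}, MeasurableSet t → MemLp (t.indicator (1 : α → ℂ)) s μ := fun ht =>
    (memLp_const (1 : ℂ)).indicator ht
  -- Dynkin's π–λ argument: complements come from linearity, and disjoint countable unions from
  -- finite ones by closedness.
  have hind : ∀ t, MeasurableSet t → P (t.indicator 1) := by
    refine MeasurableSpace.induction_on_inter (C := fun t _ => P (t.indicator 1)) h𝒮 hπ ?_ indicator
      ?_ ?_
    · have := smul 0 _ (hmem MeasurableSet.univ) (indicator _ huniv)
      rw [zero_smul] at this
      rwa [Set.indicator_empty]
    · intro t ht hPt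
      have := add _ _ (hmem MeasurableSet.univ) ((hmem ht).const_smul (-1)) (indicator _ huniv)
        (smul (-1) _ (hmem ht) hPt)
      convert this using 1
      ext x
      by_cases hx : x ∈ t <;> simp [hx]
    · intro t hdisj ht hPt
      have hfin : ∀ N : ℕ, P ((⋃ i ∈ Finset.range N, t i).indicator 1) := by
        intro N
        induction N with
        | zero =>
          have := smul 0 _ (hmem MeasurableSet.univ) (indicator _ huniv)
          rw [zero_smul] at this
          rw [Finset.range_zero]
          simp only [Finset.notMem_empty, Set.iUnion_of_empty, Set.iUnion_empty]
          rwa [Set.indicator_empty]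
        | succ N ih =>
          have hm : MeasurableSet (⋃ i ∈ Finset.range N, t i) :=
            Finset.measurableSet_biUnion _ fun i _ => ht i
          have h2 := add _ _ (hmem hm) (hmem (ht N)) ih (hPt N)
          convert h2 using 1
          rw [Finset.range_add_one, Finset.set_biUnion_insert, Set.union_comm,
            Set.indicator_union_of_disjoint]
          · rfl
          · refine Set.disjoint_iUnion₂_left.2 fun i hi => hdisj ?_
            exact (Finset.mem_range.1 hi).ne
      refine closed _ (hmem (MeasurableSet.iUnion ht)) fun ε hε => ?_
      -- The tails of a disjoint union decrease to the empty set, so by finiteness of the measure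
      -- their indicators tend to 0 in `L^s`.
      have hlim : Tendsto (fun N : ℕ => μ (⋃ i ≥ N, t i)) atTop (𝓝 0) := by
        have hanti : Antitone fun N : ℕ => ⋃ i ≥ N, t i := fun a b hab =>
          Set.biUnion_mono (fun i hi => le_trans hab hi) fun _ _ => le_rfl
        have h0 : ⋂ N : ℕ, ⋃ i ≥ N, t i = ∅ := by
          ext x
          simp only [Set.mem_iInter, Set.mem_iUnion, Set.mem_empty_iff_false, iff_false]
          intro hx
          obtain ⟨i, _, hi⟩ := hx 0
          obtain ⟨j, hj, hj'⟩ := hx (i + 1)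
          exact Set.disjoint_left.1 (hdisj (show i ≠ j by lia)) hi hj'
        have := tendsto_measure_iInter_atTop (μ := μ)
          (fun N => (MeasurableSet.biUnion (Set.to_countable {i | i ≥ N})
            fun i _ => ht i).nullMeasurableSet) hanti ⟨0, measure_ne_top _ _⟩
        change Tendsto (fun N : ℕ => μ (⋃ i ≥ N, t i)) atTop (𝓝 (μ (⋂ N : ℕ, ⋃ i ≥ N, t i))) at this
        rwa [h0, measure_empty] at this
      have hlim2 : Tendsto (fun N : ℕ => μ (⋃ i ≥ N, t i) ^ (1 / s.toReal)) atTop (𝓝 0) := by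
        have := hlim.ennrpow_const (1 / s.toReal)
        rwa [ENNReal.zero_rpow_of_pos (one_div_pos.2 (ENNReal.toReal_pos hs0 hs))] at this
      obtain ⟨N, hN⟩ := ((ENNReal.tendsto_nhds_zero.1 hlim2) ε (pos_iff_ne_zero.2 hε)).exists
      refine ⟨_, hmem (Finset.measurableSet_biUnion (Finset.range N) fun i _ => ht i), ?_, hfin N⟩
      have hsub : (⋃ i, t i).indicator (1 : α → ℂ) - (⋃ i ∈ Finset.range N, t i).indicator 1 =
          (⋃ i ≥ N, t i).indicator fun _ => (1 : ℂ) := by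
        ext x
        rw [Pi.sub_apply]
        by_cases hx : ∃ i, x ∈ t i
        · obtain ⟨i, hi⟩ := hx
          have huniq : ∀ j, x ∈ t j → j = i := fun j hj => by
            by_contra hne
            exact Set.disjoint_left.1 (hdisj hne) hj hi
          rw [Set.indicator_of_mem (Set.mem_iUnion.2 ⟨i, hi⟩)]
          by_cases hiN : i < N
          · rw [Set.indicator_of_mem (Set.mem_iUnion₂.2 ⟨i, Finset.mem_range.2 hiN, hi⟩),
              Set.indicator_of_notMem, Pi.one_apply, sub_self]
            simp only [Set.mem_iUnion, not_exists]
            intro j hj hxj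
            have := huniq j hxj
            lia
          · rw [Set.indicator_of_notMem, Set.indicator_of_mem (Set.mem_iUnion₂.2 ⟨i, not_lt.1 hiN, hi⟩),
              Pi.one_apply, sub_zero]
            simp only [Set.mem_iUnion, not_exists, Finset.mem_range]
            intro j hj hxj
            have := huniq j hxj
            lia
        · push Not at hx
          rw [Set.indicator_of_notMem (by simpa using hx), Set.indicator_of_notMem (by simp [hx]),
            Set.indicator_of_notMem (by simp [hx]), sub_zero]
      rw [hsub]
      exact (eLpNorm_indicator_const_le _ _).trans (by simpa using hN)
  refine closed f hf fun ε hε => ?_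
  obtain ⟨g, hg, hPg, hgm⟩ := MemLp.induction_dense hs (fun g => P g ∧ MemLp g s μ)
    (fun c t ht _ ε _ => ⟨t.indicator fun _ => c, by simp, by
      have h1 := smul c _ (hmem ht) (hind t ht)
      convert h1 using 1
      ext x; by_cases hx : x ∈ t <;> simp [hx], (memLp_const c).indicator ht⟩)
    (fun f g hf hg => ⟨add f g hf.2 hg.2 hf.1 hg.1, hf.2.add hg.2⟩) (fun f hf => hf.2.1) hf hε
  exact ⟨g, hgm, hg, hPg⟩

end Induction

/-! ### Mixed norms on sets of finite measure -/

section FiniteMeasure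

variable {α β : Type*} [MeasurableSpace α] [MeasurableSpace β] {μ : Measure α} {ν : Measure β}

theorem eLpNorm_eLpNorm_slice [SFinite ν] {s : ℝ≥0∞} (hs0 : s ≠ 0) (hs : s ≠ ∞)
    {F : α × β → ℝ≥0∞} (hF : Measurable F) :
    eLpNorm (fun x => eLpNorm (fun y => F (x, y)) s ν) s μ = eLpNorm F s (μ.prod ν) := by
  have hst := ENNReal.toReal_pos hs0 hs
  simp_rw [eLpNorm_eq_lintegral_rpow_enorm_toReal hs0 hs, enorm_eq_self]
  rw [lintegral_prod _ (by fun_prop)]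
  congr 1
  refine lintegral_congr fun x => ?_
  rw [← ENNReal.rpow_mul, one_div_mul_cancel hst.ne', ENNReal.rpow_one]

theorem exists_eLpNorm_eLpNorm_slice_le [IsFiniteMeasure μ] [IsFiniteMeasure ν]
    {r₁ r₂ t₁ t₂ : ℝ≥0∞} (h₁ : r₁ ≤ t₁) (h₂ : r₂ ≤ t₂) (hr₁ : 1 ≤ r₁) (hr₂ : 1 ≤ r₂)
    (ht₁ : t₁ ≠ ∞) (ht₂ : t₂ ≠ ∞) : ∃ C : ℝ≥0, ∀ F : α × β → ℝ≥0∞, Measurable F →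
      eLpNorm (fun x => eLpNorm (fun y => F (x, y)) r₂ ν) r₁ μ ≤
        C * eLpNorm (fun x => eLpNorm (fun y => F (x, y)) t₂ ν) t₁ μ := by
  have hexp : ∀ {r t : ℝ≥0∞}, r ≤ t → 1 ≤ r → t ≠ ∞ → 0 ≤ 1 / r.toReal - 1 / t.toReal := by
    intro r t hrt hr ht
    have h1 : 0 < r.toReal := ENNReal.toReal_pos (zero_lt_one.trans_le hr).ne' (hrt.trans_lt ht.lt_top).ne
    exact sub_nonneg.2 (one_div_le_one_div_of_le h1 (ENNReal.toReal_mono ht hrt))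
  set c₁ := μ Set.univ ^ (1 / r₁.toReal - 1 / t₁.toReal) with hc₁
  set c₂ := ν Set.univ ^ (1 / r₂.toReal - 1 / t₂.toReal) with hc₂
  have f₁ : c₁ ≠ ∞ := ENNReal.rpow_ne_top_of_nonneg (hexp h₁ hr₁ ht₁) (measure_ne_top _ _)
  have f₂ : c₂ ≠ ∞ := ENNReal.rpow_ne_top_of_nonneg (hexp h₂ hr₂ ht₂) (measure_ne_top _ _)
  refine ⟨(c₁ * c₂).toNNReal, fun F hF => ?_⟩
  rw [ENNReal.coe_toNNReal (ENNReal.mul_ne_top f₁ f₂)]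
  have ht₂0 : t₂ ≠ 0 := (zero_lt_one.trans_le (hr₂.trans h₂)).ne'
  have hm := measurable_eLpNorm_slice (ν := ν) ht₂0 ht₂ (f := F) hF
  calc eLpNorm (fun x => eLpNorm (fun y => F (x, y)) r₂ ν) r₁ μ
      ≤ c₂ * eLpNorm (fun x => eLpNorm (fun y => F (x, y)) t₂ ν) r₁ μ := by
        refine eLpNorm_le_mul_eLpNorm_of_ae_le_mul'' _ ?_ (Eventually.of_forall fun x => ?_)
        · exact hm.aestronglyMeasurable
        simp only [enorm_eq_self]
        rw [mul_comm]
        exact eLpNorm_le_eLpNorm_mul_rpow_measure_univ h₂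
          (hF.comp measurable_prodMk_left).aestronglyMeasurable
    _ ≤ c₂ * (eLpNorm (fun x => eLpNorm (fun y => F (x, y)) t₂ ν) t₁ μ * c₁) := by
        gcongr
        exact eLpNorm_le_eLpNorm_mul_rpow_measure_univ h₁ hm.aestronglyMeasurable
    _ = _ := by ring

theorem lintegral_mul_le_eLpNorm_mul {s t : ℝ} (hst : s.HolderConjugate t) {F G : α → ℝ≥0∞}
    (hF : Measurable F) (hG : Measurable G) :
    ∫⁻ x, F x * G x ∂μ ≤ eLpNorm F (ENNReal.ofReal s) μ * eLpNorm G (ENNReal.ofReal t) μ := by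
  rw [eLpNorm_eq_lintegral_rpow_enorm_toReal (by simpa using hst.pos) ENNReal.ofReal_ne_top,
    eLpNorm_eq_lintegral_rpow_enorm_toReal (by simpa using hst.symm.pos) ENNReal.ofReal_ne_top,
    ENNReal.toReal_ofReal hst.nonneg, ENNReal.toReal_ofReal hst.symm.nonneg]
  simp only [enorm_eq_self]
  exact ENNReal.lintegral_mul_le_Lp_mul_Lq μ hst hF.aemeasurable hG.aemeasurable

end FiniteMeasure

/-! ### Kernels in `L^s` of a product set of finite measure -/

section Compact

variable {m n : ℕ} {p₁ p₂ q₁ q₂ : ℝ≥0∞} {V₁ : Set (Rn m)} {V₂ : Set (Rn n)}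

theorem mixedNorm_indicator (hV₁ : MeasurableSet V₁) (hV₂ : MeasurableSet V₂)
    (F : Rn m × Rn n → ℝ≥0∞) : mixedNorm p₁ p₂ ((V₁ ×ˢ V₂).indicator F) =
      eLpNorm (fun x => eLpNorm (fun y => F (x, y)) p₂ (volume.restrict V₂)) p₁
        (volume.restrict V₁) := by
  rw [mixedNorm, ← eLpNorm_indicator_eq_eLpNorm_restrict hV₁]
  congr 1
  ext x
  by_cases hx : x ∈ V₁
  · rw [Set.indicator_of_mem hx, ← eLpNorm_indicator_eq_eLpNorm_restrict hV₂]
    congr 1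
    ext y
    by_cases hy : y ∈ V₂ <;> simp [Set.indicator, hx, hy]
  · rw [Set.indicator_of_notMem hx]
    simp [Set.indicator, hx]

theorem exists_mixedNorm_indicator_le (hV₁ : MeasurableSet V₁) (hV₂ : MeasurableSet V₂)
    (hV₁f : volume V₁ ≠ ∞) (hV₂f : volume V₂ ≠ ∞) {s : ℝ≥0∞} (hs : s ≠ ∞)
    (hq₁ : 1 ≤ q₁) (hq₂ : 1 ≤ q₂) (h₁ : q₁ ≤ s) (h₂ : q₂ ≤ s) :
    ∃ C : ℝ≥0, ∀ F : Rn m × Rn n → ℝ≥0∞, Measurable F →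
      mixedNorm q₁ q₂ ((V₁ ×ˢ V₂).indicator F) ≤
        C * eLpNorm F s (volume.restrict (V₁ ×ˢ V₂)) := by
  have : IsFiniteMeasure (volume.restrict V₁) := ⟨by simpa using hV₁f.lt_top⟩
  have : IsFiniteMeasure (volume.restrict V₂) := ⟨by simpa using hV₂f.lt_top⟩
  obtain ⟨C, hC⟩ := exists_eLpNorm_eLpNorm_slice_le (μ := volume.restrict V₁)
    (ν := volume.restrict V₂) h₁ h₂ hq₁ hq₂ hs hs
  refine ⟨C, fun F hF => ?_⟩
  have := hC F hF
  rwa [eLpNorm_eLpNorm_slice (zero_lt_one.trans_le (hq₁.trans h₁)).ne' hs hF,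
    Measure.prod_restrict, ← mixedNorm_indicator hV₁ hV₂] at this

theorem exists_eLpNorm_restrict_le_mixedNorm (hV₁ : MeasurableSet V₁) (hV₂ : MeasurableSet V₂)
    (hV₁f : volume V₁ ≠ ∞) (hV₂f : volume V₂ ≠ ∞) {s : ℝ≥0∞} (hs : 1 ≤ s)
    (hp₁ : p₁ ≠ ∞) (hp₂ : p₂ ≠ ∞) (h₁ : s ≤ p₁) (h₂ : s ≤ p₂) :
    ∃ C : ℝ≥0, ∀ F : Rn m × Rn n → ℝ≥0∞, Measurable F →
      eLpNorm F s (volume.restrict (V₁ ×ˢ V₂)) ≤ C * mixedNorm p₁ p₂ F := by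
  have : IsFiniteMeasure (volume.restrict V₁) := ⟨by simpa using hV₁f.lt_top⟩
  have : IsFiniteMeasure (volume.restrict V₂) := ⟨by simpa using hV₂f.lt_top⟩
  obtain ⟨C, hC⟩ := exists_eLpNorm_eLpNorm_slice_le (μ := volume.restrict V₁)
    (ν := volume.restrict V₂) h₁ h₂ hs hs hp₁ hp₂
  refine ⟨C, fun F hF => ?_⟩
  have := hC F hF
  rw [eLpNorm_eLpNorm_slice (zero_lt_one.trans_le hs).ne' (h₁.trans_lt hp₁.lt_top).ne hF,
    Measure.prod_restrict, ← mixedNorm_indicator hV₁ hV₂] at this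
  refine this.trans ?_
  gcongr
  refine eLpNorm_mono_enorm fun x => ?_
  simp only [enorm_eq_self]
  refine eLpNorm_mono_enorm fun y => ?_
  simp only [enorm_eq_self]
  exact Set.indicator_le_self _ _ _

/-- A single pair of conjugate exponents is to serve both variables at once. With t close enough to
1, here t ≤ 1 + 1/(q₁+q₂+1), its conjugate exceeds q₁ + q₂. -/
theorem exists_holderConjugate_exponents (hp₁ : 1 < p₁) (hp₂ : 1 < p₂) (hp₁' : p₁ ≠ ∞)
    (hp₂' : p₂ ≠ ∞) (hq₁ : q₁ ≠ ∞) (hq₂ : q₂ ≠ ∞) : ∃ s t : ℝ, s.HolderConjugate t ∧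
      q₁ ≤ ENNReal.ofReal s ∧ q₂ ≤ ENNReal.ofReal s ∧
      ENNReal.ofReal t ≤ p₁ ∧ ENNReal.ofReal t ≤ p₂ := by
  have a₁ : 1 < p₁.toReal := by
    rwa [← ENNReal.toReal_one, ENNReal.toReal_lt_toReal ENNReal.one_ne_top hp₁']
  have a₂ : 1 < p₂.toReal := by
    rwa [← ENNReal.toReal_one, ENNReal.toReal_lt_toReal ENNReal.one_ne_top hp₂']
  set t := min p₁.toReal (min p₂.toReal (1 + 1 / (q₁.toReal + q₂.toReal + 1))) with ht
  have hq0 : 0 < q₁.toReal + q₂.toReal + 1 := by positivity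
  have ht1 : 1 < t := lt_min a₁ (lt_min a₂ (lt_add_of_pos_right _ (by positivity)))
  have hc := Real.HolderConjugate.conjExponent ht1
  have hs : q₁.toReal + q₂.toReal ≤ t.conjExponent := by
    have h1 : t ≤ 1 + 1 / (q₁.toReal + q₂.toReal + 1) := (min_le_right _ _).trans (min_le_right _ _)
    rw [Real.conjExponent, le_div_iff₀ (by linarith)]
    have h2 : (q₁.toReal + q₂.toReal + 1) * (t - 1) ≤ 1 := by
      rw [← le_div_iff₀' hq0]; linarith
    nlinarith
  refine ⟨t.conjExponent, t, hc.symm, ?_, ?_, ?_, ?_⟩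
  · rw [ENNReal.le_ofReal_iff_toReal_le hq₁ hc.symm.nonneg]
    linarith [ENNReal.toReal_nonneg (a := q₂)]
  · rw [ENNReal.le_ofReal_iff_toReal_le hq₂ hc.symm.nonneg]
    linarith [ENNReal.toReal_nonneg (a := q₁)]
  · exact ENNReal.ofReal_le_of_le_toReal (min_le_left _ _)
  · exact ENNReal.ofReal_le_of_le_toReal ((min_le_right _ _).trans (min_le_left _ _))

/-- Hölder's inequality in y with the exponents s and t bounds the integral by the `L^s` norm of the
kernel in y times the `L^t` norm of the function. Finiteness of the measure compares these with the
mixed norms, as t lies below p₁, p₂ and s above q₁, q₂. -/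
theorem exists_mixedBound_indicator (hV₁ : MeasurableSet V₁) (hV₂ : MeasurableSet V₂)
    (hV₁f : volume V₁ ≠ ∞) (hV₂f : volume V₂ ≠ ∞)
    (hp₁ : 1 < p₁) (hp₂ : 1 < p₂) (hp₁' : p₁ ≠ ∞) (hp₂' : p₂ ≠ ∞)
    (hq₁ : 1 ≤ q₁) (hq₂ : 1 ≤ q₂) (hq₁' : q₁ ≠ ∞) (hq₂' : q₂ ≠ ∞) :
    ∃ (s : ℝ≥0∞) (C : ℝ≥0), s ≠ 0 ∧ s ≠ ∞ ∧
      ∀ g : (Rn m × Rn n) × (Rn m × Rn n) → ℂ, Measurable g →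
      MixedBound (((V₁ ×ˢ V₂) ×ˢ (V₁ ×ˢ V₂)).indicator g) p₁ p₂ q₁ q₂
        (C * eLpNorm g s ((volume.restrict (V₁ ×ˢ V₂)).prod (volume.restrict (V₁ ×ˢ V₂)))) := by
  obtain ⟨s, t, hst, h1, h2, h3, h4⟩ :=
    exists_holderConjugate_exponents hp₁ hp₂ hp₁' hp₂' hq₁' hq₂'
  have hs0 : ENNReal.ofReal s ≠ 0 := by simpa using hst.pos
  have hs : ENNReal.ofReal s ≠ ∞ := ENNReal.ofReal_ne_top
  obtain ⟨C₁, hC₁⟩ := exists_mixedNorm_indicator_le hV₁ hV₂ hV₁f hV₂f hs hq₁ hq₂ h1 h2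
  obtain ⟨C₂, hC₂⟩ := exists_eLpNorm_restrict_le_mixedNorm hV₁ hV₂ hV₁f hV₂f
    (by simpa using hst.symm.lt.le) hp₁' hp₂' h3 h4
  refine ⟨ENNReal.ofReal s, C₁ * C₂, hs0, hs, fun g hg => ⟨hg.indicator
    ((hV₁.prod hV₂).prod (hV₁.prod hV₂)), fun F hF => ?_⟩⟩
  set W := V₁ ×ˢ V₂ with hW
  have hWm : MeasurableSet W := hV₁.prod hV₂
  set N := eLpNorm F (ENNReal.ofReal t) (volume.restrict W) with hN
  set J : Rn m × Rn n → ℝ≥0∞ := fun x =>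
    eLpNorm (fun y => ‖g (x, y)‖ₑ) (ENNReal.ofReal s) (volume.restrict W) with hJ
  have hJm : Measurable J := measurable_eLpNorm_slice hs0 hs (f := fun z => ‖g z‖ₑ) hg.enorm
  have hle : ∀ x, ∫⁻ y, ‖(W ×ˢ W).indicator g (x, y)‖ₑ * F y ≤ W.indicator (fun x => N * J x) x := by
    intro x
    by_cases hx : x ∈ W
    · rw [Set.indicator_of_mem hx]
      have e : ∀ y, ‖(W ×ˢ W).indicator g (x, y)‖ₑ * F y =
          W.indicator (fun y => ‖g (x, y)‖ₑ * F y) y := fun y => by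
        by_cases hy : y ∈ W
        · rw [Set.indicator_of_mem (Set.mk_mem_prod hx hy), Set.indicator_of_mem hy]
        · rw [Set.indicator_of_notMem (fun h => hy h.2), Set.indicator_of_notMem hy, enorm_zero,
            zero_mul]
      rw [lintegral_congr e, lintegral_indicator hWm, mul_comm]
      exact lintegral_mul_le_eLpNorm_mul hst (hg.comp measurable_prodMk_left).enorm hF
    · rw [Set.indicator_of_notMem hx]
      refine le_of_eq (lintegral_eq_zero_of_ae_eq_zero (Eventually.of_forall fun y => ?_))
      change ‖(W ×ˢ W).indicator g (x, y)‖ₑ * F y = 0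
      rw [Set.indicator_of_notMem (fun h => hx h.1), enorm_zero, zero_mul]
  calc mixedNorm q₁ q₂ (fun x => ∫⁻ y, ‖(W ×ˢ W).indicator g (x, y)‖ₑ * F y)
      ≤ mixedNorm q₁ q₂ (W.indicator fun x => N * J x) :=
        mixedNorm_mono_ae (Eventually.of_forall hle)
    _ ≤ C₁ * eLpNorm (fun x => N * J x) (ENNReal.ofReal s) (volume.restrict W) :=
        hC₁ _ (hJm.const_mul N)
    _ ≤ C₁ * (N * eLpNorm J (ENNReal.ofReal s) (volume.restrict W)) := by
        gcongr
        refine eLpNorm_le_mul_eLpNorm_of_ae_le_mul'' _ hJm.aestronglyMeasurable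
          (Eventually.of_forall fun x => ?_)
        simp only [enorm_eq_self]; rfl
    _ = C₁ * (N * eLpNorm g (ENNReal.ofReal s) ((volume.restrict W).prod (volume.restrict W))) := by
        rw [hJ, eLpNorm_eLpNorm_slice hs0 hs hg.enorm, eLpNorm_enorm]
    _ ≤ C₁ * ((C₂ * mixedNorm p₁ p₂ F) *
          eLpNorm g (ENNReal.ofReal s) ((volume.restrict W).prod (volume.restrict W))) := by
        gcongr; exact hC₂ F hF
    _ = _ := by push_cast; ring

end Compact

end BiCommutator

namespace BiCommutator

open Filter Topology Metric

/-! ### Compactness of integral operators -/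

section CompactKernel

theorem isCompactOperator_of_forall_mem_span {E E' : Type*} [NormedAddCommGroup E]
    [NormedSpace ℂ E] [NormedAddCommGroup E'] [NormedSpace ℂ E'] {S : E →L[ℂ] E'} {G : E'}
    (h : ∀ F, S F ∈ Submodule.span ℂ {G}) : IsCompactOperator S := by
  have : ProperSpace (Submodule.span ℂ {G}) := FiniteDimensional.proper ℂ _
  exact (isCompactOperator_of_locallyCompactSpace_dom
    (S.codRestrict (Submodule.span ℂ {G}) h)).clm_comp (Submodule.span ℂ {G}).subtypeL

variable {m n : ℕ} {p₁ p₂ q₁ q₂ : ℝ≥0∞} {V₁ : Set (Rn m)} {V₂ : Set (Rn n)}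
  [Fact (1 ≤ p₁)] [Fact (1 ≤ p₂)] [Fact (1 ≤ q₁)] [Fact (1 ≤ q₂)]

/-- The operator has rank at most one: f goes to the integral of f over W ∩ B times the indicator of
W ∩ A, where W = V₁ × V₂. -/
theorem isCompactOperator_of_rectangle (hV₁ : MeasurableSet V₁) (hV₂ : MeasurableSet V₂)
    (hV₁f : volume V₁ ≠ ∞) (hV₂f : volume V₂ ≠ ∞) (hp₂ : p₂ ≠ ∞) (hq₁ : q₁ ≠ ∞) (hq₂ : q₂ ≠ ∞)
    {A B : Set (Rn m × Rn n)} (hA : MeasurableSet A)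
    {S : MixedLp m n p₁ p₂ →L[ℂ] MixedLp m n q₁ q₂}
    (hS : IsKernelOperator (((V₁ ×ˢ V₂) ×ˢ (V₁ ×ˢ V₂)).indicator ((A ×ˢ B).indicator 1)) S) :
    IsCompactOperator S := by
  set W := V₁ ×ˢ V₂ with hW
  have hWm : MeasurableSet W := hV₁.prod hV₂
  have : IsFiniteMeasure (volume.restrict W) := ⟨by
    rw [Measure.restrict_apply_univ, hW, Measure.volume_eq_prod, Measure.prod_prod]
    exact ENNReal.mul_lt_top hV₁f.lt_top hV₂f.lt_top⟩
  set a : Rn m × Rn n → ℂ := (W ∩ A).indicator 1 with ha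
  obtain ⟨C, hC⟩ := exists_mixedNorm_indicator_le hV₁ hV₂ hV₁f hV₂f (max_lt hq₁.lt_top hq₂.lt_top).ne
    (Fact.out (p := 1 ≤ q₁)) (Fact.out (p := 1 ≤ q₂)) (le_max_left q₁ q₂) (le_max_right q₁ q₂)
  have hfin : mixedNorm q₁ q₂ (fun z => ‖a z‖ₑ) < ∞ := by
    calc mixedNorm q₁ q₂ (fun z => ‖a z‖ₑ) ≤ mixedNorm q₁ q₂ (W.indicator 1) := by
          refine mixedNorm_mono_ae (Eventually.of_forall fun z => ?_)
          by_cases h1 : z ∈ W <;> by_cases h2 : z ∈ A <;> simp [ha, h1, h2]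
      _ ≤ C * eLpNorm 1 (max q₁ q₂) (volume.restrict W) := hC 1 measurable_one
      _ < ∞ := by
          refine ENNReal.mul_lt_top ENNReal.coe_lt_top ?_
          have := (memLp_const (μ := volume.restrict W) (p := max q₁ q₂) (1 : ℂ)).2
          refine lt_of_eq_of_lt (eLpNorm_congr_enorm_ae (Eventually.of_forall fun z => ?_)) this
          simp
  obtain ⟨G, hG⟩ := exists_represents_of_mixedNorm_lt_top hq₁ hq₂
    ((measurable_one.indicator (hWm.inter hA)).aestronglyMeasurable) hfin
  refine isCompactOperator_of_forall_mem_span (G := G) fun F => ?_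
  obtain ⟨f, hf⟩ := exists_represents hp₂ F
  have h1 := (hS f F hf).2
  set c : ℂ := ∫ y, (W ∩ B).indicator 1 y * f y with hc
  have h2 : kernelOp ((W ×ˢ W).indicator ((A ×ˢ B).indicator 1)) f = c • a := by
    ext x
    rw [Pi.smul_apply, smul_eq_mul, hc, ← integral_mul_const, kernelOp]
    refine integral_congr_ae (Eventually.of_forall fun y => ?_)
    by_cases x1 : x ∈ W <;> by_cases x2 : x ∈ A <;> by_cases y1 : y ∈ W <;> by_cases y2 : y ∈ B <;>
      simp [ha, Set.indicator, x1, x2, y1, y2]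
  rw [h2] at h1
  rw [h1.unique (hG.smul c)]
  exact Submodule.smul_mem _ _ (Submodule.mem_span_singleton_self G)

/-- The kernels giving compact operators form a linear class that is closed for the `L^s` norm and
contains the indicators of rectangles, hence it contains every bounded measurable kernel on a set of
finite measure. -/
theorem isCompactOperator_of_memLp_kernel (hV₁ : MeasurableSet V₁) (hV₂ : MeasurableSet V₂)
    (hV₁f : volume V₁ ≠ ∞) (hV₂f : volume V₂ ≠ ∞)
    (hp₁ : 1 < p₁) (hp₂ : 1 < p₂) (hp₁' : p₁ ≠ ∞) (hp₂' : p₂ ≠ ∞) (hq₁ : q₁ ≠ ∞) (hq₂ : q₂ ≠ ∞)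
    {g : (Rn m × Rn n) × (Rn m × Rn n) → ℂ} (hg : Measurable g) {M : ℝ} (hgM : ∀ z, ‖g z‖ ≤ M)
    {S : MixedLp m n p₁ p₂ →L[ℂ] MixedLp m n q₁ q₂}
    (hS : IsKernelOperator (((V₁ ×ˢ V₂) ×ˢ (V₁ ×ˢ V₂)).indicator g) S) :
    IsCompactOperator S := by
  obtain ⟨s, C, hs0, hs, hC⟩ := exists_mixedBound_indicator hV₁ hV₂ hV₁f hV₂f hp₁ hp₂ hp₁' hp₂'
    (Fact.out (p := 1 ≤ q₁)) (Fact.out (p := 1 ≤ q₂)) hq₁ hq₂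
  set W := V₁ ×ˢ V₂ with hW
  set μ := (volume.restrict W : Measure (Rn m × Rn n)) with hμ
  have : IsFiniteMeasure μ := ⟨by
    rw [hμ, Measure.restrict_apply_univ, hW, Measure.volume_eq_prod, Measure.prod_prod]
    exact ENNReal.mul_lt_top hV₁f.lt_top hV₂f.lt_top⟩
  have hex : ∀ {g}, Measurable g → MemLp g s (μ.prod μ) →
      ∃ S : MixedLp m n p₁ p₂ →L[ℂ] MixedLp m n q₁ q₂, IsKernelOperator ((W ×ˢ W).indicator g) S :=
    fun hg hgm => (hC _ hg).exists_clm (ENNReal.mul_lt_top ENNReal.coe_lt_top hgm.2).ne hp₂' hq₁ hq₂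
  have hind_sub : ∀ g g' : (Rn m × Rn n) × (Rn m × Rn n) → ℂ,
      (W ×ˢ W).indicator g - (W ×ˢ W).indicator g' = (W ×ˢ W).indicator (g - g') := fun g g' =>
    (Set.indicator_sub' _ g g').symm
  -- Kernels equal almost everywhere give the same operator, because their difference has `L^s` norm
  -- 0.
  have huniq : ∀ {g g'}, Measurable g → Measurable g' → g =ᵐ[μ.prod μ] g' →
      ∀ {S S' : MixedLp m n p₁ p₂ →L[ℂ] MixedLp m n q₁ q₂},
      IsKernelOperator ((W ×ˢ W).indicator g) S → IsKernelOperator ((W ×ˢ W).indicator g') S' →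
      S = S' := by
    intro g g' hg hg' h S S' hS hS'
    have h1 := hS.sub hS'
    rw [hind_sub] at h1
    have h2 := hC _ (hg.sub hg')
    have h3 : eLpNorm (g - g') s (μ.prod μ) = 0 := by
      rw [eLpNorm_congr_ae (h.mono fun z hz => by
        show (g - g') z = (0 : (Rn m × Rn n) × (Rn m × Rn n) → ℂ) z
        rw [Pi.sub_apply, hz, sub_self, Pi.zero_apply]), eLpNorm_zero]
    rw [h3, mul_zero] at h2
    have h4 := h1.norm_le hp₂' h2 ENNReal.zero_ne_top
    rw [ENNReal.toReal_zero] at h4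
    exact sub_eq_zero.1 (norm_le_zero_iff.1 h4)
  -- Members of `L^s` are only almost everywhere measurable, whereas kernels are required to be
  -- measurable; the property is therefore stated for all measurable versions and all their
  -- operators.
  refine memLp_induction_of_isPiSystem (μ := μ.prod μ) (s := s)
    (𝒮 := Set.image2 (· ×ˢ ·) {s : Set (Rn m × Rn n) | MeasurableSet s} {t | MeasurableSet t})
    (P := fun g => ∀ g', Measurable g' → g' =ᵐ[μ.prod μ] g →
      ∀ S : MixedLp m n p₁ p₂ →L[ℂ] MixedLp m n q₁ q₂, IsKernelOperator ((W ×ˢ W).indicator g') S →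
      IsCompactOperator S) hs0 hs generateFrom_prod.symm isPiSystem_prod
    ⟨Set.univ, by simp, Set.univ, by simp, Set.univ_prod_univ⟩ ?_ ?_ ?_ ?_
    (f := g) ?_ g hg (ae_eq_refl g) S hS
  · rintro _ ⟨A, hA, B, hB, rfl⟩ g' hg' hg'A S hS
    have hA : MeasurableSet A := hA
    have hB : MeasurableSet B := hB
    have hm : Measurable ((A ×ˢ B).indicator (1 : (Rn m × Rn n) × (Rn m × Rn n) → ℂ)) :=
      measurable_one.indicator (hA.prod hB)
    obtain ⟨S', hS'⟩ := hex hm ((memLp_const (1 : ℂ)).indicator (hA.prod hB))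
    rw [huniq hg' hm hg'A hS hS']
    exact isCompactOperator_of_rectangle hV₁ hV₂ hV₁f hV₂f hp₂' hq₁ hq₂ hA hS'
  · intro f₁ f₂ hf₁ hf₂ P₁ P₂ g' hg' hgf S hS
    have m₁ := hf₁.1.stronglyMeasurable_mk.measurable
    have m₂ := hf₂.1.stronglyMeasurable_mk.measurable
    obtain ⟨S₁, hS₁⟩ := hex m₁ (hf₁.ae_eq hf₁.1.ae_eq_mk)
    obtain ⟨S₂, hS₂⟩ := hex m₂ (hf₂.ae_eq hf₂.1.ae_eq_mk)
    have hadd := hS₁.add hS₂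
    rw [← Set.indicator_add'] at hadd
    rw [huniq hg' (m₁.add m₂) (hgf.trans (hf₁.1.ae_eq_mk.add hf₂.1.ae_eq_mk)) hS hadd]
    exact (P₁ _ m₁ hf₁.1.ae_eq_mk.symm _ hS₁).add (P₂ _ m₂ hf₂.1.ae_eq_mk.symm _ hS₂)
  · intro c f hf Pf g' hg' hgf S hS
    have m₁ := hf.1.stronglyMeasurable_mk.measurable
    obtain ⟨S₁, hS₁⟩ := hex m₁ (hf.ae_eq hf.1.ae_eq_mk)
    have hsm := hS₁.smul c
    have hcs : c • (W ×ˢ W).indicator (hf.1.mk f) = (W ×ˢ W).indicator (c • hf.1.mk f) :=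
      (Set.indicator_const_smul _ c _).symm
    rw [hcs] at hsm
    rw [huniq hg' (m₁.const_smul c) (hgf.trans (hf.1.ae_eq_mk.const_smul c)) hS hsm]
    exact (Pf _ m₁ hf.1.ae_eq_mk.symm _ hS₁).smul c
  · intro f hf happ g' hg' hgf S hS
    refine hS.isCompactOperator_of_approx hp₂' fun ε hε => ?_
    obtain ⟨f₁, hf₁, hle, P₁⟩ := happ (ENNReal.ofReal ε / (C + 1)) (by
      simp [ENNReal.div_eq_zero_iff, hε])
    have m₁ := hf₁.1.stronglyMeasurable_mk.measurable
    obtain ⟨S₁, hS₁⟩ := hex m₁ (hf₁.ae_eq hf₁.1.ae_eq_mk)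
    refine ⟨_, _, S₁, hS₁, P₁ _ m₁ hf₁.1.ae_eq_mk.symm _ hS₁, by
      rw [hind_sub]; exact hC _ (hg'.sub m₁), ?_⟩
    rw [eLpNorm_congr_ae (hgf.sub hf₁.1.ae_eq_mk.symm)]
    calc (C : ℝ≥0∞) * eLpNorm (f - f₁) s (μ.prod μ)
        ≤ (C + 1) * (ENNReal.ofReal ε / (C + 1)) := by gcongr; exact le_self_add
      _ = ENNReal.ofReal ε := ENNReal.mul_div_cancel (by simp) (by finiteness)
  · exact MemLp.of_bound hg.aestronglyMeasurable M (Eventually.of_forall hgM)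

/-- Away from the set E of moderate separations and bounded x, the kernel is ε times a kernel
bounded by the mixed Hardy–Littlewood–Sobolev inequality. On E the Riesz kernels are bounded, so the
truncated kernel gives a compact operator. -/
theorem exists_isCompactOperator_of_riesz (hm : 0 < m) (hn : 0 < n) {β₁ β₂ : ℝ} (hβ₁n : β₁ < m) (hβ₂n : β₂ < n)
    (hp₁ : 1 < p₁) (hpq₁ : p₁ < q₁) (hq₁ : q₁ < ∞) (hβ₁ : β₁ / m = 1 / p₁.toReal - 1 / q₁.toReal)
    (hp₂ : 1 < p₂) (hpq₂ : p₂ < q₂) (hq₂ : q₂ < ∞) (hβ₂ : β₂ / n = 1 / p₂.toReal - 1 / q₂.toReal)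
    {k : (Rn m × Rn n) × (Rn m × Rn n) → ℂ} (hk : Measurable k) {C : ℝ≥0}
    (hkC : ∀ x y, ‖k (x, y)‖ₑ ≤ C * (riesz β₁ x.1 y.1 * riesz β₂ x.2 y.2))
    (happ : ∀ ε : ℝ≥0, 0 < ε → ∃ R : ℝ, 1 ≤ R ∧ ∀ x y, (‖x.1 - y.1‖ < R⁻¹ ∨ R < ‖x.1 - y.1‖ ∨
      ‖x.2 - y.2‖ < R⁻¹ ∨ R < ‖x.2 - y.2‖ ∨ R < ‖x‖) →
      ‖k (x, y)‖ₑ ≤ ε * (riesz β₁ x.1 y.1 * riesz β₂ x.2 y.2)) :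
    ∃ S : MixedLp m n p₁ p₂ →L[ℂ] MixedLp m n q₁ q₂, IsKernelOperator k S ∧ IsCompactOperator S := by
  obtain ⟨H, hH⟩ := exists_mixed_hls hm hn hp₁ hpq₁ hq₁ hβ₁ hp₂ hpq₂ hq₂ hβ₂
  have hp₁' : p₁ ≠ ∞ := (hpq₁.trans hq₁).ne
  have hp₂' : p₂ ≠ ∞ := (hpq₂.trans hq₂).ne
  have hbound : ∀ {k' : (Rn m × Rn n) × (Rn m × Rn n) → ℂ} {A : ℝ≥0}, Measurable k' →
      (∀ x y, ‖k' (x, y)‖ₑ ≤ A * (riesz β₁ x.1 y.1 * riesz β₂ x.2 y.2)) →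
      MixedBound k' p₁ p₂ q₁ q₂ (A * H) := by
    intro k' A hk' hA
    refine ⟨hk', fun F hF => ?_⟩
    have hm0 : ∀ x : Rn m × Rn n,
        Measurable fun y : Rn m × Rn n => riesz β₁ x.1 y.1 * riesz β₂ x.2 y.2 * F y := fun x =>
      (((measurable_riesz β₁).comp (measurable_const.prodMk measurable_fst)).mul
        ((measurable_riesz β₂).comp (measurable_const.prodMk measurable_snd))).mul hF
    have hm1 : Measurable fun x : Rn m × Rn n => ∫⁻ y, riesz β₁ x.1 y.1 * riesz β₂ x.2 y.2 * F y := by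
      refine Measurable.lintegral_prod_right' (f := fun z : (Rn m × Rn n) × (Rn m × Rn n) =>
        riesz β₁ z.1.1 z.2.1 * riesz β₂ z.1.2 z.2.2 * F z.2) ?_
      exact (((measurable_riesz β₁).comp ((measurable_fst.comp measurable_fst).prodMk
        (measurable_fst.comp measurable_snd))).mul
        ((measurable_riesz β₂).comp ((measurable_snd.comp measurable_fst).prodMk
        (measurable_snd.comp measurable_snd)))).mul (hF.comp measurable_snd)
    have hle : mixedNorm q₁ q₂ (fun x => ∫⁻ y, ‖k' (x, y)‖ₑ * F y) ≤
        A * mixedNorm q₁ q₂ (fun x => ∫⁻ y, riesz β₁ x.1 y.1 * riesz β₂ x.2 y.2 * F y) := by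
      have hpt : ∀ x, ∫⁻ y, ‖k' (x, y)‖ₑ * F y ≤
          A * ∫⁻ y, riesz β₁ x.1 y.1 * riesz β₂ x.2 y.2 * F y := fun x => by
        rw [← lintegral_const_mul _ (hm0 x)]
        refine lintegral_mono fun y => ?_
        simp only
        rw [← mul_assoc]
        gcongr
        exact hA x y
      have hq₂0 : q₂ ≠ 0 := (zero_lt_one.trans (hp₂.trans hpq₂)).ne'
      refine eLpNorm_le_mul_eLpNorm_of_ae_le_mul'' _ ?_ (Eventually.of_forall fun x => ?_)
      · exact (measurable_eLpNorm_slice hq₂0 hq₂.ne (f := fun x : Rn m × Rn n =>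
          ∫⁻ y, riesz β₁ x.1 y.1 * riesz β₂ x.2 y.2 * F y) hm1).aestronglyMeasurable
      · simp only [enorm_eq_self]
        refine eLpNorm_le_mul_eLpNorm_of_ae_le_mul'' _
          (hm1.comp measurable_prodMk_left).aestronglyMeasurable (Eventually.of_forall fun y => ?_)
        simp only [enorm_eq_self]
        exact hpt (x, y)
    refine hle.trans ?_
    rw [mul_assoc]
    gcongr
    exact hH F hF
  obtain ⟨S, hS⟩ := (hbound hk hkC).exists_clm (by finiteness) hp₂' hq₁.ne hq₂.ne
  refine ⟨S, hS, hS.isCompactOperator_of_approx hp₂' fun ε hε => ?_⟩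
  -- Chosen so that ε' times the Hardy–Littlewood–Sobolev constant H is at most ε, also when H = 0.
  set ε' : ℝ≥0 := ε.toNNReal / (H + 1) with hε'
  have hε'0 : 0 < ε' := div_pos (Real.toNNReal_pos.2 hε) (by positivity)
  obtain ⟨R, hR1, hR⟩ := happ ε' hε'0
  have hR0 : 0 < R := by linarith
  set E : Set ((Rn m × Rn n) × (Rn m × Rn n)) := {z | R⁻¹ ≤ ‖z.1.1 - z.2.1‖ ∧ ‖z.1.1 - z.2.1‖ ≤ R ∧
    R⁻¹ ≤ ‖z.1.2 - z.2.2‖ ∧ ‖z.1.2 - z.2.2‖ ≤ R ∧ ‖z.1‖ ≤ R} with hE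
  have hEm : MeasurableSet E := by
    have h1 : Measurable fun z : (Rn m × Rn n) × (Rn m × Rn n) => ‖z.1.1 - z.2.1‖ := by fun_prop
    have h2 : Measurable fun z : (Rn m × Rn n) × (Rn m × Rn n) => ‖z.1.2 - z.2.2‖ := by fun_prop
    have h3 : Measurable fun z : (Rn m × Rn n) × (Rn m × Rn n) => ‖z.1‖ := by fun_prop
    exact (measurableSet_le measurable_const h1).inter ((measurableSet_le h1 measurable_const).inter
      ((measurableSet_le measurable_const h2).inter ((measurableSet_le h2 measurable_const).inter
      (measurableSet_le h3 measurable_const))))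
  set g := E.indicator k with hg
  have hgm : Measurable g := hk.indicator hEm
  -- On E both |x| and |xᵢ−yᵢ| are at most R, so x and y lie in the balls of radius 2R.
  set V₁ : Set (Rn m) := closedBall 0 (2 * R)
  set V₂ : Set (Rn n) := closedBall 0 (2 * R)
  have hsupp : ((V₁ ×ˢ V₂) ×ˢ (V₁ ×ˢ V₂)).indicator g = g := by
    refine Set.indicator_eq_self.2 fun z hz => ?_
    have hzE : z ∈ E := by
      by_contra h
      exact hz (Set.indicator_of_notMem h k)
    obtain ⟨-, h2, -, h4, h5⟩ := hzE
    have a1 := (norm_fst_le z.1).trans h5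
    have a2 := (norm_snd_le z.1).trans h5
    have b1 := norm_le_norm_add_norm_sub z.1.1 z.2.1
    have b2 := norm_le_norm_add_norm_sub z.1.2 z.2.2
    refine ⟨⟨?_, ?_⟩, ?_, ?_⟩ <;> rw [mem_closedBall_zero_iff] <;> linarith
  have hriesz : ∀ {d : ℕ} {β : ℝ}, β < d → ∀ x y : Rn d, R⁻¹ ≤ ‖x - y‖ →
      riesz β x y ≤ ENNReal.ofReal (R⁻¹ ^ (β - d)) := fun hβ x y h =>
    ENNReal.ofReal_le_ofReal (Real.rpow_le_rpow_of_nonpos (by positivity) h (by linarith))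
  have hbd : ∀ z, ‖g z‖ ≤ C * (R⁻¹ ^ (β₁ - m) * R⁻¹ ^ (β₂ - n)) := by
    intro z
    by_cases hz : z ∈ E
    · rw [hg, Set.indicator_of_mem hz, ← ENNReal.ofReal_le_ofReal_iff (by positivity), ofReal_norm]
      refine (hkC z.1 z.2).trans ?_
      rw [ENNReal.ofReal_mul (by positivity), ENNReal.ofReal_coe_nnreal,
        ENNReal.ofReal_mul (by positivity)]
      gcongr
      · exact hriesz hβ₁n _ _ hz.1
      · exact hriesz hβ₂n _ _ hz.2.2.1
    · rw [hg, Set.indicator_of_notMem hz, norm_zero]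
      positivity
  have hgk : ∀ x y, ‖g (x, y)‖ₑ ≤ C * (riesz β₁ x.1 y.1 * riesz β₂ x.2 y.2) := fun x y => by
    refine le_trans ?_ (hkC x y)
    by_cases hz : (x, y) ∈ E
    · rw [hg, Set.indicator_of_mem hz]
    · rw [hg, Set.indicator_of_notMem hz, enorm_zero]; exact zero_le
  obtain ⟨S', hS'⟩ := (hbound hgm hgk).exists_clm (by finiteness) hp₂' hq₁.ne hq₂.ne
  refine ⟨g, _, S', hS', ?_, hbound (A := ε') (hk.sub hgm) fun x y => ?_, ?_⟩
  · rw [← hsupp] at hS'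
    exact isCompactOperator_of_memLp_kernel measurableSet_closedBall measurableSet_closedBall
      measure_closedBall_lt_top.ne measure_closedBall_lt_top.ne hp₁ hp₂ hp₁' hp₂' hq₁.ne hq₂.ne
      hgm hbd hS'
  · by_cases hz : (x, y) ∈ E
    · rw [Pi.sub_apply, hg, Set.indicator_of_mem hz, sub_self, enorm_zero]; exact zero_le
    · rw [Pi.sub_apply, hg, Set.indicator_of_notMem hz, sub_zero]
      refine hR x y ?_
      by_contra! hcon
      exact hz hcon
  · rw [← ENNReal.coe_mul, ENNReal.ofReal, ENNReal.coe_le_coe, hε', div_mul_eq_mul_div,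
      div_le_iff₀ (by positivity)]
    gcongr
    exact le_self_add

end CompactKernel

end BiCommutator

namespace BiCommutator

open Filter Topology Metric

/-! ### From almost every pair of points to a common set of full measure -/

section HolderOffNull

variable {n : ℕ}

/-- A function satisfying a Hölder estimate for almost every pair of points satisfies it off a
null set. -/
theorem exists_holderOffNull_of_ae_prod {B : Rn n → ℂ} (hB : AEStronglyMeasurable B volume)
    {A : ℝ≥0} {β : ℝ} (hβ : 0 < β)
    (h : ∀ᵐ z : Rn n × Rn n ∂(volume.prod volume), ‖B z.1 - B z.2‖ ≤ A * ‖z.1 - z.2‖ ^ β) :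
    ∃ G, HolderOffNull B A β G := by
  have hg : ∀ᵐ y, ∀ᵐ x, ‖B x - B y‖ ≤ A * ‖x - y‖ ^ β := by
    filter_upwards [Measure.ae_ae_of_ae_prod h] with y hy
    filter_upwards [hy] with x hx
    rwa [norm_sub_rev, norm_sub_rev x y]
  have hloc : LocallyIntegrable B volume := by
    obtain ⟨x₀, hx₀⟩ := hg.exists
    rw [locallyIntegrable_iff]
    intro S hS
    obtain ⟨R, hR⟩ := hS.isBounded.exists_norm_le
    have hfin : IsFiniteMeasure (volume.restrict S) := ⟨by simpa using hS.measure_lt_top⟩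
    refine Integrable.of_bound hB.restrict (‖B x₀‖ + A * (|R| + ‖x₀‖) ^ β) ?_
    filter_upwards [ae_restrict_of_ae hx₀, ae_restrict_mem hS.measurableSet] with x hx hxS
    have h2 : ‖x - x₀‖ ^ β ≤ (|R| + ‖x₀‖) ^ β :=
      Real.rpow_le_rpow (norm_nonneg _) ((norm_sub_le _ _).trans
        (add_le_add ((hR x hxS).trans (le_abs_self R)) le_rfl)) hβ.le
    calc ‖B x‖ = ‖B x₀ + (B x - B x₀)‖ := by congr 1; ring
      _ ≤ ‖B x₀‖ + ‖B x - B x₀‖ := norm_add_le _ _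
      _ ≤ _ := by gcongr; exact hx.trans (by gcongr)
  have hleb := IsUnifLocDoublingMeasure.ae_tendsto_average volume hloc 1
  -- The two conditions play different parts: the second point y is fixed with its estimate valid
  -- for almost every z, and averaging over z in small balls around the first point x recovers B(x)
  -- by differentiation.
  refine ⟨{x | Tendsto (fun r : ℝ => ⨍ y in closedBall x r, B y) (𝓝[>] 0) (𝓝 (B x))} ∩
    {y | ∀ᵐ x, ‖B x - B y‖ ≤ A * ‖x - y‖ ^ β}, ?_, hB, ?_⟩
  · filter_upwards [hleb, hg] with x hx hx2
    refine ⟨hx (l := 𝓝[>] (0 : ℝ)) (fun _ => x) (fun r => r) tendsto_id ?_, hx2⟩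
    filter_upwards [self_mem_nhdsWithin] with r hr
    exact mem_closedBall_self (by rw [one_mul]; exact (Set.mem_Ioi.1 hr).le)
  · rintro x ⟨hx, -⟩ y ⟨-, hy⟩
    have hx : Tendsto (fun r : ℝ => ⨍ y in closedBall x r, B y) (𝓝[>] 0) (𝓝 (B x)) := hx
    have hy : ∀ᵐ x, ‖B x - B y‖ ≤ A * ‖x - y‖ ^ β := hy
    have hlim : Tendsto (fun r : ℝ => A * (‖x - y‖ + r) ^ β) (𝓝[>] 0) (𝓝 (A * ‖x - y‖ ^ β)) := by
      have h1 : Tendsto (fun r : ℝ => A * (‖x - y‖ + r) ^ β) (𝓝 0) (𝓝 (A * (‖x - y‖ + 0) ^ β)) :=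
        ((tendsto_const_nhds.add tendsto_id).rpow_const (Or.inr hβ.le)).const_mul _
      rw [add_zero] at h1
      exact h1.mono_left nhdsWithin_le_nhds
    refine le_of_tendsto_of_tendsto (hx.sub_const (B y)).norm hlim ?_
    filter_upwards [self_mem_nhdsWithin] with r hr
    have hr : 0 < r := hr
    have hv : 0 < volume.real (closedBall x r) :=
      ENNReal.toReal_pos (measure_closedBall_pos _ _ hr).ne' measure_closedBall_lt_top.ne
    have hint : IntegrableOn B (closedBall x r) :=
      hloc.integrableOn_isCompact (isCompact_closedBall x r)
    have e : (⨍ z in closedBall x r, B z) - B y =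
        (volume.real (closedBall x r))⁻¹ • ∫ z in closedBall x r, (B z - B y) := by
      rw [integral_sub hint (integrableOn_const measure_closedBall_lt_top.ne), setAverage_eq,
        setIntegral_const, smul_sub, smul_smul, inv_mul_cancel₀ hv.ne', one_smul]
    rw [e, norm_smul, norm_inv, Real.norm_of_nonneg hv.le, inv_mul_le_iff₀ hv, mul_comm]
    refine norm_setIntegral_le_of_norm_le_const_ae measure_closedBall_lt_top ?_
    filter_upwards [ae_restrict_of_ae hy, ae_restrict_mem measurableSet_closedBall] with z hz hzb
    refine hz.trans ?_
    have : ‖z - y‖ ≤ ‖x - y‖ + r := by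
      have h1 := norm_sub_le_norm_sub_add_norm_sub z x y
      rw [← dist_eq_norm z x] at h1
      linarith [mem_closedBall.1 hzb]
    gcongr

end HolderOffNull

/-! ### The symbol and the kernel of the bi-commutator -/

section Symbol

variable {m n : ℕ} {b : Rn m × Rn n → ℂ} {G : Set (Rn m × Rn n)} {M : ℝ≥0} {β₁ β₂ : ℝ}

/-- The second differences of `b` satisfy a product Hölder estimate off a null set. -/
structure RectHolder (b : Rn m × Rn n → ℂ) (G : Set (Rn m × Rn n)) (M : ℝ≥0) (β₁ β₂ : ℝ) :
    Prop where
  measurable : Measurable b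
  measurableSet : MeasurableSet G
  ae_mem : ∀ᵐ z, z ∈ G
  norm_le : ∀ x y, CornersIn G x y →
    ‖secondDiff b x y‖ ≤ M * (‖x.1 - y.1‖ ^ β₁ * ‖x.2 - y.2‖ ^ β₂)

/-- The symbol itself need not be Hölder in the second variable. Its increments in the first
variable are, since their increments are second differences; the Hölder constant gains the factor
|x−y|^β₁. -/
theorem RectHolder.holderOffNull (hb : RectHolder b G M β₁ β₂) {x y : Rn m}
    (hx : ∀ᵐ z : Rn n, (x, z) ∈ G) (hy : ∀ᵐ z : Rn n, (y, z) ∈ G) :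
    HolderOffNull (fun z => b (y, z) - b (x, z)) (M * (‖x - y‖₊ ^ β₁)) β₂
      {z | (x, z) ∈ G ∧ (y, z) ∈ G} := by
  refine ⟨hx.and hy, ((hb.measurable.comp measurable_prodMk_left).sub
    (hb.measurable.comp measurable_prodMk_left)).aestronglyMeasurable, ?_⟩
  rintro z ⟨hz1, hz2⟩ w ⟨hw1, hw2⟩
  have h := hb.norm_le (x, z) (y, w) ⟨hz1, hz2, hw1, hw2⟩
  have e : b (y, z) - b (x, z) - (b (y, w) - b (x, w)) = -secondDiff b (x, z) (y, w) := by
    simp only [secondDiff]; ring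
  rw [e, norm_neg]
  push_cast
  rw [mul_assoc]
  exact h

/-- The kernel of the bi-commutator. -/
noncomputable def bicommutatorKernel (K₁ : Rn m × Rn m → ℂ) (K₂ : Rn n × Rn n → ℂ)
    (b : Rn m × Rn n → ℂ) (G : Set (Rn m × Rn n)) (z : (Rn m × Rn n) × (Rn m × Rn n)) : ℂ :=
  -(K₁ (z.1.1, z.2.1) * K₂ (z.1.2, z.2.2) *
    {z : (Rn m × Rn n) × (Rn m × Rn n) | CornersIn G z.1 z.2}.indicator
      (fun z => secondDiff b z.1 z.2) z)

variable {T₁ : (Rn m → ℂ) → (Rn m → ℂ)} {T₂ : (Rn n → ℂ) → (Rn n → ℂ)}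
  {K₁ : Rn m × Rn m → ℂ} {K₂ : Rn n × Rn n → ℂ} {C₁ C₂ : ℝ≥0}

theorem measurableSet_cornersIn (hG : MeasurableSet G) :
    MeasurableSet {z : (Rn m × Rn n) × (Rn m × Rn n) | CornersIn G z.1 z.2} := by
  have h1 : Measurable fun z : (Rn m × Rn n) × (Rn m × Rn n) => (z.2.1, z.1.2) := by fun_prop
  have h2 : Measurable fun z : (Rn m × Rn n) × (Rn m × Rn n) => (z.1.1, z.2.2) := by fun_prop
  exact (measurable_fst hG).inter ((h1 hG).inter ((h2 hG).inter (measurable_snd hG)))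

theorem measurable_secondDiff (hb : Measurable b) :
    Measurable fun z : (Rn m × Rn n) × (Rn m × Rn n) => secondDiff b z.1 z.2 := by
  unfold secondDiff
  fun_prop

theorem measurable_bicommutatorKernel (hK₁ : Measurable K₁) (hK₂ : Measurable K₂)
    (hb : Measurable b) (hG : MeasurableSet G) : Measurable (bicommutatorKernel K₁ K₂ b G) := by
  have h := (measurable_secondDiff hb).indicator (measurableSet_cornersIn hG)
  unfold bicommutatorKernel
  exact ((((hK₁.comp (by fun_prop)).mul (hK₂.comp (by fun_prop))).mul h)).neg

/-- The kernel vanishes unless all four corners lie in G, so the domination by Riesz kernels holds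
for every pair of points and not merely almost everywhere. -/
theorem enorm_bicommutatorKernel_le (hK₁ : IsKernelOf T₁ K₁ C₁) (hK₂ : IsKernelOf T₂ K₂ C₂)
    (hβ₁ : 0 < β₁) (hβ₁m : β₁ < m) (hβ₂ : 0 < β₂) (hβ₂n : β₂ < n) {x y : Rn m × Rn n} {A : ℝ≥0}
    (h : CornersIn G x y → ‖secondDiff b x y‖ ≤ A * (‖x.1 - y.1‖ ^ β₁ * ‖x.2 - y.2‖ ^ β₂)) :
    ‖bicommutatorKernel K₁ K₂ b G (x, y)‖ₑ ≤
      (A * C₁ * C₂ : ℝ≥0) * (riesz β₁ x.1 y.1 * riesz β₂ x.2 y.2) := by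
  rw [bicommutatorKernel, enorm_neg]
  by_cases hc : CornersIn G x y
  · rw [Set.indicator_of_mem (show (x, y) ∈ {z : (Rn m × Rn n) × (Rn m × Rn n) |
      CornersIn G z.1 z.2} from hc)]
    have h1 := hK₁.enorm_mul_le hβ₁ hβ₁m (A := 1) (x := x.1) (y := y.1)
      (d := ((‖x.1 - y.1‖ ^ β₁ : ℝ) : ℂ)) (by
        rw [Complex.norm_real, Real.norm_of_nonneg (by positivity)]; simp)
    have h2 := hK₂.enorm_mul_le hβ₂ hβ₂n (A := 1) (x := x.2) (y := y.2)
      (d := ((‖x.2 - y.2‖ ^ β₂ : ℝ) : ℂ)) (by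
        rw [Complex.norm_real, Real.norm_of_nonneg (by positivity)]; simp)
    have h3 : ‖secondDiff b x y‖ₑ ≤ A * (‖((‖x.1 - y.1‖ ^ β₁ : ℝ) : ℂ)‖ₑ *
        ‖((‖x.2 - y.2‖ ^ β₂ : ℝ) : ℂ)‖ₑ) := by
      rw [← ofReal_norm, ← ofReal_norm, ← ofReal_norm, Complex.norm_real, Complex.norm_real,
        Real.norm_of_nonneg (by positivity), Real.norm_of_nonneg (by positivity),
        ← ENNReal.ofReal_mul (by positivity), ← ENNReal.ofReal_coe_nnreal,
        ← ENNReal.ofReal_mul (by positivity)]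
      exact ENNReal.ofReal_le_ofReal (h hc)
    rw [enorm_mul] at h1 h2
    rw [enorm_mul, enorm_mul]
    calc ‖K₁ (x.1, y.1)‖ₑ * ‖K₂ (x.2, y.2)‖ₑ * ‖secondDiff b x y‖ₑ
        ≤ ‖K₁ (x.1, y.1)‖ₑ * ‖K₂ (x.2, y.2)‖ₑ * (A * (‖((‖x.1 - y.1‖ ^ β₁ : ℝ) : ℂ)‖ₑ *
          ‖((‖x.2 - y.2‖ ^ β₂ : ℝ) : ℂ)‖ₑ)) := by gcongr
      _ = A * ((‖K₁ (x.1, y.1)‖ₑ * ‖((‖x.1 - y.1‖ ^ β₁ : ℝ) : ℂ)‖ₑ) *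
          (‖K₂ (x.2, y.2)‖ₑ * ‖((‖x.2 - y.2‖ ^ β₂ : ℝ) : ℂ)‖ₑ)) := by ring
      _ ≤ A * ((C₁ * (1 : ℝ≥0) * riesz β₁ x.1 y.1) * (C₂ * (1 : ℝ≥0) * riesz β₂ x.2 y.2)) := by
          gcongr
      _ = _ := by push_cast; ring
  · rw [Set.indicator_of_notMem (show (x, y) ∉ {z : (Rn m × Rn n) × (Rn m × Rn n) |
      CornersIn G z.1 z.2} from hc), mul_zero, enorm_zero]
    exact zero_le

theorem measurable_riesz_right (β : ℝ) (x : Rn n) : Measurable fun y => riesz β x y := by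
  unfold riesz
  fun_prop

/-- The product of Riesz kernels is integrable over bounded sets, locally uniformly in `x`. -/
theorem exists_lintegral_riesz_mul_riesz_le (hβ₁ : 0 < β₁) (hβ₁m : β₁ < m) (hβ₂ : 0 < β₂)
    (hβ₂n : β₂ < n) (R : ℝ) : ∃ D : ℝ≥0, ∀ x : Rn m × Rn n, ‖x‖ ≤ R →
      ∫⁻ y in ball (0 : Rn m) R ×ˢ ball (0 : Rn n) R,
        riesz β₁ x.1 y.1 * riesz β₂ x.2 y.2 ≤ D := by
  obtain ⟨D₁, hD₁, h₁⟩ := exists_lintegral_ball_riesz_le hβ₁ hβ₁m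
  obtain ⟨D₂, hD₂, h₂⟩ := exists_lintegral_ball_riesz_le hβ₂ hβ₂n
  refine ⟨(D₁ * (|R| + |R| + 1) ^ β₁ * (D₂ * (|R| + |R| + 1) ^ β₂)).toNNReal, fun x hx => ?_⟩
  have hsub : ∀ {d : ℕ} (x : Rn d), ‖x‖ ≤ R → ball (0 : Rn d) R ⊆ ball x (|R| + |R| + 1) := by
    intro d x hx y hy
    rw [mem_ball, dist_eq_norm]
    have := norm_sub_le y x
    have h3 := mem_ball_zero_iff.1 hy
    linarith [le_abs_self R]
  have m₁ := measurable_riesz_right β₁ x.1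
  have m₂ := measurable_riesz_right β₂ x.2
  have hprod := lintegral_prod_mul (μ := volume.restrict (ball (0 : Rn m) R))
    (ν := volume.restrict (ball (0 : Rn n) R)) m₁.aemeasurable m₂.aemeasurable
  rw [Measure.prod_restrict, ← Measure.volume_eq_prod] at hprod
  have h₃ := (lintegral_mono_set (hsub x.1 ((norm_fst_le x).trans hx))).trans
    (h₁ x.1 (|R| + |R| + 1) (by positivity))
  have h₄ := (lintegral_mono_set (hsub x.2 ((norm_snd_le x).trans hx))).trans
    (h₂ x.2 (|R| + |R| + 1) (by positivity))
  refine (hprod.trans_le (mul_le_mul' h₃ h₄)).trans_eq ?_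
  rw [← ENNReal.ofReal_mul (by positivity), ENNReal.ofReal]

end Symbol

end BiCommutator

namespace BiCommutator

open Filter Topology Metric

/-! ### The bi-commutator on tensor products -/

section Tensor

variable {m n : ℕ} {b : Rn m × Rn n → ℂ} {G : Set (Rn m × Rn n)} {M : ℝ≥0} {β₁ β₂ : ℝ}
  {T₁ : (Rn m → ℂ) → (Rn m → ℂ)} {T₂ : (Rn n → ℂ) → (Rn n → ℂ)}
  {K₁ : Rn m × Rn m → ℂ} {K₂ : Rn n × Rn n → ℂ} {C₁ C₂ : ℝ≥0} {f₁ : Rn m → ℂ} {f₂ : Rn n → ℂ}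

theorem ae_of_forall_ae_restrict_closedBall {P : Rn m → Prop}
    (h : ∀ N : ℕ, ∀ᵐ x ∂(volume.restrict (closedBall (0 : Rn m) N)), P x) : ∀ᵐ x, P x := by
  have h' : ∀ᵐ x : Rn m, ∀ N : ℕ, x ∈ closedBall (0 : Rn m) N → P x :=
    ae_all_iff.2 fun N => (ae_restrict_iff' measurableSet_closedBall).1 (h N)
  filter_upwards [h'] with x hx
  obtain ⟨N, hN⟩ := exists_nat_ge ‖x‖
  exact hx N (mem_closedBall_zero_iff.2 hN)

theorem MemL2loc.ae_memLp_mul (hb : MemL2loc b) (hf : BoundedCompact f₂) :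
    ∀ᵐ x : Rn m, MemLp (fun y => b (x, y) * f₂ y) 2 volume := by
  refine ae_of_forall_ae_restrict_closedBall fun N => ?_
  have h1 := hb _ ((isCompact_closedBall (0 : Rn m) N).prod hf.2.isCompact)
  rw [Measure.volume_eq_prod, ← Measure.prod_restrict] at h1
  filter_upwards [ae_memLp_slice two_ne_zero ENNReal.ofNat_ne_top h1] with x hx
  have h2 : MemLp (fun y => b (x, y) * f₂ y) 2 (volume.restrict (tsupport f₂)) :=
    (hf.1.restrict _).mul (p := 2) (q := ∞) (r := 2) hx
  rw [← memLp_indicator_iff_restrict (isClosed_tsupport f₂).measurableSet] at h2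
  refine h2.ae_eq (Eventually.of_forall fun y => ?_)
  refine Set.indicator_apply_eq_self.2 fun hy => ?_
  rw [image_eq_zero_of_notMem_tsupport hy, mul_zero]

/-- The function `[b, T₂](1 ⊗ f₂)`. -/
theorem exists_partialCommutator (hT₂ : IsCZO T₂) (hb : Measurable b) (hL : MemL2loc b)
    (hf : BoundedCompact f₂) :
    ∃ c H : Rn m × Rn n → ℂ, Measurable c ∧ ActsSecond T₂ (fun z => b z * f₂ z.2) H ∧
      c =ᵐ[volume] (fun z => b z * T₂ f₂ z.2 - H z) ∧
      ∀ᵐ x : Rn m, MemLp (fun y => b (x, y) * f₂ y) 2 volume ∧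
        (fun y => c (x, y)) =ᵐ[volume]
          fun y => b (x, y) * T₂ f₂ y - T₂ (fun y => b (x, y) * f₂ y) y := by
  have hs := hL.ae_memLp_mul hf
  obtain ⟨H, hH⟩ := exists_actsSecond hT₂ ENNReal.one_lt_two (by simp)
    (f := fun z : Rn m × Rn n => b z * f₂ z.2) (hb.aestronglyMeasurable.mul hf.1.1.comp_snd) hs
  have hTf : AEStronglyMeasurable (T₂ f₂) volume :=
    (hT₂.memLp ENNReal.one_lt_two (by simp) (hf.memLp 2)).1
  have hc : AEStronglyMeasurable (fun z : Rn m × Rn n => b z * T₂ f₂ z.2 - H z) volume :=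
    (hb.aestronglyMeasurable.mul hTf.comp_snd).sub hH.1
  refine ⟨hc.mk _, H, hc.stronglyMeasurable_mk.measurable, hH, hc.ae_eq_mk.symm, ?_⟩
  filter_upwards [hs, hH.2, Measure.ae_ae_of_ae_prod hc.ae_eq_mk] with x h1 h2 h3
  refine ⟨h1, ?_⟩
  filter_upwards [h2.2, h3] with y h4 h5
  rw [← h5, h4]

theorem measurable_commutatorIntegral_diff (hK₂ : Measurable K₂) (hb : Measurable b)
    (hf : Measurable f₂) :
    Measurable fun w : Rn n × (Rn m × Rn m) =>
      commutatorIntegral K₂ (fun y => b (w.2.2, y) - b (w.2.1, y)) f₂ w.1 := by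
  unfold commutatorIntegral
  have : Measurable fun z : (Rn n × (Rn m × Rn m)) × Rn n =>
      K₂ (z.1.1, z.2) * ((b (z.1.2.2, z.2) - b (z.1.2.1, z.2)) -
        (b (z.1.2.2, z.1.1) - b (z.1.2.1, z.1.1))) * f₂ z.2 := by fun_prop
  exact this.stronglyMeasurable.integral_prod_right'.measurable

/-- In the increment of c in the first variable only the increment of b survives, and this is Hölder
in the second variable. The one-variable theorem for `T₂` therefore expresses it as an integral,
whose bound makes c(·,x₂) Hölder of order β₁. -/
theorem ae_partialCommutator_sub (hT₂ : IsCZO T₂) (hK₂ : IsKernelOf T₂ K₂ C₂) (hβ₂ : 0 < β₂)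
    (hβ₂n : β₂ < n) (hb : RectHolder b G M β₁ β₂) (hf : BoundedCompact f₂) (hfm : Measurable f₂)
    {c : Rn m × Rn n → ℂ} (hc : Measurable c)
    (h : ∀ᵐ x : Rn m, MemLp (fun y => b (x, y) * f₂ y) 2 volume ∧
        (fun y => c (x, y)) =ᵐ[volume]
          fun y => b (x, y) * T₂ f₂ y - T₂ (fun y => b (x, y) * f₂ y) y) :
    ∃ A : Rn n → ℝ≥0, ∀ᵐ x₂ : Rn n, ∀ᵐ z : Rn m × Rn m ∂(volume.prod volume),
      c (z.2, x₂) - c (z.1, x₂) =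
        -commutatorIntegral K₂ (fun y => b (z.2, y) - b (z.1, y)) f₂ x₂ ∧
      ‖commutatorIntegral K₂ (fun y => b (z.2, y) - b (z.1, y)) f₂ x₂‖ ≤
        A x₂ * ‖z.1 - z.2‖ ^ β₁ := by
  obtain ⟨D, hD⟩ := lintegral_commutator_le hK₂ hβ₂ hβ₂n
  obtain ⟨F, hF⟩ := hf.ae_norm_le
  obtain ⟨R, hR⟩ := hf.2.isCompact.isBounded.exists_norm_le
  refine ⟨fun x₂ => D * M * F * (‖R‖₊ + ‖x₂‖₊ + 1) ^ β₂, ?_⟩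
  have hCI := measurable_commutatorIntegral_diff (m := m) hK₂.measurable hb.measurable hfm
  have hA : Measurable fun w : Rn n × (Rn m × Rn m) =>
      ((D * M * F * (‖R‖₊ + ‖w.1‖₊ + 1) ^ β₂ : ℝ≥0) : ℝ) * ‖w.2.1 - w.2.2‖ ^ β₁ := by fun_prop
  have hmeas : MeasurableSet {w : Rn n × (Rn m × Rn m) | c (w.2.2, w.1) - c (w.2.1, w.1) =
        -commutatorIntegral K₂ (fun y => b (w.2.2, y) - b (w.2.1, y)) f₂ w.1 ∧
      ‖commutatorIntegral K₂ (fun y => b (w.2.2, y) - b (w.2.1, y)) f₂ w.1‖ ≤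
        (D * M * F * (‖R‖₊ + ‖w.1‖₊ + 1) ^ β₂ : ℝ≥0) * ‖w.2.1 - w.2.2‖ ^ β₁} := by
    have h1 : Measurable fun w : Rn n × (Rn m × Rn m) => c (w.2.2, w.1) - c (w.2.1, w.1) := by
      fun_prop
    exact (measurableSet_eq_fun h1 hCI.neg).inter (measurableSet_le hCI.norm hA)
  -- The one-variable theorem holds for almost every x₂ once the pair of first coordinates is fixed,
  -- while the conclusion fixes x₂ first. Exchanging the quantifiers requires the measurability just
  -- shown.
  refine (Measure.ae_ae_comm hmeas).2 ?_
  have hG : ∀ᵐ x : Rn m, ∀ᵐ y : Rn n, (x, y) ∈ G := Measure.ae_ae_of_ae_prod hb.ae_mem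
  have hgood := h.and hG
  have hgood₁ : ∀ᵐ z : Rn m × Rn m ∂(volume.prod volume), _ :=
    (Measure.quasiMeasurePreserving_fst (μ := (volume : Measure (Rn m)))
      (ν := (volume : Measure (Rn m)))).ae hgood
  have hgood₂ : ∀ᵐ z : Rn m × Rn m ∂(volume.prod volume), _ :=
    (Measure.quasiMeasurePreserving_snd (μ := (volume : Measure (Rn m)))
      (ν := (volume : Measure (Rn m)))).ae hgood
  filter_upwards [hgood₁, hgood₂] with z hz₁ hz₂
  obtain ⟨⟨m₁, e₁⟩, g₁⟩ := hz₁
  obtain ⟨⟨m₂, e₂⟩, g₂⟩ := hz₂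
  have hH := hb.holderOffNull g₁ g₂
  have hcomm := commutator_eq_commutatorIntegral hT₂ hK₂ hβ₂ hβ₂n hH hf
  have hsub := hT₂.map_sub ENNReal.one_lt_two (by simp) m₂ m₁
  have hfun : (fun y => b (z.2, y) * f₂ y) - (fun y => b (z.1, y) * f₂ y) =
      (fun y => b (z.2, y) - b (z.1, y)) * f₂ := by
    ext y; simp only [Pi.sub_apply, Pi.mul_apply]; ring
  rw [hfun] at hsub
  filter_upwards [hcomm, hsub, e₁, e₂, g₁, g₂] with x₂ k₁ k₂ k₃ k₄ k₅ k₆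
  refine ⟨?_, ?_⟩
  · rw [← k₁, k₂, k₃, k₄, Pi.sub_apply]; ring
  · refine norm_commutatorIntegral_le (by positivity) ((hD _ _ _ hH f₂ F hF x₂ ⟨k₅, k₆⟩
      (‖R‖ + ‖x₂‖ + 1) (by positivity) fun y hy => ?_).trans_eq ?_)
    · rw [mem_ball, dist_eq_norm]
      have h3 := hR y (subset_tsupport f₂ hy)
      have := norm_sub_le y x₂
      linarith [le_abs_self R, Real.norm_eq_abs R]
    · congr 1
      push_cast
      ring

theorem actsSecond_fst_mul (hT₂ : IsCZO T₂) {g : Rn m → ℂ} (hg : AEStronglyMeasurable g volume)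
    {H HF : Rn m × Rn n → ℂ} (hH : ActsSecond T₂ H HF) :
    ActsSecond T₂ (fun z => g z.1 * H z) (fun z => g z.1 * HF z) := by
  refine ⟨hg.comp_fst.mul hH.1, ?_⟩
  filter_upwards [hH.2] with x hx
  obtain ⟨⟨r, hr1, hr2, hr⟩, he⟩ := hx
  refine ⟨⟨r, hr1, hr2, hr.const_mul (g x)⟩, ?_⟩
  filter_upwards [he, hT₂.map_smul r hr1 hr2 (g x) _ hr] with y h1 h2
  have e : (fun y => g x * H (x, y)) = g x • fun y => H (x, y) := rfl
  rw [e, h2, Pi.smul_apply, smul_eq_mul, h1]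

theorem actsSecond_snd (hT₂ : IsCZO T₂) (hf : BoundedCompact f₂) :
    ActsSecond (m := m) T₂ (fun z => f₂ z.2) (fun z => T₂ f₂ z.2) :=
  ⟨(hT₂.memLp ENNReal.one_lt_two (by simp) (hf.memLp 2)).1.comp_snd, Eventually.of_forall fun _ =>
    ⟨⟨2, ENNReal.one_lt_two, by simp, hf.memLp 2⟩, EventuallyEq.rfl⟩⟩

theorem actsFirst_tensor (hT₁ : IsCZO T₁) (hf₁ : BoundedCompact f₁) (hf₂ : BoundedCompact f₂) :
    ActsFirst T₁ (fun z : Rn m × Rn n => f₁ z.1 * f₂ z.2) (fun z => T₁ f₁ z.1 * f₂ z.2) := by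
  rw [actsFirst_iff_swap]
  have := actsSecond_fst_mul hT₁ hf₂.1.1 (actsSecond_snd (m := n) hT₁ hf₁)
  simpa only [Prod.fst_swap, Prod.snd_swap, mul_comm] using this

/-- The unique value of the bi-commutator on a tensor product, in terms of
`c = [b, T₂](1 ⊗ f₂)`. -/
theorem IsBicommutator.tensor_slices (hT₁ : IsCZO T₁) (hT₂ : IsCZO T₂)
    (hf₁ : BoundedCompact f₁) (hf₂ : BoundedCompact f₂) {c H h : Rn m × Rn n → ℂ}
    (hH : ActsSecond T₂ (fun z => b z * f₂ z.2) H)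
    (hc : c =ᵐ[volume] (fun z => b z * T₂ f₂ z.2 - H z))
    (hh : IsBicommutator b T₁ T₂ (fun z => f₁ z.1 * f₂ z.2) h) :
    ∀ᵐ x₂ : Rn n, (fun x₁ => h (x₁, x₂)) =ᵐ[volume] fun x₁ =>
      T₁ (fun y₁ => c (y₁, x₂) * f₁ y₁) x₁ - c (x₁, x₂) * T₁ f₁ x₁ := by
  obtain ⟨u, Tu, v, w, ⟨F, Q, hF, hQ, hu⟩, hTu, hv, ⟨F', Q', hF', hQ', hw⟩, hh⟩ := hh
  have hTf₁ := (hT₁.memLp ENNReal.one_lt_two (by simp) (hf₁.memLp 2)).1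
  -- Each intermediate function is determined up to null sets. For a tensor, functions of x₁ act as
  -- scalars for `T₂`, so all of them are expressed through c, T₁f₁ and f₂.
  have eF := hF.unique (actsSecond_fst_mul hT₂ hf₁.1.1 (actsSecond_snd hT₂ hf₂))
  have eQ := hQ.unique ((actsSecond_fst_mul hT₂ hf₁.1.1 hH).congr hT₂
    (Eventually.of_forall fun z => by simp only [Pi.mul_apply]; ring) EventuallyEq.rfl)
  have ev : v =ᵐ[volume] fun z => T₁ f₁ z.1 * f₂ z.2 := by
    have h1 := (actsFirst_iff_swap.1 hv).unique (actsFirst_iff_swap.1 (actsFirst_tensor hT₁ hf₁ hf₂))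
    have h2 := ae_prod_swap h1
    simp only [Prod.swap_swap] at h2
    exact h2
  have eF' := hF'.unique ((actsSecond_fst_mul hT₂ hTf₁ (actsSecond_snd hT₂ hf₂)).congr hT₂ ev.symm
    EventuallyEq.rfl)
  have eQ' := hQ'.unique ((actsSecond_fst_mul hT₂ hTf₁ hH).congr hT₂ (by
    filter_upwards [ev] with z hz
    rw [Pi.mul_apply, hz]; ring) EventuallyEq.rfl)
  have eu : u =ᵐ[volume] fun z => c z * f₁ z.1 := by
    filter_upwards [hu, eF, eQ, hc] with z h1 h2 h3 h4
    rw [h1, h4, Pi.sub_apply, Pi.mul_apply, h2, h3]; ring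
  have ew : h =ᵐ[volume] fun z => Tu z - c z * T₁ f₁ z.1 := by
    filter_upwards [hh, hw, eF', eQ', hc] with z h0 h1 h2 h3 h4
    rw [h0, Pi.sub_apply, h1, h4, Pi.sub_apply, Pi.mul_apply, h2, h3]; ring
  have swap_slices : ∀ {p q : Rn m × Rn n → ℂ}, p =ᵐ[volume] q →
      ∀ᵐ y : Rn n, (fun x => p (x, y)) =ᵐ[volume] fun x => q (x, y) := fun h1 =>
    Measure.ae_ae_of_ae_prod (ae_prod_swap h1)
  filter_upwards [swap_slices eu, swap_slices ew, hTu.2] with x₂ h1 h2 h3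
  obtain ⟨⟨r, hr1, hr2, hr⟩, h3⟩ := h3
  filter_upwards [h2, h3, hT₁.congr hr1 hr2 hr h1] with x₁ k1 k2 k3
  rw [k1, k2, k3]

theorem integrable_bicommutatorKernel_mul (hK₁ : IsKernelOf T₁ K₁ C₁) (hK₂ : IsKernelOf T₂ K₂ C₂)
    (hβ₁ : 0 < β₁) (hβ₁m : β₁ < m) (hβ₂ : 0 < β₂) (hβ₂n : β₂ < n) (hb : RectHolder b G M β₁ β₂)
    {f : Rn m × Rn n → ℂ} (hf : BoundedCompact f) (x : Rn m × Rn n) :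
    Integrable (fun y => bicommutatorKernel K₁ K₂ b G (x, y) * f y) volume := by
  have hk := measurable_bicommutatorKernel hK₁.measurable hK₂.measurable hb.measurable
    hb.measurableSet
  refine ⟨(hk.comp measurable_prodMk_left).aestronglyMeasurable.mul hf.1.1, ?_⟩
  obtain ⟨F, hF⟩ := hf.ae_norm_le
  obtain ⟨R, hR⟩ := hf.2.isCompact.isBounded.exists_norm_le
  obtain ⟨D, hD⟩ := exists_lintegral_riesz_mul_riesz_le hβ₁ hβ₁m hβ₂ hβ₂n (|R| + ‖x‖ + 1)
  have hDx := hD x (by linarith [abs_nonneg R])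
  set W := ball (0 : Rn m) (|R| + ‖x‖ + 1) ×ˢ ball (0 : Rn n) (|R| + ‖x‖ + 1) with hW
  have hWm : MeasurableSet W := measurableSet_ball.prod measurableSet_ball
  have hsupp : ∀ y, f y ≠ 0 → y ∈ W := fun y hy => by
    have h1 := hR y (subset_tsupport f hy)
    have h2 := norm_nonneg x
    have h3 := le_abs_self R
    constructor
    · rw [mem_ball_zero_iff]; linarith [norm_fst_le y]
    · rw [mem_ball_zero_iff]; linarith [norm_snd_le y]
  calc ∫⁻ y, ‖bicommutatorKernel K₁ K₂ b G (x, y) * f y‖ₑ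
      ≤ ∫⁻ y, ((M * C₁ * C₂ : ℝ≥0) * F) * W.indicator
          (fun y => riesz β₁ x.1 y.1 * riesz β₂ x.2 y.2) y := by
        refine lintegral_mono_ae ?_
        filter_upwards [hF] with y hy
        by_cases hy0 : f y = 0
        · simp [hy0]
        rw [Set.indicator_of_mem (hsupp y hy0), enorm_mul]
        have h3 : ‖f y‖ₑ ≤ F := by
          rw [enorm_eq_nnnorm]; exact_mod_cast hy
        calc _ ≤ (M * C₁ * C₂ : ℝ≥0) * (riesz β₁ x.1 y.1 * riesz β₂ x.2 y.2) * F :=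
              mul_le_mul' (enorm_bicommutatorKernel_le hK₁ hK₂ hβ₁ hβ₁m hβ₂ hβ₂n (hb.norm_le x y)) h3
          _ = _ := by ring
    _ = ((M * C₁ * C₂ : ℝ≥0) * F) * ∫⁻ y in W, riesz β₁ x.1 y.1 * riesz β₂ x.2 y.2 := by
        rw [lintegral_const_mul' _ _ (by finiteness), lintegral_indicator hWm]
    _ ≤ ((M * C₁ * C₂ : ℝ≥0) * F) * D := by gcongr
    _ < ∞ := by finiteness

theorem IsBicommutator.aestronglyMeasurable (hb : AEStronglyMeasurable b volume)
    {f h : Rn m × Rn n → ℂ} (hh : IsBicommutator b T₁ T₂ f h) : AEStronglyMeasurable h volume := by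
  obtain ⟨u, Tu, v, w, -, hTu, -, ⟨F', Q', hF', hQ', hw⟩, hh⟩ := hh
  exact (hTu.1.sub (((hb.mul hF'.1).sub hQ'.1).congr hw.symm)).congr hh.symm

theorem aestronglyMeasurable_kernelOp {k : (Rn m × Rn n) × (Rn m × Rn n) → ℂ} (hk : Measurable k)
    {f : Rn m × Rn n → ℂ} (hf : AEStronglyMeasurable f volume) :
    AEStronglyMeasurable (kernelOp k f) volume :=
  (aestronglyMeasurable_kernel_mul hk hf).integral_prod_right'

theorem RectHolder.ae_cornersIn (hb : RectHolder b G M β₁ β₂) :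
    ∀ᵐ x₂ : Rn n, ∀ᵐ x₁ : Rn m, ∀ᵐ y₁ : Rn m, ∀ᵐ y₂ : Rn n, CornersIn G (x₁, x₂) (y₁, y₂) := by
  have h₁ : ∀ᵐ x₁ : Rn m, ∀ᵐ x₂ : Rn n, (x₁, x₂) ∈ G := Measure.ae_ae_of_ae_prod hb.ae_mem
  have h₂ : ∀ᵐ x₂ : Rn n, ∀ᵐ x₁ : Rn m, (x₁, x₂) ∈ G :=
    (Measure.ae_ae_comm (p := fun (x₁ : Rn m) (x₂ : Rn n) => (x₁, x₂) ∈ G) hb.measurableSet).1 h₁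
  filter_upwards [h₂] with x₂ h₃
  filter_upwards [h₃, h₁] with x₁ h₄ h₅
  filter_upwards [h₃, h₁] with y₁ h₆ h₇
  filter_upwards [h₅, h₇] with y₂ h₈ h₉
  exact ⟨h₄, h₆, h₈, h₉⟩

/-- The bi-commutator of a tensor product is given by absolutely convergent integrals. -/
theorem IsBicommutator.eq_kernelOp_tensor (hT₁ : IsCZO T₁) (hT₂ : IsCZO T₂)
    (hK₁ : IsKernelOf T₁ K₁ C₁) (hK₂ : IsKernelOf T₂ K₂ C₂) (hβ₁ : 0 < β₁) (hβ₁m : β₁ < m)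
    (hβ₂ : 0 < β₂) (hβ₂n : β₂ < n) (hb : RectHolder b G M β₁ β₂) (hL : MemL2loc b)
    (hf₁ : BoundedCompact f₁) (hf₂ : BoundedCompact f₂) (hfm₂ : Measurable f₂)
    (hf : BoundedCompact fun z : Rn m × Rn n => f₁ z.1 * f₂ z.2) {h : Rn m × Rn n → ℂ}
    (hh : IsBicommutator b T₁ T₂ (fun z => f₁ z.1 * f₂ z.2) h) :
    h =ᵐ[volume] kernelOp (bicommutatorKernel K₁ K₂ b G) (fun z => f₁ z.1 * f₂ z.2) := by
  obtain ⟨c, H, hc, hH, hcH, hslice⟩ := exists_partialCommutator hT₂ hb.measurable hL hf₂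
  obtain ⟨A, hA⟩ := ae_partialCommutator_sub hT₂ hK₂ hβ₂ hβ₂n hb hf₂ hfm₂ hc hslice
  have hts := hh.tensor_slices hT₁ hT₂ hf₁ hf₂ hH hcH
  have key : ∀ᵐ x₂ : Rn n, (fun x₁ : Rn m => h (x₁, x₂)) =ᵐ[volume] fun x₁ =>
      kernelOp (bicommutatorKernel K₁ K₂ b G) (fun z => f₁ z.1 * f₂ z.2) (x₁, x₂) := by
    filter_upwards [hA, hts, hb.ae_cornersIn] with x₂ h₁ h₂ h₃
    -- The second use of the one-variable theorem, now for `T₁` and the function c(·,x₂).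
    obtain ⟨E, hE⟩ := exists_holderOffNull_of_ae_prod (B := fun x₁ => c (x₁, x₂)) (A := A x₂)
      (hc.comp measurable_prodMk_right).aestronglyMeasurable hβ₁ (by
        filter_upwards [h₁] with z hz
        rw [norm_sub_rev, hz.1, norm_neg]
        exact hz.2)
    have hcomm := commutator_eq_commutatorIntegral hT₁ hK₁ hβ₁ hβ₁m hE hf₁
    filter_upwards [h₂, hcomm, h₃, Measure.ae_ae_of_ae_prod h₁] with x₁ k₁ k₂ k₃ k₄
    rw [k₁]
    refine k₂.trans ?_
    rw [commutatorIntegral, kernelOp, Measure.volume_eq_prod, integral_prod _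
      (integrable_bicommutatorKernel_mul hK₁ hK₂ hβ₁ hβ₁m hβ₂ hβ₂n hb hf (x₁, x₂))]
    refine integral_congr_ae ?_
    filter_upwards [k₃, k₄] with y₁ e₁ e₂
    -- Here c is b·T₂ − T₂b, opposite to the order in `commutatorIntegral`; this is the origin of
    -- the minus sign in the kernel.
    have e₃ : c (y₁, x₂) - c (x₁, x₂) =
      -commutatorIntegral K₂ (fun y => b (y₁, y) - b (x₁, y)) f₂ x₂ := e₂.1
    rw [e₃, commutatorIntegral, ← integral_neg, ← integral_const_mul, ← integral_mul_const]
    refine integral_congr_ae ?_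
    filter_upwards [e₁] with y₂ e₄
    rw [bicommutatorKernel, Set.indicator_of_mem (show ((x₁, x₂), (y₁, y₂)) ∈
      {z : (Rn m × Rn n) × (Rn m × Rn n) | CornersIn G z.1 z.2} from e₄)]
    simp only [secondDiff]
    ring
  have hk := measurable_bicommutatorKernel hK₁.measurable hK₂.measurable hb.measurable
    hb.measurableSet
  have hswap := ae_eq_prod_of_slices
    (hh.aestronglyMeasurable hb.measurable.aestronglyMeasurable).prod_swap
    (aestronglyMeasurable_kernelOp hk hf.1.1).prod_swap key
  have h2 := ae_prod_swap hswap
  simp only [Prod.swap_swap] at h2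
  exact h2

end Tensor

end BiCommutator

/-! ### The inner commutator between L⁴ and L^(4/3) -/

namespace BiCommutator

open Filter Topology Metric

/-- With b ∈ L²_loc and functions in L⁴, products lie locally in L^(4/3). Both 4 and 4/3 are
admissible for Calderón–Zygmund operators, so every term of the bi-commutator makes sense. -/
theorem holderTriple_two_four : ENNReal.HolderTriple 2 4 (4 / 3) := by
  refine ⟨?_⟩
  rw [ENNReal.inv_div (by simp) (by simp), ← ENNReal.toReal_eq_toReal_iff' (by simp) (by finiteness)]
  rw [ENNReal.toReal_add (by simp) (by simp)]
  simp only [ENNReal.toReal_inv, ENNReal.toReal_div, ENNReal.toReal_ofNat]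
  norm_num

theorem one_lt_four_div_three : (1 : ℝ≥0∞) < 4 / 3 := by
  rw [ENNReal.lt_div_iff_mul_lt (by simp) (by simp)]
  norm_num

theorem four_div_three_lt_top : (4 / 3 : ℝ≥0∞) < ∞ := by finiteness

theorem one_lt_four : (1 : ℝ≥0∞) < 4 := by norm_num

section Second

variable {m n : ℕ} {b : Rn m × Rn n → ℂ} {T₁ : (Rn m → ℂ) → (Rn m → ℂ)}
  {T₂ : (Rn n → ℂ) → (Rn n → ℂ)} {f g h u v w v' w' : Rn m × Rn n → ℂ}
  {V₁ : Set (Rn m)} {V₂ : Set (Rn n)}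

theorem eLpNorm_mul_restrict_le (hb : MemL2loc b) {S : Set (Rn m × Rn n)} (hS : IsCompact S)
    (hv : AEStronglyMeasurable v volume) :
    eLpNorm (b * v) (4 / 3) (volume.restrict S) ≤
      eLpNorm b 2 (volume.restrict S) * eLpNorm v 4 volume := by
  have := holderTriple_two_four
  have h1 := eLpNorm_smul_le_mul_eLpNorm (p := 2) (q := 4) (r := 4 / 3) (f := v) (φ := b)
    (μ := volume.restrict S) hv.restrict (hb S hS).1
  have h2 : eLpNorm v 4 (volume.restrict S) ≤ eLpNorm v 4 volume :=
    eLpNorm_mono_measure v Measure.restrict_le_self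
  exact h1.trans (mul_le_mul_right h2 _)

/-- The second variable is not restricted in the norm, but v vanishes outside V₂ there, so b is only
measured on the compact set C₁ × V₂. -/
theorem eLpNorm_mul_le (hb : MemL2loc b) {C₁ : Set (Rn m)} (hC₁ : IsCompact C₁) (hV₂ : IsCompact V₂)
    (hv : AEStronglyMeasurable v volume) (hsupp : ∀ᵐ z : Rn m × Rn n, z.2 ∉ V₂ → v z = 0) :
    eLpNorm (b * v) (4 / 3) ((volume.restrict C₁).prod volume) ≤
      eLpNorm b 2 (volume.restrict (C₁ ×ˢ V₂)) * eLpNorm v 4 volume := by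
  have e : ((volume.restrict C₁).prod volume : Measure (Rn m × Rn n)) =
      volume.restrict (C₁ ×ˢ Set.univ) := by
    rw [Measure.volume_eq_prod, ← Measure.prod_restrict, Measure.restrict_univ]
  have hV : MeasurableSet (Set.univ ×ˢ V₂ : Set (Rn m × Rn n)) :=
    MeasurableSet.univ.prod hV₂.measurableSet
  have h1 : b * v =ᵐ[volume.restrict (C₁ ×ˢ Set.univ)]
      (Set.univ ×ˢ V₂ : Set (Rn m × Rn n)).indicator (b * v) := by
    filter_upwards [ae_restrict_of_ae hsupp] with z hz
    by_cases hz2 : z.2 ∈ V₂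
    · rw [Set.indicator_of_mem (Set.mk_mem_prod (Set.mem_univ _) hz2)]
    · rw [Set.indicator_of_notMem fun h => hz2 h.2, Pi.mul_apply, hz hz2, mul_zero]
  rw [e, eLpNorm_congr_ae h1, eLpNorm_indicator_eq_eLpNorm_restrict hV,
    Measure.restrict_restrict hV, Set.prod_inter_prod, Set.univ_inter, Set.inter_univ]
  exact eLpNorm_mul_restrict_le hb (hC₁.prod hV₂) hv

theorem memLp_mul (hbm : AEStronglyMeasurable b volume) (hb : MemL2loc b) {C₁ : Set (Rn m)}
    (hC₁ : IsCompact C₁) (hV₂ : IsCompact V₂) (hv : MemLp v 4 volume)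
    (hsupp : ∀ᵐ z : Rn m × Rn n, z.2 ∉ V₂ → v z = 0) :
    MemLp (b * v) (4 / 3) ((volume.restrict C₁).prod volume) := by
  refine ⟨?_, (eLpNorm_mul_le hb hC₁ hV₂ hv.1 hsupp).trans_lt
    (ENNReal.mul_lt_top (hb _ (hC₁.prod hV₂)).2 hv.2)⟩
  have h := (hbm.mul hv.1).restrict (s := C₁ ×ˢ Set.univ)
  rwa [Measure.volume_eq_prod, ← Measure.prod_restrict, Measure.restrict_univ] at h

theorem ae_memLp_mul (hbm : AEStronglyMeasurable b volume) (hb : MemL2loc b)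
    (hV₂ : IsCompact V₂) (hv : MemLp v 4 volume)
    (hsupp : ∀ᵐ z : Rn m × Rn n, z.2 ∉ V₂ → v z = 0) :
    ∀ᵐ x : Rn m, MemLp (fun y => (b * v) (x, y)) (4 / 3) volume :=
  ae_of_forall_ae_restrict_closedBall fun N =>
    ae_memLp_slice (zero_lt_one.trans one_lt_four_div_three).ne' four_div_three_lt_top.ne
      (memLp_mul hbm hb (isCompact_closedBall (0 : Rn m) N) hV₂ hv hsupp)

theorem ae_memLp_slice_four (hv : MemLp v 4 volume) :
    ∀ᵐ x : Rn m, MemLp (fun y => v (x, y)) 4 volume :=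
  ae_memLp_slice (zero_lt_one.trans one_lt_four).ne' (by simp) hv

theorem exists_isCommutatorSecond (hT₂ : IsCZO T₂) (hbm : AEStronglyMeasurable b volume)
    (hb : MemL2loc b) (hV₂ : IsCompact V₂) (hv : MemLp v 4 volume)
    (hsupp : ∀ᵐ z : Rn m × Rn n, z.2 ∉ V₂ → v z = 0) : ∃ w, IsCommutatorSecond b T₂ v w := by
  obtain ⟨F, hF⟩ := exists_actsSecond hT₂ one_lt_four (by simp) hv.1 (ae_memLp_slice_four hv)
  obtain ⟨Q, hQ⟩ := exists_actsSecond hT₂ one_lt_four_div_three four_div_three_lt_top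
    (hbm.mul hv.1) (ae_memLp_mul hbm hb hV₂ hv hsupp)
  exact ⟨_, F, Q, hF, hQ, EventuallyEq.rfl⟩

theorem IsCommutatorSecond.aestronglyMeasurable (hbm : AEStronglyMeasurable b volume)
    (hw : IsCommutatorSecond b T₂ v w) : AEStronglyMeasurable w volume := by
  obtain ⟨F, Q, hF, hQ, hw⟩ := hw
  exact ((hbm.mul hF.1).sub hQ.1).congr hw.symm

theorem IsCommutatorSecond.smul (hT₂ : IsCZO T₂) (c : ℂ) (hw : IsCommutatorSecond b T₂ v w) :
    IsCommutatorSecond b T₂ (c • v) (c • w) := by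
  obtain ⟨F, Q, hF, hQ, hw⟩ := hw
  refine ⟨c • F, c • Q, hF.smul hT₂ c, ?_, ?_⟩
  · rw [mul_smul_comm]
    exact hQ.smul hT₂ c
  · rw [mul_smul_comm, ← smul_sub]
    exact hw.const_smul c

theorem IsCommutatorSecond.add (hT₂ : IsCZO T₂) (hbm : AEStronglyMeasurable b volume)
    (hb : MemL2loc b) (hV₂ : IsCompact V₂) (hv : MemLp v 4 volume)
    (hsupp : ∀ᵐ z : Rn m × Rn n, z.2 ∉ V₂ → v z = 0) (hv' : MemLp v' 4 volume)
    (hsupp' : ∀ᵐ z : Rn m × Rn n, z.2 ∉ V₂ → v' z = 0) (hw : IsCommutatorSecond b T₂ v w)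
    (hw' : IsCommutatorSecond b T₂ v' w') : IsCommutatorSecond b T₂ (v + v') (w + w') := by
  obtain ⟨F, Q, hF, hQ, hw⟩ := hw
  obtain ⟨F', Q', hF', hQ', hw'⟩ := hw'
  refine ⟨F + F', Q + Q', hF.add hT₂ one_lt_four (by simp) hF' (ae_memLp_slice_four hv)
    (ae_memLp_slice_four hv'), ?_, ?_⟩
  · rw [mul_add]
    exact hQ.add hT₂ one_lt_four_div_three four_div_three_lt_top hQ'
      (ae_memLp_mul hbm hb hV₂ hv hsupp) (ae_memLp_mul hbm hb hV₂ hv' hsupp')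
  · filter_upwards [hw, hw'] with z h1 h2
    simp only [Pi.add_apply, Pi.sub_apply, Pi.mul_apply] at h1 h2 ⊢
    rw [h1, h2]; ring

/-- Since `T₂` does not mix different x₁, confining x₁ to C₁ from the start loses nothing, and only
norms of b over compact sets occur. -/
theorem exists_isCommutatorSecond_bound (hT₂ : IsCZO T₂) (hbm : AEStronglyMeasurable b volume)
    (hb : MemL2loc b) (hV₂ : IsCompact V₂) {C₁ : Set (Rn m)} {C₂ : Set (Rn n)}
    (hC₁ : IsCompact C₁) (hC₂ : IsCompact C₂) :
    ∃ D : ℝ≥0, ∀ v w : Rn m × Rn n → ℂ, MemLp v 4 volume →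
      (∀ᵐ z : Rn m × Rn n, z.2 ∉ V₂ → v z = 0) → IsCommutatorSecond b T₂ v w →
      eLpNorm w (4 / 3) (volume.restrict (C₁ ×ˢ C₂)) ≤ D * eLpNorm v 4 volume := by
  obtain ⟨D₁, hD₁⟩ := exists_actsSecond_bound hT₂ m one_lt_four (by simp)
  obtain ⟨D₂, hD₂⟩ := exists_actsSecond_bound hT₂ m one_lt_four_div_three four_div_three_lt_top
  have f₁ := (hb _ (hC₁.prod hC₂)).2
  have f₂ := (hb _ (hC₁.prod hV₂)).2
  refine ⟨((eLpNorm b 2 (volume.restrict (C₁ ×ˢ C₂))) * D₁ +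
    D₂ * eLpNorm b 2 (volume.restrict (C₁ ×ˢ V₂))).toNNReal, fun v w hv hsupp hw => ?_⟩
  rw [ENNReal.coe_toNNReal (by finiteness)]
  obtain ⟨F, Q, hF, hQ, hw⟩ := hw
  have b₁ := hD₁ v F hF Set.univ
  rw [Measure.restrict_univ, ← Measure.volume_eq_prod] at b₁
  have b₁' := (b₁ hv).2
  have b₂ := (hD₂ (b * v) Q hQ C₁ (memLp_mul hbm hb hC₁ hV₂ hv hsupp)).2
  have hle : (volume.restrict (C₁ ×ˢ C₂) : Measure (Rn m × Rn n)) ≤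
      (volume.restrict C₁).prod volume := by
    have e : ((volume.restrict C₁).prod volume : Measure (Rn m × Rn n)) =
        volume.restrict (C₁ ×ˢ Set.univ) := by
      rw [Measure.volume_eq_prod, ← Measure.prod_restrict, Measure.restrict_univ]
    rw [e]
    exact Measure.restrict_mono (Set.prod_mono_right (Set.subset_univ _)) le_rfl
  calc eLpNorm w (4 / 3) (volume.restrict (C₁ ×ˢ C₂))
      = eLpNorm (b * F - Q) (4 / 3) (volume.restrict (C₁ ×ˢ C₂)) :=
        eLpNorm_congr_ae (ae_restrict_of_ae hw)
    _ ≤ eLpNorm (b * F) (4 / 3) (volume.restrict (C₁ ×ˢ C₂)) +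
          eLpNorm Q (4 / 3) (volume.restrict (C₁ ×ˢ C₂)) :=
        eLpNorm_sub_le (hbm.mul hF.1).restrict hQ.1.restrict one_lt_four_div_three.le
    _ ≤ eLpNorm b 2 (volume.restrict (C₁ ×ˢ C₂)) * (D₁ * eLpNorm v 4 volume) +
          D₂ * (eLpNorm b 2 (volume.restrict (C₁ ×ˢ V₂)) * eLpNorm v 4 volume) := by
        gcongr
        · exact (eLpNorm_mul_restrict_le hb (hC₁.prod hC₂) hF.1).trans (by gcongr)
        · exact ((eLpNorm_mono_measure _ hle).trans b₂).trans
            (by gcongr; exact eLpNorm_mul_le hb hC₁ hV₂ hv.1 hsupp)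
    _ = _ := by ring

theorem IsCZO.map_zero {T : (Rn n → ℂ) → (Rn n → ℂ)} (hT : IsCZO T) {p : ℝ≥0∞} (h1 : 1 < p)
    (h2 : p < ∞) {f : Rn n → ℂ} (hf : f =ᵐ[volume] 0) : T f =ᵐ[volume] 0 := by
  have h0 := hT.map_smul p h1 h2 0 (0 : Rn n → ℂ) MemLp.zero
  rw [zero_smul] at h0
  exact (hT.congr h1 h2 (MemLp.zero.ae_eq hf.symm) hf).trans (h0.trans (by rw [zero_smul]))

theorem ActsSecond.ae_eq_zero (hT₂ : IsCZO T₂) {F : Rn m × Rn n → ℂ} (hF : ActsSecond T₂ v F)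
    (hV₁ : MeasurableSet V₁) (hsupp : ∀ᵐ z : Rn m × Rn n, z.1 ∉ V₁ → v z = 0) :
    ∀ᵐ z : Rn m × Rn n, z.1 ∉ V₁ → F z = 0 := by
  have h0 : ∀ᵐ x : Rn m, ∀ᵐ y : Rn n, x ∉ V₁ → v (x, y) = 0 := Measure.ae_ae_of_ae_prod hsupp
  have h1 : ∀ᵐ x : Rn m, ∀ᵐ y : Rn n, x ∉ V₁ → F (x, y) = 0 := by
    filter_upwards [hF.2, h0] with x hx hx0
    by_cases hxV : x ∈ V₁
    · exact Eventually.of_forall fun y h => absurd hxV h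
    · have : (fun y => v (x, y)) =ᵐ[volume] 0 := hx0.mono fun y hy => hy hxV
      filter_upwards [hx.2, hT₂.map_zero ENNReal.one_lt_two (by simp) this] with y h1 h2 _
      rw [h1, h2, Pi.zero_apply]
  -- Vanishing on almost every slice passes to the product for measurable functions, which the
  -- indicator makes possible.
  have h2 := ae_eq_prod_of_slices (f := {z : Rn m × Rn n | z.1 ∉ V₁}.indicator F) (g := 0)
    (hF.1.indicator (measurable_fst hV₁.compl)) aestronglyMeasurable_zero (by
      filter_upwards [h1] with x hx
      filter_upwards [hx] with y hy
      by_cases hxV : x ∈ V₁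
      · exact Set.indicator_of_notMem (show (x, y) ∉ {z : Rn m × Rn n | z.1 ∉ V₁} from fun h => h hxV) _
      · rw [Set.indicator_of_mem (show (x, y) ∈ {z : Rn m × Rn n | z.1 ∉ V₁} from hxV), hy hxV]; rfl)
  filter_upwards [h2] with z hz hzV
  rw [Set.indicator_of_mem (show z ∈ {z : Rn m × Rn n | z.1 ∉ V₁} from hzV)] at hz
  exact hz

theorem IsCommutatorSecond.ae_eq_zero (hT₂ : IsCZO T₂) (hw : IsCommutatorSecond b T₂ v w)
    (hV₁ : MeasurableSet V₁) (hsupp : ∀ᵐ z : Rn m × Rn n, z.1 ∉ V₁ → v z = 0) :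
    ∀ᵐ z : Rn m × Rn n, z.1 ∉ V₁ → w z = 0 := by
  obtain ⟨F, Q, hF, hQ, hw⟩ := hw
  filter_upwards [hw, hF.ae_eq_zero hT₂ hV₁ hsupp, hQ.ae_eq_zero hT₂ hV₁ (by
    filter_upwards [hsupp] with z hz h
    rw [Pi.mul_apply, hz h, mul_zero])] with z h1 h2 h3 h
  rw [h1, Pi.sub_apply, Pi.mul_apply, h2 h, h3 h, mul_zero, sub_zero]

end Second

end BiCommutator

namespace BiCommutator

open Filter Topology Metric

/-! ### Existence, linearity and local continuity of the bi-commutator -/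

section Full

variable {m n : ℕ} {b : Rn m × Rn n → ℂ} {T₁ : (Rn m → ℂ) → (Rn m → ℂ)}
  {T₂ : (Rn n → ℂ) → (Rn n → ℂ)} {f g h u v w F F' h' : Rn m × Rn n → ℂ}
  {V₁ : Set (Rn m)} {V₂ : Set (Rn n)}

theorem eLpNorm_prod_swap {p : ℝ≥0∞} {μ : Measure (Rn m)} {ν : Measure (Rn n)} [SFinite μ]
    [SFinite ν] (hf : AEStronglyMeasurable f (μ.prod ν)) :
    eLpNorm (fun z : Rn n × Rn m => f z.swap) p (ν.prod μ) = eLpNorm f p (μ.prod ν) :=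
  eLpNorm_comp_measurePreserving hf Measure.measurePreserving_swap

theorem MemLp.prod_swap {p : ℝ≥0∞} {μ : Measure (Rn m)} {ν : Measure (Rn n)} [SFinite μ]
    [SFinite ν] (hf : MemLp f p (μ.prod ν)) :
    MemLp (fun z : Rn n × Rn m => f z.swap) p (ν.prod μ) :=
  hf.comp_measurePreserving Measure.measurePreserving_swap

theorem ActsFirst.add (hT₁ : IsCZO T₁) {p : ℝ≥0∞} (h1 : 1 < p) (h2 : p < ∞)
    (hf : ActsFirst T₁ f F) (hg : ActsFirst T₁ g F')
    (hfp : ∀ᵐ y : Rn n, MemLp (fun x => f (x, y)) p volume)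
    (hgp : ∀ᵐ y : Rn n, MemLp (fun x => g (x, y)) p volume) : ActsFirst T₁ (f + g) (F + F') :=
  actsFirst_iff_swap.2 ((actsFirst_iff_swap.1 hf).add hT₁ h1 h2 (actsFirst_iff_swap.1 hg) hfp hgp)

theorem ActsFirst.smul (hT₁ : IsCZO T₁) (c : ℂ) (hf : ActsFirst T₁ f F) :
    ActsFirst T₁ (c • f) (c • F) :=
  actsFirst_iff_swap.2 ((actsFirst_iff_swap.1 hf).smul hT₁ c)

theorem exists_actsFirst (hT₁ : IsCZO T₁) {p : ℝ≥0∞} (h1 : 1 < p) (h2 : p < ∞)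
    (hf : AEStronglyMeasurable f volume)
    (hs : ∀ᵐ y : Rn n, MemLp (fun x => f (x, y)) p volume) : ∃ F, ActsFirst T₁ f F := by
  obtain ⟨F, hF⟩ := exists_actsSecond hT₁ h1 h2 (f := fun z : Rn n × Rn m => f z.swap)
    hf.prod_swap hs
  exact ⟨fun z => F z.swap, actsFirst_iff_swap.2 hF⟩

theorem exists_actsFirst_bound (hT₁ : IsCZO T₁) (n : ℕ) {p : ℝ≥0∞} (h1 : 1 < p) (h2 : p < ∞) :
    ∃ C : ℝ≥0, ∀ (f F : Rn m × Rn n → ℂ), ActsFirst T₁ f F →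
      ∀ (A : Set (Rn n)), MemLp f p (volume.prod (volume.restrict A)) →
        MemLp F p (volume.prod (volume.restrict A)) ∧
        eLpNorm F p (volume.prod (volume.restrict A)) ≤
          C * eLpNorm f p (volume.prod (volume.restrict A)) := by
  obtain ⟨C, hC⟩ := exists_actsSecond_bound hT₁ n h1 h2
  refine ⟨C, fun f F hF A hf => ?_⟩
  obtain ⟨hm, hle⟩ := hC _ _ (actsFirst_iff_swap.1 hF) A (MemLp.prod_swap hf)
  have hm' : MemLp F p (volume.prod (volume.restrict A)) := MemLp.prod_swap hm
  rw [eLpNorm_prod_swap hf.1, eLpNorm_prod_swap hm'.1] at hle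
  exact ⟨hm', hle⟩

theorem ActsFirst.ae_eq_zero (hT₁ : IsCZO T₁) (hF : ActsFirst T₁ f F) (hV₂ : MeasurableSet V₂)
    (hsupp : ∀ᵐ z : Rn m × Rn n, z.2 ∉ V₂ → f z = 0) :
    ∀ᵐ z : Rn m × Rn n, z.2 ∉ V₂ → F z = 0 := by
  have hq : Measure.QuasiMeasurePreserving (Prod.swap : Rn n × Rn m → Rn m × Rn n) :=
    Measure.measurePreserving_swap.quasiMeasurePreserving
  have hq' : Measure.QuasiMeasurePreserving (Prod.swap : Rn m × Rn n → Rn n × Rn m) :=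
    Measure.measurePreserving_swap.quasiMeasurePreserving
  exact hq'.ae ((actsFirst_iff_swap.1 hF).ae_eq_zero hT₁ hV₂ (hq.ae hsupp))

/-- The functions of `L⁴` supported in `V₁ × V₂`. -/
structure L4On (V₁ : Set (Rn m)) (V₂ : Set (Rn n)) (f : Rn m × Rn n → ℂ) : Prop where
  memLp : MemLp f 4 volume
  eq_zero : ∀ z, z ∉ V₁ ×ˢ V₂ → f z = 0

theorem L4On.ae_fst (hf : L4On V₁ V₂ f) : ∀ᵐ z : Rn m × Rn n, z.1 ∉ V₁ → f z = 0 :=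
  Eventually.of_forall fun z hz => hf.eq_zero z fun h => hz h.1

theorem L4On.ae_snd (hf : L4On V₁ V₂ f) : ∀ᵐ z : Rn m × Rn n, z.2 ∉ V₂ → f z = 0 :=
  Eventually.of_forall fun z hz => hf.eq_zero z fun h => hz h.2

theorem L4On.add (hf : L4On V₁ V₂ f) (hg : L4On V₁ V₂ g) : L4On V₁ V₂ (f + g) :=
  ⟨hf.memLp.add hg.memLp, fun z hz => by rw [Pi.add_apply, hf.eq_zero z hz, hg.eq_zero z hz, add_zero]⟩

theorem L4On.smul (c : ℂ) (hf : L4On V₁ V₂ f) : L4On V₁ V₂ (c • f) :=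
  ⟨hf.memLp.const_smul c, fun z hz => by rw [Pi.smul_apply, hf.eq_zero z hz, smul_zero]⟩

theorem eLpNorm_volume_eq_of_support {p : ℝ≥0∞} (hV₁ : MeasurableSet V₁) {C₂ : Set (Rn n)}
    (hu : ∀ᵐ z : Rn m × Rn n, z.1 ∉ V₁ → u z = 0) :
    eLpNorm u p (volume.prod (volume.restrict C₂)) = eLpNorm u p (volume.restrict (V₁ ×ˢ C₂)) := by
  have e : (volume.prod (volume.restrict C₂) : Measure (Rn m × Rn n)) =
      volume.restrict (Set.univ ×ˢ C₂) := by
    rw [Measure.volume_eq_prod, ← Measure.prod_restrict, Measure.restrict_univ]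
  have hV : MeasurableSet (V₁ ×ˢ Set.univ : Set (Rn m × Rn n)) := hV₁.prod MeasurableSet.univ
  have h1 : u =ᵐ[volume.restrict (Set.univ ×ˢ C₂)]
      (V₁ ×ˢ Set.univ : Set (Rn m × Rn n)).indicator u := by
    filter_upwards [ae_restrict_of_ae hu] with z hz
    by_cases hz1 : z.1 ∈ V₁
    · rw [Set.indicator_of_mem (Set.mk_mem_prod hz1 (Set.mem_univ _))]
    · rw [Set.indicator_of_notMem fun h => hz1 h.1, hz hz1]
  rw [e, eLpNorm_congr_ae h1, eLpNorm_indicator_eq_eLpNorm_restrict hV,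
    Measure.restrict_restrict hV, Set.prod_inter_prod, Set.univ_inter, Set.inter_univ]

/-- `T₂` keeps the support in the first variable, so [b,T₂]f still lives over V₁. The norm may
therefore be taken over the whole first space, which is what allows `T₁` to act on it. -/
theorem exists_isCommutatorSecond_bound_first (hT₂ : IsCZO T₂)
    (hbm : AEStronglyMeasurable b volume) (hb : MemL2loc b) (hV₁ : IsCompact V₁) (hV₂ : IsCompact V₂)
    {C₂ : Set (Rn n)} (hC₂ : IsCompact C₂) :
    ∃ D : ℝ≥0, ∀ f u : Rn m × Rn n → ℂ, L4On V₁ V₂ f → IsCommutatorSecond b T₂ f u →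
      MemLp u (4 / 3) (volume.prod (volume.restrict C₂)) ∧
      eLpNorm u (4 / 3) (volume.prod (volume.restrict C₂)) ≤ D * eLpNorm f 4 volume := by
  obtain ⟨D, hD⟩ := exists_isCommutatorSecond_bound hT₂ hbm hb hV₂ hV₁ hC₂
  refine ⟨D, fun f u hf hu => ?_⟩
  have h1 := hD f u hf.memLp hf.ae_snd hu
  rw [← eLpNorm_volume_eq_of_support hV₁.measurableSet
    (hu.ae_eq_zero hT₂ hV₁.measurableSet hf.ae_fst)] at h1
  refine ⟨⟨?_, h1.trans_lt (ENNReal.mul_lt_top ENNReal.coe_lt_top hf.memLp.2)⟩, h1⟩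
  have h2 := (hu.aestronglyMeasurable hbm).restrict (s := Set.univ ×ˢ C₂)
  rwa [Measure.volume_eq_prod, ← Measure.prod_restrict, Measure.restrict_univ] at h2

theorem IsCommutatorSecond.ae_memLp_first (hT₂ : IsCZO T₂) (hbm : AEStronglyMeasurable b volume)
    (hb : MemL2loc b) (hV₁ : IsCompact V₁) (hV₂ : IsCompact V₂) (hf : L4On V₁ V₂ f)
    (hu : IsCommutatorSecond b T₂ f u) :
    ∀ᵐ y : Rn n, MemLp (fun x => u (x, y)) (4 / 3) volume := by
  refine ae_of_forall_ae_restrict_closedBall fun N => ?_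
  obtain ⟨D, hD⟩ := exists_isCommutatorSecond_bound_first hT₂ hbm hb hV₁ hV₂
    (isCompact_closedBall (0 : Rn n) N)
  exact ae_memLp_slice (zero_lt_one.trans one_lt_four_div_three).ne' four_div_three_lt_top.ne
    (MemLp.prod_swap (hD f u hf hu).1)

theorem L4On.memLp_actsFirst (hT₁ : IsCZO T₁) (hf : L4On V₁ V₂ f) (hv : ActsFirst T₁ f v) :
    MemLp v 4 volume := by
  obtain ⟨C, hC⟩ := exists_actsFirst_bound hT₁ n one_lt_four (by simp)
  have h := hC f v hv Set.univ
  rw [Measure.restrict_univ, ← Measure.volume_eq_prod] at h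
  exact (h hf.memLp).1

theorem L4On.ae_memLp_swap (hf : L4On V₁ V₂ f) :
    ∀ᵐ y : Rn n, MemLp (fun x => f (x, y)) 4 volume :=
  ae_memLp_slice_four (MemLp.prod_swap hf.memLp)

theorem L4On.exists_isBicommutator (hT₁ : IsCZO T₁) (hT₂ : IsCZO T₂)
    (hbm : AEStronglyMeasurable b volume) (hb : MemL2loc b) (hV₁ : IsCompact V₁) (hV₂ : IsCompact V₂)
    (hf : L4On V₁ V₂ f) : ∃ h, IsBicommutator b T₁ T₂ f h := by
  obtain ⟨u, hu⟩ := exists_isCommutatorSecond hT₂ hbm hb hV₂ hf.memLp hf.ae_snd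
  obtain ⟨Tu, hTu⟩ := exists_actsFirst hT₁ one_lt_four_div_three four_div_three_lt_top
    (hu.aestronglyMeasurable hbm) (hu.ae_memLp_first hT₂ hbm hb hV₁ hV₂ hf)
  obtain ⟨v, hv⟩ := exists_actsFirst hT₁ one_lt_four (by simp) hf.memLp.1 hf.ae_memLp_swap
  obtain ⟨w, hw⟩ := exists_isCommutatorSecond hT₂ hbm hb hV₂ (hf.memLp_actsFirst hT₁ hv)
    (hv.ae_eq_zero hT₁ hV₂.measurableSet hf.ae_snd)
  exact ⟨_, u, Tu, v, w, hu, hTu, hv, hw, EventuallyEq.rfl⟩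

theorem IsBicommutator.add (hT₁ : IsCZO T₁) (hT₂ : IsCZO T₂)
    (hbm : AEStronglyMeasurable b volume) (hb : MemL2loc b) (hV₁ : IsCompact V₁) (hV₂ : IsCompact V₂)
    (hf : L4On V₁ V₂ f) (hg : L4On V₁ V₂ g) (hh : IsBicommutator b T₁ T₂ f h)
    (hh' : IsBicommutator b T₁ T₂ g h') : IsBicommutator b T₁ T₂ (f + g) (h + h') := by
  obtain ⟨u, Tu, v, w, hu, hTu, hv, hw, hh⟩ := hh
  obtain ⟨u', Tu', v', w', hu', hTu', hv', hw', hh'⟩ := hh'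
  refine ⟨u + u', Tu + Tu', v + v', w + w',
    hu.add hT₂ hbm hb hV₂ hf.memLp hf.ae_snd hg.memLp hg.ae_snd hu',
    hTu.add hT₁ one_lt_four_div_three four_div_three_lt_top hTu'
      (hu.ae_memLp_first hT₂ hbm hb hV₁ hV₂ hf) (hu'.ae_memLp_first hT₂ hbm hb hV₁ hV₂ hg),
    hv.add hT₁ one_lt_four (by simp) hv' hf.ae_memLp_swap hg.ae_memLp_swap,
    hw.add hT₂ hbm hb hV₂ (hf.memLp_actsFirst hT₁ hv)
      (hv.ae_eq_zero hT₁ hV₂.measurableSet hf.ae_snd) (hg.memLp_actsFirst hT₁ hv')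
      (hv'.ae_eq_zero hT₁ hV₂.measurableSet hg.ae_snd) hw', ?_⟩
  filter_upwards [hh, hh'] with z h1 h2
  simp only [Pi.add_apply, Pi.sub_apply] at h1 h2 ⊢
  rw [h1, h2]; ring

theorem IsBicommutator.smul (hT₁ : IsCZO T₁) (hT₂ : IsCZO T₂) (c : ℂ)
    (hh : IsBicommutator b T₁ T₂ f h) : IsBicommutator b T₁ T₂ (c • f) (c • h) := by
  obtain ⟨u, Tu, v, w, hu, hTu, hv, hw, hh⟩ := hh
  refine ⟨c • u, c • Tu, c • v, c • w, hu.smul hT₂ c, hTu.smul hT₁ c, hv.smul hT₁ c,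
    hw.smul hT₂ c, ?_⟩
  rw [← smul_sub]
  exact hh.const_smul c

/-- This continuity has nothing to do with the exponents of the theorem; it serves the passage from
tensors to general functions. -/
theorem exists_isBicommutator_bound (hT₁ : IsCZO T₁) (hT₂ : IsCZO T₂)
    (hbm : AEStronglyMeasurable b volume) (hb : MemL2loc b) (hV₁ : IsCompact V₁) (hV₂ : IsCompact V₂)
    {C₁ : Set (Rn m)} {C₂ : Set (Rn n)} (hC₁ : IsCompact C₁) (hC₂ : IsCompact C₂) :
    ∃ D : ℝ≥0, ∀ f h : Rn m × Rn n → ℂ, L4On V₁ V₂ f → IsBicommutator b T₁ T₂ f h →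
      eLpNorm h (4 / 3) (volume.restrict (C₁ ×ˢ C₂)) ≤ D * eLpNorm f 4 volume := by
  obtain ⟨D₁, hD₁⟩ := exists_isCommutatorSecond_bound_first hT₂ hbm hb hV₁ hV₂ hC₂
  obtain ⟨D₂, hD₂⟩ := exists_isCommutatorSecond_bound hT₂ hbm hb hV₂ hC₁ hC₂
  obtain ⟨D₃, hD₃⟩ := exists_actsFirst_bound hT₁ n one_lt_four_div_three four_div_three_lt_top
  obtain ⟨D₄, hD₄⟩ := exists_actsFirst_bound hT₁ n one_lt_four (by simp)
  refine ⟨D₃ * D₁ + D₂ * D₄, fun f h hf hh => ?_⟩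
  obtain ⟨u, Tu, v, w, hu, hTu, hv, hw, hh⟩ := hh
  obtain ⟨mu, bu⟩ := hD₁ f u hf hu
  have bTu := (hD₃ u Tu hTu C₂ mu).2
  have bv := hD₄ f v hv Set.univ
  rw [Measure.restrict_univ, ← Measure.volume_eq_prod] at bv
  have bw := hD₂ v w (hf.memLp_actsFirst hT₁ hv) (hv.ae_eq_zero hT₁ hV₂.measurableSet hf.ae_snd) hw
  have hle : (volume.restrict (C₁ ×ˢ C₂) : Measure (Rn m × Rn n)) ≤
      volume.prod (volume.restrict C₂) := by
    have e : (volume.prod (volume.restrict C₂) : Measure (Rn m × Rn n)) =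
        volume.restrict (Set.univ ×ˢ C₂) := by
      rw [Measure.volume_eq_prod, ← Measure.prod_restrict, Measure.restrict_univ]
    rw [e]
    exact Measure.restrict_mono (Set.prod_mono_left (Set.subset_univ _)) le_rfl
  calc eLpNorm h (4 / 3) (volume.restrict (C₁ ×ˢ C₂))
      = eLpNorm (Tu - w) (4 / 3) (volume.restrict (C₁ ×ˢ C₂)) :=
        eLpNorm_congr_ae (ae_restrict_of_ae hh)
    _ ≤ eLpNorm Tu (4 / 3) (volume.restrict (C₁ ×ˢ C₂)) +
          eLpNorm w (4 / 3) (volume.restrict (C₁ ×ˢ C₂)) :=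
        eLpNorm_sub_le hTu.1.restrict (hw.aestronglyMeasurable hbm).restrict one_lt_four_div_three.le
    _ ≤ D₃ * (D₁ * eLpNorm f 4 volume) + D₂ * (D₄ * eLpNorm f 4 volume) := by
        gcongr
        · exact (eLpNorm_mono_measure _ hle).trans (bTu.trans (by gcongr))
        · exact bw.trans (by gcongr; exact (bv hf.memLp).2)
    _ = _ := by push_cast; ring

theorem ActsSecond.congr_symbol {b' : Rn m × Rn n → ℂ} (hT₂ : IsCZO T₂) (hbb : b =ᵐ[volume] b')
    (hF : ActsSecond T₂ (b * f) F) : ActsSecond T₂ (b' * f) F :=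
  hF.congr hT₂ (hbb.mul EventuallyEq.rfl) EventuallyEq.rfl

theorem IsCommutatorSecond.congr_symbol {b' : Rn m × Rn n → ℂ} (hT₂ : IsCZO T₂)
    (hbb : b =ᵐ[volume] b') (hw : IsCommutatorSecond b T₂ v w) : IsCommutatorSecond b' T₂ v w := by
  obtain ⟨F, Q, hF, hQ, hw⟩ := hw
  exact ⟨F, Q, hF, hQ.congr_symbol hT₂ hbb,
    hw.trans ((hbb.mul EventuallyEq.rfl).sub EventuallyEq.rfl)⟩

theorem IsBicommutator.congr_symbol {b' : Rn m × Rn n → ℂ} (hT₂ : IsCZO T₂)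
    (hbb : b =ᵐ[volume] b') (hh : IsBicommutator b T₁ T₂ f h) : IsBicommutator b' T₁ T₂ f h := by
  obtain ⟨u, Tu, v, w, hu, hTu, hv, hw, hh⟩ := hh
  exact ⟨u, Tu, v, w, hu.congr_symbol hT₂ hbb, hTu, hv, hw.congr_symbol hT₂ hbb, hh⟩

end Full

end BiCommutator

namespace BiCommutator

open Filter Topology Metric

/-! ### From tensor products to general functions -/

section Density

variable {m n : ℕ} {b : Rn m × Rn n → ℂ} {G : Set (Rn m × Rn n)} {M : ℝ≥0} {β₁ β₂ : ℝ}
  {T₁ : (Rn m → ℂ) → (Rn m → ℂ)} {T₂ : (Rn n → ℂ) → (Rn n → ℂ)}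
  {K₁ : Rn m × Rn m → ℂ} {K₂ : Rn n × Rn n → ℂ} {C₁ C₂ : ℝ≥0} {f g h h' : Rn m × Rn n → ℂ}

/-- A product of closed balls centred at the origin. -/
def box (m n : ℕ) (R : ℝ) : Set (Rn m × Rn n) := closedBall 0 R ×ˢ closedBall 0 R

theorem measurableSet_box (R : ℝ) : MeasurableSet (box m n R) :=
  measurableSet_closedBall.prod measurableSet_closedBall

theorem isCompact_box (R : ℝ) : IsCompact (box m n R) :=
  (isCompact_closedBall _ _).prod (isCompact_closedBall _ _)

theorem ae_of_forall_ae_restrict_box {P : Rn m × Rn n → Prop}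
    (h : ∀ N : ℕ, ∀ᵐ x ∂(volume.restrict (box m n N)), P x) : ∀ᵐ x, P x := by
  have h' : ∀ᵐ x : Rn m × Rn n, ∀ N : ℕ, x ∈ box m n N → P x :=
    ae_all_iff.2 fun N => (ae_restrict_iff' (measurableSet_box _)).1 (h N)
  filter_upwards [h'] with x hx
  obtain ⟨N, hN⟩ := exists_nat_ge ‖x‖
  exact hx N ⟨mem_closedBall_zero_iff.2 ((norm_fst_le x).trans hN),
    mem_closedBall_zero_iff.2 ((norm_snd_le x).trans hN)⟩

theorem lintegral_le_eLpNorm_four {W : Set (Rn m × Rn n)}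
    (hf : AEStronglyMeasurable f volume) :
    ∫⁻ x in W, ‖f x‖ₑ ≤ eLpNorm f 4 volume * volume W ^ (3 / 4 : ℝ) := by
  rw [← eLpNorm_one_eq_lintegral_enorm]
  refine (eLpNorm_le_eLpNorm_mul_rpow_measure_univ one_lt_four.le hf.restrict).trans ?_
  rw [Measure.restrict_apply_univ]
  have e : (1 / (1 : ℝ≥0∞).toReal - 1 / (4 : ℝ≥0∞).toReal) = (3 / 4 : ℝ) := by norm_num
  rw [e]
  gcongr
  exact Measure.restrict_le_self

/-- By Tonelli the x-integral is done first; it is finite uniformly for y in the box since the Riesz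
kernels are symmetric and locally integrable. What is left is the L¹ norm of f on the box. -/
theorem exists_lintegral_kernel_bound (hK₁ : IsKernelOf T₁ K₁ C₁) (hK₂ : IsKernelOf T₂ K₂ C₂)
    (hβ₁ : 0 < β₁) (hβ₁m : β₁ < m) (hβ₂ : 0 < β₂) (hβ₂n : β₂ < n) (hb : RectHolder b G M β₁ β₂)
    (R N : ℝ) : ∃ D : ℝ≥0, ∀ f : Rn m × Rn n → ℂ, L4On (closedBall 0 R) (closedBall 0 R) f →
      ∫⁻ x in box m n N, ∫⁻ y, ‖bicommutatorKernel K₁ K₂ b G (x, y) * f y‖ₑ ≤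
        D * eLpNorm f 4 volume := by
  obtain ⟨D, hD⟩ := exists_lintegral_riesz_mul_riesz_le hβ₁ hβ₁m hβ₂ hβ₂n (|R| + |N| + 1)
  have hvol : volume (box m n R) ≠ ∞ := (isCompact_box R).measure_lt_top.ne
  refine ⟨(M * C₁ * C₂) * D * (volume (box m n R) ^ (3 / 4 : ℝ)).toNNReal, fun f hf => ?_⟩
  have hk := measurable_bicommutatorKernel hK₁.measurable hK₂.measurable hb.measurable
    hb.measurableSet
  have hm : AEMeasurable (fun z : (Rn m × Rn n) × (Rn m × Rn n) =>
      ‖bicommutatorKernel K₁ K₂ b G z * f z.2‖ₑ) ((volume.restrict (box m n N)).prod volume) := by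
    refine (AEStronglyMeasurable.enorm ?_)
    exact hk.aestronglyMeasurable.mul hf.memLp.1.comp_snd
  rw [lintegral_lintegral_swap hm]
  have hinner : ∀ y, ∫⁻ x in box m n N, ‖bicommutatorKernel K₁ K₂ b G (x, y) * f y‖ₑ ≤
      (box m n R).indicator (fun y => ((M * C₁ * C₂ : ℝ≥0) * D) * ‖f y‖ₑ) y := by
    intro y
    by_cases hy : y ∈ box m n R
    · rw [Set.indicator_of_mem hy]
      have h1 : ‖y‖ ≤ |R| + |N| + 1 := by
        have a1 := mem_closedBall_zero_iff.1 hy.1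
        have a2 := mem_closedBall_zero_iff.1 hy.2
        rw [Prod.norm_def]
        refine max_le ?_ ?_ <;> linarith [le_abs_self R, abs_nonneg N]
      have h2 : box m n N ⊆ ball 0 (|R| + |N| + 1) ×ˢ ball 0 (|R| + |N| + 1) := fun x hx =>
        ⟨closedBall_subset_ball (by linarith [le_abs_self N, abs_nonneg R]) hx.1,
          closedBall_subset_ball (by linarith [le_abs_self N, abs_nonneg R]) hx.2⟩
      have h3 := (lintegral_mono_set h2).trans (hD y h1)
      calc ∫⁻ x in box m n N, ‖bicommutatorKernel K₁ K₂ b G (x, y) * f y‖ₑ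
          ≤ ∫⁻ x in box m n N, ((M * C₁ * C₂ : ℝ≥0) * ‖f y‖ₑ) *
              (riesz β₁ y.1 x.1 * riesz β₂ y.2 x.2) := by
            refine lintegral_mono fun x => ?_
            have := enorm_bicommutatorKernel_le hK₁ hK₂ hβ₁ hβ₁m hβ₂ hβ₂n (hb.norm_le x y)
            rw [riesz_comm β₁ x.1, riesz_comm β₂ x.2] at this
            simp only [enorm_mul]
            calc _ ≤ (M * C₁ * C₂ : ℝ≥0) * (riesz β₁ y.1 x.1 * riesz β₂ y.2 x.2) * ‖f y‖ₑ :=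
                  mul_le_mul' this le_rfl
              _ = _ := by ring
        _ = ((M * C₁ * C₂ : ℝ≥0) * ‖f y‖ₑ) * ∫⁻ x in box m n N,
              (riesz β₁ y.1 x.1 * riesz β₂ y.2 x.2) :=
            lintegral_const_mul' _ _ (by finiteness)
        _ ≤ ((M * C₁ * C₂ : ℝ≥0) * ‖f y‖ₑ) * D := by gcongr
        _ = _ := by ring
    · rw [Set.indicator_of_notMem hy, hf.eq_zero y hy]
      simp
  calc ∫⁻ y, ∫⁻ x in box m n N, ‖bicommutatorKernel K₁ K₂ b G (x, y) * f y‖ₑ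
      ≤ ∫⁻ y, (box m n R).indicator (fun y => ((M * C₁ * C₂ : ℝ≥0) * D) * ‖f y‖ₑ) y :=
        lintegral_mono hinner
    _ = ((M * C₁ * C₂ : ℝ≥0) * D) * ∫⁻ y in box m n R, ‖f y‖ₑ := by
        rw [lintegral_indicator (measurableSet_box R), lintegral_const_mul' _ _ (by finiteness)]
    _ ≤ ((M * C₁ * C₂ : ℝ≥0) * D) * (eLpNorm f 4 volume * volume (box m n R) ^ (3 / 4 : ℝ)) := by
        gcongr
        exact lintegral_le_eLpNorm_four hf.memLp.1
    _ = _ := by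
        push_cast
        rw [ENNReal.coe_toNNReal (ENNReal.rpow_ne_top_of_nonneg (by norm_num) hvol)]
        ring

theorem L4On.ae_integrable_kernel (hK₁ : IsKernelOf T₁ K₁ C₁) (hK₂ : IsKernelOf T₂ K₂ C₂)
    (hβ₁ : 0 < β₁) (hβ₁m : β₁ < m) (hβ₂ : 0 < β₂) (hβ₂n : β₂ < n) (hb : RectHolder b G M β₁ β₂)
    {R : ℝ} (hf : L4On (closedBall 0 R) (closedBall 0 R) f) :
    ∀ᵐ x, Integrable (fun y => bicommutatorKernel K₁ K₂ b G (x, y) * f y) volume := by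
  have hk := measurable_bicommutatorKernel hK₁.measurable hK₂.measurable hb.measurable
    hb.measurableSet
  refine ae_of_forall_ae_restrict_box fun N => ?_
  obtain ⟨D, hD⟩ := exists_lintegral_kernel_bound hK₁ hK₂ hβ₁ hβ₁m hβ₂ hβ₂n hb R N
  have h1 := (hD f hf).trans_lt (ENNReal.mul_lt_top ENNReal.coe_lt_top hf.memLp.2)
  have hm : AEMeasurable (fun x => ∫⁻ y, ‖bicommutatorKernel K₁ K₂ b G (x, y) * f y‖ₑ)
      (volume.restrict (box m n N)) :=
    ((aestronglyMeasurable_kernel_mul hk hf.memLp.1).enorm.lintegral_prod_right').restrict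
  filter_upwards [ae_lt_top' hm h1.ne] with x hx
  exact ⟨(hk.comp measurable_prodMk_left).aestronglyMeasurable.mul hf.memLp.1, hx⟩

theorem exists_isBicommutator_sub_bound (hT₁ : IsCZO T₁) (hT₂ : IsCZO T₂)
    (hbm : AEStronglyMeasurable b volume) (hb : MemL2loc b) (R N : ℝ) :
    ∃ D : ℝ≥0, ∀ f g h h' : Rn m × Rn n → ℂ, L4On (closedBall 0 R) (closedBall 0 R) f →
      L4On (closedBall 0 R) (closedBall 0 R) g → IsBicommutator b T₁ T₂ f h →
      IsBicommutator b T₁ T₂ g h' →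
      eLpNorm (h - h') (4 / 3) (volume.restrict (box m n N)) ≤ D * eLpNorm (f - g) 4 volume := by
  obtain ⟨D, hD⟩ := exists_isBicommutator_bound hT₁ hT₂ hbm hb (isCompact_closedBall (0 : Rn m) R)
    (isCompact_closedBall (0 : Rn n) R) (isCompact_closedBall (0 : Rn m) N)
    (isCompact_closedBall (0 : Rn n) N)
  refine ⟨D, fun f g h h' hf hg hh hh' => ?_⟩
  have h1 := hh.add hT₁ hT₂ hbm hb (isCompact_closedBall _ _) (isCompact_closedBall _ _) hf
    (hg.smul (-1)) (hh'.smul hT₁ hT₂ (-1))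
  have h2 := hD _ _ (hf.add (hg.smul (-1))) h1
  rwa [neg_one_smul, neg_one_smul, ← sub_eq_add_neg, ← sub_eq_add_neg] at h2

/-- The difference of two values is a value at f − f = 0, and the local bound makes it vanish. -/
theorem IsBicommutator.unique (hT₁ : IsCZO T₁) (hT₂ : IsCZO T₂)
    (hbm : AEStronglyMeasurable b volume) (hb : MemL2loc b) {R : ℝ}
    (hf : L4On (closedBall 0 R) (closedBall 0 R) f) (hh : IsBicommutator b T₁ T₂ f h)
    (hh' : IsBicommutator b T₁ T₂ f h') : h =ᵐ[volume] h' := by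
  refine ae_of_forall_ae_restrict_box fun N => ?_
  obtain ⟨D, hD⟩ := exists_isBicommutator_sub_bound hT₁ hT₂ hbm hb R N
  have h1 := hD f f h h' hf hf hh hh'
  rw [sub_self, eLpNorm_zero, mul_zero, nonpos_iff_eq_zero, eLpNorm_eq_zero_iff
    ((hh.aestronglyMeasurable hbm).sub (hh'.aestronglyMeasurable hbm)).restrict
    (zero_lt_one.trans one_lt_four_div_three).ne'] at h1
  filter_upwards [h1] with x hx
  exact sub_eq_zero.1 hx

theorem eq_zero_of_forall_le_mul {t : ℝ≥0∞} {D : ℝ≥0} (h : ∀ ε : ℝ≥0∞, ε ≠ 0 → t ≤ D * ε) :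
    t = 0 := by
  have h1 : Tendsto (fun N : ℕ => (D : ℝ≥0∞) * (N : ℝ≥0∞)⁻¹) atTop (𝓝 (D * 0)) :=
    ENNReal.Tendsto.const_mul ENNReal.tendsto_inv_nat_nhds_zero (Or.inr ENNReal.coe_ne_top)
  rw [mul_zero] at h1
  exact nonpos_iff_eq_zero.1 (ge_of_tendsto' h1 fun N => h _ (by simp))

/-- The bi-commutator is given by absolutely convergent integrals. -/
theorem IsBicommutator.eq_kernelOp (hT₁ : IsCZO T₁) (hT₂ : IsCZO T₂)
    (hK₁ : IsKernelOf T₁ K₁ C₁) (hK₂ : IsKernelOf T₂ K₂ C₂) (hβ₁ : 0 < β₁) (hβ₁m : β₁ < m)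
    (hβ₂ : 0 < β₂) (hβ₂n : β₂ < n) (hb : RectHolder b G M β₁ β₂) (hL : MemL2loc b)
    {R : ℝ} (hf : L4On (closedBall 0 R) (closedBall 0 R) f) (hh : IsBicommutator b T₁ T₂ f h) :
    h =ᵐ[volume] kernelOp (bicommutatorKernel K₁ K₂ b G) f := by
  have hbm : AEStronglyMeasurable b volume := hb.measurable.aestronglyMeasurable
  have hk := measurable_bicommutatorKernel hK₁.measurable hK₂.measurable hb.measurable
    hb.measurableSet
  set W := box m n R with hW
  have hWm : MeasurableSet W := measurableSet_box R
  set μ := (volume.restrict W : Measure (Rn m × Rn n)) with hμ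
  have : IsFiniteMeasure μ := ⟨by
    rw [hμ, Measure.restrict_apply_univ]; exact (isCompact_box R).measure_lt_top⟩
  have hL4 : ∀ {g}, MemLp g 4 μ → L4On (closedBall 0 R) (closedBall 0 R) (W.indicator g) :=
    fun hg => ⟨(memLp_indicator_iff_restrict hWm).2 hg, fun z hz => Set.indicator_of_notMem hz _⟩
  have hex : ∀ {g}, MemLp g 4 μ → ∃ h, IsBicommutator b T₁ T₂ (W.indicator g) h := fun hg =>
    (hL4 hg).exists_isBicommutator hT₁ hT₂ hbm hL (isCompact_closedBall _ _)
      (isCompact_closedBall _ _)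
  have hint : ∀ {g}, MemLp g 4 μ → ∀ᵐ x, Integrable
      (fun y => bicommutatorKernel K₁ K₂ b G (x, y) * W.indicator g y) volume := fun hg =>
    (hL4 hg).ae_integrable_kernel hK₁ hK₂ hβ₁ hβ₁m hβ₂ hβ₂n hb
  have hfW : W.indicator f = f := Set.indicator_eq_self.2 fun z hz => by
    by_contra hzW
    exact hz (hf.eq_zero z hzW)
  -- Cutting off with the indicator of the box lets the induction run over all of L⁴ of the box.
  suffices hP : ∀ h, IsBicommutator b T₁ T₂ (W.indicator f) h →
      h =ᵐ[volume] kernelOp (bicommutatorKernel K₁ K₂ b G) (W.indicator f) by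
    rw [hfW] at hP
    exact hP h hh
  refine memLp_induction_of_isPiSystem (μ := μ) (s := 4)
    (𝒮 := Set.image2 (· ×ˢ ·) {s : Set (Rn m) | MeasurableSet s} {t : Set (Rn n) | MeasurableSet t})
    (P := fun g => ∀ h, IsBicommutator b T₁ T₂ (W.indicator g) h →
      h =ᵐ[volume] kernelOp (bicommutatorKernel K₁ K₂ b G) (W.indicator g)) (by simp) (by simp)
    generateFrom_prod.symm isPiSystem_prod ⟨Set.univ, by simp, Set.univ, by simp, Set.univ_prod_univ⟩
    ?_ ?_ ?_ ?_ (hf.memLp.restrict W)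
  -- The box is a product, so the cut-off indicator of a rectangle is a tensor.
  · rintro _ ⟨A, hA, B, hB, rfl⟩ h hh
    have hA : MeasurableSet A := hA
    have hB : MeasurableSet B := hB
    have e : W.indicator ((A ×ˢ B).indicator (1 : Rn m × Rn n → ℂ)) = fun z =>
        (closedBall (0 : Rn m) R ∩ A).indicator (1 : Rn m → ℂ) z.1 *
          (closedBall (0 : Rn n) R ∩ B).indicator (1 : Rn n → ℂ) z.2 := by
      ext z
      by_cases z1 : z.1 ∈ closedBall (0 : Rn m) R <;> by_cases z2 : z.1 ∈ A <;>
        by_cases z3 : z.2 ∈ closedBall (0 : Rn n) R <;> by_cases z4 : z.2 ∈ B <;>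
        simp only [Set.indicator, hW, box, Set.mem_prod, Set.mem_inter_iff, z1, z2, z3, z4, and_self,
          and_true, and_false, true_and, false_and, if_true, if_false, Pi.one_apply, mul_one, mul_zero,
          zero_mul]
    have hprod : BoundedCompact (W.indicator ((A ×ˢ B).indicator (1 : Rn m × Rn n → ℂ))) := by
      rw [Set.indicator_indicator]
      exact boundedCompact_indicator_one (hWm.inter (hA.prod hB))
        ((isCompact_box R).isBounded.subset Set.inter_subset_left)
    rw [e] at hh hprod ⊢
    exact hh.eq_kernelOp_tensor hT₁ hT₂ hK₁ hK₂ hβ₁ hβ₁m hβ₂ hβ₂n hb hL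
      (boundedCompact_indicator_one (measurableSet_closedBall.inter hA)
        (isBounded_closedBall.subset Set.inter_subset_left))
      (boundedCompact_indicator_one (measurableSet_closedBall.inter hB)
        (isBounded_closedBall.subset Set.inter_subset_left))
      (measurable_one.indicator (measurableSet_closedBall.inter hB)) hprod
  · intro f₁ f₂ hf₁ hf₂ P₁ P₂ h hh
    obtain ⟨h₁, hh₁⟩ := hex hf₁
    obtain ⟨h₂, hh₂⟩ := hex hf₂
    have hadd := hh₁.add hT₁ hT₂ hbm hL (isCompact_closedBall _ _) (isCompact_closedBall _ _)
      (hL4 hf₁) (hL4 hf₂) hh₂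
    rw [← Set.indicator_add'] at hadd
    filter_upwards [hh.unique hT₁ hT₂ hbm hL (hL4 (hf₁.add hf₂)) hadd, P₁ h₁ hh₁, P₂ h₂ hh₂,
      hint hf₁, hint hf₂] with x k₁ k₂ k₃ k₄ k₅
    rw [k₁, Pi.add_apply, k₂, k₃, Set.indicator_add', kernelOp_add k₄ k₅]
  · intro c f₁ hf₁ P₁ h hh
    obtain ⟨h₁, hh₁⟩ := hex hf₁
    have hsm := hh₁.smul hT₁ hT₂ c
    have e : c • W.indicator f₁ = W.indicator (c • f₁) := (Set.indicator_const_smul W c f₁).symm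
    rw [e] at hsm
    filter_upwards [hh.unique hT₁ hT₂ hbm hL (hL4 (hf₁.const_smul c)) hsm, P₁ h₁ hh₁] with x k₁ k₂
    rw [k₁, Pi.smul_apply, k₂, ← e, kernelOp_smul, smul_eq_mul]
  · intro f₁ hf₁ happ h hh
    refine ae_of_forall_ae_restrict_box fun N => ?_
    obtain ⟨D₁, hD₁⟩ := exists_isBicommutator_sub_bound hT₁ hT₂ hbm hL R N
    obtain ⟨D₂, hD₂⟩ := exists_lintegral_kernel_bound hK₁ hK₂ hβ₁ hβ₁m hβ₂ hβ₂n hb R N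
    set c := volume (box m n N) ^ (1 / (1 : ℝ≥0∞).toReal - 1 / (4 / 3 : ℝ≥0∞).toReal) with hc
    have hc' : c ≠ ∞ := by
      refine ENNReal.rpow_ne_top_of_nonneg ?_ (isCompact_box _).measure_lt_top.ne
      rw [ENNReal.toReal_div]
      norm_num
    have hkm : ∀ {g}, MemLp g 4 μ → AEStronglyMeasurable
        (kernelOp (bicommutatorKernel K₁ K₂ b G) (W.indicator g)) volume := fun hg =>
      aestronglyMeasurable_kernelOp hk (hL4 hg).memLp.1
    have hhm := hh.aestronglyMeasurable hbm
    -- Both the bi-commutator and the integral operator are continuous from L⁴ of the box to L¹ of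
    -- any other box, so their agreement survives the limit.
    have hzero : eLpNorm (h - kernelOp (bicommutatorKernel K₁ K₂ b G) (W.indicator f₁)) 1
        (volume.restrict (box m n N)) = 0 := by
      refine eq_zero_of_forall_le_mul (D := D₁ * c.toNNReal + D₂) fun ε hε => ?_
      obtain ⟨g, hg, hge, Pg⟩ := happ ε hε
      obtain ⟨h₁, hh₁⟩ := hex hg
      have hsub : W.indicator f₁ - W.indicator g = W.indicator (f₁ - g) :=
        (Set.indicator_sub' W f₁ g).symm
      have hε4 : eLpNorm (W.indicator f₁ - W.indicator g) 4 volume ≤ ε := by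
        rw [hsub, eLpNorm_indicator_eq_eLpNorm_restrict hWm]
        exact hge
      have b₁ := hD₁ _ _ h h₁ (hL4 hf₁) (hL4 hg) hh hh₁
      have b₂ : eLpNorm (h₁ - kernelOp (bicommutatorKernel K₁ K₂ b G) (W.indicator f₁)) 1
          (volume.restrict (box m n N)) ≤ D₂ * ε := by
        rw [eLpNorm_one_eq_lintegral_enorm]
        refine le_trans (lintegral_mono_ae ?_) ((hD₂ _ (hL4 (hf₁.sub hg))).trans
          (by rw [← hsub]; gcongr))
        filter_upwards [ae_restrict_of_ae (Pg h₁ hh₁), ae_restrict_of_ae (hint hf₁),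
          ae_restrict_of_ae (hint hg)] with x k₁ k₂ k₃
        rw [Pi.sub_apply, k₁, ← enorm_neg, neg_sub, kernelOp, kernelOp, ← integral_sub k₂ k₃]
        refine (enorm_integral_le_lintegral_enorm _).trans_eq (lintegral_congr fun y => ?_)
        rw [← mul_sub, ← Pi.sub_apply (W.indicator f₁) (W.indicator g), hsub]
      have esum : h - kernelOp (bicommutatorKernel K₁ K₂ b G) (W.indicator f₁) = (h - h₁) +
          (h₁ - kernelOp (bicommutatorKernel K₁ K₂ b G) (W.indicator f₁)) := by
        rw [sub_add_sub_cancel]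
      have m₁ := hh₁.aestronglyMeasurable hbm
      calc _ ≤ eLpNorm (h - h₁) 1 (volume.restrict (box m n N)) +
            eLpNorm (h₁ - kernelOp (bicommutatorKernel K₁ K₂ b G) (W.indicator f₁)) 1
              (volume.restrict (box m n N)) := by
            rw [esum]
            exact eLpNorm_add_le (hhm.sub m₁).restrict (m₁.sub (hkm hf₁)).restrict le_rfl
        _ ≤ D₁ * ε * c + D₂ * ε := by
            gcongr
            refine (eLpNorm_le_eLpNorm_mul_rpow_measure_univ one_lt_four_div_three.le
              (hhm.sub m₁).restrict).trans ?_
            rw [Measure.restrict_apply_univ]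
            gcongr
            exact b₁.trans (by gcongr)
        _ = _ := by
            push_cast
            rw [ENNReal.coe_toNNReal hc']
            ring
    rw [eLpNorm_eq_zero_iff (hhm.sub (hkm hf₁)).restrict one_ne_zero] at hzero
    filter_upwards [hzero] with x hx
    exact sub_eq_zero.1 hx

end Density

/-! ### Assembly -/

section Main

variable {m n : ℕ} {b : Rn m × Rn n → ℂ} {β₁ β₂ : ℝ}

theorem secondDiff_eq_zero {x y : Rn m × Rn n} (h : x.1 = y.1 ∨ x.2 = y.2) :
    secondDiff b x y = 0 := by
  obtain ⟨x₁, x₂⟩ := x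
  obtain ⟨y₁, y₂⟩ := y
  rcases h with h | h <;> (simp only at h; subst h; simp only [secondDiff]; ring)

/-- A measurable version of the symbol, with a measurable null set off which the second differences
satisfy the product Hölder estimate, with small constants off a bounded region. -/
theorem MemVMO.exists_rectHolder (hβ₁ : 0 < β₁) (hβ₂ : 0 < β₂) (hb : MemVMO β₁ β₂ b) :
    ∃ (b' : Rn m × Rn n → ℂ) (G : Set (Rn m × Rn n)) (M : ℝ≥0), b =ᵐ[volume] b' ∧
      RectHolder b' G M β₁ β₂ ∧ ∀ ε : ℝ≥0, 0 < ε → ∃ R : ℝ, 1 ≤ R ∧ ∀ x y, CornersIn G x y →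
        (‖x.1 - y.1‖ < R⁻¹ ∨ R < ‖x.1 - y.1‖ ∨ ‖x.2 - y.2‖ < R⁻¹ ∨ R < ‖x.2 - y.2‖ ∨ R < ‖x‖) →
        ‖secondDiff b' x y‖ ≤ ε * (‖x.1 - y.1‖ ^ β₁ * ‖x.2 - y.2‖ ^ β₂) := by
  have hm := hb.1.1.aestronglyMeasurable
  obtain ⟨M, hM0, hM⟩ := hb.1.exists_norm_secondDiff_le hβ₁ hβ₂
  -- G consists of points where the cube averages of b converge to b and where b agrees with its
  -- measurable version.
  obtain ⟨G, hGae, hGm, hG⟩ := ((ae_tendsto_average_cube hb.1.1).and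
    hm.ae_eq_mk).exists_measurable_mem
  have hreg : ∀ {x y}, CornersIn G x y → CornersIn (regularPoints b) x y := fun hc =>
    ⟨(hG _ hc.1).1, (hG _ hc.2.1).1, (hG _ hc.2.2.1).1, (hG _ hc.2.2.2).1⟩
  have heq : ∀ {x y}, CornersIn G x y → secondDiff (hm.mk b) x y = secondDiff b x y := fun hc => by
    simp only [secondDiff]
    rw [(hG _ hc.1).2, (hG _ hc.2.1).2, (hG _ hc.2.2.1).2, (hG _ hc.2.2.2).2]
  refine ⟨hm.mk b, G, M.toNNReal, hm.ae_eq_mk, ⟨hm.stronglyMeasurable_mk.measurable, hGm, hGae,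
    fun x y hc => ?_⟩, fun ε hε => ?_⟩
  · rw [Real.coe_toNNReal _ hM0]
    -- On degenerate rectangles the second difference is 0; the pointwise estimates were proved for
    -- distinct coordinates.
    by_cases h1 : x.1 = y.1
    · rw [secondDiff_eq_zero (Or.inl h1), norm_zero]; positivity
    by_cases h2 : x.2 = y.2
    · rw [secondDiff_eq_zero (Or.inr h2), norm_zero]; positivity
    rw [heq hc]
    exact hM x y h1 h2 (hreg hc)
  · obtain ⟨R, hR1, hR⟩ := hb.exists_norm_secondDiff_le hβ₁ hβ₂ (NNReal.coe_pos.2 hε)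
    refine ⟨R, hR1, fun x y hc hxy => ?_⟩
    by_cases h1 : x.1 = y.1
    · rw [secondDiff_eq_zero (Or.inl h1), norm_zero]; positivity
    by_cases h2 : x.2 = y.2
    · rw [secondDiff_eq_zero (Or.inr h2), norm_zero]; positivity
    rw [heq hc]
    exact hR x y h1 h2 (hreg hc) hxy

theorem BoundedCompact.exists_represents {p₁ p₂ : ℝ≥0∞} [Fact (1 ≤ p₁)] [Fact (1 ≤ p₂)]
    (hp₁ : p₁ ≠ ∞) (hp₂ : p₂ ≠ ∞) {f : Rn m × Rn n → ℂ} (hf : BoundedCompact f) {R : ℝ}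
    (hR : ∀ z ∉ box m n R, f z = 0) : ∃ F : MixedLp m n p₁ p₂, Represents f F := by
  obtain ⟨F, hF⟩ := hf.ae_norm_le
  obtain ⟨C, hC⟩ := exists_mixedNorm_indicator_le (V₁ := closedBall (0 : Rn m) R)
    (V₂ := closedBall (0 : Rn n) R) measurableSet_closedBall measurableSet_closedBall
    measure_closedBall_lt_top.ne measure_closedBall_lt_top.ne (max_lt hp₁.lt_top hp₂.lt_top).ne
    (Fact.out (p := 1 ≤ p₁)) (Fact.out (p := 1 ≤ p₂)) (le_max_left p₁ p₂) (le_max_right p₁ p₂)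
  refine exists_represents_of_mixedNorm_lt_top hp₁ hp₂ hf.1.1 ?_
  have hfin : IsFiniteMeasure (volume.restrict (box m n R)) := ⟨by
    rw [Measure.restrict_apply_univ]; exact (isCompact_box R).measure_lt_top⟩
  calc mixedNorm p₁ p₂ (fun z => ‖f z‖ₑ)
      ≤ mixedNorm p₁ p₂ ((box m n R).indicator fun _ => (F : ℝ≥0∞)) := by
        refine mixedNorm_mono_ae ?_
        filter_upwards [hF] with z hz
        by_cases hzR : z ∈ box m n R
        · rw [Set.indicator_of_mem hzR, enorm_eq_nnnorm]
          exact_mod_cast hz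
        · rw [Set.indicator_of_notMem hzR, hR z hzR, enorm_zero]
    _ ≤ C * eLpNorm (fun _ => (F : ℝ≥0∞)) (max p₁ p₂) (volume.restrict (box m n R)) :=
        hC _ measurable_const
    _ < ∞ := by
        refine ENNReal.mul_lt_top ENNReal.coe_lt_top ?_
        have := (memLp_const (μ := volume.restrict (box m n R)) (p := max p₁ p₂) ((F : ℝ) : ℂ)).2
        refine lt_of_eq_of_lt (eLpNorm_congr_enorm_ae (Eventually.of_forall fun z => ?_)) this
        simp [enorm_eq_nnnorm]

theorem exponent_bounds {d : ℕ} (hd : 0 < d) {p q : ℝ≥0∞} {β : ℝ} (hp : 1 < p) (hpq : p < q)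
    (hq : q < ∞) (hβ : β / d = 1 / p.toReal - 1 / q.toReal) : 0 < β ∧ β < d := by
  have hd' : (0 : ℝ) < d := by exact_mod_cast hd
  have h1 : 1 < p.toReal := by
    rwa [← ENNReal.toReal_one, ENNReal.toReal_lt_toReal ENNReal.one_ne_top (hpq.trans hq).ne]
  have h2 : p.toReal < q.toReal := (ENNReal.toReal_lt_toReal (hpq.trans hq).ne hq.ne).2 hpq
  have h3 : 1 / q.toReal < 1 / p.toReal := one_div_lt_one_div_of_lt (by linarith) h2
  have h4 : 1 / p.toReal < 1 := by rw [div_lt_one (by linarith)]; exact h1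
  have h5 : 0 < 1 / q.toReal := one_div_pos.2 (by linarith)
  have e : β = (1 / p.toReal - 1 / q.toReal) * d := by rw [← hβ, div_mul_cancel₀ _ hd'.ne']
  constructor
  · rw [e]; exact mul_pos (by linarith) hd'
  · rw [e]; nlinarith

end Main

end BiCommutator

namespace BiCommutator

theorem MemL2loc.congr {m n : ℕ} {b b' : Rn m × Rn n → ℂ} (hb : MemL2loc b)
    (h : b =ᵐ[volume] b') : MemL2loc b' :=
  fun A hA => (hb A hA).ae_eq (ae_restrict_of_ae h)

theorem BoundedCompact.exists_eq_zero_off_box {m n : ℕ} {f : Rn m × Rn n → ℂ}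
    (hf : BoundedCompact f) : ∃ R, ∀ z ∉ box m n R, f z = 0 := by
  obtain ⟨R, hR⟩ := hf.2.isCompact.isBounded.exists_norm_le
  refine ⟨R, fun z hz => image_eq_zero_of_notMem_tsupport fun hz' => hz ?_⟩
  exact ⟨mem_closedBall_zero_iff.2 ((norm_fst_le z).trans (hR z hz')),
    mem_closedBall_zero_iff.2 ((norm_snd_le z).trans (hR z hz'))⟩

end BiCommutator

open BiCommutator

theorem theorem4 (d₁ d₂ : ℕ) (hd₁ : 0 < d₁) (hd₂ : 0 < d₂)
    (p₁ p₂ q₁ q₂ : ℝ≥0∞)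
    [Fact (1 ≤ p₁)] [Fact (1 ≤ p₂)] [Fact (1 ≤ q₁)] [Fact (1 ≤ q₂)]
    (hp₁ : 1 < p₁) (hpq₁ : p₁ < q₁) (hq₁ : q₁ < ∞)
    (hp₂ : 1 < p₂) (hpq₂ : p₂ < q₂) (hq₂ : q₂ < ∞)
    (β₁ β₂ : ℝ)
    (hβ₁ : β₁ / (d₁ : ℝ) = 1 / p₁.toReal - 1 / q₁.toReal)
    (hβ₂ : β₂ / (d₂ : ℝ) = 1 / p₂.toReal - 1 / q₂.toReal)
    (b : BiCommutator.Rn d₁ × BiCommutator.Rn d₂ → ℂ)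
    (hb_loc : BiCommutator.MemL2loc b)
    (hb : BiCommutator.MemVMO β₁ β₂ b)
    (T₁ : (BiCommutator.Rn d₁ → ℂ) → (BiCommutator.Rn d₁ → ℂ))
    (T₂ : (BiCommutator.Rn d₂ → ℂ) → (BiCommutator.Rn d₂ → ℂ))
    (hT₁ : BiCommutator.IsCZO T₁) (hT₂ : BiCommutator.IsCZO T₂) :
    ∃ S : BiCommutator.MixedLp d₁ d₂ p₁ p₂ →L[ℂ] BiCommutator.MixedLp d₁ d₂ q₁ q₂,
      IsCompactOperator S ∧
      ∀ f : BiCommutator.Rn d₁ × BiCommutator.Rn d₂ → ℂ, BiCommutator.BoundedCompact f →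
        ∃ (F : BiCommutator.MixedLp d₁ d₂ p₁ p₂) (h : BiCommutator.Rn d₁ × BiCommutator.Rn d₂ → ℂ),
          BiCommutator.Represents f F ∧
          BiCommutator.IsBicommutator b T₁ T₂ f h ∧
          BiCommutator.Represents h (S F) := by
  obtain ⟨hβ₁0, hβ₁d⟩ := exponent_bounds hd₁ hp₁ hpq₁ hq₁ hβ₁
  obtain ⟨hβ₂0, hβ₂d⟩ := exponent_bounds hd₂ hp₂ hpq₂ hq₂ hβ₂
  obtain ⟨K₁, C₁, hK₁⟩ := hT₁.exists_kernel
  obtain ⟨K₂, C₂, hK₂⟩ := hT₂.exists_kernel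
  obtain ⟨b', G, M, hbb, hrect, hsmall⟩ := hb.exists_rectHolder hβ₁0 hβ₂0
  have hk := measurable_bicommutatorKernel hK₁.measurable hK₂.measurable hrect.measurable
    hrect.measurableSet
  obtain ⟨S, hS, hSc⟩ := exists_isCompactOperator_of_riesz hd₁ hd₂ hβ₁d hβ₂d hp₁ hpq₁ hq₁ hβ₁
    hp₂ hpq₂ hq₂ hβ₂ hk
    (fun x y => enorm_bicommutatorKernel_le hK₁ hK₂ hβ₁0 hβ₁d hβ₂0 hβ₂d (hrect.norm_le x y))
    (fun ε hε => by
      -- The kernel bound multiplies the Hölder constant by C₁C₂; the extra 1 avoids a division by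
      -- zero.
      obtain ⟨R, hR1, hR⟩ := hsmall (ε / (C₁ * C₂ + 1)) (by positivity)
      refine ⟨R, hR1, fun x y hxy => (enorm_bicommutatorKernel_le hK₁ hK₂ hβ₁0 hβ₁d hβ₂0 hβ₂d
        fun hc => hR x y hc hxy).trans ?_⟩
      gcongr
      calc ε / (C₁ * C₂ + 1) * C₁ * C₂ ≤ ε / (C₁ * C₂ + 1) * (C₁ * C₂ + 1) := by
            rw [mul_assoc]; gcongr; exact le_self_add
        _ = ε := div_mul_cancel₀ _ (by positivity))
  refine ⟨S, hSc, fun f hf => ?_⟩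
  obtain ⟨R, hR⟩ := hf.exists_eq_zero_off_box
  have hf4 : L4On (Metric.closedBall 0 R) (Metric.closedBall 0 R) f := ⟨hf.memLp 4, hR⟩
  obtain ⟨F, hF⟩ := hf.exists_represents (hpq₁.trans hq₁).ne (hpq₂.trans hq₂).ne hR
  obtain ⟨h, hh⟩ := hf4.exists_isBicommutator hT₁ hT₂ hb.1.1.aestronglyMeasurable hb_loc
    (isCompact_closedBall _ _) (isCompact_closedBall _ _)
  -- The kernel was built from the measurable version of the symbol; replacing b by it does not
  -- change the bi-commutator.
  have heq := (hh.congr_symbol hT₂ hbb).eq_kernelOp hT₁ hT₂ hK₁ hK₂ hβ₁0 hβ₁d hβ₂0 hβ₂d hrect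
    (hb_loc.congr hbb) hf4
  exact ⟨F, h, hF, hh, (hS f F hF).2.congr heq.symm⟩
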